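/- Let $T$ be the triangular lattice (edge length $1$) in $\mathbb C$, $H$ its dual hexagonal lattice, and consider critical face percolation $\mathbb P^\delta$ on $\delta H$: the hexagons are independently blue or yellow with probability $1/2$ each. Call $\lambda>0$ an annulus exponent if there are constants $c,K>0$ such that, for all $\delta,r>0$ and $R$ with $R/r\ge c$ and $r/\delta\ge c$, the $\mathbb P^\delta$-probability that a path of blue hexagons crosses a given annulus of inner radius $r$ and outer radius $R$ is at most $K(r/R)^\lambda$. A bounded $k$-marked Jordan domain $(D;P_1,\dots,P_k)$ is a bounded simply connected open set $D\subset\mathbb C$ whose boundary is a Jordan curve, with $k$ distinct boundary points in counterclockwise order; $A_j$ denotes the counterclockwise boundary arc from $P_j$ to $P_{j+1}$ (indices mod $k$). It is discrete with mesh $\delta$ if $D$ is the interior of a union of closed hexagons of $\delta H$ and each $P_j$ is a vertex of $\delta H$ incident to exactly one hexagon inside $D$. Marked domains converge uniformly if, for each $j$, their arcs $A_j$ converge in the uniform metric on curves modulo increasing reparametrization. For a four-marked discrete domain $D_4^\delta$ of mesh $\delta$, forget $P_4$, and let $A_1,A_2,A_3$ be the arcs of the resulting three-marked domain. For a vertex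 $z$ of $\delta H$ in $D^\delta$ and $j\in\mathbb Z/3$, let $E_j(z)$ be the event that there is a simple path of blue hexagons inside $D^\delta$ from $A_{j-1}$ to $A_{j+1}$ which separates $z$ from $A_j$, and let $s_j^\delta(z)=\mathbb P^\delta[E_j(z)]$. A discrete triangular contour in $D^\delta$ is a simple closed path $C$ of $\delta T$ contained in $D^\delta$, oriented counterclockwise; $L$ is its Euclidean length. Put $$\oint_C s_j^\delta(z)\,dz=\sum_{e=(e^-,e^+)\in C}s_j^\delta(z(e))\,(e^+-e^-),$$ where $z(e)$ is the vertex of $\delta H$ immediately to the left of the oriented edge $e$. Let $\zeta=e^{2\pi i/3}$. Then annulus exponents exist, and for every annulus exponent $\lambda$ the following holds. Let $D_4^\delta$ be a family of four-marked discrete domains of mesh $\delta\downarrow0$ converging uniformly to a bounded four-marked Jordan domain $D_4$. Then there is a constant $K$ such that, for all sufficiently small $\delta$ in the family, all $j\in\mathbb Z/3$, and all discrete triangular contours $C$ in $D^\delta$, with $L$ the length of $C$, $$\left|\oint_C s_{j+1}^\delta(z)\,dz-\zeta\oint_C s_j^\delta(z)\,dz\right|\le K\,\delta^\lambda L .$$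 -/

import Mathlib

open Filter Topology MeasureTheory

noncomputable section

namespace TriPerc

/-! ### The triangular lattice `T` and its dual hexagonal lattice `H` -/

/-- Vertices of `T`. The pair `(a, b)` stands for the point `a + b e^{iπ/3}` of the plane. It also
labels the hexagon of the dual lattice that is centred at that point. -/
abbrev Site := ℤ × ℤ

/-- The triangular lattice `T`: two sites are adjacent iff their squared distance
`a ^ 2 + a * b + b ^ 2` is `1`. -/
def T : SimpleGraph Site where
  Adj u v := (v.1 - u.1) ^ 2 + (v.1 - u.1) * (v.2 - u.2) + (v.2 - u.2) ^ 2 = 1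
  symm := ⟨fun u v h => by rw [← h]; ring⟩
  loopless := ⟨fun u h => by simp at h⟩

/-- Position in the plane of the site `v` of `δT`, the triangular lattice of edge length `δ`. -/
def sitePt (δ : ℝ) (v : Site) : ℂ :=
  δ * ((v.1 : ℂ) + (v.2 : ℂ) * Complex.exp (Real.pi / 3 * Complex.I))

/-- Vertices of the dual hexagonal lattice `H`: the triangular faces of `T`, given by their three
mutually adjacent corners. -/
def HexVertex := {t : Finset Site // T.IsNClique 3 t}

/-- Position of a vertex of `δH`: the centre of the corresponding triangle of `δT`. -/
def hexPt (δ : ℝ) (t : HexVertex) : ℂ := (∑ v ∈ t.1, sitePt δ v) / 3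

/-- The hexagonal lattice `H`: two vertices are adjacent iff the two triangles share an edge. The
edge of `H` between triangles `s` and `t` is the common side of the two hexagons in `s ∩ t`. -/
def H : SimpleGraph HexVertex where
  Adj s t := (s.1 ∩ t.1).card = 2
  symm := ⟨fun s t h => by rw [Finset.inter_comm]; exact h⟩
  loopless := ⟨fun s h => by
    have := s.2.card_eq
    rw [Finset.inter_self] at h
    omega⟩

/-- The closed hexagonal face of `δH` centred at the site `v` of `δT`. -/
def hexagon (δ : ℝ) (v : Site) : Set ℂ := convexHull ℝ (hexPt δ '' {t | v ∈ t.1})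

/-- Rotation by `π/3`, i.e. multiplication of `a + b e^{iπ/3}` by `e^{iπ/3}`. -/
def rot (d : Site) : Site := (-d.2, d.1 + d.2)

lemma isNClique_left (e : T.Dart) :
    T.IsNClique 3 {e.fst, e.snd, e.fst + rot (e.snd - e.fst)} := by
  have h : (e.snd.1 - e.fst.1) ^ 2 + (e.snd.1 - e.fst.1) * (e.snd.2 - e.fst.2)
      + (e.snd.2 - e.fst.2) ^ 2 = 1 := e.adj
  rw [SimpleGraph.is3Clique_triple_iff]
  refine ⟨e.adj, ?_, ?_⟩
  · change _ = _
    simp only [rot, Prod.fst_add, Prod.snd_add, Prod.fst_sub, Prod.snd_sub]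
    rw [← h]; ring
  · change _ = _
    simp only [rot, Prod.fst_add, Prod.snd_add, Prod.fst_sub, Prod.snd_sub]
    rw [← h]; ring

/-- `z(e)`: the vertex of `H` immediately to the left of the oriented edge `e` of `T`. -/
def leftVertex (e : T.Dart) : HexVertex := ⟨_, isNClique_left e⟩

/-- The edge of `δH` dual to the edge `e` of `T`, i.e. the common side of the hexagons around the
endpoints of `e`, as a segment in the plane. -/
def hexEdge (δ : ℝ) (e : T.Dart) : Set ℂ :=
  segment ℝ (hexPt δ (leftVertex e)) (hexPt δ (leftVertex e.symm))

/-! ### Critical percolation -/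

/-- Colourings of the hexagons: `true` is blue, `false` is yellow. -/
abbrev Config := Site → Bool

/-- Critical face percolation on the hexagonal lattice: every hexagon is independently blue or
yellow with probability `1/2` each. -/
def critPerc : Measure Config :=
  Measure.infinitePi fun _ : Site => (PMF.uniformOfFintype Bool).toMeasure

/-- There is a blue crossing of the annulus of inner radius `r` and outer radius `R` around `x`: a
path of blue hexagons of `δH` from the closed inner disc to the complement of the open outer
disc. -/
def annulusCrossing (δ : ℝ) (x : ℂ) (r R : ℝ) : Set Config :=
  {ω | ∃ (u v : Site) (p : T.Walk u v), (∀ y ∈ p.support, ω y = true) ∧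
    (hexagon δ u ∩ Metric.closedBall x r).Nonempty ∧
    (hexagon δ v ∩ (Metric.ball x R)ᶜ).Nonempty}

/-- `lam > 0` is an exponent for the annulus crossing estimate: the probability of a blue crossing
of an annulus with radii `r` and `R` is at most a constant times `(r / R) ^ lam`, provided that
`R / r` and `r / δ` are at least some positive constant `c`. -/
def IsAnnulusExponent (lam : ℝ) : Prop :=
  0 < lam ∧ ∃ c > 0, ∃ K : ℝ, ∀ (δ : ℝ) (x : ℂ) (r R : ℝ), 0 < δ → 0 < r →
    c ≤ R / r → c ≤ r / δ →
      critPerc.real (annulusCrossing δ x r R) ≤ K * (r / R) ^ lam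

/-! ### Marked Jordan domains and their convergence -/

/-- A bounded `k`-marked Jordan domain: a bounded simply connected open set whose boundary is a
Jordan curve, with `k` distinct boundary points in counterclockwise order. The boundary is given by
a counterclockwise parametrization `bdry` of period `1`, and the marked points are `bdry (time j)`
for increasing times within one period. -/
structure MarkedDomain (k : ℕ) where
  carrier : Set ℂ
  isOpen : IsOpen carrier
  isBounded : Bornology.IsBounded carrier
  simplyConnected : IsSimplyConnected carrier
  bdry : ℝ → ℂ
  bdry_continuous : Continuous bdry
  bdry_periodic : Function.Periodic bdry 1
  bdry_injOn : Set.InjOn bdry (Set.Ico 0 1)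
  bdry_range : Set.range bdry = frontier carrier
  /-- Counterclockwise orientation: around each point of the domain the argument of the boundary
  curve increases by `2π` over one period. -/
  bdry_ccw : ∀ z ∈ carrier, ∃ ℓ : ℝ → ℂ, Continuous ℓ ∧
    (∀ t, bdry t - z = Complex.exp (ℓ t)) ∧ ∀ t, ℓ (t + 1) = ℓ t + 2 * Real.pi * Complex.I
  time : Fin k → ℝ
  time_strictMono : StrictMono time
  time_lt : ∀ i j, time i < time j + 1

namespace MarkedDomain

variable {k : ℕ}

/-- The `j`-th marked point. -/
def pt (D : MarkedDomain k) (j : Fin k) : ℂ := D.bdry (D.time j)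

/-- The time at which the boundary parametrization, started at the `j`-th marked point, reaches the
cyclically next marked point. -/
def nextTime (D : MarkedDomain k) (j : Fin k) : ℝ :=
  if h : (j : ℕ) + 1 < k then D.time ⟨j + 1, h⟩ else D.time ⟨0, j.pos⟩ + 1

/-- The counterclockwise boundary arc from the `j`-th marked point to the next one, as a parametrized
curve. -/
def arcCurve (D : MarkedDomain k) (j : Fin k) : C(unitInterval, ℂ) where
  toFun s := D.bdry (D.time j + s * (D.nextTime j - D.time j))
  continuous_toFun := D.bdry_continuous.comp (by fun_prop)

/-- The counterclockwise boundary arc from the `j`-th marked point to the next one. -/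
def arc (D : MarkedDomain k) (j : Fin k) : Set ℂ := Set.range (D.arcCurve j)

/-- Forget the last marked point. -/
def forgetLast (D : MarkedDomain (k + 1)) : MarkedDomain k :=
  { D with
    time := fun j => D.time j.castSucc
    time_strictMono := fun _ _ h => D.time_strictMono (Fin.castSucc_lt_castSucc_iff.2 h)
    time_lt := fun _ _ => D.time_lt _ _ }

/-- The hexagons of `δH` inside `D` (when `D` is a union of hexagons, these are the hexagons whose
centre is in `D`). -/
def faces (D : MarkedDomain k) (δ : ℝ) : Set Site := {v | sitePt δ v ∈ D.carrier}

/-- `D` is a marked discrete domain with mesh `δ`: it is the interior of a union of closed hexagonal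
faces of `δH`, and each marked point is a vertex of `δH` incident to a unique hexagon inside `D`. -/
def IsDiscrete (D : MarkedDomain k) (δ : ℝ) : Prop :=
  (∃ F : Set Site, D.carrier = interior (⋃ v ∈ F, hexagon δ v)) ∧
  ∀ j, ∃ t : HexVertex, hexPt δ t = D.pt j ∧ ∃! v, v ∈ t.1 ∧ v ∈ D.faces δ

end MarkedDomain

/-- The uniform distance between curves modulo reparametrization. -/
def dcurve (f g : C(unitInterval, ℂ)) : ℝ :=
  ⨅ φ : unitInterval ≃o unitInterval, dist (f.comp ⟨φ, φ.continuous⟩) g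

/-- Uniform convergence of marked domains: each boundary arc converges in the uniform metric. -/
def ConvergesUniformly {k : ℕ} {ι : Type*} (D : ι → MarkedDomain k) (l : Filter ι)
    (D₀ : MarkedDomain k) : Prop :=
  ∀ j, Tendsto (fun i => dcurve ((D i).arcCurve j) (D₀.arcCurve j)) l (𝓝 0)

/-! ### Separating probabilities -/

/-- The event `E_j(z)` in a three-marked discrete domain `D` of mesh `δ`: there is a blue simple path
from `A_{j-1}` to `A_{j+1}` separating `z` from `A_j` (indices modulo `3`).

The path is a simple path `γ` of blue hexagons inside `D`. Its first hexagon `u` has a side contained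
in `A_{j-1}`, shared with a neighbouring hexagon `a`, and its last hexagon `v` has a side contained
in `A_{j+1}`, shared with a neighbouring hexagon `b`; so it is drawn as the curve `a, γ, b` through
the centres of the hexagons, which enters and leaves `D` through these two sides. It separates `z`
from `A_j` iff every hexagonal path in the closure of `D` (all of whose edges are sides of hexagons
inside `D`) from `z` to a vertex on `A_j` crosses that curve, i.e. uses an edge of `H` that is
dual to an edge `s(x, y)` of the curve. -/
def sepEvent (D : MarkedDomain 3) (δ : ℝ) (j : Fin 3) (z : HexVertex) : Set Config :=
  {ω | ∃ (a u v b : Site) (hau : T.Adj a u) (γ : T.Walk u v) (hvb : T.Adj v b),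
    γ.IsPath ∧ (∀ x ∈ γ.support, x ∈ D.faces δ ∧ ω x = true) ∧
    hexEdge δ ⟨(a, u), hau⟩ ⊆ D.arc (j - 1) ∧ hexEdge δ ⟨(v, b), hvb⟩ ⊆ D.arc (j + 1) ∧
    ∀ (y : HexVertex) (W : H.Walk z y), hexPt δ y ∈ D.arc j →
      (∀ d ∈ W.darts, ∃ x ∈ D.faces δ, x ∈ d.fst.1 ∩ d.snd.1) →
      ∃ d ∈ W.darts, ∃ x y : Site,
        s(x, y) ∈ (SimpleGraph.Walk.cons hau (γ.concat hvb)).edges ∧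
        d.fst.1 ∩ d.snd.1 = {x, y}}

/-- The separating probability function `s_j`. -/
def sepProb (D : MarkedDomain 3) (δ : ℝ) (j : Fin 3) (z : HexVertex) : ℝ :=
  critPerc.real (sepEvent D δ j z)

/-! ### Discrete contour integrals -/

/-- The closed walk `C` in `T` is, at mesh `δ`, a discrete triangular contour in `U`: it is a simple
closed curve, contained in `U`, and oriented counterclockwise (its signed area is positive). -/
def IsContourIn {o : Site} (C : T.Walk o o) (δ : ℝ) (U : Set ℂ) : Prop :=
  C.IsCycle ∧ (∀ e ∈ C.darts, segment ℝ (sitePt δ e.fst) (sitePt δ e.snd) ⊆ U) ∧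
  0 < (C.darts.map fun e =>
    ((starRingEnd ℂ) (sitePt δ e.fst) * sitePt δ e.snd).im).sum

/-- The discrete contour integral `∑_{e ∈ C} f(z(e)) (e⁺ - e⁻)` along the contour `C` in `δT`. -/
def contourIntegral {o : Site} (C : T.Walk o o) (δ : ℝ) (f : HexVertex → ℝ) : ℂ :=
  (C.darts.map fun e =>
    (f (leftVertex e) : ℂ) * (sitePt δ e.snd - sitePt δ e.fst)).sum

/-- The Euclidean length of the contour `C` in `δT`. -/
def contourLength {o : Site} (C : T.Walk o o) (δ : ℝ) : ℝ :=
  (C.darts.map fun e => dist (sitePt δ e.fst) (sitePt δ e.snd)).sum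

/-- `ζ = e^{2πi/3}`. -/
def zeta : ℂ := Complex.exp (2 * Real.pi * Complex.I / 3)

end TriPerc

end

/-!
The contour integrals of `s_{j+1}` and of `ζ s_j` differ only by boundary terms. Summation by parts
writes the contour integral of `s_j` as a sum over the edges of `T` inside of the contour of the
gaps `P[E_j(w) \ E_j(z)]`, where `z` and `w` are the vertices to the left and to the right of the
edge, times the edge, up to a sum over the edges of the contour itself (`contourIntegral_eq`; it
uses that a counterclockwise cycle has winding number `1` around the triangles inside and `0` around
the others, `winding_of_area_pos`). Rotating an edge around the triangle on its left multiplies the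
edge by `ζ`, and by colour switching it takes the gap of `j` to the gap of `j + 1` (`gap_eq`). So the
sums over the interior agree, and only the gaps across the edges of the contour remain
(`norm_contourIntegral_sub_le`).

Colour switching: if a separating blue path exists for `w` but not for its neighbour `z`, then it
passes between them, and sides of yellow hexagons lead from `z` to the arc `j`
(`exists_arms_of_sep`). Hence two blue arms and a yellow arm connect the three hexagons at `z` to the
three arcs. Following the interface between the yellow arm and the blue arm on one side of it
reveals only the hexagons along the interface. The other blue arm lies in the unexplored part, where
the colours may be flipped without changing the probability. The colours are then yellow, blue and
yellow; after exchanging the colours globally this is the event of the gap of the rotated edge and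
arc (`mem_switch_of_sep`, `real_switch_le`, `flip_mem_sep_of_switch`). This gives one inequality
between gaps, and its three rotations make up a cycle.

The topology in this argument is discrete. A path of hexagons through the domain, closed outside of
it, has winding numbers that jump across the path and only there (`winding_jump`,
`exists_crossPotential`); such a potential shows which vertices are separated by the path.
Conversely, separating paths are found along the rim of a connected set of vertices, by following
the flow carried by its rim (`exists_rim_walk`).

A gap across an edge is small since the arms reach the arcs. By compactness no point of the plane is
close to all three arcs of the limit domain, and the same is true of the approximating domains
(`exists_far_arc`, `eventually_far_arc`). One of the arms therefore crosses an annulus with inner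
radius of order `δ` and fixed outer radius (`gap_le_annulusCrossing`), which has probability at most
a constant times `δ ^ λ` by the definition of an annulus exponent.

To apply this to marked discrete domains in the plane, the boundary has to be recognized as a single
cycle of sides of hexagons, which holds since a Jordan curve is connected (`sameCycle_bdryPerm`), and
its combinatorial and its analytic orientation have to be matched, which is done by comparing the
total increments of the logarithm along the boundary (`exists_ddom_arc`). Then the separation events
are the combinatorial ones (`sepEvent_eq`).

Annulus exponents exist by a Russo-Seymour-Welsh argument (`exists_annulusExponent`). A rhombus
is crossed by blue with probability at most `1 / 2` by symmetry and planarity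
(`noCrossing_rhombus`). If a strip is not crossed sideways, exploring the blue cluster of its left
side and reflecting the remainder shows that the yellow path which blocks it continues through the
mirror image with conditional probability at least `1 / 2`; two such events and Harris' inequality
block the doubled strip (`noCrossing_double`). After three doublings, six rotated copies of a zigzag
strip block an annulus with a probability that does not depend on its scale, and annuli of scales
`3 ^ j` are independent (`not_blocked_pow`).
-/


open Filter Topology MeasureTheory

noncomputable section

namespace TriPerc

/-! ### Events depending on finitely many hexagons -/

/-- The event `S` is determined by the colours of the hexagons in `F`. -/
def DetBy (F : Finset Site) (S : Set Config) : Prop :=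
  ∀ ω ω' : Config, (∀ x ∈ F, ω x = ω' x) → ω ∈ S → ω' ∈ S

lemma DetBy.iff {F : Finset Site} {S : Set Config} (h : DetBy F S) {ω ω' : Config}
    (e : ∀ x ∈ F, ω x = ω' x) : ω ∈ S ↔ ω' ∈ S :=
  ⟨h _ _ e, h _ _ fun x hx => (e x hx).symm⟩

lemma DetBy.mono {F G : Finset Site} {S : Set Config} (h : DetBy F S) (hFG : F ⊆ G) : DetBy G S :=
  fun ω ω' e => h ω ω' fun x hx => e x (hFG hx)

lemma DetBy.inter {F : Finset Site} {S S' : Set Config} (h : DetBy F S) (h' : DetBy F S') :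
    DetBy F (S ∩ S') := fun _ _ e hω => ⟨h _ _ e hω.1, h' _ _ e hω.2⟩

lemma DetBy.compl {F : Finset Site} {S : Set Config} (h : DetBy F S) : DetBy F Sᶜ :=
  fun _ _ e hω hω' => hω (h _ _ (fun x hx => (e x hx).symm) hω')

lemma DetBy.diff {F : Finset Site} {S S' : Set Config} (h : DetBy F S) (h' : DetBy F S') :
    DetBy F (S \ S') := h.inter h'.compl

/-- The configuration with the given colours on `F` that is yellow elsewhere. -/
def extend (F : Finset Site) (η : F → Bool) : Config :=
  fun x => if h : x ∈ F then η ⟨x, h⟩ else false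

lemma extend_apply {F : Finset Site} (η : F → Bool) {x : Site} (h : x ∈ F) :
    extend F η x = η ⟨x, h⟩ := by simp [extend, h]

instance : IsProbabilityMeasure critPerc := by unfold critPerc; infer_instance

lemma DetBy.eq_preimage {F : Finset Site} {S : Set Config} (h : DetBy F S) :
    S = F.restrict ⁻¹' {η : F → Bool | extend F η ∈ S} := by
  ext ω
  refine h.iff fun x hx => ?_
  simp [extend, hx]

lemma DetBy.measurableSet {F : Finset Site} {S : Set Config} (h : DetBy F S) :
    MeasurableSet S := by
  rw [h.eq_preimage]
  exact (Finset.measurable_restrict F) (Set.toFinite _).measurableSet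

open Classical in
/-- The probability of an event that depends on the hexagons in `F` only, as a proportion of the
colourings of `F`. -/
lemma DetBy.real_eq {F : Finset Site} {S : Set Config} (h : DetBy F S) :
    critPerc.real S =
      (Finset.univ.filter fun η : F → Bool => extend F η ∈ S).card / 2 ^ F.card := by
  have h1 : critPerc S = (Measure.pi fun _ : F => (PMF.uniformOfFintype Bool).toMeasure)
      {η : F → Bool | extend F η ∈ S} := by
    conv_lhs => rw [h.eq_preimage]
    rw [← Measure.map_apply (Finset.measurable_restrict F) (Set.toFinite _).measurableSet, critPerc,
      Measure.infinitePi_map_restrict]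
  rw [measureReal_def, h1]
  have h2 : {η : F → Bool | extend F η ∈ S} =
      ((Finset.univ.filter fun η : F → Bool => extend F η ∈ S : Finset (F → Bool)) :
        Set (F → Bool)) := by simp
  rw [h2, ← measureReal_def, ← sum_measureReal_singleton]
  have h3 : ∀ η : F → Bool, (Measure.pi fun _ : F =>
      (PMF.uniformOfFintype Bool).toMeasure).real {η} = (1 / 2) ^ F.card := by
    intro η
    rw [measureReal_def, Measure.pi_singleton]
    simp
  rw [Finset.sum_congr rfl fun η _ => h3 η, Finset.sum_const, nsmul_eq_mul]
  simp [div_eq_mul_inv]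

/-- If a map of configurations respects agreement on `F` and is injective on `S` up to agreement on
`F`, then it does not decrease the probability. -/
lemma real_le_of_injection {F : Finset Site} {S S' : Set Config} (h : DetBy F S)
    (h' : DetBy F S') (Φ : Config → Config) (hmap : ∀ ω ∈ S, Φ ω ∈ S')
    (hinj : ∀ ω ∈ S, ∀ ω' ∈ S, (∀ x ∈ F, Φ ω x = Φ ω' x) → ∀ x ∈ F, ω x = ω' x) :
    critPerc.real S ≤ critPerc.real S' := by
  classical
  rw [h.real_eq, h'.real_eq]
  refine div_le_div_of_nonneg_right (Nat.cast_le.2 ?_) (by positivity)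
  refine Finset.card_le_card_of_injOn (fun η => F.restrict (Φ (extend F η))) ?_ ?_
  · intro η hη
    simp only [Finset.coe_filter, Finset.mem_univ, true_and, Set.mem_ofPred_eq] at hη ⊢
    refine h' _ _ ?_ (hmap _ hη)
    intro x hx
    simp [extend, hx]
  · intro η hη η' hη' e
    simp only [Finset.coe_filter, Finset.mem_univ, true_and, Set.mem_ofPred_eq] at hη hη'
    funext ⟨x, hx⟩
    have := hinj _ hη _ hη' (fun y hy => congrFun e ⟨y, hy⟩) x hx
    rwa [extend_apply _ hx, extend_apply _ hx] at this

/-- A set of configurations is decreasing if it is stable under recolouring hexagons yellow. -/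
def Decreasing (S : Set Config) : Prop :=
  ∀ ω ω' : Config, (∀ x, ω' x = true → ω x = true) → ω ∈ S → ω' ∈ S

/-- Harris' inequality. -/
lemma harris {F : Finset Site} {S S' : Set Config} (h : DetBy F S) (h' : DetBy F S')
    (d : Decreasing S) (d' : Decreasing S') :
    critPerc.real S * critPerc.real S' ≤ critPerc.real (S ∩ S') := by
  classical
  let e : Finset F ≃ (F → Bool) :=
    { toFun := fun A x => decide (x ∈ A)
      invFun := fun η => Finset.univ.filter fun x => η x = true
      left_inv := fun A => by ext; simp
      right_inv := fun η => by ext; simp }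
  let N : Set Config → Finset (Finset F) := fun R =>
    Finset.univ.filter fun A : Finset F => extend F (e A) ∈ R
  have key : ∀ {R : Set Config}, DetBy F R → critPerc.real R = (N R).card / 2 ^ F.card := by
    intro R hR
    rw [hR.real_eq]
    congr 2
    refine (Finset.card_equiv e ?_).symm
    intro A; simp [N]
  have low : ∀ R : Set Config, Decreasing R → IsLowerSet (N R : Set (Finset F)) := by
    intro R dR A B hBA hA
    simp only [N, Finset.coe_filter, Finset.mem_univ, true_and, Set.mem_ofPred_eq] at hA ⊢
    refine dR _ _ ?_ hA
    intro x hx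
    by_cases hxF : x ∈ F
    · rw [extend_apply _ hxF] at hx ⊢
      simp only [e, Equiv.coe_fn_mk, decide_eq_true_eq] at hx ⊢
      exact hBA hx
    · simp [extend, hxF] at hx
  have hk := (low S d).le_card_inter_finset (low S' d')
  have hI : N S ∩ N S' = N (S ∩ S') := by ext; simp [N]
  rw [hI, Fintype.card_coe] at hk
  rw [key h, key h', key (h.inter h'), div_mul_div_comm,
    div_le_div_iff₀ (by positivity) (by positivity)]
  have hk' : ((N S).card : ℝ) * (N S').card ≤ 2 ^ F.card * (N (S ∩ S')).card := by
    exact_mod_cast hk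
  calc _ ≤ (2 ^ F.card * ((N (S ∩ S')).card : ℝ)) * 2 ^ F.card := by gcongr
    _ = _ := by ring

/-- Events determined by disjoint sets of hexagons are independent. -/
lemma real_inter_of_disjoint {F G : Finset Site} {S S' : Set Config} (h : DetBy F S)
    (h' : DetBy G S') (hFG : Disjoint F G) :
    critPerc.real (S ∩ S') = critPerc.real S * critPerc.real S' := by
  classical
  have hF := h.mono (Finset.subset_union_left (s₂ := G))
  have hG := h'.mono (Finset.subset_union_right (s₁ := F))
  rw [h.real_eq, h'.real_eq, (hF.inter hG).real_eq, Finset.card_union_of_disjoint hFG, pow_add,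
    div_mul_div_comm, ← Nat.cast_mul, ← Finset.card_product]
  congr 2
  refine Finset.card_bij'
    (fun η _ => (fun x => η ⟨x, Finset.mem_union_left _ x.2⟩,
      fun x => η ⟨x, Finset.mem_union_right _ x.2⟩))
    (fun p _ x => if hx : x.1 ∈ F then p.1 ⟨x, hx⟩ else
      p.2 ⟨x, (Finset.mem_union.1 x.2).resolve_left hx⟩) ?_ ?_ ?_ ?_
  · intro η hη
    simp only [Finset.mem_filter, Finset.mem_univ, true_and, Set.mem_inter_iff,
      Finset.mem_product] at hη ⊢
    refine ⟨h _ _ ?_ hη.1, h' _ _ ?_ hη.2⟩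
    · intro x hx; rw [extend_apply _ hx, extend_apply _ (Finset.mem_union_left _ hx)]
    · intro x hx; rw [extend_apply _ hx, extend_apply _ (Finset.mem_union_right _ hx)]
  · intro p hp
    simp only [Finset.mem_filter, Finset.mem_univ, true_and, Set.mem_inter_iff,
      Finset.mem_product] at hp ⊢
    refine ⟨h _ _ ?_ hp.1, h' _ _ ?_ hp.2⟩
    · intro x hx
      rw [extend_apply _ hx, extend_apply _ (Finset.mem_union_left _ hx)]; simp [hx]
    · intro x hx
      have hxF : x ∉ F := fun hx' => Finset.disjoint_left.1 hFG hx' hx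
      rw [extend_apply _ hx, extend_apply _ (Finset.mem_union_right _ hx)]; simp [hxF]
  · intro η _
    funext x
    by_cases hx : x.1 ∈ F <;> simp [hx]
  · intro p _
    ext x
    · simp
    · have hxF : x.1 ∉ F := fun hx' => Finset.disjoint_left.1 hFG hx' x.2
      simp [hxF]

/-- The law is invariant under a relabelling of the hexagons. -/
lemma real_comp {F : Finset Site} {S : Set Config} (h : DetBy F S) (g : Site ≃ Site) :
    critPerc.real {ω | ω ∘ g ∈ S} = critPerc.real S := by
  classical
  have h2 : DetBy (F.map g.toEmbedding) {ω | ω ∘ g ∈ S} := by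
    intro ω ω' e hω
    exact h _ _ (fun x hx => e _ (Finset.mem_map_of_mem _ hx)) hω
  rw [h.real_eq, h2.real_eq, Finset.card_map]
  congr 2
  refine Finset.card_bij'
    (fun η _ x => η ⟨g x, Finset.mem_map_of_mem g.toEmbedding x.2⟩)
    (fun η _ x => η ⟨g.symm x, by
      obtain ⟨y, hy, e⟩ := Finset.mem_map.1 x.2
      rw [← e]; simpa using hy⟩) ?_ ?_ ?_ ?_
  · intro η hη
    simp only [Finset.mem_filter, Finset.mem_univ, true_and, Set.mem_ofPred_eq] at hη ⊢
    refine h _ _ ?_ hη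
    intro x hx
    rw [extend_apply _ hx]
    exact extend_apply _ (Finset.mem_map_of_mem g.toEmbedding hx)
  · intro η hη
    simp only [Finset.mem_filter, Finset.mem_univ, true_and, Set.mem_ofPred_eq] at hη ⊢
    refine h _ _ ?_ hη
    intro x hx
    rw [extend_apply _ hx, Function.comp_apply,
      extend_apply _ (show g x ∈ F.map g.toEmbedding from Finset.mem_map_of_mem g.toEmbedding hx)]
    simp
  · intro η _; funext x; simp
  · intro η _; funext x; simp

/-- The colouring with all colours exchanged. -/
def flip (ω : Config) : Config := fun x => !ω x

@[simp] lemma flip_apply (ω : Config) (x : Site) : flip ω x = !ω x := rfl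

@[simp] lemma flip_flip (ω : Config) : flip (flip ω) = ω := by ext; simp

/-- The law is invariant under exchanging the colours. -/
lemma real_flip {F : Finset Site} {S : Set Config} (h : DetBy F S) :
    critPerc.real {ω | flip ω ∈ S} = critPerc.real S := by
  have h2 : DetBy F {ω | flip ω ∈ S} := by
    intro ω ω' e hω
    exact h _ _ (fun x hx => by simp [e x hx]) hω
  refine le_antisymm (real_le_of_injection h2 h flip (fun ω hω => hω) ?_)
    (real_le_of_injection h h2 flip (fun ω hω => by simpa using hω) ?_) <;>
  · intro ω _ ω' _ e x hx
    simpa using e x hx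

/-! ### The triangular lattice and winding numbers of lattice walks -/

lemma adj_cases {u v : Site} (h : T.Adj u v) :
    v = (u.1 + 1, u.2) ∨ v = (u.1, u.2 + 1) ∨ v = (u.1 - 1, u.2 + 1) ∨
    v = (u.1 - 1, u.2) ∨ v = (u.1, u.2 - 1) ∨ v = (u.1 + 1, u.2 - 1) := by
  obtain ⟨a, b⟩ := u
  obtain ⟨c, d⟩ := v
  change (c - a) ^ 2 + (c - a) * (d - b) + (d - b) ^ 2 = 1 at h
  obtain ⟨x, rfl⟩ : ∃ x, c = a + x := ⟨c - a, by ring⟩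
  obtain ⟨y, rfl⟩ : ∃ y, d = b + y := ⟨d - b, by ring⟩
  simp only [add_sub_cancel_left] at h
  have hx1 : x ≤ 1 := by nlinarith [sq_nonneg (x + 2 * y)]
  have hx2 : -1 ≤ x := by nlinarith [sq_nonneg (x + 2 * y)]
  have hy1 : y ≤ 1 := by nlinarith [sq_nonneg (2 * x + y)]
  have hy2 : -1 ≤ y := by nlinarith [sq_nonneg (2 * x + y)]
  simp only [Prod.mk.injEq]
  interval_cases x <;> interval_cases y <;> simp_all <;> omega

lemma adj_iff {u v : Site} : T.Adj u v ↔
    v = (u.1 + 1, u.2) ∨ v = (u.1, u.2 + 1) ∨ v = (u.1 - 1, u.2 + 1) ∨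
    v = (u.1 - 1, u.2) ∨ v = (u.1, u.2 - 1) ∨ v = (u.1 + 1, u.2 - 1) := by
  refine ⟨adj_cases, ?_⟩
  change _ → (v.1 - u.1) ^ 2 + (v.1 - u.1) * (v.2 - u.2) + (v.2 - u.2) ^ 2 = 1
  rintro (h | h | h | h | h | h) <;> rw [h] <;> ring

/-- The third corner of the triangle to the left of the oriented edge `e`. -/
def apex (e : T.Dart) : Site := e.fst + rot (e.snd - e.fst)

lemma leftVertex_val (e : T.Dart) : (leftVertex e).1 = {e.fst, e.snd, apex e} := rfl

lemma fst_ne_snd (e : T.Dart) : e.fst ≠ e.snd := e.adj.ne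

lemma apex_ne (e : T.Dart) : apex e ≠ e.fst ∧ apex e ≠ e.snd := by
  obtain ⟨⟨u, v⟩, h⟩ := e
  obtain ⟨a, b⟩ := u
  change T.Adj (a, b) v at h
  simp only [apex, rot, ne_eq, Prod.ext_iff, Prod.fst_add, Prod.snd_add, Prod.fst_sub,
    Prod.snd_sub]
  rcases adj_cases h with h' | h' | h' | h' | h' | h' <;> subst h' <;> constructor <;> simp
  all_goals omega

lemma sum_leftVertex (e : T.Dart) (f : Site → ℤ) :
    ∑ v ∈ (leftVertex e).1, f v = f e.fst + f e.snd + f (apex e) := by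
  rw [leftVertex_val, Finset.sum_insert, Finset.sum_insert, Finset.sum_singleton, add_assoc]
  · simpa using (apex_ne e).2.symm
  · simp only [Finset.mem_insert, Finset.mem_singleton, not_or]
    exact ⟨fst_ne_snd e, (apex_ne e).1.symm⟩

/-- The signed number of times (`0`, `1` or `-1`) that the oriented edge `d` crosses the strip
between the rows `b` and `b + 1` downwards at a place not to the right of `thr`; the place is
measured by the sum of the first coordinates of the endpoints. -/
def stripSign (d : T.Dart) (b thr : ℤ) : ℤ :=
  if d.fst.2 = b ∧ d.snd.2 = b + 1 ∧ d.fst.1 + d.snd.1 ≤ thr then -1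
  else if d.snd.2 = b ∧ d.fst.2 = b + 1 ∧ d.fst.1 + d.snd.1 ≤ thr then 1 else 0

/-- The winding number around the triangle `t` of the walk with oriented edges `L`, computed by
counting crossings of the horizontal ray that goes left from `t`. -/
def winding (L : List T.Dart) (t : HexVertex) : ℤ :=
  (L.map fun d => stripSign d ((∑ v ∈ t.1, v.2) / 3) (2 * (∑ v ∈ t.1, v.1) / 3)).sum

/-- Between the triangles above and below the edge from `(a, b)` to `(a + 1, b)` the ray moves to
the neighbouring row. Besides the passages through this edge, the sign changes by the derivative
along `d` of the indicator function of the half-row to the left. -/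
lemma stripSign_row (d : T.Dart) (a b : ℤ) :
    stripSign d b (2 * a) - stripSign d (b - 1) (2 * a + 1) =
      (if d.fst = (a, b) ∧ d.snd = (a + 1, b) then 1 else 0)
      - (if d.fst = (a + 1, b) ∧ d.snd = (a, b) then 1 else 0)
      + (if d.snd.2 = b ∧ d.snd.1 ≤ a then 1 else 0)
      - (if d.fst.2 = b ∧ d.fst.1 ≤ a then 1 else 0) := by
  obtain ⟨⟨⟨p, q⟩, v⟩, h⟩ := d
  change T.Adj (p, q) v at h
  simp only [stripSign, Prod.ext_iff]
  rcases adj_cases h with h' | h' | h' | h' | h' | h' <;> subst h' <;> dsimp only <;>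
    split_ifs <;> omega

/-- Between neighbouring triangles of one row only the passages through their common edge matter;
this lemma and the next treat the two directions of that edge. -/
lemma stripSign_step_even (d : T.Dart) (p b : ℤ) :
    stripSign d b (2 * p) - stripSign d b (2 * p - 1) =
      (if d.fst = (p, b + 1) ∧ d.snd = (p, b) then 1 else 0)
      - (if d.fst = (p, b) ∧ d.snd = (p, b + 1) then 1 else 0) := by
  obtain ⟨⟨⟨p, q⟩, v⟩, h⟩ := d
  change T.Adj (p, q) v at h
  simp only [stripSign, Prod.ext_iff]
  rcases adj_cases h with h' | h' | h' | h' | h' | h' <;> subst h' <;> dsimp only <;>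
    split_ifs <;> omega

lemma stripSign_step_odd (d : T.Dart) (p b : ℤ) :
    stripSign d b (2 * p - 1) - stripSign d b (2 * p - 2) =
      (if d.fst = (p - 1, b + 1) ∧ d.snd = (p, b) then 1 else 0)
      - (if d.fst = (p, b) ∧ d.snd = (p - 1, b + 1) then 1 else 0) := by
  obtain ⟨⟨⟨p, q⟩, v⟩, h⟩ := d
  change T.Adj (p, q) v at h
  simp only [stripSign, Prod.ext_iff]
  rcases adj_cases h with h' | h' | h' | h' | h' | h' <;> subst h' <;> dsimp only <;>
    split_ifs <;> omega

/-- The row and the place of the triangle to the left of `e`, in terms of the endpoints of `e`. -/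
lemma winding_leftVertex (L : List T.Dart) (e : T.Dart) :
    winding L (leftVertex e) = (L.map fun d => stripSign d
      ((3 * e.fst.2 + (e.snd.1 - e.fst.1) + 2 * (e.snd.2 - e.fst.2)) / 3)
      ((6 * e.fst.1 + 2 * (e.snd.1 - e.fst.1) - 2 * (e.snd.2 - e.fst.2)) / 3)).sum := by
  rw [winding, sum_leftVertex, sum_leftVertex]
  simp only [apex, rot, Prod.fst_add, Prod.snd_add, Prod.fst_sub, Prod.snd_sub]
  congr! 5
  all_goals ring

lemma dart_eq_iff {d e : T.Dart} : d = e ↔ d.fst = e.fst ∧ d.snd = e.snd := by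
  rw [SimpleGraph.Dart.ext_iff, Prod.ext_iff]

/-- Across an oriented edge `e` of `T` the strip crossing signs change by the net number of
passages through `e`, up to a discrete derivative along `d`, which vanishes in total for closed
walks. -/
lemma exists_potential (e : T.Dart) : ∃ g : Site → ℤ, ∀ d : T.Dart,
    stripSign d ((3 * e.fst.2 + (e.snd.1 - e.fst.1) + 2 * (e.snd.2 - e.fst.2)) / 3)
      ((6 * e.fst.1 + 2 * (e.snd.1 - e.fst.1) - 2 * (e.snd.2 - e.fst.2)) / 3) -
    stripSign d ((3 * e.snd.2 + (e.fst.1 - e.snd.1) + 2 * (e.fst.2 - e.snd.2)) / 3)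
      ((6 * e.snd.1 + 2 * (e.fst.1 - e.snd.1) - 2 * (e.fst.2 - e.snd.2)) / 3) =
    (if d = e then 1 else 0) - (if d = e.symm then 1 else 0) + (g d.snd - g d.fst) := by
  obtain ⟨⟨⟨a, b⟩, v⟩, h⟩ := e
  have h0 : T.Adj (a, b) v := h
  rcases adj_cases h0 with h' | h' | h' | h' | h' | h'
  · subst h'
    refine ⟨fun x => if x.2 = b ∧ x.1 ≤ a then 1 else 0, fun d => ?_⟩
    have := stripSign_row d a b
    simp only [dart_eq_iff, SimpleGraph.Dart.symm, Prod.fst_swap, Prod.snd_swap]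
    rw [show (3 * b + (a + 1 - a) + 2 * (b - b)) / 3 = b by omega,
      show (6 * a + 2 * (a + 1 - a) - 2 * (b - b)) / 3 = 2 * a by omega,
      show (3 * b + (a - (a + 1)) + 2 * (b - b)) / 3 = b - 1 by omega,
      show (6 * (a + 1) + 2 * (a - (a + 1)) - 2 * (b - b)) / 3 = 2 * a + 1 by omega]
    linarith
  · subst h'
    refine ⟨fun _ => 0, fun d => ?_⟩
    have := stripSign_step_even d a b
    simp only [dart_eq_iff, SimpleGraph.Dart.symm, Prod.fst_swap, Prod.snd_swap]
    rw [show (3 * b + (a - a) + 2 * (b + 1 - b)) / 3 = b by omega,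
      show (6 * a + 2 * (a - a) - 2 * (b + 1 - b)) / 3 = 2 * a - 1 by omega,
      show (3 * (b + 1) + (a - a) + 2 * (b - (b + 1))) / 3 = b by omega,
      show (6 * a + 2 * (a - a) - 2 * (b - (b + 1))) / 3 = 2 * a by omega]
    linarith
  · subst h'
    refine ⟨fun _ => 0, fun d => ?_⟩
    have := stripSign_step_odd d a b
    simp only [dart_eq_iff, SimpleGraph.Dart.symm, Prod.fst_swap, Prod.snd_swap]
    rw [show (3 * b + (a - 1 - a) + 2 * (b + 1 - b)) / 3 = b by omega,
      show (6 * a + 2 * (a - 1 - a) - 2 * (b + 1 - b)) / 3 = 2 * a - 2 by omega,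
      show (3 * (b + 1) + (a - (a - 1)) + 2 * (b - (b + 1))) / 3 = b by omega,
      show (6 * (a - 1) + 2 * (a - (a - 1)) - 2 * (b - (b + 1))) / 3 = 2 * a - 1 by omega]
    linarith
  · subst h'
    refine ⟨fun x => - if x.2 = b ∧ x.1 ≤ a - 1 then 1 else 0, fun d => ?_⟩
    have := stripSign_row d (a - 1) b
    simp only [dart_eq_iff, SimpleGraph.Dart.symm, Prod.fst_swap, Prod.snd_swap]
    rw [show (3 * b + (a - 1 - a) + 2 * (b - b)) / 3 = b - 1 by omega,
      show (6 * a + 2 * (a - 1 - a) - 2 * (b - b)) / 3 = 2 * (a - 1) + 1 by omega,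
      show (3 * b + (a - (a - 1)) + 2 * (b - b)) / 3 = b by omega,
      show (6 * (a - 1) + 2 * (a - (a - 1)) - 2 * (b - b)) / 3 = 2 * (a - 1) by omega]
    rw [show a - 1 + 1 = a by ring] at this
    linarith
  · subst h'
    refine ⟨fun _ => 0, fun d => ?_⟩
    have := stripSign_step_even d a (b - 1)
    simp only [dart_eq_iff, SimpleGraph.Dart.symm, Prod.fst_swap, Prod.snd_swap]
    rw [show (3 * b + (a - a) + 2 * (b - 1 - b)) / 3 = b - 1 by omega,
      show (6 * a + 2 * (a - a) - 2 * (b - 1 - b)) / 3 = 2 * a by omega,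
      show (3 * (b - 1) + (a - a) + 2 * (b - (b - 1))) / 3 = b - 1 by omega,
      show (6 * a + 2 * (a - a) - 2 * (b - (b - 1))) / 3 = 2 * a - 1 by omega]
    rw [sub_add_cancel] at this
    linarith
  · subst h'
    refine ⟨fun _ => 0, fun d => ?_⟩
    have := stripSign_step_odd d (a + 1) (b - 1)
    simp only [dart_eq_iff, SimpleGraph.Dart.symm, Prod.fst_swap, Prod.snd_swap]
    rw [show (3 * b + (a + 1 - a) + 2 * (b - 1 - b)) / 3 = b - 1 by omega,
      show (6 * a + 2 * (a + 1 - a) - 2 * (b - 1 - b)) / 3 = 2 * (a + 1) - 1 by omega,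
      show (3 * (b - 1) + (a - (a + 1)) + 2 * (b - (b - 1))) / 3 = b - 1 by omega,
      show (6 * (a + 1) + 2 * (a - (a + 1)) - 2 * (b - (b - 1))) / 3 = 2 * (a + 1) - 2 by omega]
    rw [sub_add_cancel, add_sub_cancel_right] at this
    linarith

lemma sum_darts_sub {V : Type*} {G : SimpleGraph V} {R : Type*} [AddCommGroup R] {u v : V}
    (W : G.Walk u v) (g : V → R) : (W.darts.map fun d => g d.snd - g d.fst).sum = g v - g u := by
  induction W with
  | nil => simp
  | cons h p ih => simp [ih]

/-- The net number of passages of the walk with oriented edges `L` through `e`. -/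
def passages (L : List T.Dart) (e : T.Dart) : ℤ := L.count e - L.count e.symm

lemma count_eq_sum (L : List T.Dart) (e : T.Dart) :
    (L.count e : ℤ) = (L.map fun d => if d = e then (1 : ℤ) else 0).sum := by
  induction L with
  | nil => simp
  | cons d L ih =>
    rw [List.count_cons, List.map_cons, List.sum_cons, ← ih]
    by_cases h : d = e
    · subst h; simp [add_comm]
    · simp [h]

lemma sum_map_sub' {α : Type*} (L : List α) (f g : α → ℤ) :
    (L.map f).sum - (L.map g).sum = (L.map fun d => f d - g d).sum := by
  induction L with
  | nil => simp
  | cons d L ih => simp only [List.map_cons, List.sum_cons, ← ih]; ring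

lemma sum_map_add' {α : Type*} (L : List α) (f g : α → ℤ) :
    (L.map f).sum + (L.map g).sum = (L.map fun d => f d + g d).sum := by
  induction L with
  | nil => simp
  | cons d L ih => simp only [List.map_cons, List.sum_cons, ← ih]; ring

/-- The winding number of a closed walk jumps across the edges of the walk, and only there. -/
theorem winding_jump {o : Site} (W : T.Walk o o) (e : T.Dart) :
    winding W.darts (leftVertex e) - winding W.darts (leftVertex e.symm) =
      passages W.darts e := by
  obtain ⟨g, hg⟩ := exists_potential e
  have h0 := sum_darts_sub W g
  rw [sub_self] at h0
  rw [winding_leftVertex, winding_leftVertex, sum_map_sub', passages, count_eq_sum,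
    count_eq_sum, sum_map_sub']
  have key : (W.darts.map fun d => ((if d = e then (1 : ℤ) else 0) - if d = e.symm then 1 else 0)
      + (g d.snd - g d.fst)).sum = (W.darts.map fun d => (if d = e then (1 : ℤ) else 0) -
        if d = e.symm then 1 else 0).sum := by
    rw [← sum_map_add', h0, add_zero]
  rw [← key]
  congr 1
  exact List.map_congr_left fun d _ => hg d

/-! ### Connections inside a set of sites -/

/-- `x` and `y` are joined by a path of hexagons in `S`. -/
def Joined (S : Set Site) (x y : Site) : Prop := ∃ p : T.Walk x y, ∀ v ∈ p.support, v ∈ S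

namespace Joined

variable {S S' : Set Site} {x y z : Site}

lemma left (h : Joined S x y) : x ∈ S := by
  obtain ⟨p, hp⟩ := h; exact hp _ p.start_mem_support

lemma right (h : Joined S x y) : y ∈ S := by
  obtain ⟨p, hp⟩ := h; exact hp _ p.end_mem_support

lemma refl (h : x ∈ S) : Joined S x x := ⟨.nil, by simpa using h⟩

lemma symm (h : Joined S x y) : Joined S y x := by
  obtain ⟨p, hp⟩ := h; exact ⟨p.reverse, by simpa using hp⟩

lemma trans (h : Joined S x y) (h' : Joined S y z) : Joined S x z := by
  obtain ⟨p, hp⟩ := h; obtain ⟨q, hq⟩ := h'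
  refine ⟨p.append q, fun v hv => ?_⟩
  rcases (SimpleGraph.Walk.mem_support_append_iff _ _).1 hv with hv | hv
  exacts [hp v hv, hq v hv]

lemma mono (h : Joined S x y) (hS : S ⊆ S') : Joined S' x y := by
  obtain ⟨p, hp⟩ := h; exact ⟨p, fun v hv => hS (hp v hv)⟩

lemma step (hx : x ∈ S) (hy : y ∈ S) (h : T.Adj x y) : Joined S x y :=
  ⟨h.toWalk, by simp [hx, hy]⟩

lemma tail (h : Joined S x y) (hz : z ∈ S) (e : T.Adj y z) : Joined S x z :=
  h.trans (step h.right hz e)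

lemma head (h : Joined S y z) (hx : x ∈ S) (e : T.Adj x y) : Joined S x z :=
  (step hx h.left e).trans h

/-- A set containing `x` and stable under steps inside `S` contains everything joined to `x`. -/
lemma induct {P : Site → Prop} (h : Joined S x y) (hx : P x)
    (hs : ∀ u v, u ∈ S → v ∈ S → T.Adj u v → P u → P v) : P y := by
  obtain ⟨p, hp⟩ := h
  induction p with
  | nil => exact hx
  | cons e p ih =>
    simp only [SimpleGraph.Walk.support_cons, List.mem_cons, forall_eq_or_imp] at hp
    exact ih (hs _ _ hp.1 (hp.2 _ p.start_mem_support) e hx) hp.2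

/-- A path that leaves the set `A` has a last exit from `A`. -/
lemma exists_last_exit {A : Set Site} (h : Joined S x y) (hx : x ∈ A) (hy : y ∉ A) :
    ∃ u v, u ∈ A ∧ u ∈ S ∧ v ∉ A ∧ T.Adj u v ∧ Joined (S \ A) v y := by
  suffices H : x ∉ A ∧ Joined (S \ A) x y ∨
      ∃ u v, u ∈ A ∧ u ∈ S ∧ v ∉ A ∧ T.Adj u v ∧ Joined (S \ A) v y from
    H.resolve_left fun h' => h'.1 hx
  clear hx
  obtain ⟨p, hp⟩ := h
  induction p with
  | nil =>
    simp only [SimpleGraph.Walk.support_nil, List.mem_singleton, forall_eq] at hp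
    exact .inl ⟨hy, refl ⟨hp, hy⟩⟩
  | cons e p ih =>
    simp only [SimpleGraph.Walk.support_cons, List.mem_cons, forall_eq_or_imp] at hp
    rcases ih hy hp.2 with ⟨h1, h2⟩ | h2
    · rename_i u v w
      by_cases hu : u ∈ A
      · exact .inr ⟨u, v, hu, hp.1, h1, e, h2⟩
      · exact .inl ⟨hu, h2.head ⟨hp.1, hu⟩ e⟩
    · exact .inr h2

/-- Images of paths under lattice automorphisms. -/
lemma map {f : Site → Site} (hf : ∀ u v, T.Adj u v → T.Adj (f u) (f v)) (h : Joined S x y)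
    (hS : ∀ v ∈ S, f v ∈ S') : Joined S' (f x) (f y) := by
  refine h.induct (P := fun v => Joined S' (f x) (f v)) (refl (hS _ h.left)) ?_
  intro u v _ hv e hj
  exact hj.tail (hS _ hv) (hf _ _ e)

end Joined

/-! ### Crossings of zigzag strips -/

/-- The part between the rows `b₀` and `b₁` of a strip of `m + 1` sites per row whose left side
is given by `s`. -/
def region (s : ℤ → ℤ) (b₀ b₁ m : ℤ) : Set Site :=
  {v | b₀ ≤ v.2 ∧ v.2 ≤ b₁ ∧ s v.2 ≤ v.1 ∧ v.1 ≤ s v.2 + m}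

/-- The left side of a strip follows lattice edges. -/
def Slow (s : ℤ → ℤ) : Prop := ∀ b, s (b + 1) = s b ∨ s (b + 1) = s b - 1

/-- The winding number of a walk around the triangle above and to the right of the site `v`. -/
def siteWinding (L : List T.Dart) (v : Site) : ℤ :=
  (L.map fun d => stripSign d v.2 (2 * v.1)).sum

/-- The winding number does not change between adjacent sites off the walk. The walk need not be
closed, provided that its endpoints are not on the rays to the left of the two sites. -/
lemma siteWinding_eq_of_adj {p q : Site} (W : T.Walk p q) {v v' : Site} (h : T.Adj v v')
    (hv : v ∉ W.support) (hv' : v' ∉ W.support)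
    (hp : ∀ u, u = v ∨ u = v' → ¬ (p.2 = u.2 ∧ p.1 ≤ u.1))
    (hq : ∀ u, u = v ∨ u = v' → ¬ (q.2 = u.2 ∧ q.1 ≤ u.1)) :
    siteWinding W.darts v = siteWinding W.darts v' := by
  wlog H : v' = (v.1 + 1, v.2) ∨ v' = (v.1, v.2 + 1) ∨ v' = (v.1 - 1, v.2 + 1) generalizing v v'
  · refine (this h.symm hv' hv (fun u hu => hp u hu.symm) (fun u hu => hq u hu.symm) ?_).symm
    rcases adj_cases h with e | e | e | e | e | e <;> subst e
    · exact absurd (.inl rfl) H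
    · exact absurd (.inr (.inl rfl)) H
    · exact absurd (.inr (.inr rfl)) H
    · left; ext <;> simp
    · right; left; ext <;> simp
    · right; right; ext <;> simp
  have hd : ∀ d ∈ W.darts, d.fst ≠ v ∧ d.snd ≠ v ∧ d.fst ≠ v' ∧ d.snd ≠ v' := by
    intro d hd
    have h1 := W.dart_fst_mem_support_of_mem_darts hd
    have h2 := W.dart_snd_mem_support_of_mem_darts hd
    refine ⟨?_, ?_, ?_, ?_⟩ <;> rintro rfl <;> contradiction
  obtain ⟨a, b⟩ := v
  have hp' := hp v' (.inr rfl)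
  have hq' := hq v' (.inr rfl)
  -- The half-row to the left of `v'` contains no endpoint of the walk, so that the derivative of
  -- its indicator function along the walk sums to zero.
  have tel := sum_darts_sub W fun x => if x.2 = v'.2 ∧ x.1 ≤ v'.1 then (1 : ℤ) else 0
  simp only [hp', hq', if_false, sub_zero] at tel
  unfold siteWinding
  rcases H with e | e | e <;> subst e <;> dsimp only at *
  · congr 1
    refine List.map_congr_left fun d hdd => ?_
    have h1 := stripSign_step_even d (a + 1) b
    have h2 := stripSign_step_odd d (a + 1) b
    obtain ⟨-, -, n3, n4⟩ := hd d hdd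
    simp only [n3, n4, and_false, false_and, if_false] at h1 h2
    rw [show 2 * (a + 1) - 2 = 2 * a by ring] at h2
    linarith
  · rw [← sub_eq_zero, sum_map_sub', ← neg_eq_zero, ← tel]
    rw [← neg_one_mul, ← List.sum_map_mul_left]
    congr 1
    refine List.map_congr_left fun d hdd => ?_
    have h1 := stripSign_row d a (b + 1)
    have h2 := stripSign_step_odd d (a + 1) b
    obtain ⟨-, -, n3, n4⟩ := hd d hdd
    rw [show a + 1 - 1 = a by ring] at h2
    rw [show b + 1 - 1 = b by ring] at h1
    simp only [n3, n4, and_false, false_and, if_false] at h1 h2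
    rw [show 2 * (a + 1) - 2 = 2 * a by ring, show 2 * (a + 1) - 1 = 2 * a + 1 by ring] at h2
    linarith
  · rw [← sub_eq_zero, sum_map_sub', ← neg_eq_zero, ← tel]
    rw [← neg_one_mul, ← List.sum_map_mul_left]
    congr 1
    refine List.map_congr_left fun d hdd => ?_
    have h1 := stripSign_row d (a - 1) (b + 1)
    have h2 := stripSign_step_even d a b
    obtain ⟨n1, n2, n3, n4⟩ := hd d hdd
    rw [show b + 1 - 1 = b by ring, show 2 * (a - 1) + 1 = 2 * a - 1 by ring] at h1
    simp only [n1, n2, n3, n4, and_false, false_and, if_false] at h1 h2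
    linarith

/-- A path from the top row of a strip to the bottom row, or to the right side below the end of
the other path, meets every path from the left to the right side. -/
theorem exists_common_site {s : ℤ → ℤ} {b₀ b₁ m : ℤ} (hm : 0 ≤ m) {x y x' y' : Site}
    (p : T.Walk x y) (hp : ∀ v ∈ p.support, v ∈ region s b₀ b₁ m)
    (q : T.Walk x' y') (hq : ∀ v ∈ q.support, v ∈ region s b₀ b₁ m)
    (hx : x.2 = b₁) (hy : y.2 = b₀ ∨ (y.1 = s y.2 + m ∧ y.2 < y'.2))
    (hx' : x'.1 = s x'.2) (hy' : y'.1 = s y'.2 + m) :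
    ∃ v, v ∈ p.support ∧ v ∈ q.support := by
  by_contra! hdis
  -- The first path is prolonged by one site beyond the strip at both ends.
  obtain ⟨y₂, hyy, hy₂, hy₃⟩ : ∃ y₂, T.Adj y y₂ ∧ y₂.2 < y'.2 ∧
      (y₂.2 < b₀ ∨ y₂.1 = s y₂.2 + m + 1) := by
    have h1 := (hq y' q.end_mem_support).1
    rcases hy with hy | hy
    · refine ⟨(y.1, y.2 - 1), adj_iff.2 (by simp), ?_, .inl ?_⟩ <;> dsimp only <;> omega
    · refine ⟨(y.1 + 1, y.2), adj_iff.2 (by simp), hy.2, .inr ?_⟩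
      dsimp only; omega
  have hxx : T.Adj (x.1, x.2 + 1) x := adj_iff.2 (by simp)
  set W : T.Walk (x.1, x.2 + 1) y₂ := .cons hxx (p.concat hyy) with hW
  have hsup : ∀ v, v ∈ W.support ↔ v = (x.1, x.2 + 1) ∨ v ∈ p.support ∨ v = y₂ := by
    intro v; simp [hW, SimpleGraph.Walk.support_concat]
  have hWR : ∀ v ∈ W.support, v ∈ region s b₀ b₁ m → v ∈ p.support := by
    intro v hv hR
    rcases (hsup v).1 hv with e | e | e
    · subst e; have := hR.2.1; dsimp only at this; omega
    · exact e
    · subst e; obtain ⟨h1, h2, h3, h4⟩ := hR; omega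
  -- the winding number is constant along the second path
  have hconst : siteWinding W.darts y' = siteWinding W.darts x' := by
    have hJ : Joined {v | v ∈ q.support} x' y' := ⟨q, fun v hv => hv⟩
    refine hJ.induct (P := fun v => siteWinding W.darts v = siteWinding W.darts x') rfl ?_
    intro u v hu hv e ih
    rw [← ih]
    have hnot : ∀ w, w ∈ q.support → w ∉ W.support := fun w hw hw' =>
      hdis w (hWR w hw' (hq w hw)) hw
    have hq' : ∀ w, w = u ∨ w = v → w ∈ q.support := by rintro w (rfl | rfl) <;> assumption
    refine (siteWinding_eq_of_adj W e (hnot u hu) (hnot v hv) ?_ ?_).symm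
    · intro w hw h
      have := (hq w (hq' w hw)).2.1
      dsimp only at h; omega
    · intro w hw h
      obtain ⟨h1, h2, h3, h4⟩ := hq w (hq' w hw)
      rcases hy₃ with h' | h'
      · omega
      · rw [h.1] at h'; omega
  -- The prolonged path has no site in the row of `x'` to the left of `x'`.
  have hleft : siteWinding W.darts x' = 0 := by
    refine List.sum_eq_zero fun a ha => ?_
    obtain ⟨d, hd, rfl⟩ := List.mem_map.1 ha
    have key : ∀ l u : Site, l ∈ W.support → T.Adj l u → l.2 = x'.2 → u.2 = x'.2 + 1 →
        l.1 + u.1 ≤ 2 * x'.1 → False := by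
      intro l u hl hlu h1 h2 h3
      have hR' := hq x' q.start_mem_support
      have hl1 : l.1 ≤ x'.1 := by
        rcases adj_cases hlu with e | e | e | e | e | e <;> rw [e] at h2 h3 <;>
          dsimp only at h2 h3 <;> omega
      rcases (hsup l).1 hl with e | e | e
      · subst e; have := hR'.2.1; dsimp only at h1; omega
      · have hlR := (hp l e).2.2.1
        rw [h1] at hlR
        have : l = x' := Prod.ext (by omega) h1
        subst this
        exact hdis _ e q.start_mem_support
      · subst e
        have := hR'.1
        rcases hy₃ with h' | h'
        · omega
        · rw [h1] at h'; omega
    unfold stripSign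
    split_ifs with h1 h2
    · exact (key _ _ (W.dart_fst_mem_support_of_mem_darts hd) d.adj h1.1 h1.2.1 h1.2.2).elim
    · exact (key _ _ (W.dart_snd_mem_support_of_mem_darts hd) d.adj.symm h2.1 h2.2.1
        (by rw [add_comm]; exact h2.2.2)).elim
    · rfl
  -- The prolonged path descends past the row of `y'` once in total, and nowhere to the right of
  -- `y'`.
  have hright : siteWinding W.darts y' = 1 := by
    have tel := sum_darts_sub W fun v => if y'.2 + 1 ≤ v.2 then (-1 : ℤ) else 0
    have hR' := hq y' q.end_mem_support
    rw [if_neg (by omega), if_pos (by have := hR'.2.1; dsimp only; omega)] at tel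
    rw [show (0 : ℤ) - -1 = 1 by norm_num] at tel
    refine Eq.trans ?_ tel
    unfold siteWinding
    congr 1
    refine List.map_congr_left fun d hd => ?_
    have key : ∀ l u : Site, l ∈ W.support → T.Adj l u → l.2 = y'.2 → u.2 = y'.2 + 1 →
        l.1 + u.1 ≤ 2 * y'.1 := by
      intro l u hl hlu h1 h2
      rcases (hsup l).1 hl with e | e | e
      · subst e; have := hR'.2.1; dsimp only at h1; omega
      · have hlR := (hp l e).2.2.2
        rw [h1] at hlR
        rcases adj_cases hlu with e | e | e | e | e | e <;> rw [e] at h2 ⊢ <;>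
          dsimp only at h2 ⊢ <;> omega
      · subst e; omega
    have k1 := key _ _ (W.dart_fst_mem_support_of_mem_darts hd) d.adj
    have k2 := key _ _ (W.dart_snd_mem_support_of_mem_darts hd) d.adj.symm
    have hrow : d.snd.2 ≤ d.fst.2 + 1 ∧ d.fst.2 ≤ d.snd.2 + 1 := by
      rcases adj_cases d.adj with e | e | e | e | e | e <;> rw [e] <;> constructor <;>
        dsimp only <;> omega
    unfold stripSign
    split_ifs <;> first | rfl | omega
  rw [hleft, hright] at hconst
  exact one_ne_zero hconst

/-- The indicator function of a set of sites modulo `2`. -/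
def ind (A : Set Site) (v : Site) : ZMod 2 := open Classical in if v ∈ A then 1 else 0

/-- Modulo `2`: whether the pair `u, v` joins the sets `C` and `M`. -/
def pairInd (C M : Set Site) (u v : Site) : ZMod 2 := ind C u * ind M v + ind M u * ind C v

/-- For a set of sites `C`, consisting of the clusters in `S` of the arc `A₁`, and the set `M`
consisting of the clusters of the arc `A₂` among the other sites bordering `C` (or lying on
`A₁`), the edges between `C` and `M` form cycles as far as they run inside the region, and on the
two arcs they are governed by `M` and by `C` alone. -/
lemma exists_clusters (R S A₁ A₂ : Set Site) : ∃ C M : Set Site,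
    (∀ v ∈ C, v ∈ R ∩ S ∧ ∃ x ∈ A₁, Joined (R ∩ S) x v) ∧
    (∀ v ∈ M, v ∈ R \ S ∧ ∃ x ∈ A₂, Joined (R \ S) x v) ∧
    (∀ v ∈ R, v ∈ A₁ → v ∈ A₂ → ind C v + ind M v = 1) ∧
    (∀ x ∈ R, ∀ y ∈ R, ∀ z ∈ R, T.Adj x y → T.Adj y z → T.Adj x z →
      pairInd C M x y + pairInd C M y z + pairInd C M x z = 0) ∧
    (∀ x ∈ R, ∀ y ∈ R, T.Adj x y → x ∈ A₁ → y ∈ A₁ → pairInd C M x y = ind M x + ind M y) ∧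
    (∀ x ∈ R, ∀ y ∈ R, T.Adj x y → x ∈ A₂ → y ∈ A₂ → pairInd C M x y = ind C x + ind C y) := by
  classical
  set C : Set Site := {v | ∃ x ∈ A₁, Joined (R ∩ S) x v} with hC
  -- The border of `C`, which avoids `S` since `C` is a union of clusters of `S`; `M` is the part of
  -- it that is connected to `A₂`.
  set N : Set Site := {v | v ∈ R ∧ v ∉ C ∧ (v ∈ A₁ ∨ ∃ u ∈ C, T.Adj u v)} with hN
  set M : Set Site := {v | ∃ x ∈ A₂, Joined N x v} with hM
  have hCR : ∀ v ∈ C, v ∈ R ∩ S := fun v ⟨x, _, h⟩ => h.right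
  have hNS : N ⊆ R \ S := by
    rintro v ⟨hv, hvC, h⟩
    refine ⟨hv, fun hS => hvC ?_⟩
    rcases h with h | ⟨u, ⟨x, hx, hu⟩, e⟩
    · exact ⟨v, h, .refl ⟨hv, hS⟩⟩
    · exact ⟨x, hx, hu.tail ⟨hv, hS⟩ e⟩
  have hMN : ∀ v ∈ M, v ∈ N := fun v ⟨x, _, h⟩ => h.right
  have hMC : ∀ v ∈ M, v ∉ C := fun v hv => (hMN v hv).2.1
  have hstep : ∀ u v, u ∈ M → v ∈ N → T.Adj u v → v ∈ M :=
    fun u v ⟨x, hx, h⟩ hv e => ⟨x, hx, h.tail hv e⟩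
  have hCN : ∀ u v, u ∈ C → v ∈ R → T.Adj u v → v ∈ C ∨ v ∈ N := by
    intro u v hu hv e
    by_cases h : v ∈ C
    · exact .inl h
    · exact .inr ⟨hv, h, .inr ⟨u, hu, e⟩⟩
  have hA1 : ∀ v ∈ R, v ∈ A₁ → v ∈ C ∨ v ∈ N := by
    intro v hv h1
    by_cases h : v ∈ C
    · exact .inl h
    · exact .inr ⟨hv, h, .inl h1⟩
  have hA2 : ∀ v ∈ N, v ∈ A₂ → v ∈ M := fun v hv h => ⟨v, h, .refl hv⟩
  have cls : ∀ v, (v ∈ C ∧ v ∉ M) ∨ (v ∉ C ∧ v ∈ M) ∨ (v ∉ C ∧ v ∉ M) := fun v => by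
    by_cases hv : v ∈ M
    · exact .inr (.inl ⟨hMC v hv, hv⟩)
    · by_cases hv' : v ∈ C
      · exact .inl ⟨hv', hv⟩
      · exact .inr (.inr ⟨hv', hv⟩)
  refine ⟨C, M, fun v hv => ⟨hCR v hv, hv⟩, fun v hv => ⟨hNS (hMN v hv), ?_⟩, ?_, ?_, ?_, ?_⟩
  · obtain ⟨x, hx, h⟩ := hv
    exact ⟨x, hx, h.mono hNS⟩
  · intro v hv h1 h2
    rcases hA1 v hv h1 with h | h
    · have : v ∉ M := fun h' => hMC v h' h
      simp [ind, h, this]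
    · simp [ind, h.2.1, hA2 v h h2]
  · intro x hx y hy z hz exy eyz exz
    -- If two corners of a triangle are in `C` and `M`, then the third one is in `C` or `M`. Hence
    -- either none or exactly two of its sides join `C` and `M`.
    have key : ∀ u v, u ∈ R → v ∈ R → T.Adj u v → ∀ w, w ∈ R → T.Adj u w → T.Adj v w →
        u ∈ C → v ∈ M → w ∈ C ∨ w ∈ M := by
      intro u v _ _ _ w hw euw evw huC hvM
      rcases hCN u w huC hw euw with h | h
      · exact .inl h
      · exact .inr (hstep v w hvM h evw)
    have k1 := key x y hx hy exy z hz exz eyz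
    have k2 := key y x hy hx exy.symm z hz eyz exz
    have k3 := key y z hy hz eyz x hx exy.symm exz.symm
    have k4 := key z y hz hy eyz.symm x hx exz.symm exy.symm
    have k5 := key x z hx hz exz y hy exy eyz.symm
    have k6 := key z x hz hx exz.symm y hy eyz.symm exy
    simp only [pairInd, ind]
    rcases cls x with ⟨c1, m1⟩ | ⟨c1, m1⟩ | ⟨c1, m1⟩ <;>
      rcases cls y with ⟨c2, m2⟩ | ⟨c2, m2⟩ | ⟨c2, m2⟩ <;>
      rcases cls z with ⟨c3, m3⟩ | ⟨c3, m3⟩ | ⟨c3, m3⟩ <;>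
      simp only [c1, m1, c2, m2, c3, m3, if_true, if_false] <;>
      first
        | decide
        | exact ((k1 c1 m2).elim c3 m3).elim
        | exact ((k2 c2 m1).elim c3 m3).elim
        | exact ((k3 c2 m3).elim c1 m1).elim
        | exact ((k4 c3 m2).elim c1 m1).elim
        | exact ((k5 c1 m3).elim c2 m2).elim
        | exact ((k6 c3 m1).elim c2 m2).elim
  · intro x hx y hy e h1 h2
    have k1 := hA1 x hx h1
    have k2 := hA1 y hy h2
    have k3 := hstep x y
    have k4 := hstep y x
    have e' := e.symm
    simp only [pairInd, ind]
    rcases cls x with ⟨c1, m1⟩ | ⟨c1, m1⟩ | ⟨c1, m1⟩ <;>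
      rcases cls y with ⟨c2, m2⟩ | ⟨c2, m2⟩ | ⟨c2, m2⟩ <;>
      simp only [c1, m1, c2, m2, if_true, if_false] <;>
      first
        | decide
        | exact (m1 (k4 m2 (k1.resolve_left c1) e')).elim
        | exact (m2 (k3 m1 (k2.resolve_left c2) e)).elim
  · intro x hx y hy e h1 h2
    have k1 := hA2 x
    have k2 := hA2 y
    have k3 := hCN x y
    have k4 := hCN y x
    have e' := e.symm
    simp only [pairInd, ind]
    rcases cls x with ⟨c1, m1⟩ | ⟨c1, m1⟩ | ⟨c1, m1⟩ <;>
      rcases cls y with ⟨c2, m2⟩ | ⟨c2, m2⟩ | ⟨c2, m2⟩ <;>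
      simp only [c1, m1, c2, m2, if_true, if_false] <;>
      first
        | decide
        | exact (m1 (k1 ((k4 c2 hx e').resolve_left c1) h1)).elim
        | exact (m2 (k2 ((k3 c1 hy e).resolve_left c2) h2)).elim

lemma zmod_two_add_self (a : ZMod 2) : a + a = 0 := by
  revert a; decide

/-- If every unit square has boundary sum zero modulo `2`, so does every rectangle. -/
lemma sum_boundary_eq_zero (h v : ℕ → ℕ → ZMod 2) (m n : ℕ)
    (sq : ∀ i < m, ∀ b < n, h i b + h i (b + 1) + (v i b + v (i + 1) b) = 0) :
    ∑ i ∈ Finset.range m, h i 0 + ∑ i ∈ Finset.range m, h i n +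
      (∑ b ∈ Finset.range n, v 0 b + ∑ b ∈ Finset.range n, v m b) = 0 := by
  have two : ∀ a b : ZMod 2, a - b = a + b := fun a b => by revert a b; decide
  have e1 : ∀ i, h i n + h i 0 = ∑ b ∈ Finset.range n, (h i (b + 1) + h i b) := by
    intro i
    have := Finset.sum_range_sub (h i) n
    simpa only [two] using this.symm
  have e2 : ∀ b, v m b + v 0 b = ∑ i ∈ Finset.range m, (v (i + 1) b + v i b) := by
    intro b
    have := Finset.sum_range_sub (fun i => v i b) m
    simpa only [two] using this.symm
  have e3 : ∑ i ∈ Finset.range m, (h i n + h i 0) + ∑ b ∈ Finset.range n, (v m b + v 0 b) = 0 := by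
    simp only [e1, e2]
    rw [Finset.sum_comm (s := Finset.range n), ← Finset.sum_add_distrib]
    refine Finset.sum_eq_zero fun i hi => ?_
    rw [← Finset.sum_add_distrib]
    refine Finset.sum_eq_zero fun b hb => ?_
    rw [← sq i (Finset.mem_range.1 hi) b (Finset.mem_range.1 hb)]
    ring
  rw [Finset.sum_add_distrib, Finset.sum_add_distrib] at e3
  rw [← e3]; ring

lemma sum_add_succ (f : ℕ → ZMod 2) (n : ℕ) :
    ∑ i ∈ Finset.range n, (f i + f (i + 1)) = f 0 + f n := by
  induction n with
  | zero => simp [zmod_two_add_self]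
  | succ n ih =>
    rw [Finset.sum_range_succ, ih]
    calc f 0 + f n + (f n + f (n + 1)) = f 0 + f (n + 1) + (f n + f n) := by ring
      _ = _ := by rw [zmod_two_add_self, add_zero]

section Grid

variable {s : ℤ → ℤ} {b₀ : ℤ} {m n : ℕ}

/-- The sites of a strip, numbered by rows. -/
def grid (s : ℤ → ℤ) (b₀ : ℤ) (i b : ℕ) : Site := (s (b₀ + b) + i, b₀ + b)

lemma grid_mem {i b : ℕ} (hi : i ≤ m) (hb : b ≤ n) : grid s b₀ i b ∈ region s b₀ (b₀ + n) m := by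
  simp only [grid, region, Set.mem_ofPred_eq]
  omega

lemma grid_adj_right (i b : ℕ) : T.Adj (grid s b₀ i b) (grid s b₀ (i + 1) b) :=
  adj_iff.2 (.inl (by simp [grid, add_assoc]))

lemma grid_adj_up (hs : Slow s) (i b : ℕ) : T.Adj (grid s b₀ i b) (grid s b₀ i (b + 1)) := by
  rcases hs (b₀ + b) with h | h
  · refine adj_iff.2 (.inr (.inl ?_))
    simp only [grid, Nat.cast_add, Nat.cast_one, ← add_assoc, h]
  · refine adj_iff.2 (.inr (.inr (.inl ?_)))
    simp only [grid, Prod.mk.injEq, Nat.cast_add, Nat.cast_one, ← add_assoc, h, and_true]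
    ring

/-- A unit square of the grid is divided into two triangles by a diagonal; which diagonal is an edge
of `T` depends on the step of `s`. -/
lemma pairInd_square {C M : Set Site} (hs : Slow s)
    (tri : ∀ x ∈ region s b₀ (b₀ + n) m, ∀ y ∈ region s b₀ (b₀ + n) m,
      ∀ z ∈ region s b₀ (b₀ + n) m, T.Adj x y → T.Adj y z → T.Adj x z →
      pairInd C M x y + pairInd C M y z + pairInd C M x z = 0) {i b : ℕ} (hi : i < m)
    (hb : b < n) :
    pairInd C M (grid s b₀ i b) (grid s b₀ (i + 1) b) +
      pairInd C M (grid s b₀ i (b + 1)) (grid s b₀ (i + 1) (b + 1)) +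
      (pairInd C M (grid s b₀ i b) (grid s b₀ i (b + 1)) +
        pairInd C M (grid s b₀ (i + 1) b) (grid s b₀ (i + 1) (b + 1))) = 0 := by
  have comm : ∀ u v, pairInd C M u v = pairInd C M v u := fun u v => by
    simp only [pairInd]; ring
  have mp : grid s b₀ i b ∈ region s b₀ (b₀ + n) m := grid_mem hi.le hb.le
  have mq : grid s b₀ (i + 1) b ∈ region s b₀ (b₀ + n) m := grid_mem hi hb.le
  have mr : grid s b₀ i (b + 1) ∈ region s b₀ (b₀ + n) m := grid_mem hi.le hb
  have mt : grid s b₀ (i + 1) (b + 1) ∈ region s b₀ (b₀ + n) m := grid_mem hi hb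
  have apq := grid_adj_right (s := s) (b₀ := b₀) i b
  have art := grid_adj_right (s := s) (b₀ := b₀) i (b + 1)
  have apr := grid_adj_up (b₀ := b₀) hs i b
  have aqt := grid_adj_up (b₀ := b₀) hs (i + 1) b
  rcases hs (b₀ + b) with h | h
  · have aqr : T.Adj (grid s b₀ (i + 1) b) (grid s b₀ i (b + 1)) := by
      refine adj_iff.2 (.inr (.inr (.inl ?_)))
      simp only [grid, Prod.mk.injEq, Nat.cast_add, Nat.cast_one, ← add_assoc, h, and_true]
      ring
    have h1 := tri _ mp _ mq _ mr apq aqr apr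
    have h2 := tri _ mq _ mr _ mt aqr art aqt
    have h3 := zmod_two_add_self (pairInd C M (grid s b₀ (i + 1) b) (grid s b₀ i (b + 1)))
    linear_combination h1 + h2 - h3
  · have apt : T.Adj (grid s b₀ i b) (grid s b₀ (i + 1) (b + 1)) := by
      refine adj_iff.2 (.inr (.inl ?_))
      simp only [grid, Prod.mk.injEq, Nat.cast_add, Nat.cast_one, ← add_assoc, h, and_true]
      ring
    have h1 := tri _ mp _ mq _ mt apq aqt apt
    have h2 := tri _ mp _ mr _ mt apr art apt
    have h3 := zmod_two_add_self (pairInd C M (grid s b₀ i b) (grid s b₀ (i + 1) (b + 1)))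
    linear_combination h1 + h2 - h3

/-- The Hex lemma for strips: there is a left-right crossing in `S` or a top-bottom crossing
in the complement. -/
theorem exists_crossing (hs : Slow s) (S : Set Site) :
    (∃ x y, x.1 = s x.2 ∧ y.1 = s y.2 + m ∧ Joined (region s b₀ (b₀ + n) m ∩ S) x y) ∨
    (∃ x y, x.2 = b₀ + n ∧ y.2 = b₀ ∧ Joined (region s b₀ (b₀ + n) m \ S) x y) := by
  obtain ⟨C, M, hC, hM, hcor, htri, hA1, hA2⟩ := exists_clusters (region s b₀ (b₀ + n) m) S
    {v | v.1 = s v.2} {v | v.2 = b₀}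
  by_contra! hno
  have hright : ∀ b ≤ n, ind C (grid s b₀ m b) = 0 := by
    intro b hb
    refine if_neg fun h => ?_
    obtain ⟨-, x, hx, hJ⟩ := hC _ h
    exact hno.1 _ _ hx (by simp [grid]) hJ
  have htop : ∀ i ≤ m, ind M (grid s b₀ i n) = 0 := by
    intro i hi
    refine if_neg fun h => ?_
    obtain ⟨-, x, hx, hJ⟩ := hM _ h
    exact hno.2 _ _ (by simp [grid]) hx hJ.symm
  -- The edges between `C` and `M` leave the strip an even number of times. Without crossings only
  -- the corner where the two arcs meet contributes, and it does so once.
  have tot := sum_boundary_eq_zero (fun i b => pairInd C M (grid s b₀ i b) (grid s b₀ (i + 1) b))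
    (fun i b => pairInd C M (grid s b₀ i b) (grid s b₀ i (b + 1))) m n
    fun i hi b hb => pairInd_square hs htri hi hb
  have e1 : ∑ i ∈ Finset.range m, pairInd C M (grid s b₀ i 0) (grid s b₀ (i + 1) 0) =
      ind C (grid s b₀ 0 0) := by
    rw [Finset.sum_congr rfl fun i hi => hA2 _ (grid_mem (Finset.mem_range.1 hi).le n.zero_le) _
      (grid_mem (Finset.mem_range.1 hi) n.zero_le) (grid_adj_right i 0) (by simp [grid])
      (by simp [grid]), sum_add_succ (fun i => ind C (grid s b₀ i 0)), hright 0 n.zero_le,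
      add_zero]
  have e2 : ∑ i ∈ Finset.range m, pairInd C M (grid s b₀ i n) (grid s b₀ (i + 1) n) = 0 := by
    refine Finset.sum_eq_zero fun i hi => ?_
    have := Finset.mem_range.1 hi
    rw [pairInd, htop i this.le, htop (i + 1) this]; ring
  have e3 : ∑ b ∈ Finset.range n, pairInd C M (grid s b₀ 0 b) (grid s b₀ 0 (b + 1)) =
      ind M (grid s b₀ 0 0) := by
    rw [Finset.sum_congr rfl fun b hb => hA1 _ (grid_mem m.zero_le (Finset.mem_range.1 hb).le) _
      (grid_mem m.zero_le (Finset.mem_range.1 hb)) (grid_adj_up hs 0 b) (by simp [grid])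
      (by simp [grid]), sum_add_succ (fun b => ind M (grid s b₀ 0 b)), htop 0 m.zero_le, add_zero]
  have e4 : ∑ b ∈ Finset.range n, pairInd C M (grid s b₀ m b) (grid s b₀ m (b + 1)) = 0 := by
    refine Finset.sum_eq_zero fun b hb => ?_
    have := Finset.mem_range.1 hb
    rw [pairInd, hright b this.le, hright (b + 1) this]; ring
  rw [e1, e2, e3, e4, add_zero, add_zero, hcor _ (grid_mem m.zero_le n.zero_le) (by simp [grid])
    (by simp [grid])] at tot
  exact one_ne_zero tot

/-- The Hex lemma for strips, with the left and right sides divided at the row `c`. -/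
theorem exists_corner_crossing (hs : Slow s) (S : Set Site) {c : ℕ} (hc : c ≤ n) :
    (∃ x y, x.1 = s x.2 ∧ b₀ + c ≤ x.2 ∧ (y.2 = b₀ ∨ y.1 = s y.2 + m ∧ y.2 ≤ b₀ + c) ∧
      Joined (region s b₀ (b₀ + n) m ∩ S) x y) ∨
    (∃ x y, x.1 = s x.2 ∧ x.2 ≤ b₀ + c ∧ (y.2 = b₀ + n ∨ y.1 = s y.2 + m ∧ b₀ + c ≤ y.2) ∧
      Joined (region s b₀ (b₀ + n) m \ S) x y) := by
  obtain ⟨C, M, hC, hM, hcor, htri, hA1, hA2⟩ := exists_clusters (region s b₀ (b₀ + n) m) S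
    {v | v.1 = s v.2 ∧ b₀ + c ≤ v.2} {v | v.1 = s v.2 ∧ v.2 ≤ b₀ + c}
  by_contra! hno
  have hC0 : ∀ v, (v.2 = b₀ ∨ v.1 = s v.2 + m ∧ v.2 ≤ b₀ + c) → ind C v = 0 := by
    intro v hv
    refine if_neg fun h => ?_
    obtain ⟨-, x, hx, hJ⟩ := hC _ h
    exact hno.1 _ _ hx.1 hx.2 hv hJ
  have hM0 : ∀ v, (v.2 = b₀ + n ∨ v.1 = s v.2 + m ∧ b₀ + c ≤ v.2) → ind M v = 0 := by
    intro v hv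
    refine if_neg fun h => ?_
    obtain ⟨-, x, hx, hJ⟩ := hM _ h
    exact hno.2 _ _ hx.1 hx.2 hv hJ
  -- As before, without crossings only the common site of the two arcs in row `c` contributes.
  have tot := sum_boundary_eq_zero (fun i b => pairInd C M (grid s b₀ i b) (grid s b₀ (i + 1) b))
    (fun i b => pairInd C M (grid s b₀ i b) (grid s b₀ i (b + 1))) m n
    fun i hi b hb => pairInd_square hs htri hi hb
  have e1 : ∑ i ∈ Finset.range m, pairInd C M (grid s b₀ i 0) (grid s b₀ (i + 1) 0) = 0 := by
    refine Finset.sum_eq_zero fun i hi => ?_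
    rw [pairInd, hC0 _ (by simp [grid]), hC0 _ (by simp [grid])]; ring
  have e2 : ∑ i ∈ Finset.range m, pairInd C M (grid s b₀ i n) (grid s b₀ (i + 1) n) = 0 := by
    refine Finset.sum_eq_zero fun i hi => ?_
    rw [pairInd, hM0 _ (by simp [grid]), hM0 _ (by simp [grid])]; ring
  have e4 : ∑ b ∈ Finset.range n, pairInd C M (grid s b₀ m b) (grid s b₀ m (b + 1)) = 0 := by
    refine Finset.sum_eq_zero fun b hb => ?_
    have := Finset.mem_range.1 hb
    rcases le_or_gt c b with h | h
    · rw [pairInd, hM0 _ (by simp [grid]; omega), hM0 _ (by simp [grid]; omega)]; ring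
    · rw [pairInd, hC0 _ (by simp [grid]; omega), hC0 _ (by simp [grid]; omega)]; ring
  have e3 : ∑ b ∈ Finset.range n, pairInd C M (grid s b₀ 0 b) (grid s b₀ 0 (b + 1)) =
      ind C (grid s b₀ 0 c) + ind M (grid s b₀ 0 c) := by
    obtain ⟨d, rfl⟩ := Nat.exists_eq_add_of_le hc
    rw [Finset.sum_range_add]
    congr 1
    · rw [Finset.sum_congr rfl fun b hb => hA2 _ (grid_mem m.zero_le (by
        have := Finset.mem_range.1 hb; omega)) _ (grid_mem m.zero_le (by
        have := Finset.mem_range.1 hb; omega)) (grid_adj_up hs 0 b)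
        (by have := Finset.mem_range.1 hb; simp [grid]; omega)
        (by have := Finset.mem_range.1 hb; simp [grid]; omega),
        sum_add_succ (fun b => ind C (grid s b₀ 0 b)), hC0 (grid s b₀ 0 0) (by simp [grid]),
        zero_add]
    · have hA1' : ∀ b ∈ Finset.range d, pairInd C M (grid s b₀ 0 (c + b))
          (grid s b₀ 0 (c + b + 1)) = ind M (grid s b₀ 0 (c + b)) +
            ind M (grid s b₀ 0 (c + (b + 1))) := by
        intro b hb
        have := Finset.mem_range.1 hb
        exact hA1 _ (grid_mem m.zero_le (by omega)) _ (grid_mem m.zero_le (by omega))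
          (grid_adj_up hs 0 _) (by simp [grid]) (by simp [grid]; omega)
      rw [Finset.sum_congr rfl hA1', sum_add_succ (fun b => ind M (grid s b₀ 0 (c + b))),
        hM0 (grid s b₀ 0 (c + d)) (by simp [grid]), add_zero, add_zero]
  rw [e1, e2, e3, e4, add_zero, add_zero, zero_add, hcor _ (grid_mem m.zero_le hc)
    (by simp [grid]) (by simp [grid])] at tot
  exact one_ne_zero tot

end Grid

/-! ### Crossing strips the long way -/

/-- There is no blue crossing of the strip from its left to its right side. -/
def noCrossing (s : ℤ → ℤ) (b₀ b₁ m : ℤ) : Set Config :=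
  {ω | ∀ x y, x.1 = s x.2 → y.1 = s y.2 + m →
    ¬ Joined (region s b₀ b₁ m ∩ {v | ω v = true}) x y}

lemma region_finite (s : ℤ → ℤ) (b₀ b₁ m : ℤ) : (region s b₀ b₁ m).Finite := by
  refine ((Set.finite_Icc b₀ b₁).prod (Set.finite_Icc 0 m)).image
    (fun p => (s p.1 + p.2, p.1)) |>.subset ?_
  rintro ⟨a, b⟩ ⟨h1, h2, h3, h4⟩
  refine ⟨(b, a - s b), ⟨⟨h1, h2⟩, ?_, ?_⟩, ?_⟩
  · dsimp only at *; omega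
  · dsimp only at *; omega
  · simp

/-- The sites of a strip. -/
def regionF (s : ℤ → ℤ) (b₀ b₁ m : ℤ) : Finset Site := (region_finite s b₀ b₁ m).toFinset

lemma mem_regionF {s : ℤ → ℤ} {b₀ b₁ m : ℤ} {v : Site} :
    v ∈ regionF s b₀ b₁ m ↔ v ∈ region s b₀ b₁ m := Set.Finite.mem_toFinset _

lemma joined_congr {R : Set Site} {col : Bool} {ω ω' : Config} (e : ∀ v ∈ R, ω v = ω' v)
    {x y : Site} (h : Joined (R ∩ {v | ω v = col}) x y) : Joined (R ∩ {v | ω' v = col}) x y :=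
  h.mono fun v hv => ⟨hv.1, by rw [Set.mem_ofPred_eq, ← e v hv.1]; exact hv.2⟩

lemma noCrossing_detBy (s : ℤ → ℤ) (b₀ b₁ m : ℤ) :
    DetBy (regionF s b₀ b₁ m) (noCrossing s b₀ b₁ m) := by
  intro ω ω' e h x y hx hy hJ
  exact h x y hx hy (joined_congr (fun v hv => (e v (mem_regionF.2 hv)).symm) hJ)

lemma noCrossing_decreasing (s : ℤ → ℤ) (b₀ b₁ m : ℤ) : Decreasing (noCrossing s b₀ b₁ m) := by
  intro ω ω' e h x y hx hy hJ
  exact h x y hx hy (hJ.mono fun v hv => ⟨hv.1, e v hv.2⟩)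

/-- A path from the top to the bottom row, or to the right side below the end of the other path,
cannot avoid a path from the left to the right side. -/
lemma not_disjoint_crossings {s : ℤ → ℤ} {b₀ b₁ m : ℤ} (hm : 0 ≤ m) {S S' : Set Site}
    {x y x' y' : Site} (h : Joined (region s b₀ b₁ m ∩ S) x y)
    (h' : Joined (region s b₀ b₁ m ∩ S') x' y')
    (hx : x.2 = b₁) (hy : y.2 = b₀ ∨ (y.1 = s y.2 + m ∧ y.2 < y'.2))
    (hx' : x'.1 = s x'.2) (hy' : y'.1 = s y'.2 + m) : ∃ v, v ∈ S ∧ v ∈ S' ∧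
      Joined (region s b₀ b₁ m ∩ S) x v := by
  obtain ⟨p, hp⟩ := h
  obtain ⟨q, hq⟩ := h'
  obtain ⟨v, hvp, hvq⟩ := exists_common_site hm p (fun v hv => (hp v hv).1) q
    (fun v hv => (hq v hv).1) hx hy hx' hy'
  exact ⟨v, (hp v hvp).2, (hq v hvq).2, p.takeUntil v hvp,
    fun u hu => hp u (p.support_takeUntil_subset_support hvp hu)⟩

/-- Exchange of the two lattice coordinates, a reflection. -/
def swapSite : Site ≃ Site := Equiv.prodComm ℤ ℤ

lemma swapSite_adj (u v : Site) (h : T.Adj u v) : T.Adj (swapSite u) (swapSite v) := by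
  rw [adj_iff]
  rcases adj_cases h with e | e | e | e | e | e <;> subst e <;> simp [swapSite]

/-- By symmetry, a rhombus is crossed with probability at most one half. -/
lemma noCrossing_rhombus (k : ℕ) : 1 / 2 ≤ critPerc.real (noCrossing (fun _ => 0) 0 k k) := by
  have hd := noCrossing_detBy (fun _ => 0) 0 k k
  -- a blue crossing excludes the mirror image of a yellow one
  have hs := real_comp (F := regionF (fun _ => 0) 0 k k)
    (S := {ω | flip ω ∈ (noCrossing (fun _ => 0) 0 k k)ᶜ})
    (fun ω ω' e h => hd.compl _ _ (fun x hx => by simp [e x hx]) h) swapSite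
  rw [real_flip hd.compl] at hs
  have hsub : {ω : Config | ω ∘ swapSite ∈ {ω | flip ω ∈ (noCrossing (fun _ => 0) 0 k k)ᶜ}} ⊆
      noCrossing (fun _ => 0) 0 k k := by
    intro ω hω x y hx hy hJ
    simp only [Set.mem_ofPred_eq, Set.mem_compl_iff, noCrossing, not_forall, not_not] at hω
    obtain ⟨x', y', hx', hy', hJ'⟩ := hω
    have hJ2 : Joined (region (fun _ => 0) 0 k k ∩ {v | ω v = false}) (swapSite x')
        (swapSite y') := by
      refine hJ'.map swapSite_adj ?_
      rintro ⟨a, b⟩ ⟨⟨h1, h2, h3, h4⟩, h5⟩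
      simp only [region, Set.mem_inter_iff, Set.mem_ofPred_eq, swapSite, Equiv.prodComm_apply,
        Prod.swap, flip, Function.comp, Bool.not_eq_true'] at h1 h2 h3 h4 h5 ⊢
      refine ⟨⟨?_, ?_, ?_, ?_⟩, h5⟩ <;> omega
    obtain ⟨v, hv1, hv2, -⟩ := not_disjoint_crossings (by positivity) hJ2.symm hJ
      (by simpa [swapSite] using hy') (.inl (by simpa [swapSite] using hx')) hx hy
    simp only [Set.mem_ofPred_eq] at hv1 hv2
    simp [hv1] at hv2
  have h1 := measureReal_mono (μ := critPerc) hsub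
  rw [hs, probReal_compl_eq_one_sub hd.measurableSet] at h1
  linarith

/-- Reflection in the lattice line formed by the row `c`. -/
def mirror (c : ℤ) : Site ≃ Site where
  toFun v := (v.1 + v.2 - c, 2 * c - v.2)
  invFun v := (v.1 + v.2 - c, 2 * c - v.2)
  left_inv v := by ext <;> simp only <;> ring
  right_inv v := by ext <;> simp only <;> ring

lemma mirror_mirror (c : ℤ) (v : Site) : mirror c (mirror c v) = v := (mirror c).left_inv v

lemma mirror_snd (c : ℤ) (v : Site) : (mirror c v).2 = 2 * c - v.2 := rfl

lemma mirror_adj (c : ℤ) (u v : Site) (h : T.Adj u v) : T.Adj (mirror c u) (mirror c v) := by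
  rw [adj_iff]
  simp only [mirror, Equiv.coe_fn_mk, Prod.mk.injEq]
  rcases adj_cases h with e | e | e | e | e | e <;> subst e <;> dsimp only <;> omega

lemma mirror_of_row {c : ℤ} {v : Site} (h : v.2 = c) : mirror c v = v := by
  ext <;> simp [mirror, h] <;> ring

section Doubling

variable {s : ℤ → ℤ} {c : ℤ} {k m : ℕ}

lemma mirror_mem_region (hsym : ∀ b, s (2 * c - b) = s b + b - c) {v : Site}
    (hv : v ∈ region s (c - k) (c + k) m) : mirror c v ∈ region s (c - k) (c + k) m := by
  obtain ⟨h1, h2, h3, h4⟩ := hv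
  simp only [region, mirror, Equiv.coe_fn_mk, Set.mem_ofPred_eq, hsym]
  omega

/-- Reflection of the left side of the strip. -/
lemma mirror_left (hsym : ∀ b, s (2 * c - b) = s b + b - c) (v : Site) (d : ℤ) :
    (mirror c v).1 = s (mirror c v).2 + d ↔ v.1 = s v.2 + d := by
  simp only [mirror, Equiv.coe_fn_mk, hsym]
  omega

/-- The upper half of a symmetric strip, and the whole strip. -/
lemma upper_subset : region s c (c + k) m ⊆ region s (c - k) (c + k) m :=
  fun v hv => ⟨by have := hv.1; omega, hv.2⟩

/-- The event that in the strip around the row `c` the top row is joined by a yellow path to the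
bottom row or the lower half of the right side. -/
def downLink (s : ℤ → ℤ) (c : ℤ) (k m : ℕ) : Set Config :=
  {ω | ∃ t y, t.2 = c + k ∧ (y.2 = c - k ∨ y.1 = s y.2 + m ∧ y.2 ≤ c) ∧
    Joined (region s (c - k) (c + k) m ∩ {v | ω v = false}) t y}

lemma downLink_detBy : DetBy (regionF s (c - k) (c + k) m) (downLink s c k m) := by
  rintro ω ω' e ⟨t, y, ht, hy, hJ⟩
  exact ⟨t, y, ht, hy, joined_congr (fun v hv => e v (mem_regionF.2 hv)) hJ⟩

lemma downLink_decreasing : Decreasing (downLink s c k m) := by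
  rintro ω ω' e ⟨t, y, ht, hy, hJ⟩
  refine ⟨t, y, ht, hy, hJ.mono fun v hv => ⟨hv.1, ?_⟩⟩
  have h2 := hv.2
  have := e v
  simp only [Set.mem_ofPred_eq] at h2 ⊢
  by_contra h
  rw [Bool.not_eq_false] at h
  rw [this h] at h2
  exact absurd h2 (by decide)

/-- The cluster of the left side, for the blue sites of the upper half. -/
def leftCluster (s : ℤ → ℤ) (c : ℤ) (k m : ℕ) (ω : Config) : Set Site :=
  {v | ∃ x, x.1 = s x.2 ∧ Joined (region s c (c + k) m ∩ {v | ω v = true}) x v}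

/-- The sites bordering a set `C` or on the left side. -/
def border (s : ℤ → ℤ) (c : ℤ) (k m : ℕ) (C : Set Site) : Set Site :=
  {v | v ∈ region s c (c + k) m ∧ v ∉ C ∧ (v.1 = s v.2 ∨ ∃ u ∈ C, T.Adj u v)}

/-- The sites of the upper half that are joined to the right side without using `C` or its
border. -/
def beyond (s : ℤ → ℤ) (c : ℤ) (k m : ℕ) (C : Set Site) : Set Site :=
  {v | ∃ y, y.1 = s y.2 + m ∧ Joined (region s c (c + k) m \ (C ∪ border s c k m C)) v y}

/-- The part of the border of `C` that is visible from the right side. -/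
def front (s : ℤ → ℤ) (c : ℤ) (k m : ℕ) (C : Set Site) : Set Site :=
  {v | v ∈ border s c k m C ∧ (v.1 = s v.2 + m ∨ ∃ u ∈ beyond s c k m C, T.Adj v u)}

/-- The sites beyond the border of `C`, together with their mirror images. -/
def free (s : ℤ → ℤ) (c : ℤ) (k m : ℕ) (C : Set Site) : Set Site :=
  {v | v ∈ beyond s c k m C ∨ mirror c v ∈ beyond s c k m C}

lemma leftCluster_sub {ω : Config} {v : Site} (h : v ∈ leftCluster s c k m ω) :
    v ∈ region s c (c + k) m ∧ ω v = true := by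
  obtain ⟨x, _, hJ⟩ := h; exact hJ.right

lemma border_yellow {ω : Config} {v : Site} (h : v ∈ border s c k m (leftCluster s c k m ω)) :
    ω v = false := by
  obtain ⟨hv, hvC, h⟩ := h
  by_contra hb
  rw [Bool.not_eq_false] at hb
  refine hvC ?_
  rcases h with h | ⟨u, ⟨x, hx, hJ⟩, e⟩
  · exact ⟨v, h, .refl ⟨hv, hb⟩⟩
  · exact ⟨x, hx, hJ.tail ⟨hv, hb⟩ e⟩

/-- The cluster can be recognized from the colours of its sites and of its border. -/
lemma leftCluster_congr {ω ω' : Config}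
    (e : ∀ v ∈ leftCluster s c k m ω ∪ border s c k m (leftCluster s c k m ω), ω' v = ω v) :
    leftCluster s c k m ω' = leftCluster s c k m ω := by
  ext v
  constructor
  · rintro ⟨x, hx, hJ⟩
    have key : ∀ v, v ∈ region s c (c + k) m → ω' v = true →
        (v.1 = s v.2 ∨ ∃ u ∈ leftCluster s c k m ω, T.Adj u v) → v ∈ leftCluster s c k m ω := by
      intro v hv hb h
      by_contra hC
      have hD : v ∈ border s c k m (leftCluster s c k m ω) := ⟨hv, hC, h⟩
      have := e v (.inr hD)
      rw [border_yellow hD, hb] at this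
      exact absurd this (by decide)
    exact hJ.induct (P := fun v => v ∈ leftCluster s c k m ω) (key x hJ.left.1 hJ.left.2 (.inl hx))
      fun u v _ hv e hu => key v hv.1 hv.2 (.inr ⟨u, hu, e⟩)
  · rintro ⟨x, hx, hJ⟩
    have hx0 : x ∈ leftCluster s c k m ω := ⟨x, hx, .refl hJ.left⟩
    refine ⟨x, hx, (hJ.induct (P := fun v => v ∈ leftCluster s c k m ω ∧
      Joined (region s c (c + k) m ∩ {v | ω' v = true}) x v) ?_ ?_).2⟩
    · exact ⟨hx0, .refl ⟨hJ.left.1, (e x (.inl hx0)).trans hJ.left.2⟩⟩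
    · rintro u v hu hv euv ⟨⟨y, hy, hyu⟩, h⟩
      have hvC : v ∈ leftCluster s c k m ω := ⟨y, hy, hyu.tail hv euv⟩
      exact ⟨hvC, h.tail ⟨hv.1, (e v (.inl hvC)).trans hv.2⟩ euv⟩

lemma beyond_sub {C : Set Site} {v : Site} (h : v ∈ beyond s c k m C) :
    v ∈ region s c (c + k) m ∧ v ∉ C ∧ v ∉ border s c k m C := by
  obtain ⟨y, _, hJ⟩ := h
  exact ⟨hJ.left.1, fun h => hJ.left.2 (.inl h), fun h => hJ.left.2 (.inr h)⟩

/-- A site that is not beyond the border but adjacent to a site beyond it is on the front. -/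
lemma mem_front {C : Set Site} {u v : Site} (hu : u ∈ region s c (c + k) m)
    (hu' : u ∉ beyond s c k m C) (hv : v ∈ beyond s c k m C) (e : T.Adj u v) :
    u ∈ front s c k m C := by
  have h1 : u ∈ C ∪ border s c k m C := by
    by_contra h
    obtain ⟨y, hy, hJ⟩ := hv
    exact hu' ⟨y, hy, hJ.head ⟨hu, h⟩ e⟩
  refine ⟨h1.resolve_left fun hC => ?_, .inr ⟨v, hv, e⟩⟩
  obtain ⟨hv1, hv2, hv3⟩ := beyond_sub hv
  exact hv3 ⟨hv1, hv2, .inr ⟨u, hC, e⟩⟩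

/-- A right side site is beyond the border or on the front, if the cluster does not reach the
right side. -/
lemma right_cases {ω : Config} (hω : ω ∈ noCrossing s c (c + k) m) {v : Site}
    (hv : v ∈ region s c (c + k) m) (h : v.1 = s v.2 + m) :
    v ∈ beyond s c k m (leftCluster s c k m ω) ∨ v ∈ front s c k m (leftCluster s c k m ω) := by
  by_cases h1 : v ∈ leftCluster s c k m ω ∪ border s c k m (leftCluster s c k m ω)
  · rcases h1 with ⟨x, hx, hJ⟩ | h1
    · exact (hω x v hx h hJ).elim
    · exact .inr ⟨h1, .inl h⟩
  · exact .inl ⟨v, h, .refl ⟨hv, h1⟩⟩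

/-- Every site of the front is joined to the top row by a yellow path of the upper half: the front
contains a top-bottom crossing, and every site of it is indispensable. -/
lemma front_joined_top (hs : Slow s) {ω : Config} (hω : ω ∈ noCrossing s c (c + k) m) {b : Site}
    (hb : b ∈ front s c k m (leftCluster s c k m ω)) :
    ∃ t, t.2 = c + k ∧ Joined (region s c (c + k) m ∩ {v | ω v = false}) t b := by
  set C := leftCluster s c k m ω with hC
  have hBy : front s c k m C ⊆ {v | ω v = false} := fun v hv => border_yellow hv.1
  rcases exists_crossing (b₀ := c) (m := m) (n := k) hs (front s c k m C)ᶜ with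
    ⟨x, y, hx, hy, hJ⟩ | ⟨x, y, hx, hy, hJ⟩
  · -- a left-right path off the front would have to enter the part beyond the border
    exfalso
    have hxU : x ∉ beyond s c k m C := by
      intro h
      obtain ⟨h1, h2, h3⟩ := beyond_sub h
      exact h3 ⟨h1, h2, .inl hx⟩
    have hyU : y ∈ beyond s c k m C := (right_cases hω hJ.right.1 hy).resolve_right hJ.right.2
    obtain ⟨u, v, hu, huS, hv, e, -⟩ := hJ.exists_last_exit (A := (beyond s c k m C)ᶜ) hxU
      (fun h => h hyU)
    exact huS.2 (mem_front huS.1 hu (not_not.1 hv) e)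
  · refine ⟨x, hx, ?_⟩
    have hb1 := hb.1
    -- a path from the left side through the cluster, `b` and the part beyond it to the right side
    have hLR : ∃ x' y', x'.1 = s x'.2 ∧ y'.1 = s y'.2 + m ∧
        Joined (region s c (c + k) m ∩ (C ∪ {b} ∪ beyond s c k m C)) x' y' := by
      have h1 : ∃ x', x'.1 = s x'.2 ∧
          Joined (region s c (c + k) m ∩ (C ∪ {b} ∪ beyond s c k m C)) x' b := by
        have hb0 : b ∈ region s c (c + k) m ∩ (C ∪ {b} ∪ beyond s c k m C) :=
          ⟨hb1.1, .inl (.inr rfl)⟩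
        rcases hb1.2.2 with h | ⟨u, ⟨x', hx', hJ'⟩, e⟩
        · exact ⟨b, h, .refl hb0⟩
        · refine ⟨x', hx', Joined.tail ?_ hb0 e⟩
          refine (hJ'.induct (P := fun v => v ∈ C ∧
            Joined (region s c (c + k) m ∩ (C ∪ {b} ∪ beyond s c k m C)) x' v) ?_ ?_).2
          · have : x' ∈ C := ⟨x', hx', .refl hJ'.left⟩
            exact ⟨this, .refl ⟨hJ'.left.1, .inl (.inl this)⟩⟩
          · rintro u v hu hv e ⟨⟨z, hz, hzu⟩, h⟩
            have : v ∈ C := ⟨z, hz, hzu.tail hv e⟩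
            exact ⟨this, h.tail ⟨hv.1, .inl (.inl this)⟩ e⟩
      have h2 : ∃ y', y'.1 = s y'.2 + m ∧
          Joined (region s c (c + k) m ∩ (C ∪ {b} ∪ beyond s c k m C)) b y' := by
        have hb0 : b ∈ region s c (c + k) m ∩ (C ∪ {b} ∪ beyond s c k m C) :=
          ⟨hb1.1, .inl (.inr rfl)⟩
        rcases hb.2 with h | ⟨u, ⟨y', hy', hJ'⟩, e⟩
        · exact ⟨b, h, .refl hb0⟩
        · refine ⟨y', hy', Joined.head ?_ hb0 e⟩
          refine (hJ'.symm.induct (P := fun v => v ∈ beyond s c k m C ∧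
            Joined (region s c (c + k) m ∩ (C ∪ {b} ∪ beyond s c k m C)) v y') ?_ ?_).2
          · have : y' ∈ beyond s c k m C := ⟨y', hy', .refl hJ'.right⟩
            exact ⟨this, .refl ⟨hJ'.right.1, .inr this⟩⟩
          · rintro u v hu hv e ⟨⟨z, hz, hzu⟩, h⟩
            have : v ∈ beyond s c k m C := ⟨z, hz, hzu.head hv e.symm⟩
            exact ⟨this, h.head ⟨hv.1, .inr this⟩ e.symm⟩
      obtain ⟨x', hx', h1⟩ := h1
      obtain ⟨y', hy', h2⟩ := h2
      exact ⟨x', y', hx', hy', h1.trans h2⟩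
    obtain ⟨x', y', hx', hy', hJ'⟩ := hLR
    have hJ2 : Joined (region s c (c + k) m ∩ front s c k m C) x y :=
      hJ.mono fun v hv => ⟨hv.1, not_not.1 hv.2⟩
    obtain ⟨v, hv1, hv2, hJv⟩ := not_disjoint_crossings (by positivity) hJ2 hJ' hx (.inl hy) hx' hy'
    have hvb : v = b := by
      rcases hv2 with (h | h) | h
      · exact (hv1.1.2.1 h).elim
      · exact h
      · exact ((beyond_sub h).2.2 hv1.1).elim
    subst hvb
    exact hJv.mono fun u hu => ⟨hu.1, hBy hu.2⟩

/-- Some site of the front is joined, through yellow free sites, to the bottom row or to the lower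
half of the right side, unless it lies itself on the right side. -/
def yellowExit (s : ℤ → ℤ) (c : ℤ) (k m : ℕ) : Set Config :=
  {ω | ∃ b ∈ front s c k m (leftCluster s c k m ω), (b.1 = s b.2 + m ∧ b.2 ≤ c) ∨
    ∃ v y, T.Adj b v ∧ (y.2 = c - k ∨ y.1 = s y.2 + m ∧ y.2 ≤ c) ∧
      Joined (free s c k m (leftCluster s c k m ω) ∩ {v | ω v = false}) v y}

/-- The mirror image of the event `yellowExit`, with the colours of the free sites exchanged. -/
def blueExit (s : ℤ → ℤ) (c : ℤ) (k m : ℕ) : Set Config :=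
  {ω | ∃ b ∈ front s c k m (leftCluster s c k m ω),
    ∃ v y, T.Adj (mirror c b) v ∧ (y.2 = c + k ∨ y.1 = s y.2 + m ∧ c ≤ y.2) ∧
      Joined (free s c k m (leftCluster s c k m ω) ∩ {v | ω v = true}) v y}

lemma free_sub (hsym : ∀ b, s (2 * c - b) = s b + b - c) {C : Set Site} {v : Site}
    (h : v ∈ free s c k m C) : v ∈ region s (c - k) (c + k) m := by
  rcases h with h | h
  · exact upper_subset (beyond_sub h).1
  · have := mirror_mem_region hsym (upper_subset (beyond_sub h).1)
    rwa [mirror_mirror] at this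

lemma mem_upper_or_mirror (hsym : ∀ b, s (2 * c - b) = s b + b - c) {v : Site}
    (h : v ∈ region s (c - k) (c + k) m) (hv : v.2 ≤ c) :
    mirror c v ∈ region s c (c + k) m := by
  have := mirror_mem_region hsym h
  exact ⟨by rw [mirror_snd]; omega, this.2⟩

lemma adj_row {u v : Site} (e : T.Adj u v) : v.2 ≤ u.2 + 1 ∧ u.2 ≤ v.2 + 1 := by
  rcases adj_cases e with e | e | e | e | e | e <;> subst e <;> constructor <;> dsimp only <;> omega

/-- Duality in the domain beyond the front and its mirror image, whose two sides are coloured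
yellow and blue. -/
lemma yellowExit_or_blueExit (hs : Slow s) (hsym : ∀ b, s (2 * c - b) = s b + b - c) (hk : 0 < k)
    {ω : Config} (hω : ω ∈ noCrossing s c (c + k) m) :
    ω ∈ yellowExit s c k m ∨ ω ∈ blueExit s c k m := by
  set C := leftCluster s c k m ω with hC
  set K := region s c (c + k) m with hK
  set U := beyond s c k m C with hU
  set Φ := free s c k m C with hΦ
  -- The sites up to the front count as yellow and their mirror images as blue.
  set P : Set Site := {v | (v ∈ K ∧ v ∉ U) ∨ (v ∈ Φ ∧ ω v = false)} with hP
  have hR : region s (c - k) (c - k + ((2 * k : ℕ) : ℤ)) m = region s (c - k) (c + k) m := by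
    congr 1; push_cast; ring
  have hleft : ∀ v, v ∈ U → v.1 ≠ s v.2 := by
    intro v hv h
    obtain ⟨h1, h2, h3⟩ := beyond_sub hv
    exact h3 ⟨h1, h2, .inl h⟩
  rcases exists_corner_crossing (b₀ := c - k) (m := m) (n := 2 * k) hs P (c := k) (by omega) with
    ⟨x, y, hx, hxc, hy, hJ⟩ | ⟨x, y, hx, hxc, hy, hJ⟩
  · rw [hR] at hJ
    rw [show c - k + (k : ℤ) = c by ring] at hxc hy
    left
    have hxK : x ∈ K := ⟨hxc, hJ.left.1.2⟩
    by_cases hyc : y ∈ K ∧ y ∉ U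
    · have h1 := hyc.1.1
      have hy' : y.1 = s y.2 + m ∧ y.2 ≤ c := hy.resolve_left (by omega)
      exact ⟨y, (right_cases hω hyc.1 hy'.1).resolve_left hyc.2, .inl hy'⟩
    · obtain ⟨u, v, hu, -, hv, e, hJ'⟩ := hJ.exists_last_exit (A := {v | v ∈ K ∧ v ∉ U})
        ⟨hxK, fun h => hleft x h hx⟩ hyc
      have hvΦ : v ∈ Φ := (hJ'.left.1.2.resolve_left hv).1
      refine ⟨u, ?_, .inr ⟨v, y, e, hy, hJ'.mono ?_⟩⟩
      · by_cases hvU : v ∈ U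
        · exact mem_front hu.1 hu.2 hvU e
        · have hvU' : mirror c v ∈ U := hvΦ.resolve_left hvU
          have h1 := (beyond_sub hvU').1.1
          rw [mirror_snd] at h1
          have h2 : v.2 ≠ c := fun h => hvU (by rwa [mirror_of_row h] at hvU')
          have h3 := hu.1.1
          have h4 := adj_row e
          have e' := mirror_adj c u v e
          rw [mirror_of_row (show u.2 = c by omega)] at e'
          exact mem_front hu.1 hu.2 hvU' e'
      · rintro w ⟨⟨-, hw⟩, hw'⟩
        exact hw.resolve_left hw'
  · rw [hR] at hJ
    rw [show c - k + (k : ℤ) = c by ring] at hxc hy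
    rw [show c - k + ((2 * k : ℕ) : ℤ) = c + k by push_cast; ring] at hy
    right
    have hyU : y ∈ U := by
      by_contra h
      exact hJ.right.2 (.inl ⟨⟨by rcases hy with h | h <;> omega, hJ.right.1.2⟩, h⟩)
    have hxΦ : x ∉ Φ := by
      rintro (h | h)
      · exact hleft x h hx
      · refine hleft _ h ?_
        have := (mirror_left hsym x 0).2 (by simpa using hx)
        simpa using this
    obtain ⟨u, v, hu, huS, hv, e, hJ'⟩ := hJ.exists_last_exit (A := Φᶜ) hxΦ
      (fun h => h (.inl hyU))
    rw [Set.mem_compl_iff, not_not] at hv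
    have huK : u ∉ K := fun h => huS.2 (.inl ⟨h, fun h' => hu (.inl h')⟩)
    have huc : u.2 < c := by
      by_contra h
      exact huK ⟨not_lt.1 h, huS.1.2⟩
    have hvU : mirror c v ∈ U := by
      rcases hv with h | h
      · have h1 := (beyond_sub h).1.1
        have h4 := adj_row e
        rwa [mirror_of_row (show v.2 = c by omega)]
      · exact h
    refine ⟨mirror c u, mem_front (mem_upper_or_mirror hsym huS.1 huc.le)
      (fun h => hu (.inr h)) hvU (mirror_adj c u v e), v, y, by rwa [mirror_mirror], hy,
      hJ'.mono ?_⟩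
    rintro w ⟨⟨-, hw⟩, hw'⟩
    rw [Set.mem_compl_iff, not_not] at hw'
    refine ⟨hw', ?_⟩
    by_contra h
    exact hw (.inr ⟨hw', by simpa using h⟩)

open Classical in
/-- Reflect the free sites and exchange their colours. -/
def flipFree (s : ℤ → ℤ) (c : ℤ) (k m : ℕ) (ω : Config) : Config := fun v =>
  if v ∈ free s c k m (leftCluster s c k m ω) then !ω (mirror c v) else ω v

lemma mirror_mem_free {C : Set Site} {v : Site} :
    mirror c v ∈ free s c k m C ↔ v ∈ free s c k m C := by
  simp only [free, Set.mem_ofPred_eq, mirror_mirror]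
  exact or_comm

/-- The left cluster is found without looking at the free sites. -/
lemma leftCluster_flipFree (ω : Config) :
    leftCluster s c k m (flipFree s c k m ω) = leftCluster s c k m ω := by
  refine leftCluster_congr fun v hv => if_neg ?_
  have hK : v ∈ region s c (c + k) m := by
    rcases hv with h | h
    exacts [(leftCluster_sub h).1, h.1]
  have hU : v ∉ beyond s c k m (leftCluster s c k m ω) := by
    intro h
    obtain ⟨-, h2, h3⟩ := beyond_sub h
    exact hv.elim h2 h3
  rintro (h | h)
  · exact hU h
  · have h1 := (beyond_sub h).1.1
    rw [mirror_snd] at h1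
    have h2 := hK.1
    rw [mirror_of_row (show v.2 = c by omega)] at h
    exact hU h

lemma flipFree_flipFree (ω : Config) : flipFree s c k m (flipFree s c k m ω) = ω := by
  classical
  ext v
  rw [flipFree, leftCluster_flipFree]
  split_ifs with h
  · rw [flipFree, if_pos (mirror_mem_free.2 h), mirror_mirror, Bool.not_not]
  · rw [flipFree, if_neg h]

lemma noCrossing_iff {ω : Config} : ω ∈ noCrossing s c (c + k) m ↔
    ∀ v ∈ leftCluster s c k m ω, v.1 ≠ s v.2 + m :=
  ⟨fun h v ⟨x, hx, hJ⟩ hv => h x v hx hv hJ, fun h x y hx hy hJ => h y ⟨x, hx, hJ⟩ hy⟩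

lemma leftCluster_eq_of_eqOn {ω ω' : Config} (e : ∀ v ∈ region s c (c + k) m, ω v = ω' v) :
    leftCluster s c k m ω = leftCluster s c k m ω' := by
  ext v
  constructor
  · rintro ⟨x, hx, hJ⟩; exact ⟨x, hx, joined_congr e hJ⟩
  · rintro ⟨x, hx, hJ⟩; exact ⟨x, hx, joined_congr (fun v hv => (e v hv).symm) hJ⟩

lemma yellowExit_detBy (hsym : ∀ b, s (2 * c - b) = s b + b - c) :
    DetBy (regionF s (c - k) (c + k) m) (yellowExit s c k m) := by
  intro ω ω' e h
  have e' : ∀ v ∈ region s (c - k) (c + k) m, ω v = ω' v := fun v hv => e v (mem_regionF.2 hv)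
  unfold yellowExit at h ⊢
  rw [Set.mem_ofPred_eq] at h ⊢
  rw [← leftCluster_eq_of_eqOn fun v hv => e' v (upper_subset hv)]
  obtain ⟨b, hb, h⟩ := h
  refine ⟨b, hb, h.imp_right ?_⟩
  rintro ⟨v, y, hv, hy, hJ⟩
  exact ⟨v, y, hv, hy, joined_congr (fun v hv => e' v (free_sub hsym hv)) hJ⟩

lemma blueExit_detBy (hsym : ∀ b, s (2 * c - b) = s b + b - c) :
    DetBy (regionF s (c - k) (c + k) m) (blueExit s c k m) := by
  intro ω ω' e h
  have e' : ∀ v ∈ region s (c - k) (c + k) m, ω v = ω' v := fun v hv => e v (mem_regionF.2 hv)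
  unfold blueExit at h ⊢
  rw [Set.mem_ofPred_eq] at h ⊢
  rw [← leftCluster_eq_of_eqOn fun v hv => e' v (upper_subset hv)]
  obtain ⟨b, hb, v, y, hv, hy, hJ⟩ := h
  exact ⟨b, hb, v, y, hv, hy, joined_congr (fun v hv => e' v (free_sub hsym hv)) hJ⟩

lemma upper_regionF_subset : regionF s c (c + k) m ⊆ regionF s (c - k) (c + k) m :=
  fun _ hv => mem_regionF.2 (upper_subset (mem_regionF.1 hv))

/-- By symmetry the yellow exit has conditional probability at least one half. -/
lemma half_le_yellowExit (hs : Slow s) (hsym : ∀ b, s (2 * c - b) = s b + b - c) (hk : 0 < k) :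
    critPerc.real (noCrossing s c (c + k) m) / 2 ≤
      critPerc.real (noCrossing s c (c + k) m ∩ yellowExit s c k m) := by
  have dK := (noCrossing_detBy s c (c + k) m).mono upper_regionF_subset
  have dY := yellowExit_detBy (k := k) (m := m) hsym
  have dB := blueExit_detBy (k := k) (m := m) hsym
  -- Reflecting the free sites and exchanging their colours turns a blue exit into a yellow one. The
  -- map is injective, since the cluster and hence the free sites can be recovered from the image.
  have hle : critPerc.real (noCrossing s c (c + k) m ∩ blueExit s c k m) ≤
      critPerc.real (noCrossing s c (c + k) m ∩ yellowExit s c k m) := by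
    refine real_le_of_injection (dK.inter dB) (dK.inter dY) (flipFree s c k m) ?_ ?_
    · classical
      rintro ω ⟨h1, b, hb, v, y, hv, hy, hJ⟩
      refine ⟨?_, ?_⟩
      · rw [noCrossing_iff, leftCluster_flipFree, ← noCrossing_iff]; exact h1
      · rw [yellowExit, Set.mem_ofPred_eq, leftCluster_flipFree]
        refine ⟨b, hb, .inr ⟨mirror c v, mirror c y, ?_, ?_, ?_⟩⟩
        · have := mirror_adj c _ _ hv; rwa [mirror_mirror] at this
        · refine hy.imp (fun h => ?_) (fun h => ⟨(mirror_left hsym y m).2 h.1, ?_⟩)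
          · rw [mirror_snd]; omega
          · rw [mirror_snd]; omega
        · refine hJ.map (mirror_adj c) ?_
          rintro w ⟨hw, hw'⟩
          refine ⟨mirror_mem_free.2 hw, ?_⟩
          rw [Set.mem_ofPred_eq, flipFree, if_pos (mirror_mem_free.2 hw), mirror_mirror]
          rw [Set.mem_ofPred_eq] at hw'
          rw [hw']; rfl
    · intro ω _ ω' _ e x hx
      have e' : ∀ v ∈ region s (c - k) (c + k) m, flipFree s c k m ω v = flipFree s c k m ω' v :=
        fun v hv => e v (mem_regionF.2 hv)
      have hcl : leftCluster s c k m ω = leftCluster s c k m ω' := by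
        rw [← leftCluster_flipFree ω, ← leftCluster_flipFree ω']
        exact leftCluster_eq_of_eqOn fun v hv => e' v (upper_subset hv)
      classical
      have key : ∀ ω : Config, ω x = if x ∈ free s c k m (leftCluster s c k m ω) then
          !flipFree s c k m ω (mirror c x) else flipFree s c k m ω x := fun ω =>
        (congrFun (flipFree_flipFree (s := s) (c := c) (k := k) (m := m) ω) x).symm.trans (by
          change (if x ∈ free s c k m (leftCluster s c k m (flipFree s c k m ω)) then
            _ else _) = _
          rw [leftCluster_flipFree])
      rw [key ω, key ω', hcl]
      split_ifs with h
      · rw [e' _ (free_sub hsym (mirror_mem_free.2 h))]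
      · exact e' _ (mem_regionF.1 hx)
  have hcov : critPerc.real (noCrossing s c (c + k) m) ≤
      critPerc.real (noCrossing s c (c + k) m ∩ yellowExit s c k m) +
      critPerc.real (noCrossing s c (c + k) m ∩ blueExit s c k m) := by
    refine (measureReal_mono ?_).trans (measureReal_union_le _ _)
    intro ω hω
    exact (yellowExit_or_blueExit hs hsym hk hω).imp (fun h => ⟨hω, h⟩) (fun h => ⟨hω, h⟩)
  linarith

lemma yellowExit_subset_downLink (hs : Slow s) (hsym : ∀ b, s (2 * c - b) = s b + b - c) :
    noCrossing s c (c + k) m ∩ yellowExit s c k m ⊆ downLink s c k m := by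
  rintro ω ⟨hω, b, hb, h⟩
  obtain ⟨t, ht, hJ⟩ := front_joined_top hs hω hb
  have hJ' := hJ.mono (S' := region s (c - k) (c + k) m ∩ {v | ω v = false})
    fun v hv => ⟨upper_subset hv.1, hv.2⟩
  rcases h with h | ⟨v, y, e, hy, hJ2⟩
  · exact ⟨t, b, ht, .inr h, hJ'⟩
  · have hJ3 := hJ2.mono (S' := region s (c - k) (c + k) m ∩ {v | ω v = false})
      fun v hv => ⟨free_sub hsym hv.1, hv.2⟩
    exact ⟨t, y, ht, hy, (hJ'.tail hJ3.left e).trans hJ3⟩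

/-- Doubling the height of a strip by reflection costs only a square in the probability that the
strip is not crossed sideways. -/
theorem noCrossing_double (hs : Slow s) (hsym : ∀ b, s (2 * c - b) = s b + b - c) (hk : 0 < k) :
    (critPerc.real (noCrossing s c (c + k) m) / 2) ^ 2 ≤
      critPerc.real (noCrossing s (c - k) (c + k) m) := by
  have h1 : critPerc.real (noCrossing s c (c + k) m) / 2 ≤ critPerc.real (downLink s c k m) :=
    (half_le_yellowExit hs hsym hk).trans (measureReal_mono (yellowExit_subset_downLink hs hsym))
  have hd : DetBy (regionF s (c - k) (c + k) m) (downLink s c k m) := downLink_detBy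
  have hdecr : Decreasing (downLink s c k m) := downLink_decreasing
  have hd' : DetBy (regionF s (c - k) (c + k) m) {ω | ω ∘ mirror c ∈ downLink s c k m} := by
    intro ω ω' e h
    refine hd _ _ (fun x hx => e _ ?_) h
    exact mem_regionF.2 (mirror_mem_region hsym (mem_regionF.1 hx))
  have hdecr' : Decreasing {ω | ω ∘ mirror c ∈ downLink s c k m} :=
    fun ω ω' e h => hdecr _ _ (fun x hx => e _ hx) h
  have h2 := harris hd hd' hdecr hdecr'
  rw [real_comp hd] at h2
  refine le_trans ?_ (h2.trans (measureReal_mono ?_))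
  · rw [sq]; gcongr
  · rintro ω ⟨⟨t, y, ht, hy, hJ⟩, ⟨t', y', ht', hy', hJ'⟩⟩ p q hp hq hpq
    have hJm : Joined (region s (c - k) (c + k) m ∩ {v | ω v = false}) (mirror c t')
        (mirror c y') := by
      refine hJ'.map (mirror_adj c) ?_
      rintro w ⟨hw, hw'⟩
      exact ⟨mirror_mem_region hsym hw, hw'⟩
    have hmeet : ∀ v, v ∈ {v | ω v = false} → v ∈ {v | ω v = true} → False := by
      intro v h1 h2
      rw [Set.mem_ofPred_eq] at h1 h2
      rw [h1] at h2
      exact absurd h2 (by decide)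
    -- the blue crossing ends on the upper or on the lower half of the right side
    rcases le_or_gt c q.2 with h | h
    · have hy2 : y.2 = c - k ∨ y.1 = s y.2 + m ∧ y.2 < q.2 := by
        refine hy.imp_right fun hy => ⟨hy.1, lt_of_le_of_ne (hy.2.trans h) fun e => ?_⟩
        have : y = q := Prod.ext (by rw [hy.1, hq, e]) e
        exact hmeet y hJ.right.2 (this ▸ hpq.right.2)
      obtain ⟨v, hv1, hv2, -⟩ := not_disjoint_crossings (by positivity) hJ hpq ht hy2 hp hq
      exact hmeet v hv1 hv2
    · -- reflect the crossing
      have hpq' : Joined (region s (c - k) (c + k) m ∩ {v | ω (mirror c v) = true}) (mirror c p)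
          (mirror c q) := by
        refine hpq.map (mirror_adj c) ?_
        rintro w ⟨hw, hw'⟩
        exact ⟨mirror_mem_region hsym hw, by rw [Set.mem_ofPred_eq, mirror_mirror]; exact hw'⟩
      have hp' : (mirror c p).1 = s (mirror c p).2 := by
        simpa using (mirror_left hsym p 0).2 (by simpa using hp)
      have hq' := (mirror_left hsym q m).2 hq
      have hy2 : y'.2 = c - k ∨ y'.1 = s y'.2 + m ∧ y'.2 < (mirror c q).2 := by
        refine hy'.imp_right fun hy => ⟨hy.1, ?_⟩
        rw [mirror_snd]; omega
      obtain ⟨v, hv1, hv2, -⟩ := not_disjoint_crossings (by positivity) hJ' hpq' ht' hy2 hp' hq'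
      exact hmeet (mirror c v) hv1 hv2

end Doubling

/-! ### Blocked annuli and the existence of annulus exponents -/

/-- The side of a strip, reflected in the row `c`. -/
def reflectSide (c : ℤ) (s : ℤ → ℤ) (b : ℤ) : ℤ :=
  if c ≤ b then s b else s (2 * c - b) + (2 * c - b) - c

lemma reflectSide_slow {c : ℤ} {s : ℤ → ℤ} (hs : Slow s) : Slow (reflectSide c s) := by
  intro b
  unfold reflectSide
  split_ifs with h1 h2 h2
  · exact hs b
  · have : b = c - 1 := by omega
    subst this
    have := hs c
    rw [show c - 1 + 1 = c by ring, show 2 * c - (c - 1) = c + 1 by ring]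
    omega
  · omega
  · have := hs (2 * c - (b + 1))
    rw [show 2 * c - (b + 1) + 1 = 2 * c - b by ring] at this
    omega

lemma reflectSide_symm (c : ℤ) (s : ℤ → ℤ) (b : ℤ) :
    reflectSide c s (2 * c - b) = reflectSide c s b + b - c := by
  unfold reflectSide
  rcases lt_trichotomy b c with h | h | h
  · rw [if_pos (by omega), if_neg (by omega)]; ring
  · subst h; rw [show 2 * b - b = b by ring]; simp
  · rw [if_neg (by omega), if_pos (by omega), show 2 * c - (2 * c - b) = b by ring]

lemma noCrossing_congr {s s' : ℤ → ℤ} {b₀ b₁ m : ℤ} (h : ∀ b, b₀ ≤ b → s b = s' b) :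
    noCrossing s b₀ b₁ m = noCrossing s' b₀ b₁ m := by
  have hr : region s b₀ b₁ m = region s' b₀ b₁ m := by
    ext v
    simp only [region, Set.mem_ofPred_eq]
    by_cases hv : b₀ ≤ v.2
    · rw [h _ hv]
    · simp [hv]
  ext ω
  simp only [noCrossing, Set.mem_ofPred_eq, hr]
  refine forall₂_congr fun x y => ?_
  by_cases hJ : Joined (region s' b₀ b₁ m ∩ {v | ω v = true}) x y
  · rw [h _ hJ.left.1.1, h _ hJ.right.1.1]
  · simp [hJ]

/-- The left side of a strip that consists of eight rhombi, each the mirror image of the next. -/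
def zigzag (k : ℕ) : ℤ → ℤ :=
  reflectSide (-3 * k) (reflectSide (-k) (reflectSide 0 fun _ => 0))

lemma zigzag_slow (k : ℕ) : Slow (zigzag k) :=
  reflectSide_slow (reflectSide_slow (reflectSide_slow fun _ => .inl rfl))

/-- The left side of the zigzag strip stays close to a vertical line. -/
lemma zigzag_bounds (k : ℕ) {b : ℤ} (h1 : -7 * k ≤ b) (h2 : b ≤ k) :
    0 ≤ 2 * zigzag k b + b ∧ 2 * zigzag k b + b ≤ k := by
  unfold zigzag reflectSide
  split_ifs <;> beta_reduce <;> omega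

/-- Doubling takes a lower bound `x` to `(x / 2) ^ 2`; three doublings of `1 / 2` give `2⁻¹ ^ 22`.
-/
lemma noCrossing_zigzag {k : ℕ} (hk : 0 < k) :
    (2 : ℝ)⁻¹ ^ 22 ≤ critPerc.real (noCrossing (zigzag k) (-7 * k) k k) := by
  have h0 := noCrossing_rhombus k
  have e1 : noCrossing (fun _ => 0) 0 k k = noCrossing (reflectSide 0 fun _ => 0) 0 (0 + k) k := by
    rw [zero_add]
    exact noCrossing_congr fun b hb => by simp [reflectSide, hb]
  rw [e1] at h0
  have h1 := noCrossing_double (s := reflectSide 0 fun _ => 0) (c := 0) (k := k) (m := k)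
    (reflectSide_slow fun _ => .inl rfl) (reflectSide_symm 0 _) hk
  have e2 : noCrossing (reflectSide 0 fun _ => 0) (0 - k) (0 + k) k =
      noCrossing (reflectSide (-k) (reflectSide 0 fun _ => 0)) (-k) (-k + (2 * k : ℕ)) k := by
    rw [show (0 : ℤ) - k = -k by ring, show (0 : ℤ) + k = -k + (2 * k : ℕ) by push_cast; ring]
    exact noCrossing_congr fun b hb => (if_pos hb).symm
  rw [e2] at h1
  have h2 := noCrossing_double (s := reflectSide (-k) (reflectSide 0 fun _ => 0)) (c := -k)
    (k := 2 * k) (m := k) (reflectSide_slow (reflectSide_slow fun _ => .inl rfl))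
    (reflectSide_symm _ _) (by omega)
  have e3 : noCrossing (reflectSide (-k) (reflectSide 0 fun _ => 0)) (-k - (2 * k : ℕ))
      (-k + (2 * k : ℕ)) k = noCrossing (zigzag k) (-3 * k) k k := by
    rw [show (-k : ℤ) - (2 * k : ℕ) = -3 * k by push_cast; ring,
      show (-k : ℤ) + (2 * k : ℕ) = k by push_cast; ring]
    exact noCrossing_congr fun b hb => (if_pos hb).symm
  rw [e3] at h2
  have h3 := noCrossing_double (s := zigzag k) (c := -3 * k) (k := 4 * k) (m := k)
    (zigzag_slow k) (reflectSide_symm _ _) (by omega)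
  rw [show (-3 * k : ℤ) - (4 * k : ℕ) = -7 * k by push_cast; ring,
    show (-3 * k : ℤ) + (4 * k : ℕ) = k by push_cast; ring] at h3
  have step : ∀ {a x y : ℝ}, 0 ≤ a → a ≤ x → (x / 2) ^ 2 ≤ y → (a / 2) ^ 2 ≤ y :=
    fun ha h h' => (pow_le_pow_left₀ (by positivity) (by linarith) 2).trans h'
  refine le_trans ?_ (step (by positivity) (step (by positivity) (step (by norm_num) h0 h1) h2) h3)
  norm_num

/-- A blue path that traverses the rows of a strip from far left to far right crosses the strip. -/
lemma noCrossing_far {s : ℤ → ℤ} {b₀ b₁ m : ℤ} (hm : 0 ≤ m) (hs : Slow s) {ω : Config}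
    (hω : ω ∈ noCrossing s b₀ b₁ m) {x y : Site} (hx : x.1 < s x.2) (hy : s y.2 + m < y.1) :
    ¬ Joined {v | b₀ ≤ v.2 ∧ v.2 ≤ b₁ ∧ ω v = true} x y := by
  intro hJ
  have step : ∀ u v : Site, T.Adj u v → ∃ e : ℤ, (e = 0 ∨ e = 1 ∨ e = -1) ∧
      u.1 - s u.2 - (v.1 - s v.2) = e := by
    intro u v h
    refine ⟨_, ?_, rfl⟩
    have h1 := hs u.2
    have h2 := hs (u.2 - 1)
    rw [sub_add_cancel] at h2
    rcases adj_cases h with e | e | e | e | e | e <;> rw [e] <;> dsimp only <;> omega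
  -- From the last site to the left of the strip on, up to the first site to the right of it, the
  -- path stays in the strip; by the slow variation of `s` it cannot jump over the strip.
  obtain ⟨u, v, hu, -, hv, e, hJ1⟩ := hJ.exists_last_exit (A := {v | v.1 < s v.2}) hx
    (by rw [Set.mem_ofPred_eq]; omega)
  obtain ⟨u', v', hu', -, hv', e', hJ2⟩ := hJ1.symm.exists_last_exit
    (A := {v | s v.2 + m < v.1}) hy (by
      obtain ⟨t, ht, ht'⟩ := step u v e
      rw [Set.mem_ofPred_eq] at hu hv ⊢
      omega)
  obtain ⟨t, ht, hte⟩ := step u v e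
  obtain ⟨t', ht', hte'⟩ := step u' v' e'
  rw [Set.mem_ofPred_eq] at hu hv hu' hv'
  refine hω v v' (by omega) (by omega) (hJ2.symm.mono ?_)
  rintro w ⟨⟨⟨h1, h2, h3⟩, h4⟩, h5⟩
  rw [Set.mem_ofPred_eq] at h4 h5
  exact ⟨⟨h1, h2, by omega, by omega⟩, h3⟩

/-- Rotation by `π/3` about the origin. -/
def rotation : Equiv.Perm Site where
  toFun := rot
  invFun v := (v.1 + v.2, -v.1)
  left_inv v := by ext <;> simp [rot]
  right_inv v := by ext <;> simp [rot]

lemma rotation_adj (u v : Site) (h : T.Adj u v) : T.Adj (rotation u) (rotation v) := by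
  rw [adj_iff]
  simp only [rotation, Equiv.coe_fn_mk, rot, Prod.mk.injEq]
  rcases adj_cases h with e | e | e | e | e | e <;> subst e <;> dsimp only <;> omega

/-- The hexagonal norm on the lattice: twice the largest coordinate in the lattice directions. -/
def hexNorm (v : Site) : ℤ :=
  max (max (max (2 * v.1 + v.2) (-(2 * v.1 + v.2))) (max (v.1 - v.2) (-(v.1 - v.2))))
    (max (v.1 + 2 * v.2) (-(v.1 + 2 * v.2)))

lemma hexNorm_rotation (v : Site) : hexNorm (rotation v) = hexNorm v := by
  simp only [hexNorm, rotation, Equiv.coe_fn_mk, rot]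
  omega

lemma hexNorm_rotation_pow (i : ℕ) (v : Site) : hexNorm ((rotation ^ i) v) = hexNorm v := by
  induction i with
  | zero => rfl
  | succ i ih => rw [pow_succ', Equiv.Perm.mul_apply, hexNorm_rotation, ih]

lemma rotation_pow_adj (i : ℕ) (u v : Site) (h : T.Adj u v) :
    T.Adj ((rotation ^ i) u) ((rotation ^ i) v) := by
  induction i with
  | zero => exact h
  | succ i ih => rw [pow_succ', Equiv.Perm.mul_apply, Equiv.Perm.mul_apply]; exact rotation_adj _ _ ih

lemma exists_rotation (v : Site) :
    ∃ i < 6, 2 * ((rotation ^ i) v).1 + ((rotation ^ i) v).2 = hexNorm v := by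
  have key : hexNorm v = 2 * v.1 + v.2 ∨ hexNorm v = v.1 - v.2 ∨ hexNorm v = -(v.1 + 2 * v.2) ∨
      hexNorm v = -(2 * v.1 + v.2) ∨ hexNorm v = -(v.1 - v.2) ∨ hexNorm v = v.1 + 2 * v.2 := by
    unfold hexNorm; omega
  rcases key with h | h | h | h | h | h
  · exact ⟨0, by norm_num, h.symm⟩
  · refine ⟨1, by norm_num, Eq.trans ?_ h.symm⟩
    simp [rotation, rot]; ring
  · refine ⟨2, by norm_num, Eq.trans ?_ h.symm⟩
    simp [pow_succ, rotation, rot]; ring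
  · refine ⟨3, by norm_num, Eq.trans ?_ h.symm⟩
    simp [pow_succ, rotation, rot]; ring
  · refine ⟨4, by norm_num, Eq.trans ?_ h.symm⟩
    simp [pow_succ, rotation, rot]; ring
  · refine ⟨5, by norm_num, Eq.trans ?_ h.symm⟩
    simp [pow_succ, rotation, rot]; ring

lemma hexNorm_bounds {v : Site} {r : ℤ} (h : hexNorm v ≤ r) :
    2 * v.1 + v.2 ≤ r ∧ v.1 - v.2 ≤ r ∧ v.1 + 2 * v.2 ≤ r := by
  unfold hexNorm at h; omega

/-- The placement of the zigzag strip in the annulus of scale `k` around `o`, on the `i`-th side. -/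
def place (o : Site) (k i : ℕ) : Site ≃ Site :=
  (Equiv.addRight ((k + 1 : ℤ), (3 * k : ℤ))).trans
    ((rotation ^ i).symm.trans (Equiv.addRight o))

lemma place_symm_apply (o : Site) (k i : ℕ) (v : Site) :
    (place o k i).symm v = (rotation ^ i) (v - o) - ((k + 1 : ℤ), (3 * k : ℤ)) := by
  rw [Equiv.symm_apply_eq]
  simp [place]

lemma place_symm_adj (o : Site) (k i : ℕ) (u v : Site) (h : T.Adj u v) :
    T.Adj ((place o k i).symm u) ((place o k i).symm v) := by
  rw [place_symm_apply, place_symm_apply]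
  have h1 : T.Adj (u - o) (v - o) := by
    change _ = _ at h ⊢
    rw [← h]; simp
  have h2 := rotation_pow_adj i _ _ h1
  change _ = _ at h2 ⊢
  rw [← h2]; simp

/-- None of the six strips around the annulus of scale `k` is crossed. -/
def blocked (o : Site) (k : ℕ) : Set Config :=
  {ω | ∀ i < 6, ω ∘ place o k i ∈ noCrossing (zigzag k) (-7 * k) k k}

/-- The six strips around the annulus of scale `k`. -/
def blockedF (o : Site) (k : ℕ) : Finset Site :=
  (Finset.range 6).biUnion fun i => (regionF (zigzag k) (-7 * k) k k).map (place o k i).toEmbedding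

/-- The events that the single strips are not crossed are decreasing, so that by Harris' inequality
the probability that none of the first `n` strips is crossed is at least the product. -/
lemma blocked_aux (o : Site) (k n : ℕ) (hk : 0 < k) :
    DetBy ((Finset.range n).biUnion fun i =>
      (regionF (zigzag k) (-7 * k) k k).map (place o k i).toEmbedding)
      {ω | ∀ i < n, ω ∘ place o k i ∈ noCrossing (zigzag k) (-7 * k) k k} ∧
    Decreasing {ω | ∀ i < n, ω ∘ place o k i ∈ noCrossing (zigzag k) (-7 * k) k k} ∧
    ((2 : ℝ)⁻¹ ^ 22) ^ n ≤ critPerc.real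
      {ω | ∀ i < n, ω ∘ place o k i ∈ noCrossing (zigzag k) (-7 * k) k k} := by
  have det : ∀ n, DetBy ((Finset.range n).biUnion fun i =>
      (regionF (zigzag k) (-7 * k) k k).map (place o k i).toEmbedding)
      {ω | ∀ i < n, ω ∘ place o k i ∈ noCrossing (zigzag k) (-7 * k) k k} := by
    intro n ω ω' e h i hi
    refine noCrossing_detBy _ _ _ _ _ _ (fun x hx => e _ ?_) (h i hi)
    exact Finset.mem_biUnion.2 ⟨i, Finset.mem_range.2 hi, Finset.mem_map_of_mem _ hx⟩
  have dec : ∀ n, Decreasing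
      {ω | ∀ i < n, ω ∘ place o k i ∈ noCrossing (zigzag k) (-7 * k) k k} := by
    intro n ω ω' e h i hi
    exact noCrossing_decreasing _ _ _ _ _ _ (fun x hx => e _ hx) (h i hi)
  refine ⟨det n, dec n, ?_⟩
  induction n with
  | zero => simp
  | succ n ih =>
    have hd1 : DetBy ((Finset.range (n + 1)).biUnion fun i =>
        (regionF (zigzag k) (-7 * k) k k).map (place o k i).toEmbedding)
        {ω | ω ∘ place o k n ∈ noCrossing (zigzag k) (-7 * k) k k} := by
      intro ω ω' e h
      refine noCrossing_detBy _ _ _ _ _ _ (fun x hx => e _ ?_) h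
      exact Finset.mem_biUnion.2 ⟨n, Finset.mem_range.2 n.lt_succ_self, Finset.mem_map_of_mem _ hx⟩
    have hdec1 : Decreasing {ω | ω ∘ place o k n ∈ noCrossing (zigzag k) (-7 * k) k k} :=
      fun ω ω' e h => noCrossing_decreasing _ _ _ _ _ _ (fun x hx => e _ hx) h
    have hH := harris ((det n).mono (Finset.biUnion_subset_biUnion_of_subset_left _
      (Finset.range_subset_range.2 n.le_succ))) hd1 (dec n) hdec1
    rw [real_comp (noCrossing_detBy _ _ _ _)] at hH
    rw [pow_succ]
    refine le_trans (mul_le_mul ih (noCrossing_zigzag hk) (by positivity) measureReal_nonneg)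
      (hH.trans (measureReal_mono ?_))
    rintro ω ⟨h1, h2⟩ i hi
    rcases Nat.lt_succ_iff_lt_or_eq.1 hi with h | rfl
    exacts [h1 i h, h2]

lemma blockedF_hexNorm {o : Site} {k : ℕ} {v : Site} (h : v ∈ blockedF o k) :
    5 * k < hexNorm (v - o) ∧ hexNorm (v - o) ≤ 10 * k + 2 := by
  obtain ⟨i, -, hi⟩ := Finset.mem_biUnion.1 h
  obtain ⟨t, ht, rfl⟩ := Finset.mem_map.1 hi
  obtain ⟨h1, h2, h3, h4⟩ := mem_regionF.1 ht
  have h5 := zigzag_bounds k h1 h2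
  have e : (rotation ^ i) ((place o k i).toEmbedding t - o) = t + ((k + 1 : ℤ), (3 * k : ℤ)) := by
    simp [place]
  rw [← hexNorm_rotation_pow i, e]
  simp only [hexNorm, Prod.fst_add, Prod.snd_add]
  omega

/-- If the annulus of scale `k` is blocked, no blue path traverses it: on the side on which it
leaves, it would have to cross the strip placed there. -/
lemma not_joined_of_blocked {o : Site} {k : ℕ} (hk : 9 ≤ k) {ω : Config} (h : ω ∈ blocked o k)
    {x y : Site} (hx : hexNorm (x - o) ≤ 5 * k) (hy : 8 * k + 4 < hexNorm (y - o)) :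
    ¬ Joined {v | ω v = true} x y := by
  intro hJ
  obtain ⟨u, v, hu, -, hv, e, hJ1⟩ := hJ.symm.exists_last_exit
    (A := {v | 8 * k + 4 < hexNorm (v - o)}) hy (by rw [Set.mem_ofPred_eq]; omega)
  -- The side on which the path leaves the annulus for the first time; `f` is twice the coordinate
  -- in this direction.
  obtain ⟨i, hi, hiu⟩ := exists_rotation (u - o)
  set f : Site → ℤ := fun v => 2 * ((rotation ^ i) (v - o)).1 + ((rotation ^ i) (v - o)).2 with hf
  have hstep : ∀ u v, T.Adj u v → f u ≤ f v + 2 := by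
    intro u v h
    have h1 : T.Adj (u - o) (v - o) := by
      change _ = _ at h ⊢
      rw [← h]; simp
    have h2 := adj_cases (rotation_pow_adj i _ _ h1)
    simp only [hf]
    rcases h2 with e | e | e | e | e | e <;> rw [e] <;> dsimp only <;> omega
  have hfv : 8 * k + 3 ≤ f v := by
    have h1 := hstep u v e
    have h2 : 8 * k + 4 < hexNorm (u - o) := hu
    have h3 : f u = hexNorm (u - o) := hiu
    omega
  have hle : ∀ w, f w ≤ hexNorm (w - o) := fun w => by
    have := (hexNorm_bounds (le_refl (hexNorm ((rotation ^ i) (w - o))))).1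
    rwa [hexNorm_rotation_pow] at this
  have hfx : f x ≤ 5 * k := (hle x).trans hx
  -- From here on the path stays in the sector of the strip, on the way from its inner to its outer
  -- side.
  obtain ⟨u', v', hu', huS, hv', e', hJ2⟩ := hJ1.symm.exists_last_exit
    (A := {v | f v ≤ 5 * k}) hfx (by rw [Set.mem_ofPred_eq]; omega)
  rw [Set.mem_ofPred_eq] at hu' hv'
  have hu'' : 5 * k - 1 ≤ f u' := by have := hstep v' u' e'.symm; omega
  have hJ3 : Joined {w | 5 * k - 1 ≤ f w ∧ hexNorm (w - o) ≤ 8 * k + 4 ∧ ω w = true} u' v := by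
    refine (hJ2.mono ?_).head ?_ e'
    · rintro w ⟨⟨h1, h2⟩, h3⟩
      rw [Set.mem_ofPred_eq] at h1 h2 h3
      exact ⟨by omega, by omega, h1⟩
    · have h1 := huS.1
      have h2 := huS.2
      rw [Set.mem_ofPred_eq] at h1 h2
      exact ⟨hu'', by omega, h1⟩
  have hJ4 : Joined {t | -7 * k ≤ t.2 ∧ t.2 ≤ k ∧ (ω ∘ place o k i) t = true}
      ((place o k i).symm u') ((place o k i).symm v) := by
    refine hJ3.map (place_symm_adj o k i) ?_
    rintro w ⟨h1, h2, h3⟩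
    rw [Set.mem_ofPred_eq, Function.comp_apply, Equiv.apply_symm_apply, place_symm_apply]
    rw [← hexNorm_rotation_pow i] at h2
    have h4 := hexNorm_bounds h2
    simp only [hf] at h1
    refine ⟨?_, ?_, h3⟩ <;> simp only [Prod.snd_sub] <;> omega
  have hrow1 := hJ4.left
  have hrow2 := hJ4.right
  rw [Set.mem_ofPred_eq] at hrow1 hrow2
  have z1 := zigzag_bounds k hrow1.1 hrow1.2.1
  have z2 := zigzag_bounds k hrow2.1 hrow2.2.1
  refine noCrossing_far (by positivity) (zigzag_slow k) (h i hi) ?_ ?_ hJ4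
  · rw [place_symm_apply] at z1 ⊢
    simp only [hf, Prod.fst_sub, Prod.snd_sub] at hu' z1 ⊢
    omega
  · rw [place_symm_apply] at z2 ⊢
    simp only [hf, Prod.fst_sub, Prod.snd_sub] at hfv z2 ⊢
    omega

/-- Independence over scales. -/
lemma not_blocked_pow (o : Site) (k : ℕ) (hk : 0 < k) (n : ℕ) :
    critPerc.real {ω | ∀ j < n, ω ∉ blocked o (k * 3 ^ j)} ≤ (1 - ((2 : ℝ)⁻¹ ^ 22) ^ 6) ^ n := by
  have det : ∀ n, DetBy ((Finset.range n).biUnion fun j => blockedF o (k * 3 ^ j))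
      {ω | ∀ j < n, ω ∉ blocked o (k * 3 ^ j)} := by
    intro n ω ω' e h j hj
    refine (blocked_aux o (k * 3 ^ j) 6 (by positivity)).1.compl _ _ (fun x hx => e x ?_) (h j hj)
    exact Finset.mem_biUnion.2 ⟨j, Finset.mem_range.2 hj, hx⟩
  have h01 : (0 : ℝ) ≤ 1 - ((2 : ℝ)⁻¹ ^ 22) ^ 6 := by norm_num
  induction n with
  | zero => simp
  | succ n ih =>
    obtain ⟨hd, -, hp⟩ := blocked_aux o (k * 3 ^ n) 6 (by positivity)
    have hdis : Disjoint ((Finset.range n).biUnion fun j => blockedF o (k * 3 ^ j))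
        (blockedF o (k * 3 ^ n)) := by
      rw [Finset.disjoint_biUnion_left]
      intro j hj
      rw [Finset.disjoint_left]
      intro v hv hv'
      have h1 := (blockedF_hexNorm hv).2
      have h2 := (blockedF_hexNorm hv').1
      have h3 : k * 3 ^ j * 3 ≤ k * 3 ^ n := by
        rw [mul_assoc, ← pow_succ]
        exact Nat.mul_le_mul_left _ (Nat.pow_le_pow_right (by norm_num) (Finset.mem_range.1 hj))
      have h4 : 0 < k * 3 ^ j := by positivity
      omega
    have hI := real_inter_of_disjoint (det n) hd.compl hdis
    have hsub : {ω | ∀ j < n + 1, ω ∉ blocked o (k * 3 ^ j)} ⊆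
        {ω | ∀ j < n, ω ∉ blocked o (k * 3 ^ j)} ∩ (blocked o (k * 3 ^ n))ᶜ :=
      fun ω h => ⟨fun j hj => h j (by omega), h n n.lt_succ_self⟩
    refine (measureReal_mono hsub).trans ?_
    change critPerc.real (_ ∩ (blocked o (k * 3 ^ n))ᶜ) = _ at hI
    rw [hI, pow_succ, probReal_compl_eq_one_sub hd.measurableSet]
    have : critPerc.real {ω | ∀ i < 6, ω ∘ place o (k * 3 ^ n) i ∈
      noCrossing (zigzag (k * 3 ^ n)) (-7 * ↑(k * 3 ^ n)) ↑(k * 3 ^ n) ↑(k * 3 ^ n)} ≤ 1 :=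
      measureReal_le_one
    exact mul_le_mul ih (by linarith) (by linarith) (by positivity)

/-! ### Lattice geometry in the plane -/

lemma exp_pi_div_three : Complex.exp (Real.pi / 3 * Complex.I) = ⟨1 / 2, √3 / 2⟩ := by
  have : (Real.pi / 3 * Complex.I : ℂ) = ((Real.pi / 3 : ℝ) : ℂ) * Complex.I := by push_cast; rfl
  rw [this, Complex.exp_mul_I, ← Complex.ofReal_cos, ← Complex.ofReal_sin, Real.cos_pi_div_three,
    Real.sin_pi_div_three]
  apply Complex.ext <;> simp

lemma sitePt_re (δ : ℝ) (v : Site) : (sitePt δ v).re = δ * (v.1 + v.2 / 2) := by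
  rw [sitePt, exp_pi_div_three]
  simp [div_eq_mul_inv]

lemma sitePt_im (δ : ℝ) (v : Site) : (sitePt δ v).im = δ * (v.2 * (√3 / 2)) := by
  simp [sitePt, exp_pi_div_three]

lemma sitePt_sub (δ : ℝ) (u v : Site) : sitePt δ (u - v) = sitePt δ u - sitePt δ v := by
  simp only [sitePt, Prod.fst_sub, Prod.snd_sub]; push_cast; ring

lemma norm_sitePt_sq (δ : ℝ) (v : Site) :
    ‖sitePt δ v‖ ^ 2 = δ ^ 2 * (v.1 ^ 2 + v.1 * v.2 + v.2 ^ 2) := by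
  rw [Complex.sq_norm, Complex.normSq_apply, sitePt_re, sitePt_im]
  have : √3 * √3 = 3 := Real.mul_self_sqrt (by norm_num)
  linear_combination (δ ^ 2 * v.2 ^ 2 / 4) * this

lemma dist_sitePt_of_adj {δ : ℝ} (hδ : 0 < δ) {u v : Site} (h : T.Adj u v) :
    dist (sitePt δ u) (sitePt δ v) = δ := by
  rw [dist_comm, dist_eq_norm, ← sitePt_sub]
  have h1 := norm_sitePt_sq δ (v - u)
  have h2 : ((v - u).1 : ℝ) ^ 2 + (v - u).1 * (v - u).2 + (v - u).2 ^ 2 = 1 := by exact_mod_cast h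
  rw [h2, mul_one] at h1
  exact (pow_left_inj₀ (norm_nonneg _) hδ.le two_ne_zero).1 h1

lemma norm_sitePt_le {δ : ℝ} (hδ : 0 < δ) (v : Site) : ‖sitePt δ v‖ ≤ δ * hexNorm v := by
  have h0 : 0 ≤ hexNorm v := by unfold hexNorm; omega
  refine abs_le_of_sq_le_sq' ?_ (by positivity) |>.2
  rw [norm_sitePt_sq, mul_pow]
  refine mul_le_mul_of_nonneg_left ?_ (by positivity)
  have h1 : |2 * v.1 + v.2| ≤ hexNorm v := by rw [abs_le]; unfold hexNorm; omega
  have h2 : |v.1 - v.2| ≤ hexNorm v := by rw [abs_le]; unfold hexNorm; omega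
  have h3 : |v.1 + 2 * v.2| ≤ hexNorm v := by rw [abs_le]; unfold hexNorm; omega
  have : v.1 ^ 2 + v.1 * v.2 + v.2 ^ 2 ≤ hexNorm v ^ 2 := by
    have h1' := sq_le_sq' (abs_le.1 h1).1 (abs_le.1 h1).2
    have h2' := sq_le_sq' (abs_le.1 h2).1 (abs_le.1 h2).2
    have h3' := sq_le_sq' (abs_le.1 h3).1 (abs_le.1 h3).2
    nlinarith
  exact_mod_cast this

lemma hexNorm_le (δ : ℝ) (v : Site) : δ * hexNorm v ≤ 2 * ‖sitePt δ v‖ := by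
  refine abs_le_of_sq_le_sq' ?_ (by positivity) |>.2
  rw [mul_pow, mul_pow, norm_sitePt_sq]
  have : hexNorm v ^ 2 ≤ 4 * (v.1 ^ 2 + v.1 * v.2 + v.2 ^ 2) := by
    have : hexNorm v = 2 * v.1 + v.2 ∨ hexNorm v = v.1 - v.2 ∨ hexNorm v = -(v.1 + 2 * v.2) ∨
      hexNorm v = -(2 * v.1 + v.2) ∨ hexNorm v = -(v.1 - v.2) ∨ hexNorm v = v.1 + 2 * v.2 := by
      unfold hexNorm; omega
    rcases this with h | h | h | h | h | h <;> rw [h] <;>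
      nlinarith [sq_nonneg (v.1), sq_nonneg v.2, sq_nonneg (v.1 + v.2)]
  have h2 : (hexNorm v : ℝ) ^ 2 ≤ 4 * (v.1 ^ 2 + v.1 * v.2 + v.2 ^ 2) := by exact_mod_cast this
  nlinarith [mul_le_mul_of_nonneg_left h2 (sq_nonneg δ)]

lemma dist_hexPt_le {δ : ℝ} (hδ : 0 < δ) {v : Site} {t : HexVertex} (h : v ∈ t.1) :
    dist (hexPt δ t) (sitePt δ v) ≤ δ := by
  have e : hexPt δ t - sitePt δ v = (∑ u ∈ t.1, (sitePt δ u - sitePt δ v)) / 3 := by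
    rw [hexPt, Finset.sum_sub_distrib, Finset.sum_const, t.2.card_eq]
    simp only [nsmul_eq_mul]; push_cast; ring
  rw [dist_eq_norm, e, norm_div]
  have : ‖∑ u ∈ t.1, (sitePt δ u - sitePt δ v)‖ ≤ ∑ u ∈ t.1, δ := by
    refine norm_sum_le_of_le _ fun u hu => ?_
    rw [← dist_eq_norm]
    by_cases huv : u = v
    · rw [huv, dist_self]; exact hδ.le
    · exact (dist_sitePt_of_adj hδ (t.2.isClique hu h huv)).le
  rw [Finset.sum_const, t.2.card_eq] at this
  simp only [nsmul_eq_mul, Nat.cast_ofNat] at this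
  rw [Complex.norm_ofNat]
  linarith

lemma hexagon_subset_closedBall {δ : ℝ} (hδ : 0 < δ) (v : Site) :
    hexagon δ v ⊆ Metric.closedBall (sitePt δ v) δ := by
  refine convexHull_min ?_ (convex_closedBall _ _)
  rintro _ ⟨t, ht, rfl⟩
  exact dist_hexPt_le hδ ht

lemma exists_near_site {δ : ℝ} (hδ : 0 < δ) (x : ℂ) : ∃ o : Site, dist (sitePt δ o) x ≤ δ := by
  have h3 : 0 < √3 := by positivity
  have h3' : √3 < 2 := by rw [Real.sqrt_lt' (by norm_num)]; norm_num
  set b : ℤ := round (x.im / (δ * (√3 / 2)))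
  set a : ℤ := round (x.re / δ - b / 2)
  refine ⟨(a, b), ?_⟩
  have hb := abs_sub_round (x.im / (δ * (√3 / 2)))
  have ha := abs_sub_round (x.re / δ - b / 2)
  rw [dist_comm, dist_eq_norm]
  refine (Complex.norm_le_abs_re_add_abs_im _).trans ?_
  rw [Complex.sub_re, Complex.sub_im, sitePt_re, sitePt_im]
  have e1 : x.re - δ * (a + b / 2) = δ * (x.re / δ - b / 2 - a) := by field_simp; ring
  have e2 : x.im - δ * (b * (√3 / 2)) = (δ * (√3 / 2)) * (x.im / (δ * (√3 / 2)) - b) := by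
    field_simp
  dsimp only
  rw [e1, e2, abs_mul, abs_mul, abs_of_pos hδ, abs_of_pos (show 0 < δ * (√3 / 2) by positivity)]
  have := mul_le_mul_of_nonneg_left ha hδ.le
  have := mul_le_mul_of_nonneg_left hb (show 0 ≤ δ * (√3 / 2) by positivity)
  nlinarith

/-- A walk through blue hexagons joins its endpoints. -/
lemma joined_of_walk {S : Set Site} {u v : Site} (p : T.Walk u v) (h : ∀ y ∈ p.support, y ∈ S) :
    Joined S u v := by
  induction p with
  | nil => exact .refl (h _ (by simp))
  | cons hadj p ih =>
    exact (ih fun y hy => h y (by simp [hy])).head (h _ (by simp)) hadj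

/-- Annulus exponents exist: each of the logarithmically many annuli of scales `k * 3 ^ j` between
the two radii is blocked with a probability bounded below, independently of the others. -/
theorem exists_annulusExponent : ∃ lam : ℝ, IsAnnulusExponent lam := by
  obtain ⟨q, hq0, hq1, hq⟩ : ∃ q : ℝ, 0 < q ∧ q < 1 ∧ ∀ (o : Site) (k n : ℕ), 0 < k →
      critPerc.real {ω | ∀ j < n, ω ∉ blocked o (k * 3 ^ j)} ≤ q ^ n :=
    ⟨_, by norm_num, by norm_num, fun o k n hk => not_blocked_pow o k hk n⟩
  have hl3 : 0 < Real.log 3 := Real.log_pos (by norm_num)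
  set lam : ℝ := -Real.log q / Real.log 3 with hlam
  have hlam0 : 0 < lam := div_pos (neg_pos.2 (Real.log_neg hq0 hq1)) hl3
  have hq3 : q = (3 : ℝ) ^ (-lam) := by
    rw [Real.rpow_def_of_pos (by norm_num), hlam, neg_div, neg_neg, mul_div_cancel₀ _ hl3.ne',
      Real.exp_log hq0]
  -- The constant leaves room for the annuli of scales `k * 3 ^ j`, `j < n`: they reach up to `8 * k
  -- * 3 ^ j + 4` in the hexagonal norm, with `k ≤ 11 * (r / δ)`.
  refine ⟨lam, hlam0, 94, by norm_num, 3 ^ lam * 94 ^ lam, fun δ x r R hδ hr hR hrδ => ?_⟩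
  have hRr : 1 ≤ R / r / 94 := by rw [le_div_iff₀ (by norm_num)]; linarith
  obtain ⟨n, hn1, hn2⟩ := exists_nat_pow_near hRr (show (1 : ℝ) < 3 by norm_num)
  obtain ⟨o, ho⟩ := exists_near_site hδ x
  -- The ball of radius `r` has to be inside of the first annulus, with room for the radius of a
  -- hexagon and for the distance of `o` from `x`.
  set k : ℕ := ⌈r / δ⌉₊ + 9 with hk
  have hk1 : r / δ + 9 ≤ k := by rw [hk]; push_cast; linarith [Nat.le_ceil (r / δ)]
  have hk2 : (k : ℝ) ≤ r / δ + 10 := by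
    rw [hk]; push_cast; linarith [Nat.ceil_lt_add_one (show 0 ≤ r / δ by positivity)]
  have hsub : annulusCrossing δ x r R ⊆ {ω | ∀ j < n, ω ∉ blocked o (k * 3 ^ j)} := by
    rintro ω ⟨u, v, p, hp, ⟨pu, hu, hu'⟩, pv, hv, hv'⟩ j hj hbl
    have hu1 := hexagon_subset_closedBall hδ u hu
    have hv1 := hexagon_subset_closedBall hδ v hv
    rw [Metric.mem_closedBall] at hu1 hu' hv1
    rw [Set.mem_compl_iff, Metric.mem_ball, not_lt] at hv'
    have hj3 : (1 : ℝ) ≤ 3 ^ j := one_le_pow₀ (by norm_num)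
    refine not_joined_of_blocked ?_ hbl ?_ ?_ (joined_of_walk p hp)
    · have : 1 ≤ 3 ^ j := Nat.one_le_pow _ _ (by norm_num)
      have : k * 1 ≤ k * 3 ^ j := Nat.mul_le_mul_left _ this
      omega
    · have h1 := hexNorm_le δ (u - o)
      have h2 : ‖sitePt δ (u - o)‖ ≤ r + 2 * δ := by
        rw [sitePt_sub, ← dist_eq_norm]
        have := dist_triangle4 (sitePt δ u) pu x (sitePt δ o)
        rw [dist_comm (sitePt δ u) pu, dist_comm x] at this
        linarith
      have h3 : (hexNorm (u - o) : ℝ) ≤ 2 * (r / δ) + 4 := by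
        rw [← mul_le_mul_iff_right₀ hδ]
        have : δ * (2 * (r / δ) + 4) = 2 * r + 4 * δ := by field_simp
        linarith
      have h4 : (hexNorm (u - o) : ℝ) ≤ 5 * (k * 3 ^ j) := by
        have : (0 : ℝ) ≤ r / δ := by positivity
        nlinarith
      exact_mod_cast h4
    · have h1 := norm_sitePt_le hδ (v - o)
      have h2 : R - 2 * δ ≤ ‖sitePt δ (v - o)‖ := by
        rw [sitePt_sub, ← dist_eq_norm]
        have := dist_triangle4 pv (sitePt δ v) (sitePt δ o) x
        linarith
      have h3 : R / δ - 2 ≤ hexNorm (v - o) := by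
        rw [← mul_le_mul_iff_right₀ hδ]
        have : δ * (R / δ - 2) = R - 2 * δ := by field_simp
        linarith
      have h5 : 94 * (r / δ) * (3 * 3 ^ j) ≤ R / δ := by
        have : (3 : ℝ) * 3 ^ j ≤ 3 ^ n := by
          rw [mul_comm, ← pow_succ]
          exact pow_le_pow_right₀ (by norm_num) hj
        have h6 := this.trans hn1
        rw [le_div_iff₀ (by norm_num), le_div_iff₀ hr] at h6
        rw [le_div_iff₀ hδ]
        calc _ = 3 * 3 ^ j * 94 * r := by field_simp
          _ ≤ R := h6
      have h4 : 8 * ((k : ℝ) * 3 ^ j) + 4 < hexNorm (v - o) := by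
        have h7 : (k : ℝ) * 3 ^ j ≤ 11 * (r / δ) * 3 ^ j :=
          mul_le_mul_of_nonneg_right (by linarith) (by positivity)
        have h8 : r / δ ≤ r / δ * 3 ^ j := le_mul_of_one_le_right (by positivity) hj3
        nlinarith
      exact_mod_cast h4
  refine (measureReal_mono hsub).trans ((hq o k n (by omega)).trans ?_)
  have hR0 : 0 < R := by
    by_contra hneg
    have : R / r ≤ 0 := div_nonpos_of_nonpos_of_nonneg (not_lt.1 hneg) hr.le
    linarith
  have h9 : (r / R) ^ lam = (94 : ℝ) ^ (-lam) * (R / r / 94) ^ (-lam) := by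
    rw [← Real.mul_rpow (by norm_num) (by positivity), mul_div_cancel₀ _ (by norm_num),
      Real.rpow_neg (by positivity), ← Real.inv_rpow (by positivity), inv_div]
  have h10 : (3 : ℝ) ^ (-lam) * q ^ n ≤ (R / r / 94) ^ (-lam) := by
    have h11 : (3 : ℝ) ^ (-lam) * q ^ n = ((3 : ℝ) ^ (n + 1)) ^ (-lam) := by
      rw [← hq3, ← pow_succ', hq3, ← Real.rpow_natCast, ← Real.rpow_natCast, ← Real.rpow_mul
        (by norm_num), ← Real.rpow_mul (by norm_num), mul_comm]
    rw [h11]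
    exact Real.rpow_le_rpow_of_nonpos (by positivity) hn2.le (by linarith)
  have h12 : (3 : ℝ) ^ lam * 3 ^ (-lam) = 1 := by
    rw [← Real.rpow_add (by norm_num), add_neg_cancel, Real.rpow_zero]
  have h13 : (94 : ℝ) ^ lam * 94 ^ (-lam) = 1 := by
    rw [← Real.rpow_add (by norm_num), add_neg_cancel, Real.rpow_zero]
  have h14 : (0 : ℝ) < 3 ^ lam := by positivity
  calc q ^ n = 3 ^ lam * (3 ^ (-lam) * q ^ n) := by rw [← mul_assoc, h12, one_mul]
    _ ≤ 3 ^ lam * (R / r / 94) ^ (-lam) := by gcongr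
    _ = _ := by rw [h9]; linear_combination (-(3 ^ lam * (R / r / 94) ^ (-lam))) * h13

/-! ### Edges and triangles around a site -/

/-- The oriented edge following `e` in the counterclockwise order around its initial point. -/
def turn (e : T.Dart) : T.Dart :=
  ⟨(e.fst, apex e), (SimpleGraph.is3Clique_triple_iff.1 (isNClique_left e)).2.1⟩

/-- The side of the triangle to the left of `e` that follows `e`. -/
def cyc (e : T.Dart) : T.Dart :=
  ⟨(e.snd, apex e), (SimpleGraph.is3Clique_triple_iff.1 (isNClique_left e)).2.2⟩

@[simp] lemma turn_fst (e : T.Dart) : (turn e).fst = e.fst := rfl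
@[simp] lemma turn_snd (e : T.Dart) : (turn e).snd = apex e := rfl
@[simp] lemma cyc_fst (e : T.Dart) : (cyc e).fst = e.snd := rfl
@[simp] lemma cyc_snd (e : T.Dart) : (cyc e).snd = apex e := rfl
@[simp] lemma symm_fst (e : T.Dart) : e.symm.fst = e.snd := rfl
@[simp] lemma symm_snd (e : T.Dart) : e.symm.snd = e.fst := rfl

lemma apex_cyc (e : T.Dart) : apex (cyc e) = e.fst := by
  ext <;> simp [apex, rot] <;> ring

lemma cyc_cyc_cyc (e : T.Dart) : cyc (cyc (cyc e)) = e := by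
  rw [dart_eq_iff]
  refine ⟨?_, ?_⟩
  · change apex (cyc e) = _
    exact apex_cyc e
  · change apex (cyc (cyc e)) = _
    exact apex_cyc _

lemma turn_symm (e : T.Dart) : (turn e).symm = cyc (cyc e) := by
  rw [dart_eq_iff]
  refine ⟨rfl, ?_⟩
  change e.fst = apex (cyc e)
  exact (apex_cyc e).symm

lemma leftVertex_cyc (e : T.Dart) : leftVertex (cyc e) = leftVertex e := by
  refine Subtype.ext ?_
  rw [leftVertex_val, leftVertex_val, apex_cyc, cyc_fst, cyc_snd]
  ext v
  simp only [Finset.mem_insert, Finset.mem_singleton]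
  tauto

lemma rightVertex_turn (e : T.Dart) : leftVertex (turn e).symm = leftVertex e := by
  rw [turn_symm, leftVertex_cyc, leftVertex_cyc]

lemma mem_leftVertex {e : T.Dart} {v : Site} :
    v ∈ (leftVertex e).1 ↔ v = e.fst ∨ v = e.snd ∨ v = apex e := by
  simp [leftVertex_val]

lemma fst_mem_left (e : T.Dart) : e.fst ∈ (leftVertex e).1 := mem_leftVertex.2 (.inl rfl)
lemma snd_mem_left (e : T.Dart) : e.snd ∈ (leftVertex e).1 := mem_leftVertex.2 (.inr (.inl rfl))
lemma fst_mem_right (e : T.Dart) : e.fst ∈ (leftVertex e.symm).1 := snd_mem_left e.symm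
lemma snd_mem_right (e : T.Dart) : e.snd ∈ (leftVertex e.symm).1 := fst_mem_left e.symm

lemma offset_cases (e : T.Dart) : e.snd - e.fst = (1, 0) ∨ e.snd - e.fst = (0, 1) ∨
    e.snd - e.fst = (-1, 1) ∨ e.snd - e.fst = (-1, 0) ∨ e.snd - e.fst = (0, -1) ∨
    e.snd - e.fst = (1, -1) := by
  simp only [sub_eq_iff_eq_add', Prod.ext_iff, Prod.fst_add, Prod.snd_add]
  have := adj_cases e.adj
  simp only [Prod.ext_iff] at this
  omega

lemma turn_iterate_fst (e : T.Dart) (i : ℕ) : (turn^[i] e).fst = e.fst := by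
  induction i with
  | zero => rfl
  | succ i ih => rw [Function.iterate_succ_apply', turn_fst, ih]

lemma turn_iterate_offset (e : T.Dart) (i : ℕ) :
    (turn^[i] e).snd - e.fst = rot^[i] (e.snd - e.fst) := by
  induction i with
  | zero => rfl
  | succ i ih =>
    rw [Function.iterate_succ_apply', turn_snd, apex, turn_iterate_fst, Function.iterate_succ_apply',
      ih, add_sub_cancel_left]

lemma turn_iterate_eq_iff (e d : T.Dart) (i : ℕ) :
    turn^[i] e = d ↔ d.fst = e.fst ∧ rot^[i] (e.snd - e.fst) = d.snd - e.fst := by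
  rw [dart_eq_iff, turn_iterate_fst, ← turn_iterate_offset, sub_left_inj]
  exact and_congr_left fun _ => eq_comm

lemma turn_iterate_six (e : T.Dart) : turn^[6] e = e := by
  rw [turn_iterate_eq_iff]
  refine ⟨rfl, ?_⟩
  rcases offset_cases e with h | h | h | h | h | h <;> rw [h] <;> decide

lemma turn_iterate_injOn (e : T.Dart) {i j : ℕ} (hi : i < 6) (hj : j < 6)
    (h : turn^[i] e = turn^[j] e) : i = j := by
  have h1 : rot^[i] (e.snd - e.fst) = rot^[j] (e.snd - e.fst) := by
    rw [← turn_iterate_offset, ← turn_iterate_offset, h]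
  rcases offset_cases e with h' | h' | h' | h' | h' | h' <;> rw [h'] at h1 <;>
    interval_cases i <;> interval_cases j <;> first | rfl | exact absurd h1 (by decide)

lemma exists_turn {e d : T.Dart} (h : d.fst = e.fst) : ∃ i < 6, turn^[i] e = d := by
  have h1 := offset_cases d
  rw [h] at h1
  simp only [turn_iterate_eq_iff, h, true_and]
  rcases offset_cases e with h' | h' | h' | h' | h' | h' <;>
    rcases h1 with h1 | h1 | h1 | h1 | h1 | h1 <;> rw [h', h1] <;> decide

lemma leftVertex_eq_of_fst_eq {e d : T.Dart} (h : d.fst = e.fst)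
    (h' : leftVertex d = leftVertex e) : d = e := by
  obtain ⟨i, hi, rfl⟩ := exists_turn h
  have h1 : (turn^[i] e).snd ∈ (leftVertex e).1 := h' ▸ snd_mem_left _
  have h2 : apex (turn^[i] e) ∈ (leftVertex e).1 := h' ▸ mem_leftVertex.2 (.inr (.inr rfl))
  rw [← turn_snd, ← Function.iterate_succ_apply' turn] at h2
  have key : ∀ j < 6, (turn^[j] e).snd ∈ (leftVertex e).1 → j = 0 ∨ j = 1 := by
    intro j hj h
    rcases mem_leftVertex.1 h with h | h | h
    · exact absurd (h.trans (turn_iterate_fst e j).symm) (fst_ne_snd _).symm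
    · exact .inl (turn_iterate_injOn e hj (by norm_num)
        (dart_eq_iff.2 ⟨turn_iterate_fst e j, h⟩ : turn^[j] e = turn^[0] e))
    · exact .inr (turn_iterate_injOn e hj (by norm_num)
        (dart_eq_iff.2 ⟨turn_iterate_fst e j, h⟩ : turn^[j] e = turn^[1] e))
  rcases key i hi h1 with rfl | rfl
  · rfl
  · have := key 2 (by norm_num) h2
    omega

lemma leftVertex_eq_iff {e d : T.Dart} :
    leftVertex d = leftVertex e ↔ d = e ∨ d = cyc e ∨ d = cyc (cyc e) := by
  constructor
  · intro h
    have h1 : d.fst ∈ (leftVertex e).1 := h ▸ fst_mem_left d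
    rcases mem_leftVertex.1 h1 with h1 | h1 | h1
    · exact .inl (leftVertex_eq_of_fst_eq h1 h)
    · exact .inr (.inl (leftVertex_eq_of_fst_eq h1 (h.trans (leftVertex_cyc e).symm)))
    · refine .inr (.inr (leftVertex_eq_of_fst_eq h1 (h.trans ?_)))
      rw [leftVertex_cyc, leftVertex_cyc]
  · rintro (rfl | rfl | rfl)
    · rfl
    · exact leftVertex_cyc e
    · rw [leftVertex_cyc, leftVertex_cyc]

/-- The oriented edges with the triangle to the left of `e` on their right. -/
lemma rightVertex_eq_iff {e d : T.Dart} :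
    leftVertex d.symm = leftVertex e ↔ d = e.symm ∨ d = (cyc e).symm ∨ d = turn e := by
  rw [leftVertex_eq_iff, ← turn_symm, SimpleGraph.Dart.symm_involutive.injective.eq_iff]
  refine or_congr ?_ (or_congr ?_ Iff.rfl) <;>
  · constructor
    · intro h; rw [← h, SimpleGraph.Dart.symm_symm]
    · intro h; rw [h, SimpleGraph.Dart.symm_symm]

lemma leftVertex_ne_rightVertex (e : T.Dart) : leftVertex e.symm ≠ leftVertex e := by
  intro h
  rcases rightVertex_eq_iff.1 h with h | h | h
  · exact fst_ne_snd e (dart_eq_iff.1 h).1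
  · exact (apex_ne e).1 (dart_eq_iff.1 h).1.symm
  · exact (apex_ne e).2 (dart_eq_iff.1 h).2.symm

lemma exists_leftVertex_eq (t : HexVertex) : ∃ e, leftVertex e = t := by
  obtain ⟨a, b, c, hab, hac, hbc, ht⟩ := SimpleGraph.is3Clique_iff.1 t.2
  have key : c = a + rot (b - a) ∨ c = b + rot (a - b) := by
    have h1 := adj_cases hab
    have h2 := adj_cases hac
    have h3 := adj_cases hbc
    simp only [rot, Prod.ext_iff, Prod.fst_add, Prod.snd_add, Prod.fst_sub, Prod.snd_sub] at *
    omega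
  rcases key with h | h
  · exact ⟨⟨(a, b), hab⟩, Subtype.ext (by rw [ht, h]; rfl)⟩
  · refine ⟨⟨(b, a), hab.symm⟩, Subtype.ext ?_⟩
    rw [ht, h, Finset.insert_comm]; rfl

lemma exists_dart_of_mem {t : HexVertex} {v : Site} (h : v ∈ t.1) :
    ∃ e, e.fst = v ∧ leftVertex e = t := by
  obtain ⟨e, rfl⟩ := exists_leftVertex_eq t
  rcases mem_leftVertex.1 h with rfl | rfl | rfl
  · exact ⟨e, rfl, rfl⟩
  · exact ⟨cyc e, rfl, leftVertex_cyc e⟩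
  · exact ⟨cyc (cyc e), rfl, by rw [leftVertex_cyc, leftVertex_cyc]⟩

lemma eq_left_or_right {t : HexVertex} {e : T.Dart} (h1 : e.fst ∈ t.1) (h2 : e.snd ∈ t.1) :
    t = leftVertex e ∨ t = leftVertex e.symm := by
  obtain ⟨d, hd, rfl⟩ := exists_dart_of_mem h1
  rcases mem_leftVertex.1 h2 with h | h | h
  · exact absurd (h.trans hd).symm (fst_ne_snd e)
  · left; rw [dart_eq_iff.2 ⟨hd, h.symm⟩]
  · right
    rw [show e = turn d from dart_eq_iff.2 ⟨hd.symm, h⟩, rightVertex_turn]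

lemma left_inter_right (e : T.Dart) :
    (leftVertex e.symm).1 ∩ (leftVertex e).1 = {e.fst, e.snd} := by
  ext v
  simp only [Finset.mem_inter, Finset.mem_insert, Finset.mem_singleton]
  constructor
  · rintro ⟨h1, h2⟩
    rcases mem_leftVertex.1 h2 with h | h | h
    · exact .inl h
    · exact .inr h
    · exfalso
      subst h
      rcases eq_left_or_right (e := turn e) (fst_mem_right e) h1 with h | h
      · rcases rightVertex_eq_iff.1 (show leftVertex e.symm = leftVertex (turn e) from h) with
          h | h | h
        · exact fst_ne_snd e ((dart_eq_iff.1 h).2.symm)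
        · have h3 := (dart_eq_iff.1 h).2
          exact (apex_ne e).2 h3.symm
        · have h3 := (dart_eq_iff.1 h).2
          rcases offset_cases e with h' | h' | h' | h' | h' | h' <;>
            simp [apex, rot, Prod.ext_iff] at h3 h' <;> omega
      · rw [rightVertex_turn] at h
        exact leftVertex_ne_rightVertex e h
  · rintro (rfl | rfl)
    · exact ⟨fst_mem_right e, fst_mem_left e⟩
    · exact ⟨snd_mem_right e, snd_mem_left e⟩

lemma H_adj_iff {s t : HexVertex} :
    H.Adj s t ↔ ∃ e, leftVertex e.symm = s ∧ leftVertex e = t := by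
  constructor
  · intro h
    obtain ⟨x, y, hxy, hst⟩ := Finset.card_eq_two.1 (show (s.1 ∩ t.1).card = 2 from h)
    have hx : x ∈ s.1 ∩ t.1 := by rw [hst]; simp
    have hy : y ∈ s.1 ∩ t.1 := by rw [hst]; simp
    rw [Finset.mem_inter] at hx hy
    let e : T.Dart := ⟨(x, y), s.2.isClique hx.1 hy.1 hxy⟩
    have hne : s ≠ t := h.ne
    rcases eq_left_or_right (e := e) hx.1 hy.1 with h1 | h1 <;>
      rcases eq_left_or_right (e := e) hx.2 hy.2 with h2 | h2
    · exact absurd (h1.trans h2.symm) hne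
    · exact ⟨e.symm, h1.symm, h2.symm⟩
    · exact ⟨e, h1.symm, h2.symm⟩
    · exact absurd (h1.trans h2.symm) hne
  · rintro ⟨e, rfl, rfl⟩
    change ((leftVertex e.symm).1 ∩ (leftVertex e).1).card = 2
    rw [left_inter_right, Finset.card_pair (fst_ne_snd e)]

/-! ### Connections between hexagon vertices -/

/-- `s` and `t` are joined by a path along hexagon sides whose dual edges satisfy `ok`. -/
def Conn (ok : T.Dart → Prop) (s t : HexVertex) : Prop :=
  Relation.ReflTransGen (fun s t => ∃ e, ok e ∧ leftVertex e.symm = s ∧ leftVertex e = t) s t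

namespace Conn

variable {ok ok' : T.Dart → Prop} {s t u : HexVertex}

lemma refl (ok : T.Dart → Prop) (s : HexVertex) : Conn ok s s := Relation.ReflTransGen.refl

lemma trans (h : Conn ok s t) (h' : Conn ok t u) : Conn ok s u := Relation.ReflTransGen.trans h h'

lemma step {e : T.Dart} (h : ok e) : Conn ok (leftVertex e.symm) (leftVertex e) :=
  Relation.ReflTransGen.single ⟨e, h, rfl, rfl⟩

lemma mono (h : Conn ok s t) (hok : ∀ e, ok e → ok' e) : Conn ok' s t := by
  induction h with
  | refl => exact refl _ _
  | tail _ h ih =>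
    obtain ⟨e, he, rfl, rfl⟩ := h
    exact ih.trans (step (hok e he))

lemma symm (hok : ∀ e, ok e → ok e.symm) (h : Conn ok s t) : Conn ok t s := by
  induction h with
  | refl => exact refl _ _
  | tail _ h ih =>
    obtain ⟨e, he, rfl, rfl⟩ := h
    have := step (ok := ok) (hok e he)
    rw [SimpleGraph.Dart.symm_symm] at this
    exact this.trans ih

lemma induct {P : HexVertex → Prop} (h : Conn ok s t) (hs : P s)
    (hstep : ∀ e, ok e → P (leftVertex e.symm) → P (leftVertex e)) : P t := by
  induction h with
  | refl => exact hs
  | tail _ h ih =>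
    obtain ⟨e, he, rfl, rfl⟩ := h
    exact hstep e he ih

lemma eq_of (h : Conn ok s t) {n : HexVertex → ℤ}
    (hn : ∀ e, ok e → n (leftVertex e) = n (leftVertex e.symm)) : n t = n s :=
  h.induct (P := fun t => n t = n s) rfl fun e he h => (hn e he).trans h

/-- Turning counterclockwise around a site. -/
lemma around {e : T.Dart} {l : ℕ} (h : ∀ i, 0 < i → i < l → ok (turn^[i] e)) (hl : 0 < l) :
    Conn ok (leftVertex e) (leftVertex (turn^[l] e).symm) := by
  induction l with
  | zero => omega
  | succ l ih =>
    rw [Function.iterate_succ_apply', rightVertex_turn]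
    rcases Nat.eq_zero_or_pos l with rfl | hl'
    · exact refl _ _
    · exact (ih (fun i h1 h2 => h i h1 (by omega)) hl').trans (step (h l hl' (by omega)))

/-- The corners of the hexagon around `v` between two different sides. -/
lemma between {e d : T.Dart} (hed : d.fst = e.fst) (hne : d ≠ e)
    (h : ∀ c : T.Dart, c.fst = e.fst → c ≠ e → c ≠ d → ok c) :
    Conn ok (leftVertex e) (leftVertex d.symm) := by
  obtain ⟨l, hl, rfl⟩ := exists_turn hed
  have hl0 : 0 < l := Nat.pos_of_ne_zero fun h0 => hne (by rw [h0]; rfl)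
  refine around (fun i h1 h2 => h _ (turn_iterate_fst e i) (fun h3 => ?_) fun h3 => ?_) hl0
  · have := turn_iterate_injOn e (by omega) (by norm_num) (show turn^[i] e = turn^[0] e from h3)
    omega
  · have := turn_iterate_injOn e (by omega) hl h3
    omega

/-- All corners of the hexagon around a site are joined along its boundary. -/
lemma hexagon {v : Site} (hs : v ∈ s.1) (ht : v ∈ t.1) (h : ∀ e : T.Dart, e.fst = v → ok e) :
    Conn ok s t := by
  obtain ⟨e, he, rfl⟩ := exists_dart_of_mem hs
  obtain ⟨d, hd, rfl⟩ := exists_dart_of_mem ht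
  obtain ⟨i, hi, rfl⟩ := exists_turn (hd.trans he.symm)
  clear ht hd
  induction i with
  | zero => exact refl _ _
  | succ i ih =>
    refine (ih (by omega)).trans ?_
    have := step (ok := ok) (h (turn^[i + 1] e) ((turn_iterate_fst e _).trans he))
    rw [Function.iterate_succ_apply', rightVertex_turn] at this
    rwa [Function.iterate_succ_apply']

end Conn

/-- The total increment of a function around a hexagon vanishes. -/
lemma sum_turn_eq_zero {A : Type*} [AddCommGroup A] (f : HexVertex → A) (e : T.Dart) :
    ∑ i ∈ Finset.range 6, (f (leftVertex (turn^[i] e)) - f (leftVertex (turn^[i] e).symm)) = 0 := by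
  have h1 : ∀ i, leftVertex (turn^[i] e) = leftVertex (turn^[i + 1] e).symm := fun i => by
    rw [Function.iterate_succ_apply', rightVertex_turn]
  simp only [h1]
  rw [Finset.sum_range_sub (fun i => f (leftVertex (turn^[i] e).symm)), turn_iterate_six]
  simp

/-! ### Combinatorial discrete domains -/

/-- The combinatorial content of a three-marked discrete domain: the finite set `F` of hexagons and
the sides `β k` of the boundary in counterclockwise order, each encoded as the oriented edge of `T`
that crosses it outwards. The `i`-th marked point is the vertex at which the side `β (M i)`
starts; `mark` says that only one hexagon of the domain is incident to it. Indices are extended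
periodically. -/
structure DDom where
  F : Finset Site
  N : ℕ
  β : ℤ → T.Dart
  M : ℤ → ℤ
  β_add : ∀ k, β (k + N) = β k
  β_fst : ∀ k, (β k).fst ∈ F
  β_snd : ∀ k, (β k).snd ∉ F
  β_left : ∀ k, leftVertex (β (k + 1)).symm = leftVertex (β k)
  β_inj : ∀ k l, β k = β l → (N : ℤ) ∣ k - l
  β_surj : ∀ d : T.Dart, d.fst ∈ F → d.snd ∉ F → ∃ k, β k = d
  M_lt : ∀ i, M i < M (i + 1)
  M_add : ∀ i, M (i + 3) = M i + N
  mark : ∀ i, (β (M i - 1)).fst = (β (M i)).fst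

namespace DDom

variable (D : DDom)

/-- The vertex of the boundary at which the side `β k` starts. -/
def vert (k : ℤ) : HexVertex := leftVertex (D.β k).symm

/-- The sides of the `j`-th boundary arc. -/
def arcDart (j : ℤ) : Set T.Dart := {e | ∃ k, D.M j ≤ k ∧ k < D.M (j + 1) ∧ D.β k = e}

/-- The vertices of the `j`-th boundary arc. -/
def arcVert (j : ℤ) : Set HexVertex := {t | ∃ k, D.M j ≤ k ∧ k ≤ D.M (j + 1) ∧ D.vert k = t}

/-- The edges of `T` whose dual is a side of a hexagon of the domain. -/
def Inner (e : T.Dart) : Prop := e.fst ∈ D.F ∨ e.snd ∈ D.F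

variable {D}

lemma vert_succ (k : ℤ) : D.vert (k + 1) = leftVertex (D.β k) := D.β_left k

lemma left_pred (k : ℤ) : leftVertex (D.β (k - 1)) = D.vert k := by
  rw [← vert_succ, sub_add_cancel]

lemma β_add_mul (k m : ℤ) : D.β (k + m * D.N) = D.β k := by
  induction m with
  | zero => simp
  | succ m ih => rw [← ih, add_mul, one_mul, ← add_assoc, D.β_add]
  | pred m ih => rw [← ih, ← D.β_add (k + (-(m : ℤ) - 1) * D.N)]; congr 1; ring

lemma β_eq_of_dvd {k l : ℤ} (h : (D.N : ℤ) ∣ k - l) : D.β k = D.β l := by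
  obtain ⟨m, hm⟩ := h
  rw [show k = l + m * D.N by linarith, β_add_mul]

lemma vert_add (k : ℤ) : D.vert (k + D.N) = D.vert k := by
  rw [vert, vert, D.β_add]

/-- Only one outgoing side of the boundary has a given triangle on its left, so that a side with the
endpoint of `β k` as its endpoint is `β k`. -/
lemma eq_β_of_left {d : T.Dart} (h1 : d.fst ∈ D.F) (h2 : d.snd ∉ D.F) {k : ℤ}
    (h : leftVertex d = D.vert (k + 1)) : d = D.β k := by
  rw [vert_succ] at h
  rcases leftVertex_eq_iff.1 h with h | h | h
  · exact h
  · rw [(dart_eq_iff.1 h).1] at h1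
    exact absurd h1 (D.β_snd k)
  · exact absurd (D.β_fst k) (by
      have : d.snd = (D.β k).fst := by rw [h]; exact apex_cyc _
      rwa [← this])

lemma eq_β_of_right {d : T.Dart} (h1 : d.fst ∈ D.F) (h2 : d.snd ∉ D.F) {k : ℤ}
    (h : leftVertex d.symm = D.vert k) : d = D.β k := by
  have hk1 := D.β_fst k
  have hk2 := D.β_snd k
  rcases leftVertex_eq_iff.1 (show leftVertex d.symm = leftVertex (D.β k).symm from h) with h | h | h
  · exact SimpleGraph.Dart.symm_involutive.injective h
  · refine absurd ?_ h2
    rw [show d.snd = (D.β k).fst from (dart_eq_iff.1 h).1]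
    exact hk1
  · refine absurd h1 ?_
    rw [show d.fst = (D.β k).snd from (dart_eq_iff.1 h).2.trans (apex_cyc _)]
    exact hk2

/-- The sites outside `F` along the boundary are joined outside `F`. -/
lemma joined_outside (k : ℤ) (n : ℕ) :
    Joined {v | v ∉ D.F} (D.β k).snd (D.β (k + n)).snd := by
  induction n with
  | zero => simpa using Joined.refl (S := {v | v ∉ D.F}) (D.β_snd k)
  | succ n ih =>
    rw [Nat.cast_succ, ← add_assoc]
    have h1 := D.β_fst (k + n + 1)
    have h2 := D.β_snd (k + n)
    rcases rightVertex_eq_iff.1 (D.β_left (k + n)) with h | h | h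
    · rw [h] at h1; exact absurd h1 h2
    · rw [h]; exact ih
    · refine ih.tail (D.β_snd _) ?_
      rw [h]
      exact (cyc (D.β (k + n))).adj

lemma count_eq_zero_of_notMem_support {u v : Site} (p : T.Walk u v) (e : T.Dart)
    (h : e.fst ∉ p.support ∨ e.snd ∉ p.support) : p.darts.count e = 0 := by
  rw [List.count_eq_zero]
  intro he
  rcases h with h | h
  · exact h (p.dart_fst_mem_support_of_mem_darts he)
  · exact h (p.dart_snd_mem_support_of_mem_darts he)

/-- A path of hexagons through the domain, entering through the side `β k` and leaving through
`β l`, has a potential: a function on the vertices that increases by `1` when the path is crossed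
from right to left. It is obtained by closing the path outside the domain. -/
theorem exists_crossPotential {k l : ℤ} (hkl : k < l) (hlk : l < k + D.N)
    (p : T.Walk (D.β k).fst (D.β l).fst) (hp : ∀ x ∈ p.support, x ∈ D.F) :
    ∃ n : HexVertex → ℤ,
      (∀ e : T.Dart, e.fst ∈ D.F → n (leftVertex e) - n (leftVertex e.symm) =
        passages p.darts e + (if e = D.β l then 1 else 0) - (if e = D.β k then 1 else 0)) ∧
      (∀ i, k < i → i ≤ l → n (D.vert i) = 0) ∧
      ∀ i, l < i → i ≤ k + D.N → n (D.vert i) = 1 := by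
  obtain ⟨q, hq⟩ : Joined {v | v ∉ D.F} (D.β l).snd (D.β k).snd := by
    have := joined_outside (D := D) l (k + D.N - l).toNat
    rwa [Int.toNat_of_nonneg (by omega), add_sub_cancel, D.β_add] at this
  -- The path is closed by a path outside of the domain.
  let W : T.Walk (D.β k).fst (D.β k).fst :=
    p.append (.cons (D.β l).adj (q.append (.cons (D.β k).symm.adj .nil)))
  have hW : W.darts = p.darts ++ D.β l :: (q.darts ++ [(D.β k).symm]) := by
    simp only [W, SimpleGraph.Walk.darts_append, SimpleGraph.Walk.darts_cons]
    rfl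
  have key : ∀ e : T.Dart, e.fst ∈ D.F → passages W.darts e =
      passages p.darts e + (if e = D.β l then 1 else 0) - (if e = D.β k then 1 else 0) := by
    intro e he
    have h1 : q.darts.count e = 0 :=
      count_eq_zero_of_notMem_support q e (.inl fun h => hq _ h he)
    have h2 : q.darts.count e.symm = 0 :=
      count_eq_zero_of_notMem_support q e.symm (.inr fun h => hq _ h he)
    have h3 : (D.β k).symm ≠ e := fun h => D.β_snd k (by
      have := (dart_eq_iff.1 h).1
      rw [symm_fst] at this
      rwa [this])
    have h4 : D.β l ≠ e.symm := fun h => D.β_snd l (by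
      have := (dart_eq_iff.1 h).2
      rw [symm_snd] at this
      rwa [this])
    have h5 : ((D.β k).symm = e.symm) = (e = D.β k) := by
      rw [SimpleGraph.Dart.symm_involutive.injective.eq_iff]; exact propext eq_comm
    simp only [passages, hW, List.count_append, List.count_cons, List.count_nil, h1, h2, beq_iff_eq,
      h3, h4, h5, if_false, @eq_comm _ (D.β l) e]
    push_cast
    ring
  -- The winding number of the closed path, normalized to vanish after `β k`.
  set n : HexVertex → ℤ := fun t => winding W.darts t - winding W.darts (D.vert (k + 1)) with hn
  have hj : ∀ e : T.Dart, e.fst ∈ D.F → n (leftVertex e) - n (leftVertex e.symm) =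
      passages p.darts e + (if e = D.β l then 1 else 0) - (if e = D.β k then 1 else 0) := by
    intro e he
    rw [← key e he, ← winding_jump]
    simp only [hn]; ring
  have hb : ∀ i, n (D.vert (i + 1)) - n (D.vert i) =
      (if D.β i = D.β l then 1 else 0) - (if D.β i = D.β k then 1 else 0) := by
    intro i
    rw [vert_succ, vert, hj _ (D.β_fst i), passages,
      count_eq_zero_of_notMem_support p _ (.inr fun h => D.β_snd i (hp _ h)),
      count_eq_zero_of_notMem_support p _ (.inl fun h => D.β_snd i (hp _ h))]
    simp
  have hmod : ∀ a b : ℤ, a < b → b < a + D.N → D.β b ≠ D.β a := by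
    intro a b h1 h2 h3
    have := Int.le_of_dvd (by omega) (D.β_inj _ _ h3)
    omega
  have h0 : ∀ m : ℕ, k + 1 + m ≤ l → n (D.vert (k + 1 + m)) = 0 := by
    intro m
    induction m with
    | zero => intro _; simp [hn]
    | succ m ih =>
      intro hm
      push_cast at hm ⊢
      have := hb (k + 1 + m)
      rw [if_neg (hmod _ _ (by omega) (by omega)).symm, if_neg (hmod _ _ (by omega) (by omega)),
        ih (by omega)] at this
      rw [← add_assoc]
      omega
  have h1 : ∀ m : ℕ, l + 1 + m ≤ k + D.N → n (D.vert (l + 1 + m)) = 1 := by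
    intro m
    induction m with
    | zero =>
      intro _
      have := hb l
      have h3 := h0 (l - k - 1).toNat (by omega)
      rw [Int.toNat_of_nonneg (by omega), show k + 1 + (l - k - 1) = l by ring] at h3
      rw [if_pos rfl, if_neg (hmod _ _ hkl hlk)] at this
      simp
      omega
    | succ m ih =>
      intro hm
      push_cast at hm ⊢
      have := hb (l + 1 + m)
      rw [if_neg (hmod _ _ (by omega) (by omega)), if_neg (hmod _ _ (by omega) (by omega)),
        ih (by omega)] at this
      rw [← add_assoc]
      omega
  refine ⟨n, hj, fun i hi hi' => ?_, fun i hi hi' => ?_⟩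
  · have := h0 (i - k - 1).toNat (by omega)
    rwa [Int.toNat_of_nonneg (by omega), show k + 1 + (i - k - 1) = i by ring] at this
  · have := h1 (i - l - 1).toNat (by omega)
    rwa [Int.toNat_of_nonneg (by omega), show l + 1 + (i - l - 1) = i by ring] at this

end DDom

namespace DDom

variable {D : DDom}

/-! ### Separating paths -/

/-- The dual of `e` is not crossed by the path `γ` that enters through the side `β k` and leaves
through the side `β l`. -/
def Off (D : DDom) {u v : Site} (γ : T.Walk u v) (k l : ℤ) (e : T.Dart) : Prop :=
  e ∉ γ.darts ∧ e.symm ∉ γ.darts ∧ e ≠ D.β k ∧ e.symm ≠ D.β k ∧ e ≠ D.β l ∧ e.symm ≠ D.β l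

/-- The event that a simple blue path from the arc `j - 1` to the arc `j + 1` separates `z` from
the arc `j`. -/
def sep (D : DDom) (j : ℤ) (z : HexVertex) : Set Config :=
  {ω | ∃ k l, D.M (j - 1) ≤ k ∧ k < D.M j ∧ D.M (j + 1) ≤ l ∧ l < D.M (j + 2) ∧
    ∃ γ : T.Walk (D.β k).fst (D.β l).fst, γ.IsPath ∧ (∀ x ∈ γ.support, x ∈ D.F ∧ ω x = true) ∧
      ∀ t ∈ D.arcVert j, ¬ Conn (fun e => D.Inner e ∧ D.Off γ k l e) z t}

/-- The dual of `e` is a side of a yellow hexagon of the domain. -/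
def yellowSide (D : DDom) (ω : Config) (e : T.Dart) : Prop :=
  (e.fst ∈ D.F ∧ ω e.fst = false) ∨ (e.snd ∈ D.F ∧ ω e.snd = false)

/-- The vertices joined to the arc `j` along sides of yellow hexagons. -/
def below (D : DDom) (ω : Config) (j : ℤ) : Set HexVertex :=
  {t | ∃ s ∈ D.arcVert j, Conn (D.yellowSide ω) s t}

lemma Inner.symm {e : T.Dart} (h : D.Inner e) : D.Inner e.symm := Or.symm h

lemma yellowSide.symm {ω : Config} {e : T.Dart} (h : D.yellowSide ω e) : D.yellowSide ω e.symm :=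
  Or.symm h

lemma yellowSide.inner {ω : Config} {e : T.Dart} (h : D.yellowSide ω e) : D.Inner e :=
  h.imp And.left And.left

lemma Off.symm {u v : Site} {γ : T.Walk u v} {k l : ℤ} {e : T.Dart} (h : D.Off γ k l e) :
    D.Off γ k l e.symm := by
  unfold Off at *
  rw [SimpleGraph.Dart.symm_symm]
  tauto

/-- The sides of yellow hexagons are not crossed by a blue path. -/
lemma yellowSide.off {ω : Config} {k l : ℤ} {γ : T.Walk (D.β k).fst (D.β l).fst}
    (hγ : ∀ x ∈ γ.support, x ∈ D.F ∧ ω x = true) {e : T.Dart} (h : D.yellowSide ω e) :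
    D.Off γ k l e := by
  have key : ∀ e : T.Dart, D.yellowSide ω e → e ∉ γ.darts ∧ e ≠ D.β k ∧ e ≠ D.β l := by
    intro e h
    refine ⟨fun he => ?_, fun he => ?_, fun he => ?_⟩
    · have h1 := (hγ _ (γ.dart_fst_mem_support_of_mem_darts he)).2
      have h2 := (hγ _ (γ.dart_snd_mem_support_of_mem_darts he)).2
      rcases h with h | h
      · rw [h1] at h; exact Bool.noConfusion h.2
      · rw [h2] at h; exact Bool.noConfusion h.2
    · subst he
      rcases h with h | h
      · rw [(hγ _ γ.start_mem_support).2] at h; exact Bool.noConfusion h.2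
      · exact D.β_snd k h.1
    · subst he
      rcases h with h | h
      · rw [(hγ _ γ.end_mem_support).2] at h; exact Bool.noConfusion h.2
      · exact D.β_snd l h.1
  obtain ⟨h1, h2, h3⟩ := key e h
  obtain ⟨h4, h5, h6⟩ := key e.symm h.symm
  exact ⟨h1, h4, h2, h5, h3, h6⟩

/-- The potential of a path changes only across the path. -/
lemma pot_eq_of_off {k l : ℤ} {γ : T.Walk (D.β k).fst (D.β l).fst} {n : HexVertex → ℤ}
    (hn : ∀ e : T.Dart, e.fst ∈ D.F → n (leftVertex e) - n (leftVertex e.symm) =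
        passages γ.darts e + (if e = D.β l then 1 else 0) - (if e = D.β k then 1 else 0))
    {e : T.Dart} (hi : D.Inner e) (ho : D.Off γ k l e) :
    n (leftVertex e) = n (leftVertex e.symm) := by
  obtain ⟨h1, h2, h3, h4, h5, h6⟩ := ho
  rcases hi with h | h
  · have := hn e h
    rw [passages, List.count_eq_zero.2 h1, List.count_eq_zero.2 h2, if_neg h3, if_neg h5] at this
    simp at this; linarith
  · have := hn e.symm h
    rw [passages, SimpleGraph.Dart.symm_symm, List.count_eq_zero.2 h1, List.count_eq_zero.2 h2,
      if_neg h4, if_neg h6] at this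
    simp at this; linarith

lemma M_mono (D : DDom) : StrictMono D.M := strictMono_int_of_lt_succ D.M_lt

lemma M_add_two (D : DDom) (j : ℤ) : D.M (j + 2) = D.M (j - 1) + D.N := by
  rw [← D.M_add, show j - 1 + 3 = j + 2 by ring]

lemma β_ne {a b : ℤ} (h1 : a < b) (h2 : b < a + D.N) : D.β a ≠ D.β b := fun h => by
  have := Int.le_of_dvd (by omega) (D.β_inj _ _ h.symm)
  omega

lemma β_symm_ne (k l : ℤ) : (D.β k).symm ≠ D.β l := fun h => by
  have h1 := D.β_fst k
  have h2 := (dart_eq_iff.1 h).2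
  rw [symm_snd] at h2
  exact D.β_snd l (h2 ▸ h1)

lemma notMem_darts_β {u v : Site} {γ : T.Walk u v} (hγ : ∀ x ∈ γ.support, x ∈ D.F) (i : ℤ) :
    D.β i ∉ γ.darts ∧ (D.β i).symm ∉ γ.darts :=
  ⟨fun h => D.β_snd i (hγ _ (γ.dart_snd_mem_support_of_mem_darts h)),
    fun h => D.β_snd i (hγ _ (γ.dart_fst_mem_support_of_mem_darts h))⟩

/-- Vertices of the boundary are joined along the boundary. -/
lemma conn_boundary {ok : T.Dart → Prop} {a b : ℤ} (hab : a ≤ b)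
    (h : ∀ i, a ≤ i → i < b → ok (D.β i)) : Conn ok (D.vert a) (D.vert b) := by
  obtain ⟨m, rfl⟩ := Int.le.dest hab
  clear hab
  induction m with
  | zero => simpa using Conn.refl ok (D.vert a)
  | succ m ih =>
    push_cast at h ⊢
    rw [← add_assoc] at h ⊢
    refine (ih fun i h1 h2 => h i h1 (by omega)).trans ?_
    rw [vert_succ]
    exact Conn.step (h _ (by omega) (by omega))

/-- Along a simple path the vertices on its left are joined to each other without crossing the path,
and so are the vertices on its right. -/
lemma conn_sides {ok : T.Dart → Prop} {u v : Site} (p : T.Walk u v) (hp : p.IsPath) (d : T.Dart)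
    (hd : d.snd = u) (hd' : d.fst ∉ p.support)
    (hok : ∀ c : T.Dart, c.fst ∈ p.support → c.fst ≠ v → c ∉ p.darts → c.symm ∉ p.darts →
      c ≠ d.symm → ok c) :
    ∀ e ∈ p.darts, Conn ok (leftVertex d.symm) (leftVertex e.symm) ∧
      Conn ok (leftVertex e) (leftVertex d) := by
  induction p generalizing d with
  | nil => simp
  | @cons u u' v hadj p ih =>
    rw [SimpleGraph.Walk.cons_isPath_iff] at hp
    have hvu : v ≠ u := fun h => hp.2 (h ▸ p.end_mem_support)
    rw [SimpleGraph.Walk.support_cons, List.mem_cons, not_or] at hd'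
    let a : T.Dart := ⟨(u, u'), hadj⟩
    have hne : a ≠ d.symm := fun h => hd'.2 (by
      have : u' = d.fst := (dart_eq_iff.1 h).2
      rw [← this]; exact p.start_mem_support)
    have hmid : ∀ c : T.Dart, c.fst = u → c ≠ a → c ≠ d.symm → ok c := by
      intro c h1 h2 h3
      refine hok c (by simp [h1]) (by rw [h1]; exact hvu.symm) ?_ ?_ h3
      · rw [SimpleGraph.Walk.darts_cons, List.mem_cons, not_or]
        exact ⟨h2, fun h => hp.2 (h1 ▸ p.dart_fst_mem_support_of_mem_darts h)⟩
      · rw [SimpleGraph.Walk.darts_cons, List.mem_cons, not_or]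
        refine ⟨fun h => hadj.ne ?_, fun h => hp.2 (h1 ▸ p.dart_snd_mem_support_of_mem_darts h)⟩
        have := (dart_eq_iff.1 h).2
        exact h1.symm.trans this
    have hr : Conn ok (leftVertex d.symm) (leftVertex a.symm) :=
      Conn.between (e := d.symm) (d := a) (by simp [a, hd]) hne
        fun c h1 h2 h3 => hmid c (h1.trans hd) h3 h2
    have hl : Conn ok (leftVertex a) (leftVertex d) :=
      Conn.between (e := a) (d := d.symm) (by simp [a, hd]) hne.symm
        fun c h1 h2 h3 => hmid c h1 h2 h3
    intro e he
    rw [SimpleGraph.Walk.darts_cons, List.mem_cons] at he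
    rcases he with rfl | he
    · exact ⟨hr, hl⟩
    have := ih hp.1 a rfl hp.2 (fun c h1 h2 h3 h4 h5 => by
      have hcu : c.fst ≠ u := fun h => hp.2 (h ▸ h1)
      refine hok c (by simp [h1]) h2 ?_ ?_ fun h => hcu (by rw [h]; exact hd)
      · rw [SimpleGraph.Walk.darts_cons, List.mem_cons, not_or]
        exact ⟨fun h => hcu (dart_eq_iff.1 h).1, h3⟩
      · rw [SimpleGraph.Walk.darts_cons, List.mem_cons, not_or]
        exact ⟨fun h => h5 (by rw [← SimpleGraph.Dart.symm_symm c, h]), h4⟩) e he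
    exact ⟨hr.trans this.1, this.2.trans hl⟩

/-- A path with a potential that differs from its value on the arc `j` at `z` separates `z`. -/
lemma mem_sep_of_pot {ω : Config} {j k l : ℤ} (h1 : D.M (j - 1) ≤ k) (h2 : k < D.M j)
    (h3 : D.M (j + 1) ≤ l) (h4 : l < D.M (j + 2)) {γ : T.Walk (D.β k).fst (D.β l).fst}
    (hp : γ.IsPath) (hγ : ∀ x ∈ γ.support, x ∈ D.F ∧ ω x = true) {n : HexVertex → ℤ}
    (hn : ∀ e : T.Dart, e.fst ∈ D.F → n (leftVertex e) - n (leftVertex e.symm) =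
        passages γ.darts e + (if e = D.β l then 1 else 0) - (if e = D.β k then 1 else 0))
    (h0 : ∀ i, k < i → i ≤ l → n (D.vert i) = 0) {z : HexVertex} (hz : n z ≠ 0) :
    ω ∈ D.sep j z := by
  refine ⟨k, l, h1, h2, h3, h4, γ, hp, hγ, ?_⟩
  rintro t ⟨i, hi1, hi2, rfl⟩ h
  refine hz ?_
  rw [← h.eq_of (n := n) fun e he => pot_eq_of_off hn he.1 he.2]
  exact h0 i (by omega) (by omega)

/-! ### The flow around a set of vertices -/

/-- A reference oriented edge at each site. -/
def baseDart (x : Site) : T.Dart := ⟨(x, x + (1, 0)), by rw [adj_iff]; left; ext <;> simp⟩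

/-- The oriented edges of `T` starting in `X`. -/
def star (X : Finset Site) : Finset T.Dart :=
  X.biUnion fun x => (Finset.range 6).image fun i => turn^[i] (baseDart x)

lemma mem_star {X : Finset Site} {e : T.Dart} : e ∈ star X ↔ e.fst ∈ X := by
  simp only [star, Finset.mem_biUnion, Finset.mem_image, Finset.mem_range]
  constructor
  · rintro ⟨x, hx, i, -, rfl⟩
    rwa [turn_iterate_fst]
  · intro h
    obtain ⟨i, hi, h2⟩ := exists_turn (e := baseDart e.fst) (d := e) rfl
    exact ⟨_, h, i, hi, h2⟩

lemma sum_star {R : Type*} [AddCommMonoid R] (X : Finset Site) (f : T.Dart → R) :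
    ∑ e ∈ star X, f e = ∑ x ∈ X, ∑ i ∈ Finset.range 6, f (turn^[i] (baseDart x)) := by
  rw [star, Finset.sum_biUnion]
  · refine Finset.sum_congr rfl fun x _ => ?_
    rw [Finset.sum_image]
    intro i hi j hj h
    simp only [Finset.coe_range, Set.mem_Iio] at hi hj
    exact turn_iterate_injOn _ hi hj h
  · intro x _ y _ hxy
    rw [Function.onFun, Finset.disjoint_left]
    intro e h1 h2
    obtain ⟨i, -, rfl⟩ := Finset.mem_image.1 h1
    obtain ⟨i', -, h⟩ := Finset.mem_image.1 h2
    have := (dart_eq_iff.1 h).1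
    rw [turn_iterate_fst, turn_iterate_fst] at this
    exact hxy this.symm

lemma sum_star_eq_zero (X : Finset Site) (f : HexVertex → ℤ) :
    ∑ e ∈ star X, (f (leftVertex e) - f (leftVertex e.symm)) = 0 := by
  rw [sum_star]
  exact Finset.sum_eq_zero fun x _ => sum_turn_eq_zero f _

/-- In the sum of an antisymmetric function over the oriented edges that start in `X`, only the
edges that leave `X` contribute. -/
lemma sum_boundary {R : Type*} [AddCommGroup R] (X : Finset Site) {f : T.Dart → R}
    (hf : ∀ e, f e.symm = -f e) :
    ∑ e ∈ (star X).filter (fun e => e.snd ∉ X), f e = ∑ e ∈ star X, f e := by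
  rw [← Finset.sum_filter_add_sum_filter_not (star X) fun e => e.snd ∉ X, left_eq_add]
  refine Finset.sum_involution (fun e _ => e.symm) ?_ ?_ ?_ ?_
  · intro e _
    rw [hf, add_neg_cancel]
  · intro e _ _ h
    exact fst_ne_snd e (dart_eq_iff.1 h).2
  · intro e he
    simp only [Finset.mem_filter, mem_star, not_not, symm_fst, symm_snd] at he ⊢
    exact he.symm
  · intro e _
    exact SimpleGraph.Dart.symm_symm e

/-- The total flow out of a set `R` of hexagons vanishes. -/
lemma sum_boundary_eq (R : Finset Site) (f : HexVertex → ℤ) :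
    ∑ e ∈ (star R).filter (fun e => e.snd ∉ R), (f (leftVertex e) - f (leftVertex e.symm)) = 0 := by
  rw [sum_boundary (f := fun e => f (leftVertex e) - f (leftVertex e.symm)), sum_star_eq_zero]
  intro e
  rw [SimpleGraph.Dart.symm_symm, neg_sub]

/-- A sum over the sides of the domain is a sum over one period, here with the sides of hexagons in
`R` only. -/
lemma sum_outside {A : Type*} [AddCommMonoid A] (D : DDom) (R : Finset Site) (hR : R ⊆ D.F) (a : ℤ)
    (f : T.Dart → A) :
    ∑ e ∈ (star R).filter (fun e => e.snd ∉ D.F), f e =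
      ∑ k ∈ Finset.Ico a (a + D.N), if (D.β k).fst ∈ R then f (D.β k) else 0 := by
  rw [← Finset.sum_filter]
  symm
  refine Finset.sum_bij (fun k _ => D.β k) ?_ ?_ ?_ ?_
  · intro k hk
    simp only [Finset.mem_filter, mem_star] at hk ⊢
    exact ⟨hk.2, D.β_snd k⟩
  · intro k hk l hl h
    simp only [Finset.mem_filter, Finset.mem_Ico] at hk hl
    rcases lt_trichotomy k l with h' | h' | h'
    · exact absurd h (β_ne h' (by omega))
    · exact h'
    · exact absurd h.symm (β_ne h' (by omega))
  · intro e he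
    simp only [Finset.mem_filter, mem_star] at he
    obtain ⟨k, rfl⟩ := D.β_surj e (hR he.1) he.2
    have hN : 0 < (D.N : ℤ) := by
      have := D.M_add 0
      have := D.M_mono (show (0 : ℤ) < 0 + 3 by norm_num)
      omega
    refine ⟨a + (k - a) % D.N, ?_, ?_⟩
    · have e1 : D.β (a + (k - a) % D.N) = D.β k := by
        refine β_eq_of_dvd ⟨-((k - a) / D.N), ?_⟩
        have := Int.emod_add_mul_ediv (k - a) D.N
        linarith
      simp only [Finset.mem_filter, Finset.mem_Ico, e1]
      have := Int.emod_nonneg (k - a) hN.ne'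
      have := Int.emod_lt_of_pos (k - a) hN
      exact ⟨⟨by omega, by omega⟩, he.1⟩
    · refine β_eq_of_dvd ⟨-((k - a) / D.N), ?_⟩
      have := Int.emod_add_mul_ediv (k - a) D.N
      linarith
  · exact fun k _ => rfl

lemma sum_outside_eq (D : DDom) (R : Finset Site) (hR : R ⊆ D.F) (a : ℤ) (f : HexVertex → ℤ) :
    ∑ e ∈ (star R).filter (fun e => e.snd ∉ D.F), (f (leftVertex e) - f (leftVertex e.symm)) =
      ∑ k ∈ Finset.Ico a (a + D.N), if (D.β k).fst ∈ R then f (D.vert (k + 1)) - f (D.vert k)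
        else 0 := by
  rw [sum_outside D R hR a fun e => f (leftVertex e) - f (leftVertex e.symm)]
  exact Finset.sum_congr rfl fun k _ => by rw [vert_succ]; rfl

end DDom

namespace DDom

variable {D : DDom}

/-- The oriented edges with `K` on their left but not on their right. -/
def Rim (D : DDom) (K : Set HexVertex) (e : T.Dart) : Prop :=
  D.Inner e ∧ leftVertex e ∈ K ∧ leftVertex e.symm ∉ K

/-- If a set `K` of vertices contains the beginning of the arc `j - 1` but no vertex of the
arc `j`, then one can walk along its rim from the arc `j - 1` to the arc `j + 1`: the rim carries a
flow of which the net amount `1` enters through the arc `j - 1`. -/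
lemma exists_rim_walk (K : Set HexVertex) (j : ℤ) (h1 : D.vert (D.M (j - 1)) ∈ K)
    (h2 : ∀ t ∈ D.arcVert j, t ∉ K) :
    ∃ k l, D.M (j - 1) ≤ k ∧ k < D.M j ∧ D.M (j + 1) ≤ l ∧ l < D.M (j + 2) ∧
      D.Rim K (D.β k).symm ∧ D.Rim K (D.β l) ∧
      ∃ γ : T.Walk (D.β k).fst (D.β l).fst, (∀ x ∈ γ.support, x ∈ D.F) ∧
        ∀ e ∈ γ.darts, D.Rim K e := by
  classical
  let κ : HexVertex → ℤ := fun t => if t ∈ K then 1 else 0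
  have κ1 : ∀ t ∈ K, κ t = 1 := fun t ht => if_pos ht
  have κ0 : ∀ t, t ∉ K → κ t = 0 := fun t ht => if_neg ht
  have κr : ∀ t, 0 ≤ κ t ∧ κ t ≤ 1 := fun t => by
    by_cases h : t ∈ K
    · rw [κ1 t h]; omega
    · rw [κ0 t h]; omega
  let entry : ℤ → Prop := fun k => D.M (j - 1) ≤ k ∧ k < D.M j ∧ D.vert k ∈ K ∧ D.vert (k + 1) ∉ K
  let Reach : Site → Prop := fun y => ∃ k, entry k ∧ ∃ γ : T.Walk (D.β k).fst y,
    (∀ x ∈ γ.support, x ∈ D.F) ∧ ∀ e ∈ γ.darts, D.Rim K e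
  -- Otherwise the flow that enters through the arc `j - 1` cannot leave the set `R` of hexagons
  -- that it reaches. The total flow out of `R` vanishes; but no flow leaves into the rest of the
  -- domain (`hin`) or through the arc `j + 1` (`hexit`), while the flow through the arc `j - 1` is
  -- negative (`hbd`).
  by_contra hcon
  have hexit : ∀ l, D.M (j + 1) ≤ l → l < D.M (j + 2) → Reach (D.β l).fst →
      κ (D.vert (l + 1)) - κ (D.vert l) ≤ 0 := by
    rintro l hl1 hl2 ⟨k, ⟨hk1, hk2, hk3, hk4⟩, γ, hγ1, hγ2⟩
    by_contra hpos
    have hv1 : D.vert (l + 1) ∈ K := by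
      by_contra h
      have := κ0 _ h
      have := (κr (D.vert l)).1
      omega
    have hv2 : D.vert l ∉ K := by
      intro h
      have := κ1 _ h
      have := (κr (D.vert (l + 1))).2
      omega
    rw [vert_succ] at hv1 hk4
    refine hcon ⟨k, l, hk1, hk2, hl1, hl2, ⟨.inr (D.β_fst k), hk3, ?_⟩, ⟨.inl (D.β_fst l), hv1, hv2⟩,
      γ, hγ1, hγ2⟩
    rwa [SimpleGraph.Dart.symm_symm]
  let R : Finset Site := D.F.filter Reach
  have hR : ∀ x, x ∈ R ↔ x ∈ D.F ∧ Reach x := fun x => Finset.mem_filter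
  have hM : D.M (j - 1) < D.M j := D.M_mono (by omega)
  have hM' : D.M j < D.M (j + 1) := D.M_mono (by omega)
  have hM2 := M_add_two D j
  have hM'' : D.M (j + 1) < D.M (j + 2) := D.M_mono (by omega)
  have hsum := sum_boundary_eq R κ
  rw [← Finset.sum_filter_add_sum_filter_not _ (fun e : T.Dart => e.snd ∈ D.F)] at hsum
  have hin : ∑ e ∈ ((star R).filter (fun e => e.snd ∉ R)).filter (fun e => e.snd ∈ D.F),
      (κ (leftVertex e) - κ (leftVertex e.symm)) ≤ 0 := by
    refine Finset.sum_nonpos fun e he => ?_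
    simp only [Finset.mem_filter, mem_star] at he
    obtain ⟨⟨he1, he2⟩, he3⟩ := he
    by_contra hpos
    have hv1 : leftVertex e ∈ K := by
      by_contra h
      have := κ0 _ h
      have := (κr (leftVertex e.symm)).1
      omega
    have hv2 : leftVertex e.symm ∉ K := by
      intro h
      have := κ1 _ h
      have := (κr (leftVertex e)).2
      omega
    obtain ⟨hF, k, hk, γ, hγ1, hγ2⟩ := (hR _).1 he1
    refine he2 ((hR _).2 ⟨he3, k, hk, γ.concat e.adj, fun x hx => ?_, fun d hd => ?_⟩)
    · rw [SimpleGraph.Walk.support_concat, List.mem_append, List.mem_singleton] at hx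
      rcases hx with hx | rfl
      exacts [hγ1 x hx, he3]
    · rw [SimpleGraph.Walk.darts_concat, List.concat_eq_append, List.mem_append,
        List.mem_singleton] at hd
      rcases hd with hd | rfl
      exacts [hγ2 d hd, ⟨.inl hF, hv1, hv2⟩]
  have hset : ((star R).filter (fun e => e.snd ∉ R)).filter (fun e => ¬ e.snd ∈ D.F) =
      (star R).filter (fun e => e.snd ∉ D.F) := by
    ext e
    simp only [Finset.mem_filter]
    have : e.snd ∉ D.F → e.snd ∉ R := fun h h' => h ((hR _).1 h').1
    tauto
  rw [hset, sum_outside_eq D R (Finset.filter_subset _ _) (D.M (j - 1))] at hsum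
  have hbd : ∑ k ∈ Finset.Ico (D.M (j - 1)) (D.M (j - 1) + D.N),
      (if (D.β k).fst ∈ R then κ (D.vert (k + 1)) - κ (D.vert k) else 0) ≤
      ∑ k ∈ Finset.Ico (D.M (j - 1)) (D.M (j - 1) + D.N),
        if k < D.M j then κ (D.vert (k + 1)) - κ (D.vert k) else 0 := by
    refine Finset.sum_le_sum fun k hk => ?_
    rw [Finset.mem_Ico] at hk
    by_cases hkj : k < D.M j
    · rw [if_pos hkj]
      split_ifs with hkR
      · exact le_rfl
      · by_contra hneg
        have hv1 : D.vert k ∈ K := by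
          by_contra h
          have := κ0 _ h
          have := (κr (D.vert (k + 1))).1
          omega
        have hv2 : D.vert (k + 1) ∉ K := by
          intro h
          have := κ1 _ h
          have := (κr (D.vert k)).2
          omega
        exact hkR ((hR _).2 ⟨D.β_fst k, k, ⟨hk.1, hkj, hv1, hv2⟩, .nil,
          by simpa using D.β_fst k, by simp⟩)
    · rw [if_neg hkj]
      split_ifs with hkR
      · by_cases hkj' : k < D.M (j + 1)
        · rw [κ0 _ (h2 _ ⟨k, by omega, by omega, rfl⟩),
            κ0 _ (h2 _ ⟨k + 1, by omega, by omega, rfl⟩)]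
          rfl
        · exact hexit k (by omega) (by omega) ((hR _).1 hkR).2
      · exact le_rfl
  have hfil : (∑ k ∈ Finset.Ico (D.M (j - 1)) (D.M (j - 1) + D.N),
      if k < D.M j then κ (D.vert (k + 1)) - κ (D.vert k) else 0) =
      ∑ k ∈ Finset.Ico (D.M (j - 1)) (D.M j), (κ (D.vert (k + 1)) - κ (D.vert k)) := by
    rw [← Finset.sum_filter]
    congr 1
    ext k
    simp only [Finset.mem_filter, Finset.mem_Ico]
    omega
  rw [hfil] at hbd
  have htel : ∀ m : ℕ, ∑ k ∈ Finset.Ico (D.M (j - 1)) (D.M (j - 1) + m),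
      (κ (D.vert (k + 1)) - κ (D.vert k)) = κ (D.vert (D.M (j - 1) + m)) - κ (D.vert (D.M (j - 1))) := by
    intro m
    induction m with
    | zero => simp
    | succ m ih =>
      rw [Nat.cast_succ, ← add_assoc, ← Finset.insert_Ico_right_eq_Ico_add_one (by omega),
        Finset.sum_insert (by simp), ih]
      ring
  have := htel (D.M j - D.M (j - 1)).toNat
  rw [Int.toNat_of_nonneg (by omega), add_sub_cancel, κ1 _ h1,
    κ0 _ (h2 _ ⟨D.M j, le_rfl, hM'.le, rfl⟩)] at this
  rw [this] at hbd
  omega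

/-- If `z` is separated from the arc `j` by no blue path, but its neighbour `w` is, then
the separating path passes between `z` and `w`, and `z` is joined to the arc `j` by sides of yellow
hexagons. Otherwise the rim of the component of `z` in the complement of `below` would be a
separating path. -/
theorem exists_arms_of_sep {ω : Config} {j : ℤ} {e₀ : T.Dart} (he : e₀.fst ∈ D.F)
    (he' : e₀.snd ∈ D.F) (hw : ω ∈ D.sep j (leftVertex e₀))
    (hz : ω ∉ D.sep j (leftVertex e₀.symm)) :
    leftVertex e₀.symm ∈ D.below ω j ∧
    ∃ k l, D.M (j - 1) ≤ k ∧ k < D.M j ∧ D.M (j + 1) ≤ l ∧ l < D.M (j + 2) ∧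
    ∃ γ : T.Walk (D.β k).fst (D.β l).fst, γ.IsPath ∧ (∀ x ∈ γ.support, x ∈ D.F ∧ ω x = true) ∧
      e₀ ∈ γ.darts := by
  obtain ⟨k, l, hk1, hk2, hl1, hl2, γ, hp, hγ, hsep⟩ := hw
  have hM' : D.M j < D.M (j + 1) := D.M_mono (by omega)
  have hM2 := M_add_two D j
  set ok : T.Dart → Prop := fun e => D.Inner e ∧ D.Off γ k l e with hok
  have oks : ∀ e, ok e → ok e.symm := fun e h => ⟨h.1.symm, h.2.symm⟩
  have okb : ∀ i, k - D.N < i → i < k + D.N → i ≠ k → l - D.N < i → i < l → ok (D.β i) := by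
    intro i h1 h2 h3 h4 h5
    refine ⟨.inl (D.β_fst i), (notMem_darts_β (fun x hx => (hγ x hx).1) i).1,
      (notMem_darts_β (fun x hx => (hγ x hx).1) i).2, ?_, β_symm_ne _ _, β_ne h5 (by omega),
      β_symm_ne _ _⟩
    rcases lt_or_gt_of_ne h3 with h | h
    · exact β_ne h (by omega)
    · exact (β_ne h (by omega)).symm
  -- The vertex `z` is joined to the arc `j` without crossing `γ`.
  obtain ⟨t, ht, hzt⟩ : ∃ t ∈ D.arcVert j, Conn ok (leftVertex e₀.symm) t := by
    by_contra! h
    exact hz ⟨k, l, hk1, hk2, hl1, hl2, γ, hp, hγ, h⟩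
  have hside := conn_sides (ok := ok) γ hp (D.β k).symm rfl
    (fun h => D.β_snd k (hγ _ h).1) (by
      intro c h1 h2 h3 h4 h5
      have hcF := (hγ _ h1).1
      refine ⟨.inl hcF, h3, h4, h5, fun h => ?_, fun h => h2 (dart_eq_iff.1 h).1, fun h => ?_⟩
      · exact D.β_snd k (by rw [← (dart_eq_iff.1 h).2]; exact hcF)
      · exact D.β_snd l (by rw [← (dart_eq_iff.1 h).2]; exact hcF))
  have hright : Conn ok (D.vert (k + 1)) (D.vert (D.M j)) :=
    conn_boundary (by omega) fun i h1 h2 => okb i (by omega) (by omega) (by omega) (by omega) (by omega)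
  -- If the path did not pass through `e₀` in this direction, then its end on the far side would
  -- still be joined to the arc `j`.
  have hmem : e₀ ∈ γ.darts := by
    by_contra h1
    by_cases h2 : e₀.symm ∈ γ.darts
    · have h3 := (hside _ h2).1
      rw [SimpleGraph.Dart.symm_symm, SimpleGraph.Dart.symm_symm, ← vert_succ] at h3
      exact hsep _ ⟨D.M j, le_rfl, hM'.le, rfl⟩ ((h3.symm oks).trans hright)
    · have h3 : ok e₀ := by
        refine ⟨.inl he, h1, h2, ?_, ?_, ?_, ?_⟩
        · rintro rfl; exact D.β_snd k he'
        · intro h; exact D.β_snd k (by rw [← (dart_eq_iff.1 h).2]; exact he)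
        · rintro rfl; exact D.β_snd l he'
        · intro h; exact D.β_snd l (by rw [← (dart_eq_iff.1 h).2]; exact he)
      exact hsep t ht (((Conn.step h3).symm oks).trans hzt)
  refine ⟨?_, k, l, hk1, hk2, hl1, hl2, γ, hp, hγ, hmem⟩
  by_contra hzQ
  -- `K` is the component of `z` in the complement of `below`.
  set okQ : T.Dart → Prop := fun e => D.Inner e ∧ leftVertex e ∉ D.below ω j with hokQ
  set K : Set HexVertex := {t | Conn okQ (leftVertex e₀.symm) t} with hK
  have hzK : leftVertex e₀.symm ∈ K := Conn.refl _ _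
  have hKQ : ∀ t ∈ K, t ∉ D.below ω j := fun t ht =>
    Conn.induct (P := fun t => t ∉ D.below ω j) ht hzQ fun e h _ => h.2
  have hKcl : ∀ e, D.Inner e → leftVertex e.symm ∈ K → leftVertex e ∉ D.below ω j →
      leftVertex e ∈ K := fun e h1 h2 h3 => Conn.trans h2 (Conn.step ⟨h1, h3⟩)
  have hwt : ∀ t, Conn ok (leftVertex e₀) t → t ∉ D.below ω j := by
    rintro t ht ⟨s, hs, hst⟩
    refine hsep s hs (ht.trans (Conn.symm oks (hst.mono fun e he => ⟨he.inner, he.off hγ⟩)))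
  have hwK : leftVertex e₀ ∈ K := hKcl _ (.inl he) hzK (hwt _ (Conn.refl _ _))
  have hwtK : ∀ t, Conn ok (leftVertex e₀) t → t ∈ K := by
    intro t ht
    refine (ht.induct (P := fun t => t ∈ K ∧ Conn ok (leftVertex e₀) t) ⟨hwK, Conn.refl _ _⟩
      fun e h1 h2 => ?_).1
    have h3 := h2.2.trans (Conn.step h1)
    exact ⟨hKcl e h1.1 h2.1 (hwt _ h3), h3⟩
  have hwk : Conn ok (leftVertex e₀) (D.vert k) := (hside _ hmem).2
  have hleft : Conn ok (D.vert (D.M (j - 1))) (D.vert k) :=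
    conn_boundary hk1 fun i h1 h2 => okb i (by omega) (by omega) (by omega) (by omega) (by omega)
  have hMK : D.vert (D.M (j - 1)) ∈ K := hwtK _ (hwk.trans (hleft.symm oks))
  have hQ : ∀ t ∈ D.arcVert j, t ∈ D.below ω j := fun t ht => ⟨t, ht, Conn.refl _ _⟩
  -- The hexagons along the rim of `K` are blue, since the sides of a yellow one would connect its
  -- corners in `K` to `below`.
  have hrim : ∀ e, D.Rim K e → ∀ x ∈ D.F, x = e.fst ∨ x = e.snd → ω x = true := by
    rintro e ⟨hi, hl, hr⟩ x hx hxe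
    by_contra hcol
    rw [Bool.not_eq_true] at hcol
    have hy : D.yellowSide ω e := by
      rcases hxe with rfl | rfl
      exacts [.inl ⟨hx, hcol⟩, .inr ⟨hx, hcol⟩]
    have hrQ : leftVertex e.symm ∈ D.below ω j := by
      by_contra h
      exact hr (hKcl e.symm hi.symm (by rwa [SimpleGraph.Dart.symm_symm]) h)
    obtain ⟨s, hs, hs'⟩ := hrQ
    exact hKQ _ hl ⟨s, hs, hs'.trans (Conn.step hy)⟩
  obtain ⟨k', l', hk1', hk2', hl1', hl2', hrk, hrl, γ', hγF, hγR⟩ :=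
    exists_rim_walk K j hMK fun t ht h => hKQ t h (hQ t ht)
  classical
  have hpF : ∀ x ∈ γ'.bypass.support, x ∈ D.F :=
    fun x hx => hγF x (γ'.support_bypass_subset_support hx)
  have hpR : ∀ e ∈ γ'.bypass.darts, D.Rim K e := fun e h => hγR e (γ'.darts_bypass_subset_darts h)
  have hpB : ∀ x ∈ γ'.bypass.support, x ∈ D.F ∧ ω x = true := by
    intro x hx
    refine ⟨hpF x hx, ?_⟩
    rcases eq_or_ne x (D.β k').fst with rfl | hne
    · exact hrim _ hrk _ (D.β_fst _) (.inr rfl)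
    · have : x ∈ γ'.bypass.support.tail := by
        rw [γ'.bypass.mem_support_iff] at hx
        exact hx.resolve_left hne
      rw [← SimpleGraph.Walk.map_snd_darts, List.mem_map] at this
      obtain ⟨e, he, rfl⟩ := this
      exact hrim e (hpR e he) _ (hpF _ hx) (.inr rfl)
  obtain ⟨n, hn1, hn2, hn3⟩ := exists_crossPotential (D := D) (k := k') (l := l') (by omega) (by omega)
    γ'.bypass hpF
  refine hz (mem_sep_of_pot hk1' hk2' hl1' hl2' γ'.bypass_isPath hpB hn1 hn2 ?_)
  have hrimne : ∀ e, leftVertex e ∈ K → leftVertex e.symm ∈ K → D.Inner e →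
      D.Off γ'.bypass k' l' e := by
    intro e h1 h2 h3
    refine ⟨fun h => (hpR _ h).2.2 h2, fun h => (hpR _ h).2.2 ?_, ?_, ?_, ?_, ?_⟩
    · rwa [SimpleGraph.Dart.symm_symm]
    · rintro rfl; exact hrk.2.2 (by rwa [SimpleGraph.Dart.symm_symm])
    · intro h; refine hrk.2.2 ?_; rwa [SimpleGraph.Dart.symm_symm, ← h]
    · rintro rfl; exact hrl.2.2 h2
    · intro h; refine hrl.2.2 ?_; rwa [← h, SimpleGraph.Dart.symm_symm]
  -- The potential of the rim is constant on `K`, and by its value at the beginning of the arc `j -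
  -- 1` it is not `0`. Hence the rim would separate `z`.
  have hconst : ∀ t ∈ K, n t = n (leftVertex e₀.symm) := by
    intro t ht
    refine (Conn.induct (P := fun t => t ∈ K ∧ n t = n (leftVertex e₀.symm)) ht ⟨hzK, rfl⟩
      fun e h1 h2 => ?_).2
    have h3 := hKcl e h1.1 h2.1 h1.2
    exact ⟨h3, (pot_eq_of_off hn1 h1.1 (hrimne e h3 h2.1 h1.1)).trans h2.2⟩
  rw [← hconst _ hMK, ← vert_add, hn3 _ (by omega) (by omega)]
  norm_num

end DDom

namespace DDom

variable {D : DDom}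

/-! ### The interface starting at a triangle -/

/-- The edge `e` has a blue hexagon at its beginning and a yellow one at its end, where the arc
`j + 1` counts as blue and the arc `j` counts as yellow. -/
def Iface (D : DDom) (j : ℤ) (ω : Config) (e : T.Dart) : Prop :=
  (e.fst ∈ D.F ∧ ω e.fst = true ∨ e.symm ∈ D.arcDart (j + 1)) ∧
  (e.snd ∈ D.F ∧ ω e.snd = false ∨ e ∈ D.arcDart j)

/-- The interface moves on from `e` to `e'`, avoiding the triangle to the left of `g`. -/
def Next (D : DDom) (j : ℤ) (g : T.Dart) (ω : Config) (e e' : T.Dart) : Prop :=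
  D.Iface j ω e' ∧ leftVertex e'.symm = leftVertex e ∧ leftVertex e' ≠ leftVertex g

/-- The interface that leaves the triangle to the left of `g = (x₂, x₁)` through the side opposite
to `x₁`. It is encoded by the oriented edges of `T` that cross it from its blue to its yellow
side. -/
def trace (D : DDom) (j : ℤ) (g : T.Dart) (ω : Config) : Set T.Dart :=
  {e | Relation.ReflTransGen (D.Next j g ω) (turn g) e}

/-- The hexagons explored by following the interface. -/
def explored (D : DDom) (j : ℤ) (g : T.Dart) (ω : Config) : Set Site :=
  {v | v ∈ D.F ∧ ∃ e ∈ D.trace j g ω, v ∈ (leftVertex e).1}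

lemma arcDart_snd {j : ℤ} {e : T.Dart} (h : e ∈ D.arcDart j) : e.snd ∉ D.F := by
  obtain ⟨k, -, -, rfl⟩ := h
  exact D.β_snd k

lemma arcDart_fst {j : ℤ} {e : T.Dart} (h : e ∈ D.arcDart j) : e.fst ∈ D.F := by
  obtain ⟨k, -, -, rfl⟩ := h
  exact D.β_fst k

lemma Iface.fst_eq {j : ℤ} {ω : Config} {e : T.Dart} (h : D.Iface j ω e) (hF : e.fst ∈ D.F) :
    ω e.fst = true := h.1.elim And.right fun h => absurd hF (arcDart_snd h)

lemma Iface.snd_eq {j : ℤ} {ω : Config} {e : T.Dart} (h : D.Iface j ω e) (hF : e.snd ∈ D.F) :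
    ω e.snd = false := h.2.elim And.right fun h => absurd hF (arcDart_snd h)

lemma Iface.inner {j : ℤ} {ω : Config} {e : T.Dart} (h : D.Iface j ω e) : D.Inner e := by
  rcases h.2 with h2 | h2
  · exact .inr h2.1
  · exact .inl (arcDart_fst h2)

lemma Iface.not_symm {j : ℤ} {ω : Config} {e : T.Dart} (h : D.Iface j ω e) :
    ¬ D.Iface j ω e.symm := by
  intro h'
  rcases h.inner with h1 | h1
  · exact Bool.noConfusion ((h.fst_eq h1).symm.trans (h'.snd_eq h1))
  · exact Bool.noConfusion ((h.snd_eq h1).symm.trans (h'.fst_eq h1))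

lemma trace_iface {j : ℤ} {g : T.Dart} {ω : Config} (h0 : D.Iface j ω (turn g))
    {e : T.Dart} (h : e ∈ D.trace j g ω) : D.Iface j ω e := by
  rcases Relation.ReflTransGen.cases_tail h with h | ⟨d, -, hd⟩
  · rwa [h]
  · exact hd.1

lemma trace_left_ne {j : ℤ} {g : T.Dart} {ω : Config} {e : T.Dart} (h : e ∈ D.trace j g ω) :
    leftVertex e ≠ leftVertex g := by
  rcases Relation.ReflTransGen.cases_tail h with h | ⟨d, -, hd⟩
  · rw [h, ← rightVertex_turn g]
    exact (leftVertex_ne_rightVertex _).symm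
  · exact hd.2.2

/-- The sites of the domain around a boundary vertex. -/
lemma eq_of_mem_vert {i : ℤ} {y : Site} (hy : y ∈ D.F) (h : y ∈ (D.vert i).1) :
    y = (D.β i).fst ∨ y = (D.β (i - 1)).fst := by
  rcases mem_leftVertex.1 h with h | h | h
  · exact absurd hy (by rw [h]; exact D.β_snd i)
  · exact .inl h
  · right
    have h1 : cyc (cyc (D.β i).symm) = D.β (i - 1) := by
      refine eq_β_of_left (show apex (D.β i).symm ∈ D.F from h ▸ hy) ?_ ?_
      · change apex (cyc (D.β i).symm) ∉ D.F
        rw [apex_cyc]; exact D.β_snd i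
      · rw [sub_add_cancel, leftVertex_cyc, leftVertex_cyc]; rfl
    rw [← h1]; exact h

lemma exists_arc_of_mem_vert {j : ℤ} {t : HexVertex} (ht : t ∈ D.arcVert j) {y : Site}
    (hy : y ∈ D.F) (h : y ∈ t.1) : ∃ k, D.M j ≤ k ∧ k < D.M (j + 1) ∧ (D.β k).fst = y := by
  obtain ⟨i, h1, h2, rfl⟩ := ht
  have hM : D.M j < D.M (j + 1) := D.M_mono (by omega)
  rcases eq_of_mem_vert hy h with rfl | rfl
  · rcases eq_or_lt_of_le h2 with rfl | h2
    · exact ⟨D.M (j + 1) - 1, by omega, by omega, D.mark _⟩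
    · exact ⟨i, h1, h2, rfl⟩
  · rcases eq_or_lt_of_le h1 with rfl | h1
    · exact ⟨D.M j, le_rfl, hM, (D.mark _).symm⟩
    · exact ⟨i - 1, by omega, by omega, rfl⟩

/-- A vertex joined to the arc `j` by sides of yellow hexagons has a yellow hexagon that is joined
to the arc by yellow hexagons, unless it lies on the arc. -/
lemma joined_of_below {ω : Config} {j : ℤ} {t : HexVertex} (h : t ∈ D.below ω j) :
    t ∈ D.arcVert j ∨ ∃ y ∈ t.1, ∃ k, D.M j ≤ k ∧ k < D.M (j + 1) ∧
      Joined {v | v ∈ D.F ∧ ω v = false} y (D.β k).fst := by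
  obtain ⟨s, hs, hst⟩ := h
  refine hst.induct (P := fun t => t ∈ D.arcVert j ∨ ∃ y ∈ t.1, ∃ k, D.M j ≤ k ∧ k < D.M (j + 1) ∧
      Joined {v | v ∈ D.F ∧ ω v = false} y (D.β k).fst) (.inl hs) fun e he ih => .inr ?_
  obtain ⟨y, hyF, hyω, hyl, hyr⟩ : ∃ y ∈ D.F, ω y = false ∧ y ∈ (leftVertex e).1 ∧
      y ∈ (leftVertex e.symm).1 := by
    rcases he with h | h
    · exact ⟨_, h.1, h.2, fst_mem_left e, fst_mem_right e⟩
    · exact ⟨_, h.1, h.2, snd_mem_left e, snd_mem_right e⟩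
  refine ⟨y, hyl, ?_⟩
  rcases ih with ih | ⟨y', hy', k, hk1, hk2, hJ⟩
  · obtain ⟨k, hk1, hk2, rfl⟩ := exists_arc_of_mem_vert ih hyF hyr
    exact ⟨k, hk1, hk2, .refl ⟨hyF, hyω⟩⟩
  · refine ⟨k, hk1, hk2, ?_⟩
    by_cases hyy : y = y'
    · rwa [hyy]
    · exact hJ.head ⟨hyF, hyω⟩ ((leftVertex e.symm).2.isClique hyr hy' hyy)

/-- Conversely, the corners of the hexagons connected to the arc by yellow hexagons are below. -/
lemma below_of_joined {ω : Config} {j k : ℤ} {t : HexVertex} {y : Site} (hk1 : D.M j ≤ k)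
    (hk2 : k < D.M (j + 1)) (hy : y ∈ t.1)
    (hJ : Joined {v | v ∈ D.F ∧ ω v = false} y (D.β k).fst) : t ∈ D.below ω j := by
  have hhex : ∀ v, v ∈ D.F ∧ ω v = false → ∀ s t : HexVertex, v ∈ s.1 → v ∈ t.1 →
      Conn (D.yellowSide ω) s t := fun v hv s t hs ht =>
    Conn.hexagon hs ht fun e he => .inl (by rw [he]; exact hv)
  have key := hJ.symm.induct (P := fun y => ∀ t : HexVertex, y ∈ t.1 →
      Conn (D.yellowSide ω) (D.vert k) t) (fun t ht => hhex _ hJ.right _ _ (fst_mem_right _) ht)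
    fun u v _ hv huv h t ht =>
      (h (leftVertex ⟨(u, v), huv⟩) (fst_mem_left _)).trans (hhex v hv _ _ (snd_mem_left _) ht)
  exact ⟨D.vert k, ⟨k, hk1, hk2.le, rfl⟩, key t hy⟩

/-- No blue path separates `t` from the arc if yellow sides lead from the arc to `t`. -/
lemma not_sep_of_below {ω : Config} {j : ℤ} {t : HexVertex} (h : t ∈ D.below ω j) :
    ω ∉ D.sep j t := by
  rintro ⟨k, l, -, -, -, -, γ, -, hγ, hsep⟩
  obtain ⟨s, hs, hst⟩ := h
  exact hsep s hs (Conn.symm (fun e h => ⟨h.1.symm, h.2.symm⟩)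
    (hst.mono fun e he => ⟨he.inner, he.off hγ⟩))

/-- Two interface edges with the same triangle on their left coincide. -/
lemma Iface.eq_of_left {j : ℤ} {ω : Config} {e d : T.Dart} (he : D.Iface j ω e)
    (hd : D.Iface j ω d) (h : leftVertex d = leftVertex e) : d = e := by
  -- Two successive sides of a triangle, oriented counterclockwise, cannot both lead from blue to
  -- yellow.
  have key : ∀ e, D.Iface j ω e → ¬ D.Iface j ω (cyc e) := by
    intro e he hd
    by_cases hF : e.snd ∈ D.F
    · exact Bool.noConfusion ((he.snd_eq hF).symm.trans (hd.fst_eq hF))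
    · obtain ⟨i, hi1, hi2, hi⟩ := he.2.resolve_left fun h => hF h.1
      obtain ⟨i', hi1', hi2', hi'⟩ := hd.1.resolve_left fun h => hF h.1
      have h1 : (cyc e).symm = D.β (i + 1) := by
        rw [← hi']
        refine eq_β_of_right (D.β_fst _) (D.β_snd _) ?_
        rw [hi', SimpleGraph.Dart.symm_symm, leftVertex_cyc, vert_succ, hi]
      have hM2 := M_add_two D j
      have hM : D.M (j - 1) < D.M j := D.M_mono (by omega)
      have hM3 : D.M (j + 1 + 1) = D.M (j + 2) := by rw [add_assoc]; rfl
      rcases lt_or_eq_of_le (show i + 1 ≤ D.M (j + 1) by omega) with h2 | h2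
      · exact β_ne (by omega) (by omega) (h1.symm.trans hi'.symm)
      · have h3 := D.mark (j + 1)
        rw [← h2, add_sub_cancel_right, hi, ← h1] at h3
        exact (apex_ne e).1 h3.symm
  rcases leftVertex_eq_iff.1 h with h | h | h
  · exact h
  · exact absurd hd (h ▸ key e he)
  · subst h
    refine absurd he ?_
    have := key _ hd
    rwa [cyc_cyc_cyc] at this

/-- The interface can be continued, except at the end of the arc `j` and on the arc `j + 2`. -/
lemma Iface.exists_next {j : ℤ} {ω : Config} {e : T.Dart} (he : D.Iface j ω e) :
    (∃ e', D.Iface j ω e' ∧ leftVertex e'.symm = leftVertex e) ∨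
    leftVertex e = D.vert (D.M (j + 1)) ∨
    ∃ k, D.M (j + 2) < k ∧ k < D.M (j + 3) ∧ leftVertex e = D.vert k := by
  have hx : leftVertex (turn e).symm = leftVertex e := rightVertex_turn e
  have hy : leftVertex (cyc e).symm.symm = leftVertex e := by
    rw [SimpleGraph.Dart.symm_symm, leftVertex_cyc]
  by_cases hr : apex e ∈ D.F
  · rcases hc : ω (apex e)
    · -- the third hexagon is yellow
      by_cases hxF : e.fst ∈ D.F
      · exact .inl ⟨turn e, ⟨.inl ⟨hxF, he.fst_eq hxF⟩, .inl ⟨hr, hc⟩⟩, hx⟩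
      · obtain ⟨k, hk1, hk2, hk⟩ := he.1.resolve_left fun h => hxF h.1
        have hv : leftVertex e = D.vert k := by rw [vert, hk, SimpleGraph.Dart.symm_symm]
        have h1 : (turn e).symm = D.β (k - 1) :=
          eq_β_of_left hr hxF (by rw [sub_add_cancel, hx, hv])
        rcases eq_or_lt_of_le hk1 with rfl | hk1
        · exact .inr (.inl hv)
        · exact .inl ⟨turn e, ⟨.inr ⟨k - 1, by omega, by omega, h1.symm⟩, .inl ⟨hr, hc⟩⟩, hx⟩
    · -- the third hexagon is blue
      by_cases hyF : e.snd ∈ D.F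
      · exact .inl ⟨(cyc e).symm, ⟨.inl ⟨hr, hc⟩, .inl ⟨hyF, he.snd_eq hyF⟩⟩, hy⟩
      · obtain ⟨k, hk1, hk2, hk⟩ := he.2.resolve_left fun h => hyF h.1
        have hv : leftVertex e = D.vert (k + 1) := by rw [vert_succ, hk]
        have h1 : (cyc e).symm = D.β (k + 1) :=
          eq_β_of_right (d := (cyc e).symm) hr hyF (by rw [hy, hv])
        rcases eq_or_lt_of_le (show k + 1 ≤ D.M (j + 1) by omega) with h2 | h2
        · exact .inr (.inl (by rw [hv, h2]))
        · exact .inl ⟨(cyc e).symm, ⟨.inl ⟨hr, hc⟩, .inr ⟨k + 1, by omega, h2, h1.symm⟩⟩, hy⟩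
  · by_cases hxF : e.fst ∈ D.F
    · by_cases hyF : e.snd ∈ D.F
      · obtain ⟨k, hk⟩ := D.β_surj (turn e) hxF hr
        have hv : leftVertex e = D.vert k := by rw [vert, hk, hx]
        have h1 : cyc e = D.β (k - 1) :=
          eq_β_of_left hyF hr (by rw [sub_add_cancel, leftVertex_cyc, hv])
        obtain ⟨k', hk1, hk2, hkk⟩ : ∃ k', D.M (j + 1) ≤ k' ∧ k' < D.M (j + 1) + D.N ∧
            ∃ m : ℤ, k = k' + m * D.N := by
          have hN : 0 < (D.N : ℤ) := by
            have := D.M_add 0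
            have := D.M_mono (show (0 : ℤ) < 0 + 3 by norm_num)
            omega
          refine ⟨D.M (j + 1) + (k - D.M (j + 1)) % D.N, ?_, ?_, (k - D.M (j + 1)) / D.N, ?_⟩
          · have := Int.emod_nonneg (k - D.M (j + 1)) hN.ne'
            omega
          · have := Int.emod_lt_of_pos (k - D.M (j + 1)) hN
            omega
          · have := Int.emod_add_mul_ediv (k - D.M (j + 1)) D.N
            linarith
        obtain ⟨m, rfl⟩ := hkk
        have e1 : D.β (k' + m * D.N) = D.β k' := β_add_mul _ _
        have e2 : D.β (k' + m * D.N - 1) = D.β (k' - 1) := by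
          rw [show k' + m * D.N - 1 = k' - 1 + m * D.N by ring, β_add_mul]
        rw [vert, e1] at hv
        rw [e1] at hk
        rw [e2] at h1
        have hM3 : D.M (j + 3) = D.M j + D.N := D.M_add j
        have hM4 : D.M (j + 1) + D.N = D.M (j + 4) := by rw [← D.M_add]; congr 1; ring
        rcases eq_or_lt_of_le hk1 with rfl | hk1
        · exact .inr (.inl hv)
        rcases le_or_gt k' (D.M (j + 2)) with h2 | h2
        · refine .inl ⟨(cyc e).symm, ⟨.inr ⟨k' - 1, by omega, ?_, ?_⟩, .inl ⟨hyF, he.snd_eq hyF⟩⟩, hy⟩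
          · rw [add_assoc]; norm_num; omega
          · rw [SimpleGraph.Dart.symm_symm, h1]
        rcases lt_or_ge k' (D.M (j + 3)) with h3 | h3
        · exact .inr (.inr ⟨k', h2, h3, hv⟩)
        · refine .inl ⟨turn e, ⟨.inl ⟨hxF, he.fst_eq hxF⟩, .inr ⟨k' - D.N, by omega, by omega, ?_⟩⟩, hx⟩
          rw [← hk, ← D.β_add (k' - D.N), sub_add_cancel]
      · obtain ⟨k, hk1, hk2, hk⟩ := he.2.resolve_left fun h => hyF h.1
        have hv : leftVertex e = D.vert (k + 1) := by rw [vert_succ, hk]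
        have h1 : turn e = D.β (k + 1) :=
          eq_β_of_right (d := turn e) hxF hr (by rw [hx, hv])
        rcases eq_or_lt_of_le (show k + 1 ≤ D.M (j + 1) by omega) with h2 | h2
        · exact .inr (.inl (by rw [hv, h2]))
        · exact .inl ⟨turn e, ⟨.inl ⟨hxF, he.fst_eq hxF⟩, .inr ⟨k + 1, by omega, h2, h1.symm⟩⟩, hx⟩
    · obtain ⟨k, hk1, hk2, hk⟩ := he.1.resolve_left fun h => hxF h.1
      have hyF : e.snd ∈ D.F := he.inner.resolve_left hxF
      have hv : leftVertex e = D.vert k := by rw [vert, hk, SimpleGraph.Dart.symm_symm]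
      have h1 : cyc e = D.β (k - 1) :=
        eq_β_of_left hyF hr (by rw [sub_add_cancel, leftVertex_cyc, hv])
      rcases eq_or_lt_of_le hk1 with rfl | hk1
      · exact .inr (.inl hv)
      · refine .inl ⟨(cyc e).symm, ⟨.inr ⟨k - 1, by omega, by omega, ?_⟩,
          .inl ⟨hyF, he.snd_eq hyF⟩⟩, hy⟩
        rw [SimpleGraph.Dart.symm_symm, h1]

/-- Only finitely many edges are sides of hexagons of the domain. -/
lemma finite_inner (D : DDom) : {e | D.Inner e}.Finite := by
  classical
  refine ((star D.F) ∪ (star D.F).image SimpleGraph.Dart.symm).finite_toSet.subset ?_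
  rintro e (h | h)
  · exact Finset.mem_union_left _ (mem_star.2 h)
  · exact Finset.mem_union_right _ (Finset.mem_image.2
      ⟨e.symm, mem_star.2 h, SimpleGraph.Dart.symm_symm e⟩)

/-- The interface has to stop somewhere. -/
lemma exists_trace_end {j : ℤ} {g : T.Dart} {ω : Config} (h0 : D.Iface j ω (turn g)) :
    ∃ e ∈ D.trace j g ω, ∀ e', ¬ D.Next j g ω e e' := by
  -- Otherwise the successor map is an injection of a finite set into itself, hence onto, and the
  -- interface returns to its first edge. But then it enters the triangle to the left of `g`.
  by_contra! hcon
  have hfin : (D.trace j g ω).Finite := (finite_inner D).subset fun e he => (trace_iface h0 he).inner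
  choose! f hf using hcon
  have hmem : ∀ e ∈ D.trace j g ω, f e ∈ D.trace j g ω := fun e he =>
    Relation.ReflTransGen.tail he (hf e he)
  have hinj : Set.InjOn f (D.trace j g ω) := by
    intro e he d hd hed
    refine (trace_iface h0 hd).eq_of_left (trace_iface h0 he) ?_
    rw [← (hf e he).2.1, ← (hf d hd).2.1, hed]
  obtain ⟨e, he, h⟩ := (((hfin.injOn_iff_bijOn_of_mapsTo hmem).1 hinj).surjOn
    (show (turn g) ∈ D.trace j g ω from Relation.ReflTransGen.refl))
  have h1 := (hf e he).2.1
  rw [h, rightVertex_turn] at h1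
  exact trace_left_ne he h1.symm

end DDom

namespace DDom

variable {D : DDom}

/-! ### Colour switching -/

/-- The interface from the triangle to the left of `g = (x₂, x₁)` runs between the blue hexagon `x₂`
and the yellow third hexagon to the end of the arc `j`, and off the explored hexagons `x₁` is
connected to the arc `j - 1` in the colour `c`. -/
def switch (D : DDom) (j : ℤ) (g : T.Dart) (c : Bool) : Set Config :=
  {ω | ω g.fst = true ∧ ω (apex g) = false ∧
    (∃ e ∈ D.trace j g ω, leftVertex e = D.vert (D.M (j + 1))) ∧
    ∃ k, D.M (j - 1) ≤ k ∧ k < D.M j ∧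
      Joined {v | v ∈ D.F ∧ v ∉ D.explored j g ω ∧ ω v = c} g.snd (D.β k).fst}

/-- A walk through an edge consists of a part before and a part after this edge. -/
lemma exists_split {u v a b : Site} (p : T.Walk u v) (hab : T.Adj a b)
    (he : (⟨(a, b), hab⟩ : T.Dart) ∈ p.darts) :
    ∃ (p₁ : T.Walk u a) (p₂ : T.Walk b v), p = p₁.append (.cons hab p₂) := by
  induction p with
  | nil => simp at he
  | cons h p ih =>
    rw [SimpleGraph.Walk.darts_cons, List.mem_cons] at he
    rcases he with he | he
    · obtain ⟨rfl, rfl⟩ := Prod.ext_iff.1 (congrArg SimpleGraph.Dart.toProd he)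
      exact ⟨.nil, p, rfl⟩
    · obtain ⟨p₁, p₂, rfl⟩ := ih he
      exact ⟨.cons h p₁, p₂, rfl⟩

lemma iface_turn {j : ℤ} {g : T.Dart} {ω : Config} (h2 : g.fst ∈ D.F) (h3 : apex g ∈ D.F)
    (hc2 : ω g.fst = true) (hc3 : ω (apex g) = false) : D.Iface j ω (turn g) :=
  ⟨.inl ⟨h2, hc2⟩, .inl ⟨h3, hc3⟩⟩

/-- If the separating path passes between the two triangles next to `g`, then the three arms exist.
The path formed by the yellow arm and the second blue arm has a potential, which confines the
interface to one of its sides and keeps it away from the first blue arm. -/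
theorem mem_switch_of_sep {ω : Config} {j : ℤ} {g : T.Dart} (hF : ∀ v ∈ (leftVertex g).1, v ∈ D.F)
    (hw : ω ∈ D.sep j (leftVertex g.symm)) (hz : ω ∉ D.sep j (leftVertex g)) :
    ω ∈ D.switch j g true := by
  have hF1 : g.snd ∈ D.F := hF _ (snd_mem_left g)
  have hF2 : g.fst ∈ D.F := hF _ (fst_mem_left g)
  have hF3 : apex g ∈ D.F := hF _ (mem_leftVertex.2 (.inr (.inr rfl)))
  obtain ⟨hQ, k, l, hk1, hk2, hl1, hl2, γ, hp, hγ, he⟩ :=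
    exists_arms_of_sep (e₀ := g.symm) hF1 hF2 hw (by rwa [SimpleGraph.Dart.symm_symm])
  rw [SimpleGraph.Dart.symm_symm] at hQ
  obtain ⟨p₁, p₂, rfl⟩ := exists_split γ (show T.Adj g.snd g.fst from g.symm.adj) he
  have hM' : D.M j < D.M (j + 1) := D.M_mono (by omega)
  have hM2 := M_add_two D j
  have hM3 : D.M (j + 3) = D.M j + D.N := D.M_add j
  have hM11 : D.M (j + 1 + 1) = D.M (j + 2) := by rw [add_assoc]; rfl
  have hdisj : ∀ x ∈ p₁.support, x ∉ p₂.support := by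
    have := hp.support_nodup
    rw [SimpleGraph.Walk.support_append, SimpleGraph.Walk.support_cons, List.tail_cons] at this
    exact fun x h1 h2 => (List.disjoint_of_nodup_append this) h1 h2
  have hb1 : ∀ x ∈ p₁.support, x ∈ D.F ∧ ω x = true := fun x hx =>
    hγ x ((SimpleGraph.Walk.mem_support_append_iff _ _).2 (.inl hx))
  have hb2 : ∀ x ∈ p₂.support, x ∈ D.F ∧ ω x = true := fun x hx =>
    hγ x ((SimpleGraph.Walk.mem_support_append_iff _ _).2 (.inr (by
      rw [SimpleGraph.Walk.support_cons]; exact List.mem_cons_of_mem _ hx)))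
  have hx1 : g.snd ∈ p₁.support := p₁.end_mem_support
  have hx2 : g.fst ∈ p₂.support := p₂.start_mem_support
  have hc1 := (hb1 _ hx1).2
  have hc2 := (hb2 _ hx2).2
  -- the yellow arm
  obtain ⟨k₃, hk31, hk32, q, hq⟩ : ∃ k₃, D.M j ≤ k₃ ∧ k₃ < D.M (j + 1) ∧
      Joined {v | v ∈ D.F ∧ ω v = false} (apex g) (D.β k₃).fst := by
    rcases joined_of_below hQ with ⟨i, -, -, hi⟩ | ⟨y, hy, k₃, h1, h2, hJ⟩
    · exact absurd (hF _ (hi ▸ snd_mem_right (D.β i))) (D.β_snd i)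
    · have hyc := hJ.left.2
      rcases mem_leftVertex.1 hy with rfl | rfl | rfl
      · exact Bool.noConfusion (hc2.symm.trans hyc)
      · exact Bool.noConfusion (hc1.symm.trans hyc)
      · exact ⟨k₃, h1, h2, hJ⟩
  have hc3 := (hq _ q.start_mem_support).2
  have hcq : ∀ {x y}, x ∈ q.support → ω y = true → x ≠ y := fun h1 h2 h3 =>
    Bool.noConfusion (h2.symm.trans (h3 ▸ (hq _ h1).2))
  -- The yellow arm, followed backwards, then `x₃`, `x₁`, `x₂` and the second blue arm.
  let p : T.Walk (D.β k₃).fst (D.β l).fst :=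
    q.reverse.append (.cons (show T.Adj (apex g) g.snd from (cyc g).symm.adj)
      (.cons (show T.Adj g.snd g.fst from g.symm.adj) p₂))
  have hpd : p.darts = q.reverse.darts ++ (cyc g).symm :: g.symm :: p₂.darts := by
    simp only [p, SimpleGraph.Walk.darts_append, SimpleGraph.Walk.darts_cons]; rfl
  have hpF : ∀ x ∈ p.support, x ∈ D.F := by
    intro x hx
    simp only [p, SimpleGraph.Walk.mem_support_append_iff, SimpleGraph.Walk.support_cons,
      SimpleGraph.Walk.support_reverse, List.mem_reverse, List.mem_cons] at hx
    rcases hx with hx | rfl | rfl | hx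
    exacts [(hq x hx).1, hF3, hF1, (hb2 x hx).1]
  have hd : ∀ e ∈ p.darts, (e.fst ∈ q.support ∧ e.snd ∈ q.support) ∨ e = (cyc g).symm ∨ e = g.symm ∨
      (e.fst ∈ p₂.support ∧ e.snd ∈ p₂.support) := by
    intro e he
    rw [hpd, List.mem_append, List.mem_cons, List.mem_cons] at he
    rcases he with he | he | he | he
    · left
      have h1 := q.reverse.dart_fst_mem_support_of_mem_darts he
      have h2 := q.reverse.dart_snd_mem_support_of_mem_darts he
      rw [SimpleGraph.Walk.support_reverse, List.mem_reverse] at h1 h2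
      exact ⟨h1, h2⟩
    · exact .inr (.inl he)
    · exact .inr (.inr (.inl he))
    · exact .inr (.inr (.inr ⟨p₂.dart_fst_mem_support_of_mem_darts he,
        p₂.dart_snd_mem_support_of_mem_darts he⟩))
  obtain ⟨n, hn1, hn2, hn3⟩ := exists_crossPotential (D := D) (k := k₃) (l := l) (by omega) (by omega)
    p hpF
  have hoff : ∀ e, D.Inner e → D.Off p k₃ l e → n (leftVertex e) = n (leftVertex e.symm) :=
    fun e => pot_eq_of_off hn1
  have hx3ne : apex g ≠ g.snd := (apex_ne g).2
  have hg13 : (cyc g).symm ≠ g.symm := fun h => (apex_ne g).2 (dart_eq_iff.1 h).1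
  have hx1p2 : g.snd ∉ p₂.support := hdisj _ hx1
  -- This path passes once between the two triangles next to `g`.
  have hzw : n (leftVertex g.symm) = n (leftVertex g) + 1 := by
    have h1 := hn1 g.symm hF1
    have h2 : p.darts.count g.symm = 1 := by
      rw [hpd, List.count_append, List.count_cons_of_ne hg13,
        List.count_cons_self, List.count_eq_zero.2, List.count_eq_zero.2]
      · exact fun h => hx1p2 (p₂.dart_fst_mem_support_of_mem_darts h)
      · intro h
        have h1 := q.reverse.dart_fst_mem_support_of_mem_darts h
        rw [SimpleGraph.Walk.support_reverse, List.mem_reverse] at h1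
        exact hcq h1 hc1 rfl
    have h3 : p.darts.count g = 0 := by
      rw [List.count_eq_zero]
      intro h
      rcases hd g h with h | h | h | h
      · exact hcq h.1 hc2 rfl
      · exact hcq q.start_mem_support hc2 (dart_eq_iff.1 h).1.symm
      · exact fst_ne_snd g (dart_eq_iff.1 h).1
      · exact hx1p2 h.2
    have h4 : g.symm ≠ D.β l := fun h => D.β_snd l (h ▸ hF2)
    have h5 : g.symm ≠ D.β k₃ := fun h => D.β_snd k₃ (h ▸ hF2)
    rw [passages, SimpleGraph.Dart.symm_symm, h2, h3, if_neg h4, if_neg h5] at h1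
    push_cast at h1
    linarith
  -- around the first arm the potential is `1`, except at the initial triangle
  have hedge : ∀ c : T.Dart, c.fst ∈ p₁.support → c ≠ g.symm → c ≠ cyc g → D.Off p k₃ l c := by
    intro c h1 h2 h3
    have hcF := (hb1 _ h1).1
    have hsupp : c.fst ∉ q.support := fun h => hcq h (hb1 _ h1).2 rfl
    refine ⟨fun h => ?_, fun h => ?_, ?_, ?_, ?_, ?_⟩
    · rcases hd c h with h | h | h | h
      · exact hsupp h.1
      · exact hcq q.start_mem_support (hb1 _ h1).2 (dart_eq_iff.1 h).1.symm
      · exact h2 h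
      · exact hdisj _ h1 h.1
    · rcases hd c.symm h with h | h | h | h
      · exact hsupp h.2
      · exact h3 (SimpleGraph.Dart.symm_involutive.injective h)
      · have : c.fst = g.fst := (dart_eq_iff.1 h).2
        rw [this] at h1
        exact hdisj _ h1 hx2
      · exact hdisj _ h1 h.2
    · rintro rfl; exact hsupp q.end_mem_support
    · intro h; exact D.β_snd k₃ (by rw [← (dart_eq_iff.1 h).2]; exact hcF)
    · rintro rfl; exact hdisj _ h1 p₂.end_mem_support
    · intro h; exact D.β_snd l (by rw [← (dart_eq_iff.1 h).2]; exact hcF)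
  have hcross : ∀ c : T.Dart, c.fst ∈ p₁.support → c ≠ g.symm → c ≠ cyc g →
      n (leftVertex c.symm) = n (leftVertex c) := fun c h1 h2 h3 =>
    (hoff c (.inl (hb1 _ h1).1) (hedge c h1 h2 h3)).symm
  have hturn : turn (cyc g) = g.symm := by
    rw [dart_eq_iff]; exact ⟨rfl, apex_cyc g⟩
  have hx1const : ∀ t : HexVertex, g.snd ∈ t.1 → t ≠ leftVertex g →
      n t = n (leftVertex g.symm) := by
    intro t ht htz
    obtain ⟨d, hd1, rfl⟩ := exists_dart_of_mem ht
    obtain ⟨i, hi, rfl⟩ := exists_turn (e := g.symm) hd1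
    have h5 : turn^[5] g.symm = cyc g := by
      rw [← hturn, ← Function.iterate_succ_apply]
      exact turn_iterate_six _
    have hi5 : i ≠ 5 := by
      rintro rfl
      rw [h5, leftVertex_cyc] at htz
      exact htz rfl
    have := Conn.around (ok := fun c => n (leftVertex c) = n (leftVertex c.symm)) (e := g.symm)
      (l := i + 1) (fun i' h1 h2 => ?_) (by omega)
    · rw [Function.iterate_succ_apply', rightVertex_turn] at this
      exact this.eq_of fun e he => he
    · refine (hcross _ (by rw [turn_iterate_fst]; exact hx1) (fun h => ?_) fun h => ?_).symm
      · have := turn_iterate_injOn g.symm (by omega) (by norm_num) (show _ = turn^[0] g.symm from h)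
        omega
      · have := turn_iterate_injOn g.symm (by omega) (by norm_num) (h.trans h5.symm)
        omega
  have hhex : ∀ y ∈ p₁.support, (∃ t : HexVertex, y ∈ t.1 ∧ t ≠ leftVertex g ∧ n t = 1) →
      ∀ t : HexVertex, y ∈ t.1 → t ≠ leftVertex g → n t = 1 := by
    rintro y hy ⟨s, hs1, hs2, hs3⟩ t ht1 ht2
    by_cases hyx : y = g.snd
    · subst hyx
      rw [hx1const t ht1 ht2, ← hx1const s hs1 hs2, hs3]
    · rw [← hs3]
      refine Conn.eq_of (ok := fun c => n (leftVertex c) = n (leftVertex c.symm))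
        (Conn.hexagon hs1 ht1 fun c hc => (hcross c (hc ▸ hy) ?_ ?_).symm) fun e he => he
      · rintro rfl; exact hyx hc.symm
      · rintro rfl; exact hyx hc.symm
  have hvertz : ∀ i, D.vert i ≠ leftVertex g := fun i h =>
    D.β_snd i (hF _ (h ▸ snd_mem_right (D.β i)))
  have harm : ∀ y ∈ p₁.support, ∀ t : HexVertex, y ∈ t.1 → t ≠ leftVertex g → n t = 1 := by
    have hind : ∀ y, Joined {v | v ∈ p₁.support} (D.β k).fst y →
        ∀ t : HexVertex, y ∈ t.1 → t ≠ leftVertex g → n t = 1 := by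
      intro y hJ
      refine hJ.induct (P := fun y => ∀ t : HexVertex, y ∈ t.1 → t ≠ leftVertex g → n t = 1) ?_ ?_
      · refine hhex _ p₁.start_mem_support ⟨D.vert k, fst_mem_right _, hvertz k, ?_⟩
        rw [← vert_add]
        exact hn3 _ (by omega) (by omega)
      · intro u v hu hv huv h
        let a : T.Dart := ⟨(u, v), huv⟩
        have hne : leftVertex a ≠ leftVertex g := by
          intro heq
          have key : ∀ x ∈ (leftVertex g).1, x ∈ p₁.support → x = g.snd := by
            intro x hx hxp
            rcases mem_leftVertex.1 hx with rfl | rfl | rfl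
            · exact absurd hx2 (hdisj _ hxp)
            · rfl
            · exact absurd rfl (hcq q.start_mem_support (hb1 _ hxp).2)
          exact huv.ne ((key u (heq ▸ fst_mem_left a) hu).trans
            (key v (heq ▸ snd_mem_left a) hv).symm)
        exact hhex v hv ⟨leftVertex a, snd_mem_left a, hne, h _ (fst_mem_left a) hne⟩
    exact fun y hy => hind y ⟨p₁.takeUntil y hy, fun v hv => p₁.support_takeUntil_subset_support hy hv⟩
  have hw1 : n (leftVertex g.symm) = 1 :=
    harm _ hx1 _ (fst_mem_left g.symm) (leftVertex_ne_rightVertex g)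
  have hz0 : n (leftVertex g) = 0 := by omega
  -- the potential is constant along the interface
  have h0 : D.Iface j ω (turn g) := iface_turn hF2 hF3 hc2 hc3
  have hiface : ∀ e, D.Iface j ω e → e ≠ cyc g → n (leftVertex e) = n (leftVertex e.symm) := by
    intro e he hne
    have hcb : ∀ {x}, x ∈ p₂.support → ω x = true := fun h => (hb2 _ h).2
    have hnot : ∀ x, x ∈ D.F → ω x = true → x ∉ q.support := fun x _ h h' => hcq h' h rfl
    refine hoff e he.inner ⟨fun h => ?_, fun h => ?_, fun h => ?_, fun h => ?_, fun h => ?_, fun h => ?_⟩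
    · have hsF := hpF _ (p.dart_snd_mem_support_of_mem_darts h)
      have hfF := hpF _ (p.dart_fst_mem_support_of_mem_darts h)
      rcases hd e h with h | h | h | h
      · exact hcq h.1 (he.fst_eq hfF) rfl
      · exact hcq q.start_mem_support (he.fst_eq hfF) (dart_eq_iff.1 h).1.symm
      · have h1 : e.snd = g.fst := (dart_eq_iff.1 h).2
        have := he.snd_eq hsF
        rw [h1, hc2] at this
        exact Bool.noConfusion this
      · have := he.snd_eq hsF
        rw [hcb h.2] at this
        exact Bool.noConfusion this
    · have hsF : e.snd ∈ D.F := hpF _ (p.dart_fst_mem_support_of_mem_darts h)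
      have hfF : e.fst ∈ D.F := hpF _ (p.dart_snd_mem_support_of_mem_darts h)
      rcases hd e.symm h with h | h | h | h
      · exact hcq h.2 (he.fst_eq hfF) rfl
      · exact hne (SimpleGraph.Dart.symm_involutive.injective h)
      · have h1 : e.snd = g.snd := (dart_eq_iff.1 h).1
        have := he.snd_eq hsF
        rw [h1, hc1] at this
        exact Bool.noConfusion this
      · have := he.snd_eq hsF
        rw [show ω e.snd = true from hcb h.1] at this
        exact Bool.noConfusion this
    · have := he.fst_eq (h ▸ D.β_fst k₃)
      rw [h] at this
      exact hcq q.end_mem_support this rfl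
    · have hsF : e.snd ∈ D.F := by
        have h1 := D.β_fst k₃
        rw [← h] at h1; exact h1
      have hfF : e.fst ∉ D.F := by
        have h1 := D.β_snd k₃
        rw [← h] at h1; exact h1
      obtain ⟨i, hi1, hi2, hi⟩ := he.1.resolve_left fun h => hfF h.1
      exact β_ne (by omega) (by omega) (h.symm.trans hi.symm)
    · have hsF : e.snd ∉ D.F := h ▸ D.β_snd l
      obtain ⟨i, hi1, hi2, hi⟩ := he.2.resolve_left fun h => hsF h.1
      exact β_ne (by omega) (by omega) (hi.trans h)
    · have hsF : e.snd ∈ D.F := by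
        have h1 := D.β_fst l
        rw [← h] at h1; exact h1
      have h1 := he.snd_eq hsF
      have h2 := (hb2 _ p₂.end_mem_support).2
      rw [show e.snd = (D.β l).fst from (dart_eq_iff.1 h).1, h2] at h1
      exact Bool.noConfusion h1
  have hne_of : ∀ e : T.Dart, leftVertex e ≠ leftVertex g → e ≠ cyc g := by
    rintro e he rfl
    exact he (leftVertex_cyc g)
  have htrace : ∀ e ∈ D.trace j g ω, n (leftVertex e) = 0 := by
    intro e he
    induction he with
    | refl =>
      rw [hiface _ h0 (hne_of _ (trace_left_ne (D := D) (j := j) (ω := ω)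
        Relation.ReflTransGen.refl)), rightVertex_turn, hz0]
    | tail _ h ih => rw [hiface _ h.1 (hne_of _ h.2.2), h.2.1, ih]
  -- The potential vanishes along the interface, but not on the arc `j + 2` and not around the first
  -- blue arm. Hence the interface can stop only at the end of the arc `j`, and the hexagons of the
  -- first arm remain unexplored.
  refine ⟨hc2, hc3, ?_, k, hk1, hk2, ?_⟩
  · obtain ⟨e, he, hend⟩ := exists_trace_end h0
    refine ⟨e, he, ?_⟩
    have hn0 := htrace e he
    rcases (trace_iface h0 he).exists_next with ⟨e', he', hee⟩ | h | ⟨i, hi1, hi2, hi⟩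
    · exfalso
      refine hend e' ⟨he', hee, fun h => ?_⟩
      rcases leftVertex_eq_iff.1 h with h | h | h
      · have := he'.snd_eq (h ▸ hF1)
        rw [h, hc1] at this
        exact Bool.noConfusion this
      · have h1 : leftVertex (cyc g).symm ≠ leftVertex g := by
          rw [← leftVertex_cyc g]; exact leftVertex_ne_rightVertex _
        have h2 := harm _ hx1 (leftVertex (cyc g).symm) (snd_mem_left _) h1
        rw [← h, hee, hn0] at h2
        norm_num at h2
      · have h1 : e'.fst = apex g := (dart_eq_iff.1 h).1
        have := he'.fst_eq (h1 ▸ hF3)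
        rw [h1, hc3] at this
        exact Bool.noConfusion this
    · exact h
    · rw [hi, hn3 i (by omega) (by omega)] at hn0
      norm_num at hn0
  · refine ⟨p₁.reverse, fun x hx => ?_⟩
    rw [SimpleGraph.Walk.support_reverse, List.mem_reverse] at hx
    refine ⟨(hb1 x hx).1, ?_, (hb1 x hx).2⟩
    rintro ⟨-, e, he, hxe⟩
    have h1 := harm x hx _ hxe (trace_left_ne he)
    rw [htrace e he] at h1
    norm_num at h1

end DDom

namespace DDom

variable {D : DDom}

lemma Iface.congr {j : ℤ} {ω ω' : Config} {e : T.Dart} (h : D.Iface j ω e)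
    (h1 : e.fst ∈ D.F → ω e.fst = ω' e.fst) (h2 : e.snd ∈ D.F → ω e.snd = ω' e.snd) :
    D.Iface j ω' e :=
  ⟨h.1.imp_left fun h => ⟨h.1, (h1 h.1).symm.trans h.2⟩,
    h.2.imp_left fun h => ⟨h.1, (h2 h.1).symm.trans h.2⟩⟩

/-- The interface is determined by the colours of the explored hexagons. -/
lemma trace_congr {j : ℤ} {g : T.Dart} {ω ω' : Config}
    (h : ∀ v ∈ D.explored j g ω, ω v = ω' v) : D.trace j g ω' = D.trace j g ω := by
  have key : ∀ d ∈ D.trace j g ω, ∀ e : T.Dart, leftVertex e.symm = leftVertex d →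
      (e.fst ∈ D.F → ω e.fst = ω' e.fst) ∧ (e.snd ∈ D.F → ω e.snd = ω' e.snd) :=
    fun d hd e hed => ⟨fun hF => h _ ⟨hF, d, hd, hed ▸ fst_mem_right e⟩,
      fun hF => h _ ⟨hF, d, hd, hed ▸ snd_mem_right e⟩⟩
  refine Set.Subset.antisymm (fun e he => ?_) fun e he => ?_
  · induction he with
    | refl => exact Relation.ReflTransGen.refl
    | tail _ hn ih =>
      obtain ⟨h1, h2⟩ := key _ ih _ hn.2.1
      exact Relation.ReflTransGen.tail ih
        ⟨hn.1.congr (fun hF => (h1 hF).symm) fun hF => (h2 hF).symm, hn.2⟩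
  · have hmem : e ∈ D.trace j g ω ∧ e ∈ D.trace j g ω' := by
      induction he with
      | refl => exact ⟨Relation.ReflTransGen.refl, Relation.ReflTransGen.refl⟩
      | tail _ hn ih =>
        obtain ⟨h1, h2⟩ := key _ ih.1 _ hn.2.1
        exact ⟨Relation.ReflTransGen.tail ih.1 hn,
          Relation.ReflTransGen.tail ih.2 ⟨hn.1.congr h1 h2, hn.2⟩⟩
    exact hmem.2

lemma explored_congr {j : ℤ} {g : T.Dart} {ω ω' : Config}
    (h : ∀ v ∈ D.explored j g ω, ω v = ω' v) : D.explored j g ω' = D.explored j g ω := by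
  unfold explored
  rw [trace_congr h]

/-- The explored hexagons carry all the information on the interface, hence the event depends on the
hexagons of the domain only. -/
lemma switch_detBy (j : ℤ) (g : T.Dart) (hF : ∀ v ∈ (leftVertex g).1, v ∈ D.F) (c : Bool) :
    DetBy D.F (D.switch j g c) := by
  rintro ω ω' h ⟨h2, h3, ht, k, hk1, hk2, hJ⟩
  have hE : ∀ v ∈ D.explored j g ω, ω v = ω' v := fun v hv => h v hv.1
  refine ⟨?_, ?_, ?_, k, hk1, hk2, hJ.mono ?_⟩
  · rw [← h _ (hF _ (fst_mem_left g)), h2]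
  · rw [← h _ (hF _ (mem_leftVertex.2 (.inr (.inr rfl)))), h3]
  · rwa [trace_congr hE]
  · rintro v ⟨hv1, hv2, hv3⟩
    exact ⟨hv1, by rwa [explored_congr hE], by rw [← h v hv1, hv3]⟩

open Classical in
/-- Flip the colours of all unexplored hexagons of the domain. -/
def flipRest (D : DDom) (j : ℤ) (g : T.Dart) (ω : Config) : Config :=
  fun v => if v ∈ D.F ∧ v ∉ D.explored j g ω then !ω v else ω v

lemma flipRest_of_explored {j : ℤ} {g : T.Dart} {ω : Config} {v : Site}
    (h : v ∈ D.explored j g ω) : D.flipRest j g ω v = ω v :=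
  if_neg fun h' => h'.2 h

lemma flipRest_of_rest {j : ℤ} {g : T.Dart} {ω : Config} {v : Site} (hF : v ∈ D.F)
    (h : v ∉ D.explored j g ω) : D.flipRest j g ω v = !ω v :=
  if_pos ⟨hF, h⟩

/-- Exploring the interface leaves the other hexagons independent, so that the colour of the third
arm can be switched. -/
lemma real_switch_le (j : ℤ) (g : T.Dart) (hF : ∀ v ∈ (leftVertex g).1, v ∈ D.F) :
    critPerc.real (D.switch j g true) ≤ critPerc.real (D.switch j g false) := by
  have hE : ∀ ω, D.explored j g (D.flipRest j g ω) = D.explored j g ω := fun ω =>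
    explored_congr fun v hv => (flipRest_of_explored hv).symm
  -- The map that flips the unexplored hexagons is an injection, since it does not change what is
  -- explored.
  refine real_le_of_injection (switch_detBy j g hF _) (switch_detBy j g hF _) (D.flipRest j g) ?_ ?_
  · rintro ω ⟨h2, h3, ht, k, hk1, hk2, hJ⟩
    have h0 : turn g ∈ D.trace j g ω := Relation.ReflTransGen.refl
    refine ⟨?_, ?_, ?_, k, hk1, hk2, hJ.mono ?_⟩
    · rw [flipRest_of_explored ⟨hF _ (fst_mem_left g), turn g, h0, fst_mem_left (turn g)⟩, h2]
    · rw [flipRest_of_explored ⟨hF _ (mem_leftVertex.2 (.inr (.inr rfl))), turn g, h0,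
        snd_mem_left (turn g)⟩, h3]
    · rwa [trace_congr fun v hv => (flipRest_of_explored hv).symm]
    · rintro v ⟨hv1, hv2, hv3⟩
      exact ⟨hv1, by rwa [hE], by rw [flipRest_of_rest hv1 hv2, hv3]; rfl⟩
  · intro ω _ ω' _ h x hx
    have hEE : D.explored j g ω = D.explored j g ω' := by
      rw [← hE ω, ← hE ω']
      exact (explored_congr fun v hv => h v hv.1).symm
    have hx' := h x hx
    by_cases hxE : x ∈ D.explored j g ω
    · rwa [flipRest_of_explored hxE, flipRest_of_explored (hEE ▸ hxE)] at hx'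
    · rw [flipRest_of_rest hx hxE, flipRest_of_rest hx (hEE ▸ hxE)] at hx'
      exact Bool.not_inj hx'

/-- The interface edges that can follow `e`. -/
lemma Next.cases {j : ℤ} {g e e' : T.Dart} {ω : Config} (he : D.Iface j ω e)
    (h : D.Next j g ω e e') : e' = turn e ∨ e' = (cyc e).symm := by
  rcases rightVertex_eq_iff.1 h.2.1 with h' | h' | h'
  · exact absurd (h' ▸ h.1) he.not_symm
  · exact .inr h'
  · exact .inl h'

/-- The blue hexagons along the interface connect its beginning to its end or to the arc
`j + 1`. -/
lemma trace_blue {j : ℤ} {g : T.Dart} {ω : Config} (hF : ∀ v ∈ (leftVertex g).1, v ∈ D.F)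
    (h2 : ω g.fst = true) (h3 : ω (apex g) = false) {e : T.Dart} (he : e ∈ D.trace j g ω) :
    (∃ l, D.M (j + 1) ≤ l ∧ l < D.M (j + 2) ∧
      Joined {v | v ∈ D.explored j g ω ∧ ω v = true} g.fst (D.β l).fst) ∨
    e.fst ∈ D.F ∧ Joined {v | v ∈ D.explored j g ω ∧ ω v = true} g.fst e.fst := by
  have hF2 : g.fst ∈ D.F := hF _ (fst_mem_left g)
  have h0 : D.Iface j ω (turn g) :=
    iface_turn hF2 (hF _ (mem_leftVertex.2 (.inr (.inr rfl)))) h2 h3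
  induction he with
  | refl =>
    exact .inr ⟨hF2, .refl ⟨⟨hF2, turn g, Relation.ReflTransGen.refl, fst_mem_left (turn g)⟩, h2⟩⟩
  | @tail e e' he hn ih =>
    rcases ih with ih | ⟨hxF, hJ⟩
    · exact .inl ih
    have hie := trace_iface h0 he
    rcases hn.cases hie with rfl | rfl
    · exact .inr ⟨hxF, hJ⟩
    · by_cases hr : apex e ∈ D.F
      · refine .inr ⟨hr, hJ.tail ⟨⟨hr, e, he, mem_leftVertex.2 (.inr (.inr rfl))⟩,
          hn.1.fst_eq hr⟩ (turn e).adj⟩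
      · left
        obtain ⟨i, hi1, hi2, hi⟩ := hn.1.1.resolve_left fun h => hr h.1
        rw [SimpleGraph.Dart.symm_symm] at hi
        have h1 : turn e = D.β (i + 1) := by
          refine eq_β_of_right (d := turn e) hxF hr ?_
          rw [vert_succ, hi, rightVertex_turn, leftVertex_cyc]
        have hM11 : D.M (j + 1 + 1) = D.M (j + 2) := by rw [add_assoc]; rfl
        have hfst : (D.β (i + 1)).fst = e.fst := by rw [← h1]; rfl
        rcases eq_or_lt_of_le (show i + 1 ≤ D.M (j + 2) by omega) with h4 | h4
        · exfalso
          have h5 := D.mark (j + 2)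
          rw [← h4, add_sub_cancel_right, hi, hfst] at h5
          exact fst_ne_snd e h5.symm
        · exact ⟨i + 1, by omega, h4, by rw [hfst]; exact hJ⟩

/-- The yellow hexagons along the interface connect its beginning to its end or to the arc
`j`. -/
lemma trace_yellow {j : ℤ} {g : T.Dart} {ω : Config} (hF : ∀ v ∈ (leftVertex g).1, v ∈ D.F)
    (h2 : ω g.fst = true) (h3 : ω (apex g) = false) {e : T.Dart} (he : e ∈ D.trace j g ω) :
    (∃ l, D.M j ≤ l ∧ l < D.M (j + 1) ∧
      Joined {v | v ∈ D.explored j g ω ∧ ω v = false} (apex g) (D.β l).fst) ∨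
    e.snd ∈ D.F ∧ Joined {v | v ∈ D.explored j g ω ∧ ω v = false} (apex g) e.snd := by
  have hF3 : apex g ∈ D.F := hF _ (mem_leftVertex.2 (.inr (.inr rfl)))
  have h0 : D.Iface j ω (turn g) := iface_turn (hF _ (fst_mem_left g)) hF3 h2 h3
  induction he with
  | refl =>
    exact .inr ⟨hF3, .refl ⟨⟨hF3, turn g, Relation.ReflTransGen.refl, snd_mem_left (turn g)⟩, h3⟩⟩
  | @tail e e' he hn ih =>
    rcases ih with ih | ⟨hyF, hJ⟩
    · exact .inl ih
    have hie := trace_iface h0 he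
    rcases hn.cases hie with rfl | rfl
    · by_cases hr : apex e ∈ D.F
      · refine .inr ⟨hr, hJ.tail ⟨⟨hr, e, he, mem_leftVertex.2 (.inr (.inr rfl))⟩,
          hn.1.snd_eq hr⟩ (cyc e).adj⟩
      · left
        obtain ⟨i, hi1, hi2, hi⟩ := hn.1.2.resolve_left fun h => hr h.1
        have h1 : cyc e = D.β (i - 1) := by
          refine eq_β_of_left (d := cyc e) hyF hr ?_
          rw [sub_add_cancel, vert, hi, rightVertex_turn, leftVertex_cyc]
        have hfst : (D.β (i - 1)).fst = e.snd := by rw [← h1]; rfl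
        rcases eq_or_lt_of_le hi1 with rfl | h4
        · exfalso
          have h5 := D.mark j
          rw [hfst, hi] at h5
          exact fst_ne_snd e h5.symm
        · exact ⟨i - 1, by omega, by omega, by rw [hfst]; exact hJ⟩
    · exact .inr ⟨hyF, hJ⟩

/-- The three arms found by following the interface, read with exchanged colours: the unexplored
arm and the yellow side of the interface form a separating path. -/
theorem flip_mem_sep_of_switch {ω : Config} {j : ℤ} {g : T.Dart}
    (hF : ∀ v ∈ (leftVertex g).1, v ∈ D.F) (h : ω ∈ D.switch j g false) :
    flip ω ∈ D.sep (j + 1) (leftVertex (cyc g).symm) \ D.sep (j + 1) (leftVertex (cyc g)) := by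
  classical
  obtain ⟨h2, h3, ⟨e, he, hend⟩, k, hk1, hk2, hJ1⟩ := h
  have hF1 : g.snd ∈ D.F := hF _ (snd_mem_left g)
  have hF3 : apex g ∈ D.F := hF _ (mem_leftVertex.2 (.inr (.inr rfl)))
  have hM' : D.M j < D.M (j + 1) := D.M_mono (by omega)
  have hM'' : D.M (j + 1) < D.M (j + 2) := D.M_mono (by omega)
  have hM2 := M_add_two D j
  have hM3 : D.M (j + 3) = D.M j + D.N := D.M_add j
  have hM11 : D.M (j + 1 + 1) = D.M (j + 2) := by rw [add_assoc]; rfl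
  have hM12 : D.M (j + 1 + 2) = D.M (j + 3) := by rw [add_assoc]; rfl
  have hM10 : D.M (j + 1 - 1) = D.M j := by rw [add_sub_cancel_right]
  have hblue : ∃ l, D.M (j + 1) ≤ l ∧ l < D.M (j + 2) ∧
      Joined {v | v ∈ D.explored j g ω ∧ ω v = true} g.fst (D.β l).fst := by
    rcases trace_blue hF h2 h3 he with h | ⟨hxF, hJ⟩
    · exact h
    · obtain ⟨l, hl1, hl2, hl⟩ := exists_arc_of_mem_vert (j := j + 1)
        ⟨D.M (j + 1), le_rfl, by omega, rfl⟩ hxF (hend ▸ fst_mem_left e)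
      exact ⟨l, hl1, by omega, hl ▸ hJ⟩
  have hyellow : ∃ l, D.M j ≤ l ∧ l < D.M (j + 1) ∧
      Joined {v | v ∈ D.explored j g ω ∧ ω v = false} (apex g) (D.β l).fst := by
    rcases trace_yellow hF h2 h3 he with h | ⟨hyF, hJ⟩
    · exact h
    · obtain ⟨l, hl1, hl2, hl⟩ := exists_arc_of_mem_vert (j := j)
        ⟨D.M (j + 1), by omega, le_rfl, rfl⟩ hyF (hend ▸ snd_mem_left e)
      exact ⟨l, hl1, hl2, hl ▸ hJ⟩
  obtain ⟨l, hl1, hl2, hJ2⟩ := hblue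
  obtain ⟨k₃, hk31, hk32, q, hq⟩ := hyellow
  obtain ⟨p, hp⟩ := hJ1
  -- The blue side of the interface becomes yellow and protects the triangle of `g` from separation
  -- from the arc `j + 1`.
  have hbelow : leftVertex (cyc g) ∈ D.below (flip ω) (j + 1) := by
    rw [leftVertex_cyc]
    refine below_of_joined hl1 (by omega) (fst_mem_left g) (hJ2.mono ?_)
    rintro v ⟨hv1, hv2⟩
    exact ⟨hv1.1, by simp [hv2]⟩
  refine ⟨?_, not_sep_of_below hbelow⟩
  -- the separating path, as a simple path
  have hβ : D.β (k + D.N) = D.β k := D.β_add k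
  have hb1 : ∀ v ∈ p.bypass.support, v ∈ D.F ∧ v ∉ D.explored j g ω ∧ ω v = false :=
    fun v hv => hp v (p.support_bypass_subset_support hv)
  have hb3 : ∀ v ∈ q.bypass.support, v ∈ D.explored j g ω ∧ ω v = false :=
    fun v hv => hq v (q.support_bypass_subset_support hv)
  obtain ⟨p', hp'1, hp'2⟩ : ∃ p' : T.Walk g.snd (D.β (k + D.N)).fst, p'.IsPath ∧
      ∀ v ∈ p'.support, v ∈ D.F ∧ v ∉ D.explored j g ω ∧ ω v = false := by
    rw [hβ]; exact ⟨p.bypass, p.bypass_isPath, hb1⟩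
  let γ : T.Walk (D.β k₃).fst (D.β (k + D.N)).fst :=
    q.bypass.reverse.append (.cons (show T.Adj (apex g) g.snd from (cyc g).symm.adj) p')
  have hγs : ∀ v ∈ γ.support, v ∈ D.F ∧ flip ω v = true := by
    intro v hv
    simp only [γ, SimpleGraph.Walk.mem_support_append_iff, SimpleGraph.Walk.support_cons,
      SimpleGraph.Walk.support_reverse, List.mem_reverse, List.mem_cons] at hv
    rcases hv with hv | rfl | hv
    · exact ⟨(hb3 v hv).1.1, by simp [(hb3 v hv).2]⟩
    · exact ⟨hF3, by simp [h3]⟩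
    · exact ⟨(hp'2 v hv).1, by simp [(hp'2 v hv).2.2]⟩
  have hγp : γ.IsPath := by
    rw [SimpleGraph.Walk.isPath_def, SimpleGraph.Walk.support_append,
      SimpleGraph.Walk.support_cons, List.tail_cons, List.nodup_append']
    refine ⟨q.bypass_isPath.reverse.support_nodup, hp'1.support_nodup, ?_⟩
    intro v hv hv'
    rw [SimpleGraph.Walk.support_reverse, List.mem_reverse] at hv
    exact (hp'2 v hv').2.1 (hb3 v hv).1
  obtain ⟨n, hn1, hn2, hn3⟩ := exists_crossPotential (D := D) (k := k₃) (l := k + D.N) (by omega)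
    (by omega) γ fun v hv => (hγs v hv).1
  refine mem_sep_of_pot (j := j + 1) (by omega) (by omega) (by omega) (by omega) hγp hγs hn1 hn2 ?_
  -- The potential of the path vanishes on the arc `j + 1`, hence at the triangle of `g`, and it
  -- jumps across the edge from `x₃` to `x₁`.
  have hz0 : n (leftVertex (cyc g)) = 0 := by
    obtain ⟨s, ⟨i, hi1, hi2, rfl⟩, hs⟩ := hbelow
    rw [hs.eq_of fun e he => pot_eq_of_off hn1 he.inner (he.off hγs)]
    exact hn2 i (by omega) (by omega)
  have hγd : γ.darts = q.bypass.reverse.darts ++ (cyc g).symm :: p'.darts := by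
    simp only [γ, SimpleGraph.Walk.darts_append, SimpleGraph.Walk.darts_cons]; rfl
  have hx1q : g.snd ∉ q.bypass.reverse.support := by
    rw [SimpleGraph.Walk.support_reverse, List.mem_reverse]
    exact fun h => (hp'2 _ p'.start_mem_support).2.1 (hb3 _ h).1
  have hx3p : apex g ∉ p'.support := fun h =>
    (hp'2 _ h).2.1 (hb3 _ q.bypass.start_mem_support).1
  have h1 := hn1 (cyc g).symm hF3
  have h4 : γ.darts.count (cyc g).symm = 1 := by
    rw [hγd, List.count_append, List.count_cons_self, List.count_eq_zero.2, List.count_eq_zero.2]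
    · exact fun h => hx3p (p'.dart_fst_mem_support_of_mem_darts h)
    · exact fun h => hx1q
        (q.bypass.reverse.dart_snd_mem_support_of_mem_darts (d := (cyc g).symm) h)
  have h5 : γ.darts.count (cyc g) = 0 := by
    rw [hγd, List.count_append, List.count_cons_of_ne, List.count_eq_zero.2, List.count_eq_zero.2]
    · exact fun h => hx3p (p'.dart_snd_mem_support_of_mem_darts h)
    · exact fun h => hx1q (q.bypass.reverse.dart_fst_mem_support_of_mem_darts h)
    · exact fun h => fst_ne_snd (cyc g) (dart_eq_iff.1 h).2
  have h6 : (cyc g).symm ≠ D.β (k + D.N) := fun h => D.β_snd _ (by rw [← h]; exact hF1)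
  have h7 : (cyc g).symm ≠ D.β k₃ := fun h => D.β_snd _ (by rw [← h]; exact hF1)
  rw [passages, SimpleGraph.Dart.symm_symm, h4, h5, if_neg h6, if_neg h7, hz0] at h1
  push_cast at h1
  omega

lemma sep_detBy (D : DDom) (j : ℤ) (z : HexVertex) : DetBy D.F (D.sep j z) := by
  rintro ω ω' h ⟨k, l, hk1, hk2, hl1, hl2, γ, hp, hγ, hsep⟩
  exact ⟨k, l, hk1, hk2, hl1, hl2, γ, hp,
    fun x hx => ⟨(hγ x hx).1, (h x (hγ x hx).1).symm.trans (hγ x hx).2⟩, hsep⟩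

lemma sep_subset_of_shift {j j' s : ℤ} (hM : ∀ i, D.M (j' + i) = D.M (j + i) + s)
    (hs : (D.N : ℤ) ∣ s) (z : HexVertex) : D.sep j z ⊆ D.sep j' z := by
  rintro ω ⟨k, l, hk1, hk2, hl1, hl2, γ, hp, hγ, hsep⟩
  have e1 : D.M (j' - 1) = D.M (j - 1) + s := hM (-1)
  have e2 := hM 1
  have e3 := hM 2
  have e0 : D.M j' = D.M j + s := by simpa using hM 0
  have main : ∀ a b, D.β a = D.β k → D.β b = D.β l → D.M (j' - 1) ≤ a → a < D.M j' →
      D.M (j' + 1) ≤ b → b < D.M (j' + 2) → ω ∈ D.sep j' z := by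
    intro a b ha hb h1 h2 h3 h4
    have : ∃ γ : T.Walk (D.β a).fst (D.β b).fst, γ.IsPath ∧
        (∀ x ∈ γ.support, x ∈ D.F ∧ ω x = true) ∧
        ∀ t ∈ D.arcVert j, ¬ Conn (fun e => D.Inner e ∧ D.Off γ a b e) z t := by
      unfold Off at *
      rw [ha, hb]
      exact ⟨γ, hp, hγ, hsep⟩
    obtain ⟨γ', h5, h6, h7⟩ := this
    refine ⟨a, b, h1, h2, h3, h4, γ', h5, h6, ?_⟩
    rintro t ⟨i, hi1, hi2, rfl⟩
    refine h7 _ ⟨i - s, by omega, by omega, ?_⟩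
    rw [vert, vert, β_eq_of_dvd (show (D.N : ℤ) ∣ i - s - i by simpa using hs)]
  exact main (k + s) (l + s) (β_eq_of_dvd (by simpa using hs)) (β_eq_of_dvd (by simpa using hs))
    (by omega) (by omega) (by omega) (by omega)

lemma sep_add_three (D : DDom) (j : ℤ) (z : HexVertex) : D.sep (j + 3) z = D.sep j z := by
  have h : ∀ i, D.M (j + 3 + i) = D.M (j + i) + D.N := fun i => by
    rw [← D.M_add]; congr 1; ring
  refine Set.Subset.antisymm (sep_subset_of_shift (s := -D.N) (fun i => ?_) ?_ z)
    (sep_subset_of_shift h (dvd_refl _) z)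
  · rw [h]; ring
  · exact (dvd_refl _).neg_right

/-- The probability that the triangle to the right of `g` is separated from the arc `j` by a blue
path but the one to the left of `g` is not. -/
def gap (D : DDom) (j : ℤ) (g : T.Dart) : ℝ :=
  critPerc.real (D.sep j (leftVertex g.symm) \ D.sep j (leftVertex g))

/-- One inequality of colour switching: the arms of a gap are found by exploration, the colour of
the unexplored one is switched, and the result is read with exchanged colours. -/
lemma gap_le {j : ℤ} {g : T.Dart} (hF : ∀ v ∈ (leftVertex g).1, v ∈ D.F) :
    D.gap j g ≤ D.gap (j + 1) (cyc g) := by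
  refine (measureReal_mono fun ω hω => mem_switch_of_sep hF hω.1 hω.2).trans
    ((real_switch_le j g hF).trans ?_)
  rw [gap, ← real_flip ((sep_detBy D _ _).diff (sep_detBy D _ _))]
  exact measureReal_mono fun ω hω => flip_mem_sep_of_switch hF hω

/-- The colour switching identity: the gap is invariant under a simultaneous rotation of the
arc and of the edge of the triangle. -/
theorem gap_eq {j : ℤ} {g : T.Dart} (hF : ∀ v ∈ (leftVertex g).1, v ∈ D.F) :
    D.gap (j + 1) (cyc g) = D.gap j g := by
  have hF' : ∀ v ∈ (leftVertex (cyc g)).1, v ∈ D.F := by rwa [leftVertex_cyc]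
  have hF'' : ∀ v ∈ (leftVertex (cyc (cyc g))).1, v ∈ D.F := by rwa [leftVertex_cyc]
  -- Applied three times around the triangle, the inequality closes up to an equality.
  have h1 := gap_le (j := j) hF
  have h2 := gap_le (j := j + 1) hF'
  have h3 := gap_le (j := j + 1 + 1) hF''
  have hper : ∀ z, D.sep (j + 1 + 1 + 1) z = D.sep j z := fun z => by
    rw [show j + 1 + 1 + 1 = j + 3 by ring, sep_add_three]
  have h4 : D.gap (j + 1 + 1 + 1) (cyc (cyc (cyc g))) = D.gap j g := by
    rw [cyc_cyc_cyc, gap, gap, hper, hper]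
  linarith

end DDom

/-! ### Winding numbers of contours -/

lemma joined_univ (u v : Site) : Joined Set.univ u v := by
  have h1 : ∀ (n : ℕ) (w : Site), Joined Set.univ w (w.1 + n, w.2) := by
    intro n w
    induction n with
    | zero => simpa using Joined.refl (Set.mem_univ w)
    | succ n ih =>
      refine ih.tail (Set.mem_univ _) ?_
      rw [adj_iff]; left; push_cast; ext <;> simp; ring
  have h2 : ∀ (n : ℕ) (w : Site), Joined Set.univ w (w.1, w.2 + n) := by
    intro n w
    induction n with
    | zero => simpa using Joined.refl (Set.mem_univ w)
    | succ n ih =>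
      refine ih.tail (Set.mem_univ _) ?_
      rw [adj_iff]; right; left; push_cast; ext <;> simp; ring
  have h3 : ∀ a b c : ℤ, Joined Set.univ (a, c) (b, c) := by
    intro a b c
    rcases le_total a b with h | h
    · have := h1 (b - a).toNat (a, c)
      rwa [Int.toNat_of_nonneg (by omega), add_sub_cancel] at this
    · have := h1 (a - b).toNat (b, c)
      rw [Int.toNat_of_nonneg (by omega), add_sub_cancel] at this
      exact this.symm
  refine (h3 u.1 v.1 u.2).trans ?_
  rcases le_total u.2 v.2 with h | h
  · have := h2 (v.2 - u.2).toNat (v.1, u.2)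
    rwa [Int.toNat_of_nonneg (by omega), add_sub_cancel] at this
  · have := h2 (u.2 - v.2).toNat v
    rw [Int.toNat_of_nonneg (by omega), add_sub_cancel] at this
    exact this.symm

lemma conn_univ (s t : HexVertex) : Conn (fun _ => True) s t := by
  obtain ⟨e, rfl⟩ := exists_leftVertex_eq s
  obtain ⟨d, rfl⟩ := exists_leftVertex_eq t
  refine (joined_univ e.fst d.fst).induct (P := fun v => ∀ t : HexVertex, v ∈ t.1 →
    Conn (fun _ => True) (leftVertex e) t) (fun t ht => Conn.hexagon (fst_mem_left e) ht
      fun _ _ => trivial) (fun u v _ _ huv h t ht => ?_) _ (fst_mem_left d)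
  exact (h (leftVertex ⟨(u, v), huv⟩) (fst_mem_left _)).trans
    (Conn.hexagon (snd_mem_left _) ht fun _ _ => trivial)

namespace DDom

variable {D : DDom}

/-- The complement of a discrete domain is connected, since its boundary is a single cycle. -/
lemma joined_compl {v w : Site} (hv : v ∉ D.F) (hw : w ∉ D.F) : Joined {v | v ∉ D.F} v w := by
  have key : ∀ v, v ∉ D.F → Joined {v | v ∉ D.F} (D.β 0).snd v := by
    intro v hv
    obtain ⟨a, b, ha, -, hb, hab, hJ⟩ := (joined_univ (D.β 0).fst v).exists_last_exit
      (A := {x | x ∈ D.F}) (D.β_fst 0) hv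
    obtain ⟨k, hk⟩ := D.β_surj ⟨(a, b), hab⟩ ha hb
    have hb' : (D.β k).snd = b := by rw [hk]
    refine Joined.trans ?_ (hJ.mono fun x hx => hx.2)
    rw [← hb']
    rcases le_total 0 k with h | h
    · have := joined_outside (D := D) 0 k.toNat
      rwa [Int.toNat_of_nonneg h, zero_add] at this
    · have := joined_outside (D := D) k (-k).toNat
      rw [Int.toNat_of_nonneg (by omega), add_neg_cancel] at this
      exact this.symm
  exact (key v hv).symm.trans (key w hw)

/-- A closed walk inside the domain does not wind around sites outside of it. -/
lemma winding_eq_zero {o : Site} (C : T.Walk o o) (hC : ∀ x ∈ C.support, x ∈ D.F) {t : HexVertex}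
    {v : Site} (hv : v ∈ t.1) (hvF : v ∉ D.F) : winding C.darts t = 0 := by
  have hstep : ∀ e : T.Dart, e.fst ∉ D.F →
      winding C.darts (leftVertex e) = winding C.darts (leftVertex e.symm) := by
    intro e he
    have h := winding_jump C e
    rw [passages, count_eq_zero_of_notMem_support C e (.inl fun h => he (hC _ h)),
      count_eq_zero_of_notMem_support C e.symm (.inr fun h => he (hC _ h))] at h
    simp only [Nat.cast_zero, sub_zero] at h
    linarith
  obtain ⟨B, hB⟩ : ∃ B : ℤ, ∀ x ∈ D.F, x.2 < B := by
    obtain ⟨B, hB⟩ := (D.F.image Prod.snd).bddAbove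
    exact ⟨B + 1, fun x hx => Int.lt_add_one_of_le (hB (by simpa using ⟨x.1, hx⟩))⟩
  -- Above the domain the rays do not meet the walk.
  let d : T.Dart := baseDart (0, B)
  have hd : d.fst ∉ D.F := fun h => lt_irrefl _ (hB _ h)
  have h0 : winding C.darts (leftVertex d) = 0 := by
    rw [winding_leftVertex]
    refine List.sum_eq_zero fun x hx => ?_
    obtain ⟨c, hc, rfl⟩ := List.mem_map.1 hx
    have h1 := hB _ (hC _ (C.dart_fst_mem_support_of_mem_darts hc))
    have h2 := hB _ (hC _ (C.dart_snd_mem_support_of_mem_darts hc))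
    simp only [d, baseDart, stripSign, Prod.fst_add, Prod.snd_add]
    rw [if_neg, if_neg] <;> omega
  rw [← h0]
  have hJ := joined_compl hd hvF
  have hhex : ∀ v, v ∉ D.F → ∀ s t : HexVertex, v ∈ s.1 → v ∈ t.1 →
      winding C.darts t = winding C.darts s := fun v hv s t hs ht =>
    (Conn.hexagon (ok := fun e => e.fst ∉ D.F) hs ht fun e he => he ▸ hv).eq_of hstep
  refine hJ.induct (P := fun v => ∀ t : HexVertex, v ∈ t.1 → winding C.darts t =
    winding C.darts (leftVertex d)) (fun t ht => hhex _ hd _ _ (fst_mem_left d) ht) ?_ t hv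
  intro u v _ hv huv h t ht
  rw [hhex v hv _ t (snd_mem_left ⟨(u, v), huv⟩) ht, h _ (fst_mem_left _)]

end DDom

section Cycle

variable {o : Site} {C : T.Walk o o}

lemma IsCycle.symm_notMem (hC : C.IsCycle) {d : T.Dart} (h : d ∈ C.darts) : d.symm ∉ C.darts := by
  intro h'
  have hn : (C.darts.map SimpleGraph.Dart.edge).Nodup := hC.isTrail.edges_nodup
  have := List.inj_on_of_nodup_map hn h h' (SimpleGraph.Dart.edge_symm d).symm
  exact fst_ne_snd d (dart_eq_iff.1 this).1

lemma IsCycle.eq_of_snd (hC : C.IsCycle) {d d' : T.Dart} (h : d ∈ C.darts) (h' : d' ∈ C.darts)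
    (e : d.snd = d'.snd) : d = d' := by
  have hn := hC.support_nodup
  rw [← SimpleGraph.Walk.map_snd_darts] at hn
  exact List.inj_on_of_nodup_map hn h h' e

lemma IsCycle.eq_of_fst (hC : C.IsCycle) {d d' : T.Dart} (h : d ∈ C.darts) (h' : d' ∈ C.darts)
    (e : d.fst = d'.fst) : d = d' := by
  have key : ∀ d ∈ C.darts, d.symm ∈ C.reverse.darts := fun d hd => by
    rw [SimpleGraph.Walk.darts_reverse, List.mem_reverse, List.mem_map]
    exact ⟨d, hd, rfl⟩
  have := IsCycle.eq_of_snd (C := C.reverse) hC.reverse (key d h) (key d' h') e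
  exact SimpleGraph.Dart.symm_involutive.injective this

lemma IsCycle.passages_eq (hC : C.IsCycle) {d : T.Dart} (h : d ∈ C.darts) :
    passages C.darts d = 1 := by
  have hn : C.darts.Nodup := List.Nodup.of_map _ (show (C.darts.map SimpleGraph.Dart.edge).Nodup
    from hC.isTrail.edges_nodup)
  rw [passages, List.count_eq_one_of_mem hn h, List.count_eq_zero.2 (IsCycle.symm_notMem hC h)]
  rfl

lemma passages_eq_zero {L : List T.Dart} {d : T.Dart} (h : d ∉ L) (h' : d.symm ∉ L) :
    passages L d = 0 := by
  rw [passages, List.count_eq_zero.2 h, List.count_eq_zero.2 h']; rfl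

/-- All vertices immediately to the left of a cycle have the same winding number. -/
lemma IsCycle.winding_left_eq (hC : C.IsCycle) {d d' : T.Dart} (hd : d ∈ C.darts)
    (hd' : d' ∈ C.darts) : winding C.darts (leftVertex d) = winding C.darts (leftVertex d') := by
  have hstep : ∀ a ∈ C.darts, ∀ b ∈ C.darts, T.DartAdj a b →
      winding C.darts (leftVertex a) = winding C.darts (leftVertex b) := by
    intro a ha b hb hab
    have := Conn.between (ok := fun c => winding C.darts (leftVertex c) =
      winding C.darts (leftVertex c.symm)) (e := b) (d := a.symm) hab
      (fun h => IsCycle.symm_notMem hC ha (h ▸ hb)) fun c h1 h2 h3 => ?_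
    · rw [SimpleGraph.Dart.symm_symm] at this
      exact this.eq_of fun e he => he
    · have h4 : c ∉ C.darts := fun h => h2 (IsCycle.eq_of_fst hC h hb h1)
      have h5 : c.symm ∉ C.darts := fun h => h3 (by
        rw [← IsCycle.eq_of_snd hC h ha (h1.trans hab.symm), SimpleGraph.Dart.symm_symm])
      have := winding_jump C c
      rw [passages_eq_zero h4 h5] at this
      linarith
  have hch := C.isChain_dartAdj_darts
  have hch2 : C.darts.IsChain fun a b =>
      winding C.darts (leftVertex a) = winding C.darts (leftVertex b) := by
    refine List.IsChain.imp_of_mem_imp ?_ hch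
    intro a b ha hb hab
    exact hstep a ha b hb hab
  have : IsTrans T.Dart fun a b =>
      winding C.darts (leftVertex a) = winding C.darts (leftVertex b) := ⟨fun _ _ _ h h' => h.trans h'⟩
  have hp := List.isChain_iff_pairwise.1 hch2
  have : Std.Symm fun a b : T.Dart =>
      winding C.darts (leftVertex a) = winding C.darts (leftVertex b) := ⟨fun _ _ h => h.symm⟩
  exact List.Pairwise.forall_of_forall (R := fun a b : T.Dart =>
    winding C.darts (leftVertex a) = winding C.darts (leftVertex b)) (fun _ _ => rfl) hp hd hd'

end Cycle

/-! ### Contour integrals of separating probabilities -/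

/-- The complex number represented by the oriented edge `e` of `δT`. -/
def vec (δ : ℝ) (e : T.Dart) : ℂ := sitePt δ e.snd - sitePt δ e.fst

lemma vec_symm (δ : ℝ) (e : T.Dart) : vec δ e.symm = -vec δ e := by
  simp [vec]

lemma exp_sq_eq : Complex.exp (Real.pi / 3 * Complex.I) ^ 2 =
    Complex.exp (Real.pi / 3 * Complex.I) - 1 := by
  rw [exp_pi_div_three]
  have h3 : √3 ^ 2 = (3 : ℝ) := Real.sq_sqrt (by norm_num)
  apply Complex.ext
  · simp only [pow_two, Complex.mul_re, Complex.sub_re, Complex.one_re]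
    linarith
  · simp [pow_two]; ring

lemma zeta_eq : zeta = Complex.exp (Real.pi / 3 * Complex.I) - 1 := by
  rw [← exp_sq_eq, ← Complex.exp_nat_mul, zeta]
  congr 1
  push_cast; ring

lemma sitePt_apex (δ : ℝ) (e : T.Dart) :
    sitePt δ (apex e) = sitePt δ e.fst + Complex.exp (Real.pi / 3 * Complex.I) * vec δ e := by
  have h := exp_sq_eq
  simp only [sitePt, vec, apex, rot, Prod.fst_add, Prod.snd_add, Prod.fst_sub, Prod.snd_sub]
  push_cast
  linear_combination (-(δ : ℂ) * ((e.snd.2 : ℂ) - e.fst.2)) * h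

lemma vec_cyc (δ : ℝ) (e : T.Dart) : vec δ (cyc e) = zeta * vec δ e := by
  have h : vec δ (cyc e) = sitePt δ (apex e) - sitePt δ e.snd := rfl
  rw [h, sitePt_apex, zeta_eq]
  simp only [vec]; ring

lemma vec_add_vec_cyc (δ : ℝ) (e : T.Dart) :
    vec δ e + vec δ (cyc e) + vec δ (cyc (cyc e)) = 0 := by
  have h : vec δ (cyc (cyc e)) = sitePt δ (apex (cyc e)) - sitePt δ (apex e) := rfl
  rw [h, apex_cyc]
  simp only [vec, cyc_fst, cyc_snd]; ring

/-- Twice the signed area of the triangle spanned by the origin and the oriented edge `e`. -/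
def areaForm (δ : ℝ) (e : T.Dart) : ℝ :=
  ((starRingEnd ℂ) (sitePt δ e.fst) * sitePt δ e.snd).im

lemma areaForm_symm (δ : ℝ) (e : T.Dart) : areaForm δ e.symm = -areaForm δ e := by
  simp [areaForm]; ring

/-- The sum is twice the area of the triangle to the left of `e`. -/
lemma areaForm_cyc_nonneg (δ : ℝ) (e : T.Dart) :
    0 ≤ areaForm δ e + areaForm δ (cyc e) + areaForm δ (cyc (cyc e)) := by
  have h1 : sitePt δ e.snd = sitePt δ e.fst + vec δ e := by simp [vec]
  have h2 := sitePt_apex δ e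
  have key : areaForm δ e + areaForm δ (cyc e) + areaForm δ (cyc (cyc e)) =
      Complex.normSq (vec δ e) * (√3 / 2) := by
    have h : (cyc (cyc e)).snd = e.fst := apex_cyc e
    simp only [areaForm, h, cyc_fst, cyc_snd, h2, exp_pi_div_three]
    rw [h1]
    generalize sitePt δ e.fst = p
    generalize vec δ e = d
    simp [Complex.normSq_apply]
    ring
  rw [key]
  exact mul_nonneg (Complex.normSq_nonneg _) (by positivity)

/-- The oriented edges with both ends in `F`. -/
def innerDarts (F : Finset Site) : Finset T.Dart := (DDom.star F).filter fun e => e.snd ∈ F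

/-- The oriented edges whose triangle on the left is contained in `F`. -/
def leftDarts (F : Finset Site) : Finset T.Dart :=
  (innerDarts F).filter fun e => apex e ∈ F

section Sums

variable {F : Finset Site} {R : Type*} [AddCommGroup R]

lemma mem_innerDarts {e : T.Dart} : e ∈ innerDarts F ↔ e.fst ∈ F ∧ e.snd ∈ F := by
  rw [innerDarts, Finset.mem_filter, DDom.mem_star]

lemma mem_leftDarts {e : T.Dart} : e ∈ leftDarts F ↔ (e.fst ∈ F ∧ e.snd ∈ F) ∧ apex e ∈ F := by
  rw [leftDarts, Finset.mem_filter, mem_innerDarts]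

lemma sum_symm (f : T.Dart → R) :
    ∑ e ∈ innerDarts F, f e.symm = ∑ e ∈ innerDarts F, f e := by
  have h : ∀ e ∈ innerDarts F, e.symm ∈ innerDarts F := fun e he => by
    rw [mem_innerDarts] at he ⊢; exact he.symm
  exact Finset.sum_nbij' (fun e => e.symm) (fun e => e.symm) h h
    (fun e _ => SimpleGraph.Dart.symm_symm e) (fun e _ => SimpleGraph.Dart.symm_symm e)
    fun _ _ => rfl

lemma sum_cyc (f : T.Dart → R) :
    ∑ e ∈ leftDarts F, f (cyc e) = ∑ e ∈ leftDarts F, f e := by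
  have h : ∀ e ∈ leftDarts F, cyc e ∈ leftDarts F := fun e he => by
    rw [mem_leftDarts] at he ⊢
    rw [apex_cyc]
    exact ⟨⟨he.1.2, he.2⟩, he.1.1⟩
  exact Finset.sum_nbij' cyc (fun e => cyc (cyc e)) h (fun e he => h _ (h _ he))
    (fun e _ => cyc_cyc_cyc e) (fun e _ => cyc_cyc_cyc e) fun _ _ => rfl

end Sums

section Cycle

variable {o : Site} {C : T.Walk o o}

/-- The winding number of a cycle takes only the values `c` and `c + 1` for `c = 0` or `c = -1`,
given that it vanishes somewhere. -/
lemma IsCycle.exists_winding (hC : C.IsCycle) {t₀ : HexVertex} (h0 : winding C.darts t₀ = 0) :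
    ∃ c : ℤ, (c = 0 ∨ c = -1) ∧ (∀ t, winding C.darts t = c ∨ winding C.darts t = c + 1) ∧
      ∀ d, d ∈ C.darts ↔
        winding C.darts (leftVertex d) = c + 1 ∧ winding C.darts (leftVertex d.symm) = c := by
  obtain ⟨d₀, hd₀⟩ : ∃ d, d ∈ C.darts := by
    cases C with
    | nil => exact (SimpleGraph.Walk.not_isCycle_nil hC).elim
    | cons h p => exact ⟨_, List.mem_cons_self⟩
  set n := winding C.darts
  obtain ⟨c, hc⟩ : ∃ c, n (leftVertex d₀) = c + 1 := ⟨n (leftVertex d₀) - 1, by ring⟩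
  have hl : ∀ d ∈ C.darts, n (leftVertex d) = c + 1 := fun d hd => by
    rw [← hc]; exact IsCycle.winding_left_eq hC hd hd₀
  have hr : ∀ d ∈ C.darts, n (leftVertex d.symm) = c := fun d hd => by
    have h1 := winding_jump C d
    rw [IsCycle.passages_eq hC hd] at h1
    have h2 := hl d hd
    simp only [n] at h2 ⊢
    linarith
  -- The winding number changes only across the cycle, where it takes the values `c` and `c + 1`; so
  -- it is one of them as soon as the cycle has been reached from `t₀`, and `0` must be one of them.
  have hP : ∀ t, (n t = 0 ∨ n t = c ∨ n t = c + 1) ∧ (n t = 0 ∨ c = 0 ∨ c = -1) := by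
    intro t
    refine (conn_univ t₀ t).induct (P := fun t => (n t = 0 ∨ n t = c ∨ n t = c + 1) ∧
      (n t = 0 ∨ c = 0 ∨ c = -1)) ⟨.inl h0, .inl h0⟩ fun e _ h => ?_
    by_cases he : e ∈ C.darts
    · have := hl e he; have := hr e he
      omega
    · by_cases he' : e.symm ∈ C.darts
      · have := hl _ he'
        have h2 := hr _ he'
        rw [SimpleGraph.Dart.symm_symm] at h2
        omega
      · have h1 := winding_jump C e
        rw [passages_eq_zero he he'] at h1
        have : n (leftVertex e) = n (leftVertex e.symm) := by simp only [n]; linarith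
        rwa [this]
  have hc' : c = 0 ∨ c = -1 := by
    have := (hP (leftVertex d₀)).2
    omega
  refine ⟨c, hc', fun t => ?_, fun d => ⟨fun hd => ⟨hl d hd, hr d hd⟩, fun h => ?_⟩⟩
  · have := (hP t).1
    omega
  · by_contra hd
    by_cases hd' : d.symm ∈ C.darts
    · have := hl _ hd'
      omega
    · have h1 := winding_jump C d
      rw [passages_eq_zero hd hd'] at h1
      simp only [n] at h
      omega

end Cycle

namespace DDom

variable {D : DDom} {o : Site} {C : T.Walk o o}

lemma sum_map_darts {R : Type*} [AddCommGroup R] (hC : C.IsCycle) (hF : ∀ x ∈ C.support, x ∈ D.F)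
    (f : T.Dart → R) :
    (C.darts.map f).sum = ∑ e ∈ innerDarts D.F, if e ∈ C.darts then f e else 0 := by
  classical
  have hn : C.darts.Nodup := List.Nodup.of_map _ (show (C.darts.map SimpleGraph.Dart.edge).Nodup
    from hC.isTrail.edges_nodup)
  rw [← List.sum_toFinset f hn, ← Finset.sum_filter]
  refine Finset.sum_congr (Finset.ext fun e => ?_) fun _ _ => rfl
  rw [List.mem_toFinset, Finset.mem_filter, mem_innerDarts]
  exact ⟨fun h => ⟨⟨hF _ (C.dart_fst_mem_support_of_mem_darts h),
    hF _ (C.dart_snd_mem_support_of_mem_darts h)⟩, h⟩, fun h => h.2⟩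

/-- Edges whose triangle on the left is not contained in the domain have winding number `0` on their
left. -/
lemma sum_winding_mul (hF : ∀ x ∈ C.support, x ∈ D.F) {R : Type*} [CommRing R]
    (f : T.Dart → R) :
    ∑ e ∈ innerDarts D.F, (winding C.darts (leftVertex e) : R) * f e =
      ∑ e ∈ leftDarts D.F, (winding C.darts (leftVertex e) : R) * f e := by
  rw [leftDarts, Finset.sum_filter]
  refine Finset.sum_congr rfl fun e _ => ?_
  split_ifs with h
  · rfl
  · rw [winding_eq_zero C hF (mem_leftVertex.2 (.inr (.inr rfl))) h, Int.cast_zero, zero_mul]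

/-- A counterclockwise cycle inside the domain winds once around the triangles inside of it. -/
lemma winding_of_area_pos (hC : C.IsCycle) (hF : ∀ x ∈ C.support, x ∈ D.F) {δ : ℝ}
    (harea : 0 < (C.darts.map (areaForm δ)).sum) :
    (∀ t, winding C.darts t = 0 ∨ winding C.darts t = 1) ∧
      ∀ d, d ∈ C.darts ↔
        winding C.darts (leftVertex d) = 1 ∧ winding C.darts (leftVertex d.symm) = 0 := by
  have h0 : winding C.darts (leftVertex (D.β 0)) = 0 :=
    winding_eq_zero C hF (snd_mem_left _) (D.β_snd 0)
  obtain ⟨c, hc | hc, h1, h2⟩ := IsCycle.exists_winding hC h0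
  · subst hc; simpa using ⟨h1, h2⟩
  exfalso
  subst hc
  set n := winding C.darts
  -- If the winding numbers were `0` and `-1`, then the enclosed area would be the negative of the
  -- total area of the triangles with winding number `-1`. The indicator of the edges of `C` is
  -- expressed by the winding numbers on both sides, and summation by parts gives a sum over
  -- triangles.
  have e1 : (C.darts.map (areaForm δ)).sum =
      ∑ e ∈ innerDarts D.F, (1 + (n (leftVertex e) : ℝ)) * (-n (leftVertex e.symm)) *
        areaForm δ e := by
    rw [sum_map_darts hC hF]
    refine Finset.sum_congr rfl fun e _ => ?_
    split_ifs with h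
    · rw [h2] at h
      rw [h.1, h.2]; push_cast; ring
    · rw [h2] at h
      rcases h1 (leftVertex e) with h3 | h3
      · rw [h3]; push_cast; ring
      · rcases h1 (leftVertex e.symm) with h4 | h4
        · exact absurd ⟨h3, h4⟩ h
        · rw [h4]; push_cast; ring
  have e2 := sum_symm (F := D.F) fun e => (n (leftVertex e) : ℝ) * n (leftVertex e.symm) *
    areaForm δ e
  simp only [SimpleGraph.Dart.symm_symm, areaForm_symm] at e2
  have e3 := sum_symm (F := D.F) fun e => (n (leftVertex e) : ℝ) * areaForm δ e
  simp only [areaForm_symm] at e3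
  have e4 := sum_winding_mul hF (areaForm δ)
  have e5 := sum_cyc (F := D.F) fun e => (n (leftVertex e) : ℝ) * areaForm δ e
  have e6 := sum_cyc (F := D.F) fun e => (n (leftVertex (cyc e)) : ℝ) * areaForm δ (cyc e)
  simp only [leftVertex_cyc] at e5 e6
  have e7 : ∑ e ∈ leftDarts D.F, (n (leftVertex e) : ℝ) *
      (areaForm δ e + areaForm δ (cyc e) + areaForm δ (cyc (cyc e))) ≤ 0 := by
    refine Finset.sum_nonpos fun e _ => mul_nonpos_of_nonpos_of_nonneg ?_ (areaForm_cyc_nonneg δ e)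
    rcases h1 (leftVertex e) with h | h <;> rw [h] <;> norm_num
  simp only [mul_add, Finset.sum_add_distrib] at e7
  have e8 : ∑ e ∈ innerDarts D.F, (1 + (n (leftVertex e) : ℝ)) * (-n (leftVertex e.symm)) *
        areaForm δ e = ∑ e ∈ innerDarts D.F, (n (leftVertex e.symm) : ℝ) * -areaForm δ e -
      ∑ e ∈ innerDarts D.F, (n (leftVertex e) : ℝ) * n (leftVertex e.symm) * areaForm δ e := by
    rw [← Finset.sum_sub_distrib]
    exact Finset.sum_congr rfl fun e _ => by ring
  have e9 : ∑ e ∈ innerDarts D.F, (n (leftVertex e) : ℝ) * n (leftVertex e.symm) *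
      areaForm δ e = 0 := by
    have : ∑ e ∈ innerDarts D.F, (n (leftVertex e.symm) : ℝ) * n (leftVertex e) *
        -areaForm δ e = - ∑ e ∈ innerDarts D.F, (n (leftVertex e) : ℝ) * n (leftVertex e.symm) *
      areaForm δ e := by
      rw [← Finset.sum_neg_distrib]
      exact Finset.sum_congr rfl fun e _ => by ring
    rw [this] at e2
    linarith
  rw [e1, e8, e9, e3] at harea
  simp only [n] at *
  linarith

/-- A discrete integration by parts: the contour integral of a separating probability, in terms of
the gaps across the edges inside of the contour. -/
lemma contourIntegral_eq (hC : C.IsCycle) (hF : ∀ x ∈ C.support, x ∈ D.F) {δ : ℝ}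
    (harea : 0 < (C.darts.map (areaForm δ)).sum) (j : ℤ) :
    contourIntegral C δ (fun t => critPerc.real (D.sep j t)) =
      ∑ e ∈ leftDarts D.F, (winding C.darts (leftVertex e) : ℂ) * (D.gap j e * vec δ e) -
        (C.darts.map fun e => (D.gap j e : ℂ) * vec δ e).sum := by
  obtain ⟨h1, h2⟩ := winding_of_area_pos hC hF harea
  set n := winding C.darts
  set s : HexVertex → ℝ := fun t => critPerc.real (D.sep j t)
  -- The indicator of the edges of `C` is `n (left) * (1 - n (right))`.
  have hdart : ∀ f : T.Dart → ℂ, (C.darts.map f).sum =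
      ∑ e ∈ leftDarts D.F, (n (leftVertex e) : ℂ) * f e -
      ∑ e ∈ innerDarts D.F, (n (leftVertex e) : ℂ) * n (leftVertex e.symm) * f e := by
    intro f
    rw [← sum_winding_mul hF, ← Finset.sum_sub_distrib, sum_map_darts hC hF]
    refine Finset.sum_congr rfl fun e _ => ?_
    have h3 := h2 e
    rcases h1 (leftVertex e) with h4 | h4 <;> rcases h1 (leftVertex e.symm) with h5 | h5 <;>
      simp only [n] at h3 h4 h5 ⊢ <;> simp [h3, h4, h5]
  have hgap : ∀ e, D.gap j e.symm - D.gap j e = s (leftVertex e) - s (leftVertex e.symm) := by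
    intro e
    have hm := fun t => (sep_detBy D j t).measurableSet
    simp only [gap, s, SimpleGraph.Dart.symm_symm]
    have a1 := measureReal_sdiff_add_inter (μ := critPerc) (s := D.sep j (leftVertex e))
      (hm (leftVertex e.symm))
    have a2 := measureReal_sdiff_add_inter (μ := critPerc) (s := D.sep j (leftVertex e.symm))
      (hm (leftVertex e))
    rw [Set.inter_comm] at a2
    linarith
  have e0 : contourIntegral C δ s = (C.darts.map fun e => (s (leftVertex e) : ℂ) * vec δ e).sum :=
    rfl
  rw [e0, hdart, hdart]
  -- The vertex `z(e)` is the same for the three sides of a triangle, whose vectors add up to zero.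
  have e1 : ∑ e ∈ leftDarts D.F, (n (leftVertex e) : ℂ) * (s (leftVertex e) * vec δ e) = 0 := by
    have e5 := sum_cyc (F := D.F) fun e => (n (leftVertex e) : ℂ) * (s (leftVertex e) * vec δ e)
    have e6 := sum_cyc (F := D.F) fun e =>
      (n (leftVertex (cyc e)) : ℂ) * (s (leftVertex (cyc e)) * vec δ (cyc e))
    simp only [leftVertex_cyc] at e5 e6
    have e7 : ∑ e ∈ leftDarts D.F, (n (leftVertex e) : ℂ) * (s (leftVertex e) *
        (vec δ e + vec δ (cyc e) + vec δ (cyc (cyc e)))) = 0 :=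
      Finset.sum_eq_zero fun e _ => by rw [vec_add_vec_cyc, mul_zero, mul_zero]
    simp only [mul_add, Finset.sum_add_distrib] at e7
    rw [e6, e5] at e7
    linear_combination e7 / 3
  -- In the remaining sum, which is symmetric under reversal of the edges up to the sign of `vec`,
  -- only the differences of `s` across edges matter, and these are differences of gaps.
  have e2 := sum_symm (F := D.F) fun e => (n (leftVertex e) : ℂ) * n (leftVertex e.symm) *
    (s (leftVertex e) * vec δ e)
  have e3 := sum_symm (F := D.F) fun e => (n (leftVertex e) : ℂ) * n (leftVertex e.symm) *
    (D.gap j e * vec δ e)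
  simp only [SimpleGraph.Dart.symm_symm, vec_symm] at e2 e3
  have e4 : ∑ e ∈ innerDarts D.F, (n (leftVertex e) : ℂ) * n (leftVertex e.symm) *
        (s (leftVertex e) * vec δ e) + ∑ e ∈ innerDarts D.F, (n (leftVertex e.symm) : ℂ) *
        n (leftVertex e) * (s (leftVertex e.symm) * -vec δ e) =
      -(∑ e ∈ innerDarts D.F, (n (leftVertex e) : ℂ) * n (leftVertex e.symm) *
        (D.gap j e * vec δ e) + ∑ e ∈ innerDarts D.F, (n (leftVertex e.symm) : ℂ) *
        n (leftVertex e) * (D.gap j e.symm * -vec δ e)) := by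
    rw [← Finset.sum_add_distrib, ← Finset.sum_add_distrib, ← Finset.sum_neg_distrib]
    refine Finset.sum_congr rfl fun e _ => ?_
    have : (D.gap j e.symm : ℂ) - D.gap j e = s (leftVertex e) - s (leftVertex e.symm) := by
      exact_mod_cast hgap e
    linear_combination (-(n (leftVertex e) : ℂ) * n (leftVertex e.symm) * vec δ e) * this
  rw [e2, e3] at e4
  rw [e1]
  linear_combination -e4 / 2

/-- By colour switching the bulk terms of the two integrals cancel, and only the gaps across the
edges of the contour contribute. -/
theorem norm_contourIntegral_sub_le (hC : C.IsCycle) (hF : ∀ x ∈ C.support, x ∈ D.F) {δ : ℝ}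
    (harea : 0 < (C.darts.map (areaForm δ)).sum) (j : ℤ) {B : ℝ}
    (hB : ∀ e ∈ C.darts, ∀ i, D.gap i e ≤ B) :
    ‖contourIntegral C δ (fun t => critPerc.real (D.sep (j + 1) t)) -
      zeta * contourIntegral C δ (fun t => critPerc.real (D.sep j t))‖ ≤
      2 * B * contourLength C δ := by
  rw [contourIntegral_eq hC hF harea, contourIntegral_eq hC hF harea]
  -- The rotation `cyc` of the sides of a triangle multiplies `vec` by `ζ` and turns the gaps of `j`
  -- into those of `j + 1`.
  have e1 : ∑ e ∈ leftDarts D.F, (winding C.darts (leftVertex e) : ℂ) *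
      (D.gap (j + 1) e * vec δ e) = zeta * ∑ e ∈ leftDarts D.F,
        (winding C.darts (leftVertex e) : ℂ) * (D.gap j e * vec δ e) := by
    rw [← sum_cyc, Finset.mul_sum]
    refine Finset.sum_congr rfl fun e he => ?_
    rw [mem_leftDarts] at he
    rw [leftVertex_cyc, vec_cyc, gap_eq]
    · ring
    · intro v hv
      rcases mem_leftVertex.1 hv with rfl | rfl | rfl
      exacts [he.1.1, he.1.2, he.2]
  have hb : ∀ i, ‖(C.darts.map fun e => (D.gap i e : ℂ) * vec δ e).sum‖ ≤
      B * contourLength C δ := by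
    intro i
    rw [contourLength, ← List.sum_map_mul_left]
    refine (norm_multiset_sum_le (C.darts.map fun e => (D.gap i e : ℂ) * vec δ e : Multiset ℂ)
      |>.trans ?_)
    rw [Multiset.map_coe, Multiset.sum_coe, List.map_map]
    refine List.sum_le_sum fun e he => ?_
    have h0 : 0 ≤ D.gap i e := measureReal_nonneg
    rw [Function.comp_apply, norm_mul, Complex.norm_real, Real.norm_of_nonneg h0,
      dist_comm, dist_eq_norm]
    exact mul_le_mul_of_nonneg_right (hB e he i) (norm_nonneg _)
  have hz : ‖zeta‖ = 1 := by
    rw [zeta, show 2 * (Real.pi : ℂ) * Complex.I / 3 = (2 * Real.pi / 3 : ℝ) * Complex.I by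
      push_cast; ring, Complex.norm_exp_ofReal_mul_I]
  rw [e1, mul_sub, sub_sub_sub_cancel_left]
  refine (norm_sub_le _ _).trans ?_
  rw [norm_mul, hz, one_mul]
  linarith [hb j, hb (j + 1)]

end DDom

/-! ### Hexagons in affine coordinates -/

/-- The first of two affine coordinates in which both the sites and the vertices of `δH` have
integer coordinates. -/
def hx (δ : ℝ) (p : ℂ) : ℝ := 2 * p.re / δ

/-- The second of the two affine coordinates in which both the sites and the vertices of `δH` have
integer coordinates. -/
def hy (δ : ℝ) (p : ℂ) : ℝ := (√3 * p.im - p.re) / δ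

lemma continuous_hx (δ : ℝ) : Continuous (hx δ) := by unfold hx; fun_prop
lemma continuous_hy (δ : ℝ) : Continuous (hy δ) := by unfold hy; fun_prop

lemma hx_comb (δ a b : ℝ) (p q : ℂ) : hx δ (a • p + b • q) = a * hx δ p + b * hx δ q := by
  simp [hx]; ring

lemma hy_comb (δ a b : ℝ) (p q : ℂ) : hy δ (a • p + b • q) = a * hy δ p + b * hy δ q := by
  simp [hy]; ring

lemma hexPt_leftVertex (δ : ℝ) (e : T.Dart) : hexPt δ (leftVertex e) =
    ((1 / 3 : ℝ) • sitePt δ e.fst + (1 / 3 : ℝ) • sitePt δ e.snd) +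
      (1 / 3 : ℝ) • sitePt δ (apex e) := by
  have h : ∑ v ∈ (leftVertex e).1, sitePt δ v =
      sitePt δ e.fst + sitePt δ e.snd + sitePt δ (apex e) := by
    rw [leftVertex_val, Finset.sum_insert, Finset.sum_insert, Finset.sum_singleton, add_assoc]
    · simpa using (apex_ne e).2.symm
    · simp only [Finset.mem_insert, Finset.mem_singleton, not_or]
      exact ⟨fst_ne_snd e, (apex_ne e).1.symm⟩
  rw [hexPt, h]
  simp only [Complex.real_smul]; push_cast; ring

section

variable {δ : ℝ} (hδ : 0 < δ)

include hδ

lemma hx_hy_ext {p q : ℂ} (h1 : hx δ p = hx δ q) (h2 : hy δ p = hy δ q) : p = q := by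
  have h3 : 0 < √3 := by positivity
  rw [hx, hx, div_left_inj' hδ.ne'] at h1
  rw [hy, hy, div_left_inj' hδ.ne'] at h2
  apply Complex.ext
  · linarith
  · have : √3 * p.im = √3 * q.im := by linarith
    exact mul_left_cancel₀ h3.ne' this

lemma hx_sitePt (v : Site) : hx δ (sitePt δ v) = (2 * v.1 + v.2 : ℤ) := by
  rw [hx, sitePt_re]; push_cast; field_simp

lemma hy_sitePt (v : Site) : hy δ (sitePt δ v) = (v.2 - v.1 : ℤ) := by
  have : √3 * √3 = 3 := Real.mul_self_sqrt (by norm_num)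
  rw [hy, sitePt_re, sitePt_im, div_eq_iff hδ.ne']; push_cast
  linear_combination (δ * v.2 / 2) * this

lemma hx_left (e : T.Dart) : hx δ (hexPt δ (leftVertex e)) =
    (2 * e.fst.1 + e.fst.2 + (e.snd - e.fst).1 : ℤ) := by
  have h1 : hx δ (hexPt δ (leftVertex e)) = 1 / 3 * hx δ (sitePt δ e.fst) +
      1 / 3 * hx δ (sitePt δ e.snd) + 1 / 3 * hx δ (sitePt δ (apex e)) := by
    rw [hexPt_leftVertex]; simp [hx]; ring
  rw [h1, hx_sitePt hδ, hx_sitePt hδ, hx_sitePt hδ]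
  simp only [apex, rot, Prod.fst_add, Prod.snd_add, Prod.fst_sub, Prod.snd_sub]
  push_cast; ring

lemma hy_left (e : T.Dart) : hy δ (hexPt δ (leftVertex e)) =
    (e.fst.2 - e.fst.1 + (e.snd - e.fst).2 : ℤ) := by
  have h1 : hy δ (hexPt δ (leftVertex e)) = 1 / 3 * hy δ (sitePt δ e.fst) +
      1 / 3 * hy δ (sitePt δ e.snd) + 1 / 3 * hy δ (sitePt δ (apex e)) := by
    rw [hexPt_leftVertex]; simp [hy]; ring
  rw [h1, hy_sitePt hδ, hy_sitePt hδ, hy_sitePt hδ]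
  simp only [apex, rot, Prod.fst_add, Prod.snd_add, Prod.fst_sub, Prod.snd_sub]
  push_cast; ring

/-- The inequalities that define the hexagon centred at `v`. -/
lemma mem_hexagon {v : Site} {p : ℂ} : p ∈ hexagon δ v ↔
    |hx δ p - (2 * v.1 + v.2 : ℤ)| ≤ 1 ∧ |hy δ p - (v.2 - v.1 : ℤ)| ≤ 1 ∧
      |hx δ p + hy δ p - (v.1 + 2 * v.2 : ℤ)| ≤ 1 := by
  constructor
  · intro hp
    refine convexHull_min (t := {p | |hx δ p - (2 * v.1 + v.2 : ℤ)| ≤ 1 ∧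
      |hy δ p - (v.2 - v.1 : ℤ)| ≤ 1 ∧ |hx δ p + hy δ p - (v.1 + 2 * v.2 : ℤ)| ≤ 1}) ?_ ?_ hp
    · rintro _ ⟨t, ht, rfl⟩
      obtain ⟨e, rfl, rfl⟩ := exists_dart_of_mem ht
      rw [Set.mem_ofPred_eq, hx_left hδ, hy_left hδ]
      have h := offset_cases e
      generalize e.snd - e.fst = d at h
      norm_cast
      rcases h with rfl | rfl | rfl | rfl | rfl | rfl <;>
        refine ⟨?_, ?_, ?_⟩ <;> rw [abs_le] <;> constructor <;> dsimp only <;> omega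
    · intro p hp q hq a b ha hb hab
      simp only [Set.mem_ofPred_eq, abs_le] at hp hq ⊢
      rw [hx_comb, hy_comb]
      have key : ∀ x y c : ℝ, (-1 ≤ x - c ∧ x - c ≤ 1) → (-1 ≤ y - c ∧ y - c ≤ 1) →
          -1 ≤ a * x + b * y - c ∧ a * x + b * y - c ≤ 1 := by
        intro x y c h h'
        have e : a * x + b * y - c = a * (x - c) + b * (y - c) := by
          linear_combination c * hab
        have h1 := mul_le_mul_of_nonneg_left h.1 ha
        have h2 := mul_le_mul_of_nonneg_left h.2 ha
        have h3 := mul_le_mul_of_nonneg_left h'.1 hb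
        have h4 := mul_le_mul_of_nonneg_left h'.2 hb
        rw [e]
        constructor <;> linarith
      refine ⟨key _ _ _ hp.1 hq.1, key _ _ _ hp.2.1 hq.2.1, ?_⟩
      have := key _ _ _ hp.2.2 hq.2.2
      constructor <;> linarith [this.1, this.2]
  · intro h
    have hcor : ∀ e : T.Dart, e.fst = v → hexPt δ (leftVertex e) ∈ hexagon δ v := fun e he =>
      subset_convexHull ℝ _ ⟨_, by rw [Set.mem_ofPred_eq, ← he]; exact fst_mem_left e, rfl⟩
    have hcv : Convex ℝ (hexagon δ v) := convex_convexHull ℝ _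
    have hcen : sitePt δ v ∈ hexagon δ v := by
      have h1 : T.Adj v (v.1 + 1, v.2) := adj_iff.2 (by simp)
      have h2 : T.Adj v (v.1 - 1, v.2) := adj_iff.2 (by simp)
      have := hcv (hcor ⟨(_, _), h1⟩ rfl) (hcor ⟨(_, _), h2⟩ rfl) (a := 1 / 2) (b := 1 / 2)
        (by norm_num) (by norm_num) (by norm_num)
      convert this using 1
      apply hx_hy_ext hδ
      · rw [hx_comb, hx_left hδ, hx_left hδ, hx_sitePt hδ]
        simp only [Prod.fst_sub]; push_cast; ring
      · rw [hy_comb, hy_left hδ, hy_left hδ, hy_sitePt hδ]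
        simp only [Prod.snd_sub]; push_cast; ring
    have hadj : ∀ d : Site, d.1 ^ 2 + d.1 * d.2 + d.2 ^ 2 = 1 → T.Adj v (v + d) := fun d h => by
      change ((v + d).1 - v.1) ^ 2 + ((v + d).1 - v.1) * ((v + d).2 - v.2) + _ = 1
      simpa using h
    -- A point of the sextant between the corners belonging to `d` and `rot d`.
    have sextant : ∀ (d : Site) (s t : ℝ), T.Adj v (v + d) → 0 ≤ s → 0 ≤ t → s + t ≤ 1 →
        hx δ p = (2 * v.1 + v.2 : ℤ) + (s * d.1 - t * d.2) →
        hy δ p = (v.2 - v.1 : ℤ) + (s * d.2 + t * (d.1 + d.2)) → p ∈ hexagon δ v := by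
      intro d s t hd hs ht hst h1 h2
      let e : T.Dart := ⟨(v, v + d), hd⟩
      have hm := hcv.sum_mem (t := Finset.univ) (w := ![1 - s - t, s, t])
        (z := ![sitePt δ v, hexPt δ (leftVertex e), hexPt δ (leftVertex (turn e))])
        (by intro i _; fin_cases i <;> simp <;> linarith) (by simp [Fin.sum_univ_three]; ring)
        (by intro i _; fin_cases i; exacts [hcen, hcor e rfl, hcor (turn e) rfl])
      convert hm using 1
      have ht1 : (turn e).snd - (turn e).fst = rot d := by
        simp only [e, turn_snd, turn_fst, apex, add_sub_cancel_left]
      have he1 : e.snd - e.fst = d := by simp [e]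
      simp only [Fin.sum_univ_three, Matrix.cons_val]
      apply hx_hy_ext hδ
      · have : ∀ a b : ℂ, hx δ (a + b) = hx δ a + hx δ b := fun a b => by
          simpa using hx_comb δ 1 1 a b
        have h' : ∀ (c : ℝ) (a : ℂ), hx δ (c • a) = c * hx δ a := fun c a => by
          simpa using hx_comb δ c 0 a a
        rw [this, this, h', h', h', hx_left hδ, hx_left hδ, hx_sitePt hδ, h1, ht1, he1]
        simp only [e, turn_fst, rot]; push_cast; ring
      · have : ∀ a b : ℂ, hy δ (a + b) = hy δ a + hy δ b := fun a b => by
          simpa using hy_comb δ 1 1 a b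
        have h' : ∀ (c : ℝ) (a : ℂ), hy δ (c • a) = c * hy δ a := fun c a => by
          simpa using hy_comb δ c 0 a a
        rw [this, this, h', h', h', hy_left hδ, hy_left hδ, hy_sitePt hδ, h2, ht1, he1]
        simp only [e, turn_fst, rot]; push_cast; ring
    obtain ⟨⟨a1, a2⟩, ⟨b1, b2⟩, c1, c2⟩ := by simpa only [abs_le] using h
    set x := hx δ p - (2 * v.1 + v.2 : ℤ) with hxe
    set y := hy δ p - (v.2 - v.1 : ℤ) with hye
    have hz : hx δ p + hy δ p - (v.1 + 2 * v.2 : ℤ) = x + y := by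
      rw [hxe, hye]; push_cast; ring
    rw [hz] at c1 c2
    have hx1 : hx δ p = (2 * v.1 + v.2 : ℤ) + x := by rw [hxe]; ring
    have hy1 : hy δ p = (v.2 - v.1 : ℤ) + y := by rw [hye]; ring
    rcases le_total 0 x with hx0 | hx0 <;> rcases le_total 0 y with hy0 | hy0
    · exact sextant (1, 0) x y (hadj _ (by norm_num)) hx0 hy0 (by linarith)
        (by rw [hx1]; push_cast; ring) (by rw [hy1]; push_cast; ring)
    · rcases le_total 0 (x + y) with h0 | h0
      · exact sextant (1, -1) (-y) (x + y) (hadj _ (by norm_num)) (by linarith)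
          (by linarith) (by linarith) (by rw [hx1]; push_cast; ring) (by rw [hy1]; push_cast; ring)
      · exact sextant (0, -1) (-x - y) x (hadj _ (by norm_num)) (by linarith)
          (by linarith) (by linarith) (by rw [hx1]; push_cast; ring) (by rw [hy1]; push_cast; ring)
    · rcases le_total 0 (x + y) with h0 | h0
      · exact sextant (0, 1) (x + y) (-x) (hadj _ (by norm_num)) (by linarith)
          (by linarith) (by linarith) (by rw [hx1]; push_cast; ring) (by rw [hy1]; push_cast; ring)
      · exact sextant (-1, 1) y (-x - y) (hadj _ (by norm_num)) (by linarith)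
          (by linarith) (by linarith) (by rw [hx1]; push_cast; ring) (by rw [hy1]; push_cast; ring)
    · exact sextant (-1, 0) (-x) (-y) (hadj _ (by norm_num)) (by linarith)
        (by linarith) (by linarith) (by rw [hx1]; push_cast; ring) (by rw [hy1]; push_cast; ring)

lemma sitePt_mem_hexagon {v w : Site} : sitePt δ v ∈ hexagon δ w ↔ v = w := by
  rw [mem_hexagon hδ, hx_sitePt hδ, hy_sitePt hδ]
  norm_cast
  simp only [abs_le, Prod.ext_iff]
  omega

lemma hexPt_mem_hexagon {t : HexVertex} {w : Site} : hexPt δ t ∈ hexagon δ w ↔ w ∈ t.1 := by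
  refine ⟨fun h => ?_, fun h => subset_convexHull ℝ _ ⟨t, h, rfl⟩⟩
  obtain ⟨e, rfl⟩ := exists_leftVertex_eq t
  rw [mem_hexagon hδ, hx_left hδ, hy_left hδ] at h
  have h' := offset_cases e
  rw [mem_leftVertex, apex, ← sub_eq_iff_eq_add',
    ← sub_eq_zero (b := e.fst), show w = e.snd ↔ w - e.fst = e.snd - e.fst from
    (sub_left_inj).symm]
  generalize e.snd - e.fst = d at h h'
  norm_cast at h
  rcases h' with rfl | rfl | rfl | rfl | rfl | rfl <;>
    simp only [abs_le, Prod.ext_iff, Prod.fst_sub, Prod.snd_sub, rot, Prod.fst_zero,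
      Prod.snd_zero] at h ⊢ <;> omega

/-- Hexagons that meet are adjacent. -/
lemma adj_of_mem_hexagon {v w : Site} (hvw : v ≠ w) {p : ℂ} (h : p ∈ hexagon δ v)
    (h' : p ∈ hexagon δ w) : T.Adj v w := by
  rw [mem_hexagon hδ] at h h'
  simp only [abs_le] at h h'
  have h1 : ((2 * v.1 + v.2 : ℤ) : ℝ) ≤ (2 * w.1 + w.2 + 2 : ℤ) := by push_cast at *; linarith
  have h2 : ((2 * w.1 + w.2 : ℤ) : ℝ) ≤ (2 * v.1 + v.2 + 2 : ℤ) := by push_cast at *; linarith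
  have h3 : ((v.2 - v.1 : ℤ) : ℝ) ≤ (w.2 - w.1 + 2 : ℤ) := by push_cast at *; linarith
  have h4 : ((w.2 - w.1 : ℤ) : ℝ) ≤ (v.2 - v.1 + 2 : ℤ) := by push_cast at *; linarith
  have h5 : ((v.1 + 2 * v.2 : ℤ) : ℝ) ≤ (w.1 + 2 * w.2 + 2 : ℤ) := by push_cast at *; linarith
  have h6 : ((w.1 + 2 * w.2 : ℤ) : ℝ) ≤ (v.1 + 2 * v.2 + 2 : ℤ) := by push_cast at *; linarith
  rw [Int.cast_le] at h1 h2 h3 h4 h5 h6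
  rw [adj_iff]
  simp only [ne_eq, Prod.ext_iff] at *
  omega

/-- Adjacent hexagons meet exactly in the side that is dual to the edge between their centres. -/
lemma hexEdge_eq (e : T.Dart) : hexEdge δ e = hexagon δ e.fst ∩ hexagon δ e.snd := by
  apply Set.Subset.antisymm
  · have hc : ∀ v, Convex ℝ (hexagon δ v) := fun v => convex_convexHull ℝ _
    refine Set.subset_inter ((hc _).segment_subset ?_ ?_) ((hc _).segment_subset ?_ ?_) <;>
      rw [hexPt_mem_hexagon hδ]
    exacts [fst_mem_left e, fst_mem_right e, snd_mem_left e, snd_mem_right e]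
  · rintro p ⟨h1, h2⟩
    have hs : ∀ t : ℝ, 0 ≤ t → t ≤ 1 →
        hx δ p = (1 - t) * (2 * e.fst.1 + e.fst.2 + (e.snd - e.fst).1 : ℤ) +
          t * (2 * e.snd.1 + e.snd.2 - (e.snd - e.fst).1 : ℤ) →
        hy δ p = (1 - t) * (e.fst.2 - e.fst.1 + (e.snd - e.fst).2 : ℤ) +
          t * (e.snd.2 - e.snd.1 - (e.snd - e.fst).2 : ℤ) → p ∈ hexEdge δ e := by
      intro t ht0 ht1 hx' hy'
      refine ⟨1 - t, t, by linarith, ht0, by ring, ?_⟩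
      apply hx_hy_ext hδ
      · rw [hx_comb, hx', hx_left hδ, hx_left hδ]
        simp only [symm_fst, symm_snd, Prod.fst_sub]; push_cast; ring
      · rw [hy_comb, hy', hy_left hδ, hy_left hδ]
        simp only [symm_fst, symm_snd, Prod.snd_sub]; push_cast; ring
    rw [mem_hexagon hδ] at h1 h2
    have h := offset_cases e
    have he : e.snd = e.fst + (e.snd - e.fst) := by abel
    generalize e.snd - e.fst = d at he h hs
    rw [he] at h2 hs
    simp only [abs_le, Prod.fst_add, Prod.snd_add] at h1 h2 hs
    generalize hx δ p = x at *
    generalize hy δ p = y at *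
    push_cast at h1 h2 hs
    generalize (e.fst.1 : ℝ) = a at *
    generalize (e.fst.2 : ℝ) = b at *
    rcases h with rfl | rfl | rfl | rfl | rfl | rfl <;> push_cast at h1 h2 hs
    · exact hs (b - a - y) (by linarith) (by linarith) (by linarith) (by linarith)
    · exact hs (x - 2 * a - b) (by linarith) (by linarith) (by linarith) (by linarith)
    · exact hs (x - 2 * a - b + 1) (by linarith) (by linarith) (by linarith) (by linarith)
    · exact hs (y - b + a) (by linarith) (by linarith) (by linarith) (by linarith)
    · exact hs (2 * a + b - x) (by linarith) (by linarith) (by linarith) (by linarith)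
    · exact hs (2 * a + b - x + 1) (by linarith) (by linarith) (by linarith) (by linarith)

/-- The hexagons cover the plane. -/
lemma exists_mem_hexagon (p : ℂ) : ∃ v, p ∈ hexagon δ v := by
  set i := ⌊hx δ p⌋
  set j := ⌊hy δ p⌋
  have h1 := Int.floor_le (hx δ p)
  have h2 := Int.lt_floor_add_one (hx δ p)
  have h3 := Int.floor_le (hy δ p)
  have h4 := Int.lt_floor_add_one (hy δ p)
  -- A site has coordinates `x`, `y` with `x ≡ y` modulo `3`.
  have key : ∀ x y : ℤ, (x - y) % 3 = 0 → |hx δ p - x| ≤ 1 → |hy δ p - y| ≤ 1 →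
      |hx δ p + hy δ p - (x + y : ℤ)| ≤ 1 → ∃ v, p ∈ hexagon δ v := by
    intro x y hxy hx' hy' hz'
    refine ⟨((x - y) / 3, y + (x - y) / 3), (mem_hexagon hδ).2 ⟨?_, ?_, ?_⟩⟩
    · rwa [show 2 * ((x - y) / 3) + (y + (x - y) / 3) = x by omega]
    · rwa [show y + (x - y) / 3 - (x - y) / 3 = y by omega]
    · rwa [show (x - y) / 3 + 2 * (y + (x - y) / 3) = x + y by omega]
  have hr : (i - j) % 3 = 0 ∨ (i - j) % 3 = 1 ∨ (i - j) % 3 = 2 := by omega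
  rcases le_total (hx δ p + hy δ p) (i + j + 1) with h0 | h0
  · rcases hr with h | h | h
    · exact key i j h (by rw [abs_le]; constructor <;> linarith)
        (by rw [abs_le]; constructor <;> linarith)
        (by rw [abs_le]; push_cast; constructor <;> linarith)
    · exact key i (j + 1) (by omega) (by rw [abs_le]; constructor <;> linarith)
        (by rw [abs_le]; push_cast; constructor <;> linarith)
        (by rw [abs_le]; push_cast; constructor <;> linarith)
    · exact key (i + 1) j (by omega) (by rw [abs_le]; push_cast; constructor <;> linarith)
        (by rw [abs_le]; constructor <;> linarith)
        (by rw [abs_le]; push_cast; constructor <;> linarith)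
  · rcases hr with h | h | h
    · exact key (i + 1) (j + 1) (by omega) (by rw [abs_le]; push_cast; constructor <;> linarith)
        (by rw [abs_le]; push_cast; constructor <;> linarith)
        (by rw [abs_le]; push_cast; constructor <;> linarith)
    · exact key i (j + 1) (by omega) (by rw [abs_le]; constructor <;> linarith)
        (by rw [abs_le]; push_cast; constructor <;> linarith)
        (by rw [abs_le]; push_cast; constructor <;> linarith)
    · exact key (i + 1) j (by omega) (by rw [abs_le]; push_cast; constructor <;> linarith)
        (by rw [abs_le]; constructor <;> linarith)
        (by rw [abs_le]; push_cast; constructor <;> linarith)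

/-- The midpoint of a side lies in no hexagon other than the two that the side separates. -/
lemma midpoint_mem_hexagon {e : T.Dart} {w : Site}
    (h : midpoint ℝ (hexPt δ (leftVertex e)) (hexPt δ (leftVertex e.symm)) ∈ hexagon δ w) :
    w = e.fst ∨ w = e.snd := by
  have hm : midpoint ℝ (hexPt δ (leftVertex e)) (hexPt δ (leftVertex e.symm)) =
      (1 / 2 : ℝ) • hexPt δ (leftVertex e) + (1 / 2 : ℝ) • hexPt δ (leftVertex e.symm) := by
    rw [midpoint_eq_smul_add, smul_add]; norm_num
  rw [hm, mem_hexagon hδ, hx_comb, hy_comb, hx_left hδ, hy_left hδ, hx_left hδ, hy_left hδ] at h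
  have h' := offset_cases e
  have he : e.snd = e.fst + (e.snd - e.fst) := by abel
  rw [symm_fst, symm_snd, ← neg_sub e.snd e.fst] at h
  generalize e.snd - e.fst = d at he h h'
  rw [he] at h ⊢
  have key : ∀ x y z : ℤ, |1 / 2 * (x : ℝ) + 1 / 2 * y - z| ≤ 1 →
      -2 ≤ x + y - 2 * z ∧ x + y - 2 * z ≤ 2 := by
    intro x y z h
    rw [abs_le] at h
    constructor
    · have : ((-2 : ℤ) : ℝ) ≤ (x + y - 2 * z : ℤ) := by push_cast; linarith
      exact_mod_cast this
    · have : ((x + y - 2 * z : ℤ) : ℝ) ≤ (2 : ℤ) := by push_cast; linarith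
      exact_mod_cast this
  obtain ⟨h1, h2, h3⟩ := h
  have k1 := key _ _ _ h1
  have k2 := key _ _ _ h2
  have k3 := key (2 * e.fst.1 + e.fst.2 + d.1 + (e.fst.2 - e.fst.1 + d.2))
    (2 * (e.fst + d).1 + (e.fst + d).2 + (-d).1 + ((e.fst + d).2 - (e.fst + d).1 + (-d).2))
    (w.1 + 2 * w.2) (by convert h3 using 2; push_cast; ring)
  simp only [Prod.ext_iff, Prod.fst_add, Prod.snd_add, Prod.fst_neg, Prod.snd_neg] at *
  omega

end

/-! ### Unions of hexagons -/

section

variable {δ : ℝ} (hδ : 0 < δ)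

include hδ

lemma finite_sites (p : ℂ) (R : ℝ) : {v | dist (sitePt δ v) p ≤ R}.Finite := by
  obtain ⟨B, hB⟩ := exists_int_gt (2 * (R + ‖p‖) / δ)
  refine ((Set.finite_Icc (-B) B).prod (Set.finite_Icc (-B) B)).subset fun v hv => ?_
  have h1 : ‖sitePt δ v‖ ≤ R + ‖p‖ := by
    have h2 : dist (sitePt δ v) p ≤ R := hv
    rw [dist_eq_norm] at h2
    linarith [norm_le_norm_sub_add (sitePt δ v) p]
  have h2 : (hexNorm v : ℝ) < B := by
    refine lt_of_le_of_lt ?_ hB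
    rw [le_div_iff₀ hδ]
    linarith [hexNorm_le δ v]
  have h3 : hexNorm v < B := by exact_mod_cast h2
  simp only [Set.mem_prod, Set.mem_Icc]
  unfold hexNorm at h3
  omega

lemma isClosed_hexagon (v : Site) : IsClosed (hexagon δ v) := by
  have e : hexagon δ v = {p | |hx δ p - (2 * v.1 + v.2 : ℤ)| ≤ 1 ∧ |hy δ p - (v.2 - v.1 : ℤ)| ≤ 1 ∧
      |hx δ p + hy δ p - (v.1 + 2 * v.2 : ℤ)| ≤ 1} := Set.ext fun p => mem_hexagon hδ
  have h1 := continuous_hx δ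
  have h2 := continuous_hy δ
  rw [e]
  exact (isClosed_le (h1.sub continuous_const).abs continuous_const).inter
    ((isClosed_le (h2.sub continuous_const).abs continuous_const).inter
      (isClosed_le ((h1.add h2).sub continuous_const).abs continuous_const))

/-- Near a point there are no other hexagons than those that contain it. -/
lemma eventually_mem_hexagon (p : ℂ) :
    ∀ᶠ q in 𝓝 p, ∀ v, q ∈ hexagon δ v → p ∈ hexagon δ v := by
  have h1 : ∀ᶠ q in 𝓝 p, ∀ v ∈ {v | dist (sitePt δ v) p ≤ 2 * δ},
      q ∈ hexagon δ v → p ∈ hexagon δ v := by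
    rw [eventually_all_finite (finite_sites hδ p _)]
    intro v _
    by_cases hp : p ∈ hexagon δ v
    · exact Eventually.of_forall fun _ _ => hp
    · filter_upwards [(isClosed_hexagon hδ v).isOpen_compl.mem_nhds hp] with q hq hq'
      exact absurd hq' hq
  filter_upwards [h1, Metric.ball_mem_nhds p hδ] with q hq hq' v hv
  refine hq v ?_ hv
  have := hexagon_subset_closedBall hδ v hv
  rw [Metric.mem_closedBall, dist_comm] at this
  rw [Metric.mem_ball] at hq'
  exact (dist_triangle _ q _).trans (by linarith)

lemma isClosed_iUnion_hexagon (F : Set Site) : IsClosed (⋃ v ∈ F, hexagon δ v) := by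
  rw [← isOpen_compl_iff, isOpen_iff_mem_nhds]
  intro p hp
  filter_upwards [eventually_mem_hexagon hδ p] with q hq hq'
  obtain ⟨v, hv, hqv⟩ := Set.mem_iUnion₂.1 hq'
  exact hp (Set.mem_biUnion hv (hq v hqv))

/-- Every point of a hexagon is a limit of points that lie in no other hexagon. -/
lemma mem_closure_of_mem_hexagon {v : Site} {p : ℂ} (hp : p ∈ hexagon δ v) :
    p ∈ closure {q | q ∈ hexagon δ v ∧ ∀ w, q ∈ hexagon δ w → w = v} := by
  -- The points of the segment from the centre to `p`.
  let f : ℝ → ℂ := fun s => (1 - s) • sitePt δ v + s • p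
  have hf : Tendsto f (𝓝[<] 1) (𝓝 p) := by
    have : Continuous f := by fun_prop
    have := (this.tendsto 1).mono_left (nhdsWithin_le_nhds (s := Set.Iio 1))
    simpa [f] using this
  refine mem_closure_of_tendsto hf ?_
  have h1 : ∀ᶠ s : ℝ in 𝓝[<] 1, 0 < s :=
    nhdsWithin_le_nhds (Ioi_mem_nhds zero_lt_one)
  filter_upwards [h1, self_mem_nhdsWithin] with s hs0 hs1
  have hs1 : s < 1 := hs1
  have hcv : Convex ℝ (hexagon δ v) := convex_convexHull ℝ _
  have hfs : f s ∈ hexagon δ v := hcv ((sitePt_mem_hexagon hδ).2 rfl) hp (by linarith) hs0.le (by ring)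
  refine ⟨hfs, fun w hw => ?_⟩
  by_contra hne
  have hadj := adj_cases (adj_of_mem_hexagon hδ (Ne.symm hne) hfs hw)
  rw [mem_hexagon hδ] at hp hw
  have e1 : hx δ (f s) = (2 * v.1 + v.2 : ℤ) + s * (hx δ p - (2 * v.1 + v.2 : ℤ)) := by
    rw [hx_comb, hx_sitePt hδ]; ring
  have e2 : hy δ (f s) = (v.2 - v.1 : ℤ) + s * (hy δ p - (v.2 - v.1 : ℤ)) := by
    rw [hy_comb, hy_sitePt hδ]; ring
  have key : ∀ x : ℝ, |x| ≤ 1 → -1 < s * x ∧ s * x < 1 := fun x hx => by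
    rw [abs_le] at hx
    constructor <;> nlinarith
  have k1 := key _ hp.1
  have k2 := key _ hp.2.1
  have k3 := key _ hp.2.2
  have e3 : s * (hx δ p - (2 * v.1 + v.2 : ℤ)) + s * (hy δ p - (v.2 - v.1 : ℤ)) =
      s * (hx δ p + hy δ p - (v.1 + 2 * v.2 : ℤ)) := by push_cast; ring
  rw [← e3] at k3
  rw [e1, e2] at hw
  generalize s * (hx δ p - (2 * v.1 + v.2 : ℤ)) = x at *
  generalize s * (hy δ p - (v.2 - v.1 : ℤ)) = y at *
  simp only [abs_le] at hw
  rcases hadj with rfl | rfl | rfl | rfl | rfl | rfl <;> push_cast at hw <;> linarith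

/-- A point is inside a union of hexagons iff all hexagons that contain it belong to the union. -/
lemma mem_interior_iUnion_hexagon {F : Set Site} {p : ℂ} :
    p ∈ interior (⋃ v ∈ F, hexagon δ v) ↔ ∀ v, p ∈ hexagon δ v → v ∈ F := by
  rw [mem_interior_iff_mem_nhds]
  constructor
  · intro h v hv
    obtain ⟨q, hq, -, hq'⟩ := mem_closure_iff_nhds.1 (mem_closure_of_mem_hexagon hδ hv) _ h
    obtain ⟨w, hw, hqw⟩ := Set.mem_iUnion₂.1 hq
    rwa [← hq' w hqw]
  · intro h
    filter_upwards [eventually_mem_hexagon hδ p] with q hq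
    obtain ⟨v, hv⟩ := exists_mem_hexagon hδ q
    exact Set.mem_biUnion (h v (hq v hv)) hv

variable {k : ℕ} {D : MarkedDomain k}

lemma mem_carrier_iff (hD : D.IsDiscrete δ) {p : ℂ} :
    p ∈ D.carrier ↔ ∀ v, p ∈ hexagon δ v → v ∈ D.faces δ := by
  obtain ⟨⟨F, hF⟩, -⟩ := hD
  have h : D.faces δ = F := by
    ext v
    rw [MarkedDomain.faces, Set.mem_ofPred_eq, hF, mem_interior_iUnion_hexagon hδ]
    simp only [sitePt_mem_hexagon hδ]
    exact ⟨fun h => h v rfl, fun h w hw => hw ▸ h⟩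
  rw [h, hF, mem_interior_iUnion_hexagon hδ]

/-- The boundary of a discrete domain consists of the sides between a hexagon of the domain and a
hexagon outside of it. -/
lemma mem_frontier_iff (hD : D.IsDiscrete δ) {p : ℂ} : p ∈ frontier D.carrier ↔
    ∃ e : T.Dart, e.fst ∈ D.faces δ ∧ e.snd ∉ D.faces δ ∧ p ∈ hexEdge δ e := by
  rw [D.isOpen.frontier_eq]
  constructor
  · rintro ⟨h1, h2⟩
    have hsub : D.carrier ⊆ ⋃ v ∈ D.faces δ, hexagon δ v := fun q hq => by
      obtain ⟨v, hv⟩ := exists_mem_hexagon hδ q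
      exact Set.mem_biUnion ((mem_carrier_iff hδ hD).1 hq v hv) hv
    have h3 := closure_minimal hsub (isClosed_iUnion_hexagon hδ _) h1
    obtain ⟨v, hv, hpv⟩ := Set.mem_iUnion₂.1 h3
    rw [mem_carrier_iff hδ hD] at h2
    push Not at h2
    obtain ⟨w, hpw, hw⟩ := h2
    have hadj := adj_of_mem_hexagon hδ (fun h : v = w => hw (h ▸ hv)) hpv hpw
    refine ⟨⟨(v, w), hadj⟩, hv, hw, ?_⟩
    rw [hexEdge_eq hδ]
    exact ⟨hpv, hpw⟩
  · rintro ⟨e, h1, h2, h3⟩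
    rw [hexEdge_eq hδ] at h3
    refine ⟨closure_mono ?_ (mem_closure_of_mem_hexagon hδ h3.1), fun h =>
      h2 ((mem_carrier_iff hδ hD).1 h _ h3.2)⟩
    rintro q ⟨-, hq⟩
    exact (mem_carrier_iff hδ hD).2 fun w hw => hq w hw ▸ h1

lemma finite_faces (D : MarkedDomain k) : (D.faces δ).Finite := by
  obtain ⟨R, hR⟩ := D.isBounded.subset_closedBall 0
  exact (finite_sites hδ 0 R).subset fun v hv => hR hv

end

/-! ### Boundary cycles -/

section

variable (F : Finset Site)

/-- An oriented edge of `T` that leaves `F`. Its dual is a side of the boundary of `F`. -/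
def IsBdry (e : T.Dart) : Prop := e.fst ∈ F ∧ e.snd ∉ F

variable {F}

/-- The next side in the counterclockwise direction. -/
def nextBdry (F : Finset Site) (e : T.Dart) : T.Dart :=
  if apex e ∈ F then (cyc e).symm else turn e

lemma isBdry_nextBdry {e : T.Dart} (h : IsBdry F e) : IsBdry F (nextBdry F e) := by
  unfold nextBdry
  split_ifs with ha
  · exact ⟨ha, h.2⟩
  · exact ⟨h.1, ha⟩

lemma right_nextBdry (e : T.Dart) : leftVertex (nextBdry F e).symm = leftVertex e := by
  unfold nextBdry
  split_ifs
  · rw [SimpleGraph.Dart.symm_symm, leftVertex_cyc]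
  · exact rightVertex_turn e

lemma IsBdry.eq_of_left {e d : T.Dart} (he : IsBdry F e) (hd : IsBdry F d)
    (h : leftVertex d = leftVertex e) : d = e := by
  rcases leftVertex_eq_iff.1 h with h | rfl | rfl
  · exact h
  · exact absurd hd.1 he.2
  · have := hd.2
    rw [cyc_snd, apex_cyc] at this
    exact absurd he.1 this

lemma IsBdry.eq_of_right {e d : T.Dart} (he : IsBdry F e) (hd : IsBdry F d)
    (h : leftVertex d.symm = leftVertex e.symm) : d = e := by
  rcases leftVertex_eq_iff.1 h with h | h | h
  · exact SimpleGraph.Dart.symm_involutive.injective h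
  · have := hd.2
    rw [show d.snd = (cyc e.symm).fst from congrArg (fun e : T.Dart => e.fst) h] at this
    exact absurd he.1 this
  · have := hd.1
    rw [show d.fst = (cyc (cyc e.symm)).snd from congrArg (fun e : T.Dart => e.snd) h, cyc_snd,
      apex_cyc] at this
    exact absurd this he.2

lemma finite_isBdry (F : Finset Site) : {e | IsBdry F e}.Finite :=
  (DDom.star F).finite_toSet.subset fun _ he => DDom.mem_star.2 he.1

instance (F : Finset Site) : Finite {e // IsBdry F e} := finite_isBdry F

/-- The permutation of the boundary sides that takes each to the next one. -/
def bdryPerm (F : Finset Site) : Equiv.Perm {e // IsBdry F e} :=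
  Equiv.ofBijective (fun e => ⟨nextBdry F e, isBdry_nextBdry e.2⟩) <|
    Finite.injective_iff_bijective.1 fun e d h => Subtype.ext <| by
      refine (IsBdry.eq_of_left d.2 e.2 ?_)
      rw [← right_nextBdry (F := F) e.1, ← right_nextBdry (F := F) d.1, (Subtype.mk.inj h : _)]

lemma bdryPerm_apply (e : {e // IsBdry F e}) : (bdryPerm F e).1 = nextBdry F e.1 := rfl

/-- Sides of the boundary with a common point are consecutive. -/
lemma eq_nextBdry_of_inter {δ : ℝ} (hδ : 0 < δ) {e d : T.Dart} (he : IsBdry F e) (hd : IsBdry F d)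
    (hne : d ≠ e) {p : ℂ} (h1 : p ∈ hexEdge δ e) (h2 : p ∈ hexEdge δ d) :
    d = nextBdry F e ∨ e = nextBdry F d := by
  rw [hexEdge_eq hδ] at h1 h2
  -- A hexagon that meets the side dual to `e` is one of the four hexagons around it.
  have hcase : ∀ w, p ∈ hexagon δ w → w = e.fst ∨ w = e.snd ∨ w = apex e ∨ w = apex e.symm := by
    intro w hw
    by_cases h3 : w = e.fst
    · exact .inl h3
    by_cases h4 : w = e.snd
    · exact .inr (.inl h4)
    have a1 := adj_of_mem_hexagon hδ h3 hw h1.1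
    have a2 := adj_of_mem_hexagon hδ h4 hw h1.2
    obtain ⟨c, hc, hcw⟩ : ∃ c : T.Dart, c.fst = e.fst ∧ c.snd = w := ⟨⟨(e.fst, w), a1.symm⟩, rfl, rfl⟩
    have h5 := offset_cases e
    have h6 := offset_cases c
    have h7 : T.Adj w e.snd := a2
    rw [adj_iff] at h7
    simp only [apex, rot, symm_fst, symm_snd] at h3 h4 ⊢
    rw [hc, hcw] at h6
    simp only [Prod.ext_iff, Prod.fst_add, Prod.snd_add, Prod.fst_sub, Prod.snd_sub] at *
    omega
  have hdart : ∀ c : T.Dart, d.fst = c.fst → d.snd = c.snd → d = c := fun c h h' =>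
    dart_eq_iff.2 ⟨h, h'⟩
  have hf : d.fst ≠ e.snd := fun h => he.2 (h ▸ hd.1)
  have hs : d.snd ≠ e.fst := fun h => hd.2 (h ▸ he.1)
  -- The two hexagons at opposite ends of the side are not adjacent.
  have hbad : ¬ (T.Adj (apex e) (apex e.symm) ∨ T.Adj (apex e.symm) (apex e)) := by
    have h5 := offset_cases e
    rw [adj_iff, adj_iff]
    simp only [apex, rot, symm_fst, symm_snd]
    simp only [Prod.ext_iff, Prod.fst_add, Prod.snd_add, Prod.fst_sub, Prod.snd_sub] at *
    omega
  have hadj := d.adj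
  rcases hcase _ h2.1 with h3 | h3 | h3 | h3
  · rcases hcase _ h2.2 with h4 | h4 | h4 | h4
    · exact absurd h4 hs
    · exact absurd (hdart e h3 h4) hne
    · left
      rw [nextBdry, if_neg (h4 ▸ hd.2)]
      exact hdart (turn e) h3 h4
    · right
      have hc : d = cyc e.symm := hdart _ h3 h4
      have ha : apex d = e.snd := by rw [hc, apex_cyc]; rfl
      rw [nextBdry, if_neg (ha ▸ he.2), dart_eq_iff]
      exact ⟨h3.symm, ha.symm⟩
  · exact absurd h3 hf
  · rcases hcase _ h2.2 with h4 | h4 | h4 | h4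
    · exact absurd h4 hs
    · left
      rw [nextBdry, if_pos (h3 ▸ hd.1)]
      exact hdart (cyc e).symm h3 h4
    · exact absurd (h3.trans h4.symm) (fst_ne_snd d)
    · exact absurd (.inl (by rw [← h3, ← h4]; exact hadj)) hbad
  · rcases hcase _ h2.2 with h4 | h4 | h4 | h4
    · exact absurd h4 hs
    · right
      have hc : d = cyc (cyc e.symm) := hdart _ h3 (by rw [cyc_snd, apex_cyc]; exact h4)
      have ha : apex d = e.fst := by rw [hc, apex_cyc]; rfl
      rw [nextBdry, if_pos (ha ▸ he.1), dart_eq_iff]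
      exact ⟨ha.symm, h4.symm⟩
    · exact absurd (.inr (by rw [← h3, ← h4]; exact hadj)) hbad
    · exact absurd (h3.trans h4.symm) (fst_ne_snd d)

end

section

variable {δ : ℝ} (hδ : 0 < δ)

include hδ

lemma isClosed_hexEdge (e : T.Dart) : IsClosed (hexEdge δ e) := by
  rw [hexEdge_eq hδ]
  exact (isClosed_hexagon hδ _).inter (isClosed_hexagon hδ _)

lemma hexPt_mem_hexEdge {t : HexVertex} {e : T.Dart} :
    hexPt δ t ∈ hexEdge δ e ↔ t = leftVertex e ∨ t = leftVertex e.symm := by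
  rw [hexEdge_eq hδ, Set.mem_inter_iff, hexPt_mem_hexagon hδ, hexPt_mem_hexagon hδ]
  constructor
  · exact fun h => eq_left_or_right h.1 h.2
  · rintro (rfl | rfl)
    · exact ⟨fst_mem_left e, snd_mem_left e⟩
    · exact ⟨fst_mem_right e, snd_mem_right e⟩

/-- The three hexagons at a vertex have only this vertex in common. -/
lemma eq_hexPt {t : HexVertex} {p : ℂ} (h : ∀ v ∈ t.1, p ∈ hexagon δ v) : p = hexPt δ t := by
  obtain ⟨e, rfl⟩ := exists_leftVertex_eq t
  have h1 := h _ (fst_mem_left e)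
  have h2 := h _ (snd_mem_left e)
  have h3 := h (apex e) (mem_leftVertex.2 (.inr (.inr rfl)))
  rw [mem_hexagon hδ] at h1 h2 h3
  have h' := offset_cases e
  have he : e.snd = e.fst + (e.snd - e.fst) := by abel
  apply hx_hy_ext hδ
  · rw [hx_left hδ]
    rw [apex] at h3
    generalize e.snd - e.fst = d at he h' h3 ⊢
    rw [he] at h2
    simp only [abs_le, Prod.fst_add, Prod.snd_add, rot] at h1 h2 h3
    rcases h' with rfl | rfl | rfl | rfl | rfl | rfl <;> push_cast at h1 h2 h3 ⊢ <;> linarith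
  · rw [hy_left hδ]
    rw [apex] at h3
    generalize e.snd - e.fst = d at he h' h3 ⊢
    rw [he] at h2
    simp only [abs_le, Prod.fst_add, Prod.snd_add, rot] at h1 h2 h3
    rcases h' with rfl | rfl | rfl | rfl | rfl | rfl <;> push_cast at h1 h2 h3 ⊢ <;> linarith

/-- Consecutive sides of the boundary have only the vertex between them in common. -/
lemma inter_nextBdry {F : Finset Site} {e : T.Dart} {p : ℂ} (h1 : p ∈ hexEdge δ e)
    (h2 : p ∈ hexEdge δ (nextBdry F e)) : p = hexPt δ (leftVertex e) := by
  rw [hexEdge_eq hδ] at h1 h2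
  refine eq_hexPt hδ fun v hv => ?_
  rcases mem_leftVertex.1 hv with rfl | rfl | rfl
  · exact h1.1
  · exact h1.2
  · unfold nextBdry at h2
    split_ifs at h2
    · exact h2.1
    · exact h2.2

/-- Since a Jordan curve is connected, the sides of the boundary form a single cycle. -/
lemma sameCycle_bdryPerm {k : ℕ} {D : MarkedDomain k} (hD : D.IsDiscrete δ) {F : Finset Site}
    (hF : (F : Set Site) = D.faces δ) (e d : {e // IsBdry F e}) : (bdryPerm F).SameCycle e d := by
  by_contra hed
  have hfr : ∀ p, p ∈ Set.range D.bdry ↔ ∃ x : {e // IsBdry F e}, p ∈ hexEdge δ x.1 := by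
    intro p
    rw [D.bdry_range, mem_frontier_iff hδ hD, ← hF]
    exact ⟨fun ⟨e, h1, h2, h3⟩ => ⟨⟨e, h1, h2⟩, h3⟩, fun ⟨x, hx⟩ => ⟨x.1, x.2.1, x.2.2, hx⟩⟩
  have hcl : ∀ S : Set {e // IsBdry F e}, IsClosed (⋃ x ∈ S, hexEdge δ x.1) := fun S =>
    S.toFinite.isClosed_biUnion fun x _ => isClosed_hexEdge hδ _
  have hpre := isPreconnected_range D.bdry_continuous
  rw [isPreconnected_closed_iff] at hpre
  have hne : ∀ x : {e // IsBdry F e}, hexPt δ (leftVertex x.1) ∈ hexEdge δ x.1 := fun x =>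
    (hexPt_mem_hexEdge hδ).2 (.inl rfl)
  -- The boundary would be the union of two nonempty closed sets, consisting of the sides in the
  -- cycle of `e` and of the other ones. A common point lies on consecutive sides, which are in the
  -- same cycle.
  obtain ⟨p, -, hp1, hp2⟩ := hpre _ _ (hcl {x | (bdryPerm F).SameCycle e x})
    (hcl {x | ¬ (bdryPerm F).SameCycle e x})
    (fun p hp => by
      obtain ⟨x, hx⟩ := (hfr p).1 hp
      by_cases h : (bdryPerm F).SameCycle e x
      · exact .inl (Set.mem_biUnion (show x ∈ {x | (bdryPerm F).SameCycle e x} from h) hx)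
      · exact .inr (Set.mem_biUnion (show x ∈ {x | ¬ (bdryPerm F).SameCycle e x} from h) hx))
    ⟨_, (hfr _).2 ⟨e, hne e⟩, Set.mem_biUnion (show e ∈ {x | (bdryPerm F).SameCycle e x} from
      Equiv.Perm.SameCycle.refl _ _) (hne e)⟩
    ⟨_, (hfr _).2 ⟨d, hne d⟩, Set.mem_biUnion (show d ∈ {x | ¬ (bdryPerm F).SameCycle e x} from
      hed) (hne d)⟩
  obtain ⟨x, hx, hpx⟩ := Set.mem_iUnion₂.1 hp1
  obtain ⟨y, hy, hpy⟩ := Set.mem_iUnion₂.1 hp2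
  have hxy : y.1 ≠ x.1 := fun h => hy (by rw [Subtype.ext h]; exact hx)
  rcases eq_nextBdry_of_inter hδ x.2 y.2 hxy hpx hpy with h | h
  · have h : y = bdryPerm F x := Subtype.ext h
    exact hy (by rw [h, Equiv.Perm.sameCycle_apply_right]; exact hx)
  · have h : x = bdryPerm F y := Subtype.ext h
    have hx : (bdryPerm F).SameCycle e x := hx
    rw [h, Equiv.Perm.sameCycle_apply_right] at hx
    exact hy hx

end

namespace MarkedDomain

variable {k : ℕ} (D : MarkedDomain k)

/-- The boundary curve is injective up to its period. -/
lemma bdry_eq_iff {s t : ℝ} : D.bdry s = D.bdry t ↔ ∃ n : ℤ, s = t + n := by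
  constructor
  · intro h
    have hfr : ∀ s : ℝ, D.bdry (Int.fract s) = D.bdry s := fun s => by
      have := D.bdry_periodic.sub_int_mul_eq (x := s) ⌊s⌋
      rwa [mul_one] at this
    have h1 := D.bdry_injOn ⟨Int.fract_nonneg s, Int.fract_lt_one s⟩
      ⟨Int.fract_nonneg t, Int.fract_lt_one t⟩ ((hfr s).trans (h.trans (hfr t).symm))
    refine ⟨⌊s⌋ - ⌊t⌋, ?_⟩
    have := Int.self_sub_fract s
    have := Int.self_sub_fract t
    push_cast
    linarith
  · rintro ⟨n, rfl⟩
    have := D.bdry_periodic.int_mul n t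
    rwa [mul_one] at this

lemma pt_injective : Function.Injective D.pt := by
  intro i j h
  obtain ⟨n, hn⟩ := D.bdry_eq_iff.1 h
  have h1 := D.time_lt i j
  have h2 := D.time_lt j i
  have h3 : (n : ℝ) < (1 : ℤ) := by push_cast; linarith
  have h4 : ((-1 : ℤ) : ℝ) < n := by push_cast; linarith
  rw [Int.cast_lt] at h3 h4
  obtain rfl : n = 0 := by omega
  exact D.time_strictMono.injective (by simpa using hn)

end MarkedDomain

/-- A mark of a discrete domain is the start of a side of the boundary whose predecessor is a side
of the same hexagon. -/
lemma exists_mark {k : ℕ} {D : MarkedDomain k} {δ : ℝ} (hD : D.IsDiscrete δ) {F : Finset Site}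
    (hF : (F : Set Site) = D.faces δ) (j : Fin k) : ∃ e, IsBdry F e ∧
      hexPt δ (leftVertex e.symm) = D.pt j ∧
      ∀ d, IsBdry F d → nextBdry F d = e → d.fst = e.fst := by
  obtain ⟨t, ht, v, ⟨hvt, hvF⟩, huniq⟩ := hD.2 j
  simp only [← hF, Finset.mem_coe] at hvF huniq
  obtain ⟨d, rfl, rfl⟩ := exists_dart_of_mem hvt
  have h1 : d.snd ∉ F := fun h => fst_ne_snd d (huniq _ ⟨snd_mem_left d, h⟩).symm
  have h2 : apex d ∉ F := fun h =>
    (apex_ne d).1 (huniq _ ⟨mem_leftVertex.2 (.inr (.inr rfl)), h⟩)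
  refine ⟨turn d, ⟨hvF, h2⟩, by rw [rightVertex_turn, ht], fun c hc hce => ?_⟩
  have : leftVertex c = leftVertex d := by
    rw [← right_nextBdry (F := F) c, hce, rightVertex_turn]
  rw [IsBdry.eq_of_left ⟨hvF, h1⟩ hc this]
  rfl

/-- The side `k` steps after `e` on the boundary. -/
def bdryAt {F : Finset Site} (e : {e // IsBdry F e}) (k : ℤ) : T.Dart := ((bdryPerm F ^ k) e).1

section

variable {F : Finset Site} (e : {e // IsBdry F e})

lemma bdryAt_zero : bdryAt e 0 = e.1 := rfl

lemma isBdry_bdryAt (k : ℤ) : IsBdry F (bdryAt e k) := ((bdryPerm F ^ k) e).2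

lemma bdryAt_succ (k : ℤ) : bdryAt e (k + 1) = nextBdry F (bdryAt e k) := by
  rw [bdryAt, add_comm, zpow_add, zpow_one, Equiv.Perm.mul_apply, bdryPerm_apply, bdryAt]

lemma bdryAt_eq_iff {k l : ℤ} :
    bdryAt e k = bdryAt e l ↔ (Function.minimalPeriod (bdryPerm F) e : ℤ) ∣ k - l := by
  have h := MulAction.zpow_smul_eq_iff_minimalPeriod_dvd (a := bdryPerm F) (b := e) (n := k - l)
  change _ ↔ ((Function.minimalPeriod (bdryPerm F) e : ℕ) : ℤ) ∣ k - l at h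
  rw [← h, Equiv.Perm.smul_def, bdryAt, bdryAt, ← Subtype.ext_iff]
  constructor
  · intro h
    rw [sub_eq_neg_add, zpow_add, Equiv.Perm.mul_apply, h, ← Equiv.Perm.mul_apply, ← zpow_add,
      neg_add_cancel, zpow_zero, Equiv.Perm.one_apply]
  · intro h
    conv_rhs => rw [← h]
    rw [← Equiv.Perm.mul_apply, ← zpow_add, add_sub_cancel]

lemma minimalPeriod_bdryPerm_pos : 0 < Function.minimalPeriod (bdryPerm F) e :=
  Function.minimalPeriod_pos_of_mem_periodicPts ((bdryPerm F).injective.mem_periodicPts e)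

end

/-- The discrete domain whose boundary is a single cycle, with marks at `0`, `a` and `b`. -/
def ddomOf {F : Finset Site} (e : {e // IsBdry F e}) (hcyc : ∀ d, (bdryPerm F).SameCycle e d)
    (m : ℤ → ℤ) (h0 : m 0 = 0) (h1 : 0 < m 1) (h2 : m 1 < m 2)
    (h3 : m 2 < Function.minimalPeriod (bdryPerm F) e)
    (hmark : ∀ i, 0 ≤ i → i < 3 → ∀ d, IsBdry F d → nextBdry F d = bdryAt e (m i) →
      d.fst = (bdryAt e (m i)).fst) : DDom where
  F := F
  N := Function.minimalPeriod (bdryPerm F) e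
  β := bdryAt e
  M i := m (i % 3) + (i / 3) * Function.minimalPeriod (bdryPerm F) e
  β_add k := (bdryAt_eq_iff e).2 (by simp)
  β_fst k := (isBdry_bdryAt e k).1
  β_snd k := (isBdry_bdryAt e k).2
  β_left k := by rw [bdryAt_succ, right_nextBdry]
  β_inj k l h := (bdryAt_eq_iff e).1 h
  β_surj d h h' := by
    obtain ⟨i, hi⟩ := hcyc ⟨d, h, h'⟩
    exact ⟨i, by rw [bdryAt, hi]⟩
  M_lt i := by
    have hi : i % 3 = 0 ∨ i % 3 = 1 ∨ i % 3 = 2 := by omega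
    rcases hi with hi | hi | hi
    · rw [show (i + 1) % 3 = 1 by omega, show (i + 1) / 3 = i / 3 by omega, hi]
      linarith
    · rw [show (i + 1) % 3 = 2 by omega, show (i + 1) / 3 = i / 3 by omega, hi]
      linarith
    · rw [show (i + 1) % 3 = 0 by omega, show (i + 1) / 3 = i / 3 + 1 by omega, hi]
      linarith
  M_add i := by
    rw [show (i + 3) % 3 = i % 3 by omega, show (i + 3) / 3 = i / 3 + 1 by omega]
    ring
  mark i := by
    have h := hmark (i % 3) (by omega) (by omega)
      (bdryAt e (m (i % 3) + (i / 3) * Function.minimalPeriod (bdryPerm F) e - 1))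
      (isBdry_bdryAt e _) (by
        rw [← bdryAt_succ, sub_add_cancel, bdryAt_eq_iff]
        exact ⟨i / 3, by ring⟩)
    rw [h]
    congr 1
    rw [show (bdryAt e (m (i % 3) + (i / 3) * Function.minimalPeriod (bdryPerm F) e)) =
      bdryAt e (m (i % 3)) from (bdryAt_eq_iff e).2 ⟨i / 3, by ring⟩]

/-- The discrete domain underlying a marked discrete domain. At first only the position of the
marks is known, and not yet that they are in counterclockwise order. -/
lemma exists_ddom {D : MarkedDomain 3} {δ : ℝ} (hδ : 0 < δ) (hD : D.IsDiscrete δ) :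
    ∃ D' : DDom, (D'.F : Set Site) = D.faces δ ∧
      (∀ k, D'.β (k + 1) = nextBdry D'.F (D'.β k)) ∧
      hexPt δ (D'.vert (D'.M 0)) = D.pt 0 ∧
      (hexPt δ (D'.vert (D'.M 1)) = D.pt 1 ∧ hexPt δ (D'.vert (D'.M 2)) = D.pt 2 ∨
        hexPt δ (D'.vert (D'.M 1)) = D.pt 2 ∧ hexPt δ (D'.vert (D'.M 2)) = D.pt 1) := by
  obtain ⟨F, hF⟩ := (finite_faces hδ D).exists_finset_coe
  choose E hE1 hE2 hE3 using exists_mark hD hF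
  let e : {e // IsBdry F e} := ⟨E 0, hE1 0⟩
  have hcyc : ∀ d, (bdryPerm F).SameCycle e d := sameCycle_bdryPerm hδ hD hF e
  set N := Function.minimalPeriod (bdryPerm F) e with hN
  have hN0 : 0 < (N : ℤ) := by exact_mod_cast minimalPeriod_bdryPerm_pos e
  -- The position of the `j`-th mark on the cycle, counted from the mark `0`.
  have hpos : ∀ j, j ≠ 0 → ∃ m : ℤ, 0 < m ∧ m < N ∧ bdryAt e m = E j := by
    intro j hj
    obtain ⟨i, hi⟩ := hcyc ⟨E j, hE1 j⟩
    have h1 : bdryAt e (i % N) = E j := by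
      have : bdryAt e (i % N) = bdryAt e i := by
        rw [bdryAt_eq_iff]
        exact ⟨-(i / N), by have := Int.emod_add_mul_ediv i N; linarith⟩
      rw [this, bdryAt, hi]
    refine ⟨i % N, (Int.emod_nonneg _ hN0.ne').lt_of_ne fun h => hj ?_, Int.emod_lt_of_pos _ hN0, h1⟩
    rw [← h, bdryAt_zero] at h1
    apply D.pt_injective
    rw [← hE2, ← hE2, ← h1]
  obtain ⟨m1, h10, h11, h12⟩ := hpos 1 (by decide)
  obtain ⟨m2, h20, h21, h22⟩ := hpos 2 (by decide)
  have hne : m1 ≠ m2 := fun h => by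
    have h3 : (1 : Fin 3) = 2 := D.pt_injective (by rw [← hE2, ← hE2, ← h12, ← h22, h])
    exact absurd h3 (by decide)
  have hmk : ∀ j m, bdryAt e m = E j → ∀ d, IsBdry F d → nextBdry F d = bdryAt e m →
      d.fst = (bdryAt e m).fst := fun j m h d hd hd' => by
    rw [h] at hd' ⊢
    exact hE3 j d hd hd'
  rcases lt_or_gt_of_ne hne with hlt | hlt
  · refine ⟨ddomOf e hcyc (fun i => if i = 0 then 0 else if i = 1 then m1 else m2) rfl h10 hlt h21
      ?_, hF, bdryAt_succ e, ?_, .inl ⟨?_, ?_⟩⟩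
    · intro i _ _
      split_ifs
      exacts [hmk 0 0 rfl, hmk 1 m1 h12, hmk 2 m2 h22]
    · rw [← hE2]; simp [DDom.vert, ddomOf, bdryAt_zero, e]
    · rw [← hE2, ← h12]; simp [DDom.vert, ddomOf]
    · rw [← hE2, ← h22]; simp [DDom.vert, ddomOf]
  · refine ⟨ddomOf e hcyc (fun i => if i = 0 then 0 else if i = 1 then m2 else m1) rfl h20 hlt h11
      ?_, hF, bdryAt_succ e, ?_, .inr ⟨?_, ?_⟩⟩
    · intro i _ _
      split_ifs
      exacts [hmk 0 0 rfl, hmk 2 m2 h22, hmk 1 m1 h12]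
    · rw [← hE2]; simp [DDom.vert, ddomOf, bdryAt_zero, e]
    · rw [← hE2, ← h22]; simp [DDom.vert, ddomOf]
    · rw [← hE2, ← h12]; simp [DDom.vert, ddomOf]

namespace DDom

variable {D : DDom} {δ : ℝ}

/-- The boundary arc from the `i`-th mark to the next, as a subset of the plane. -/
def arcSet (D : DDom) (δ : ℝ) (i : ℤ) : Set ℂ :=
  ⋃ k ∈ Set.Ico (D.M i) (D.M (i + 1)), hexEdge δ (D.β k)

lemma mem_arcSet {i : ℤ} {p : ℂ} :
    p ∈ D.arcSet δ i ↔ ∃ k, D.M i ≤ k ∧ k < D.M (i + 1) ∧ p ∈ hexEdge δ (D.β k) := by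
  simp [arcSet, and_assoc]

lemma isBdry_β (k : ℤ) : IsBdry D.F (D.β k) := ⟨D.β_fst k, D.β_snd k⟩

lemma vert_eq_iff {k l : ℤ} : D.vert k = D.vert l ↔ (D.N : ℤ) ∣ k - l := by
  refine ⟨fun h => D.β_inj _ _ (IsBdry.eq_of_right (isBdry_β l) (isBdry_β k) h), fun h => ?_⟩
  rw [vert, vert, β_eq_of_dvd h]

lemma M_add_mul (i m : ℤ) : D.M (i + 3 * m) = D.M i + m * D.N := by
  induction m with
  | zero => simp
  | succ m ih => rw [mul_add, ← add_assoc, mul_one, D.M_add, ih]; ring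
  | pred m ih =>
    have := D.M_add (i + 3 * (-(m : ℤ) - 1))
    rw [show i + 3 * (-(m : ℤ) - 1) + 3 = i + 3 * -(m : ℤ) by ring, ih] at this
    linarith

/-- A side of the boundary belongs to one arc only. -/
lemma index_unique {k i a : ℤ} (h1 : D.M i ≤ k) (h2 : k < D.M (i + 1)) (h3 : D.M a ≤ k)
    (h4 : k < D.M (a + 1)) : i = a := by
  have h5 := D.M_mono.lt_iff_lt.1 (h1.trans_lt h4)
  have h6 := D.M_mono.lt_iff_lt.1 (h3.trans_lt h2)
  omega

lemma arcSet_add_three (i : ℤ) : D.arcSet δ (i + 3) = D.arcSet δ i := by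
  have key : ∀ i j m : ℤ, j = i + 3 * m → D.arcSet δ i ⊆ D.arcSet δ j := by
    rintro i _ m rfl p hp
    rw [mem_arcSet] at hp ⊢
    obtain ⟨k, h1, h2, h3⟩ := hp
    refine ⟨k + m * D.N, ?_, ?_, by rwa [β_add_mul]⟩
    · rw [M_add_mul]; linarith
    · rw [show i + 3 * m + 1 = i + 1 + 3 * m by ring, M_add_mul]; linarith
  exact (key (i + 3) i (-1) (by ring)).antisymm (key i (i + 3) 1 (by ring))

/-- The only marks on an arc are its endpoints. -/
lemma exists_arcVert {i a : ℤ} (h : D.vert (D.M a) ∈ D.arcVert i) :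
    3 ∣ a - i ∨ 3 ∣ a - (i + 1) := by
  obtain ⟨k, h1, h2, h3⟩ := h
  obtain ⟨m, hm⟩ := vert_eq_iff.1 h3
  have h4 : k = D.M (a + 3 * m) := by rw [M_add_mul]; linarith
  rw [h4] at h1 h2
  have h5 := D.M_mono.le_iff_le.1 h1
  have h6 := D.M_mono.le_iff_le.1 h2
  omega

/-- Every side of the boundary belongs to one of the arcs `0`, `1` and `2`, after a shift by a
period. -/
lemma exists_index (k : ℤ) : ∃ i a m : ℤ, k = a + m * D.N ∧ 0 ≤ i ∧ i < 3 ∧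
    D.M i ≤ a ∧ a < D.M (i + 1) := by
  have hN : 0 < (D.N : ℤ) := by
    have := D.M_add 0
    have := D.M_mono (show (0 : ℤ) < 0 + 3 by norm_num)
    omega
  have h3 : D.M (2 + 1) = D.M 0 + D.N := D.M_add 0
  have h0 := Int.emod_add_mul_ediv (k - D.M 0) D.N
  have h1 := Int.emod_nonneg (k - D.M 0) hN.ne'
  have h2 := Int.emod_lt_of_pos (k - D.M 0) hN
  set r := (k - D.M 0) % D.N
  have hk : k = D.M 0 + r + (k - D.M 0) / D.N * D.N := by linarith
  by_cases c1 : D.M 0 + r < D.M 1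
  · exact ⟨0, _, _, hk, le_rfl, by norm_num, by linarith, c1⟩
  by_cases c2 : D.M 0 + r < D.M 2
  · exact ⟨1, _, _, hk, by norm_num, by norm_num, by linarith, c2⟩
  · exact ⟨2, _, _, hk, by norm_num, by norm_num, by linarith, by linarith⟩

section

variable (hδ : 0 < δ)

include hδ

lemma isClosed_arcSet (i : ℤ) : IsClosed (D.arcSet δ i) :=
  (Set.finite_Ico _ _).isClosed_biUnion fun _ _ => isClosed_hexEdge hδ _

lemma hexPt_mem_arcSet {i : ℤ} {t : HexVertex} :
    hexPt δ t ∈ D.arcSet δ i ↔ t ∈ D.arcVert i := by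
  have hM := D.M_lt i
  rw [mem_arcSet]
  simp only [hexPt_mem_hexEdge hδ]
  constructor
  · rintro ⟨k, h1, h2, rfl | rfl⟩
    · exact ⟨k + 1, by omega, by omega, vert_succ k⟩
    · exact ⟨k, h1, h2.le, rfl⟩
  · rintro ⟨k, h1, h2, rfl⟩
    rcases eq_or_lt_of_le h2 with rfl | h2
    · exact ⟨D.M (i + 1) - 1, by omega, by omega, .inl (left_pred _).symm⟩
    · exact ⟨k, h1, h2, .inr rfl⟩

/-- Two boundary arcs have only marks in common. -/
lemma arcSet_inter (hβ : ∀ k, D.β (k + 1) = nextBdry D.F (D.β k)) {i i' : ℤ} (hi : ¬ 3 ∣ i - i')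
    {p : ℂ} (h1 : p ∈ D.arcSet δ i) (h2 : p ∈ D.arcSet δ i') :
    ∃ a, p = hexPt δ (D.vert (D.M a)) := by
  have key : ∀ i i' : ℤ, ¬ 3 ∣ i - i' → ∀ k k', D.M i ≤ k → k < D.M (i + 1) → D.M i' ≤ k' →
      k' < D.M (i' + 1) → p ∈ hexEdge δ (D.β k) → p ∈ hexEdge δ (D.β k') →
      D.β k' = D.β (k + 1) → ∃ a, p = hexPt δ (D.vert (D.M a)) := by
    intro i i' hi k k' h1 h2 h3 h4 hp hp' he
    obtain ⟨m, hm⟩ := D.β_inj _ _ he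
    refine ⟨i + 1, ?_⟩
    have e1 := M_add_mul (D := D) i' (-m)
    have e2 := M_add_mul (D := D) (i' + 1) (-m)
    rw [show i' + 1 + 3 * -m = i' + 3 * -m + 1 by ring] at e2
    have e3 : k + 1 = D.M (i + 1) := by
      by_contra hne
      have := index_unique (D := D) (k := k + 1) (i := i) (a := i' + 3 * -m) (by omega) (by omega)
        (by linarith) (by linarith)
      omega
    rw [← e3, vert_succ]
    rw [he, hβ] at hp'
    exact inter_nextBdry hδ hp hp'
  obtain ⟨k, a1, a2, a3⟩ := mem_arcSet.1 h1
  obtain ⟨k', b1, b2, b3⟩ := mem_arcSet.1 h2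
  have hne : D.β k' ≠ D.β k := fun h => by
    obtain ⟨m, hm⟩ := D.β_inj _ _ h
    have e1 := M_add_mul (D := D) i' (-m)
    have e2 := M_add_mul (D := D) (i' + 1) (-m)
    rw [show i' + 1 + 3 * -m = i' + 3 * -m + 1 by ring] at e2
    have := index_unique (D := D) (k := k) (i := i) (a := i' + 3 * -m) a1 a2
        (by linarith) (by linarith)
    omega
  rcases eq_nextBdry_of_inter hδ (isBdry_β k) (isBdry_β k') hne a3 b3 with h | h
  · exact key i i' hi k k' a1 a2 b1 b2 a3 b3 (by rw [h, hβ])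
  · exact key i' i (fun h => hi (by omega)) k' k b1 b2 a1 a2 b3 a3 (by rw [h, hβ])

end

end DDom

/-! ### Boundary arcs -/

namespace MarkedDomain

lemma time_lt_nextTime {k : ℕ} (D : MarkedDomain k) (j : Fin k) : D.time j < D.nextTime j := by
  unfold nextTime
  split_ifs with h
  · exact D.time_strictMono (Nat.lt_succ_self (j : ℕ))
  · exact D.time_lt _ _

lemma mem_arc {k : ℕ} (D : MarkedDomain k) {j : Fin k} {p : ℂ} :
    p ∈ D.arc j ↔ ∃ t ∈ Set.Icc (D.time j) (D.nextTime j), D.bdry t = p := by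
  have h := D.time_lt_nextTime j
  constructor
  · rintro ⟨s, rfl⟩
    refine ⟨_, ⟨?_, ?_⟩, rfl⟩
    · nlinarith [s.2.1]
    · nlinarith [s.2.2]
  · rintro ⟨t, ht, rfl⟩
    refine ⟨⟨(t - D.time j) / (D.nextTime j - D.time j), div_nonneg (by linarith [ht.1])
      (by linarith), (div_le_one (by linarith)).2 (by linarith [ht.2])⟩, ?_⟩
    change D.bdry _ = _
    congr 1
    have : D.nextTime j - D.time j ≠ 0 := by linarith
    field_simp
    ring

variable (D : MarkedDomain 3)

lemma nextTime_lt (j : Fin 3) : D.nextTime j < D.time j + 1 := by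
  have h1 := D.time_strictMono (show (0 : Fin 3) < 1 by decide)
  have h2 := D.time_strictMono (show (1 : Fin 3) < 2 by decide)
  have h3 := D.time_lt 2 0
  have h4 : D.nextTime 0 = D.time 1 := rfl
  have h5 : D.nextTime 1 = D.time 2 := rfl
  have h6 : D.nextTime 2 = D.time 0 + 1 := rfl
  fin_cases j
  · simp only [Fin.zero_eta, h4]; linarith
  · simp only [Fin.mk_one, h5]; linarith
  · simp only [Fin.reduceFinMk, h6]; linarith

lemma bdry_nextTime (j : Fin 3) : D.bdry (D.nextTime j) = D.pt (j + 1) := by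
  fin_cases j
  · rfl
  · rfl
  · exact D.bdry_periodic _

lemma frontier_subset : frontier D.carrier ⊆ ⋃ j, D.arc j := by
  rw [← D.bdry_range]
  rintro _ ⟨t, rfl⟩
  have e : D.bdry (t - ⌊t - D.time 0⌋) = D.bdry t :=
    D.bdry_eq_iff.2 ⟨-⌊t - D.time 0⌋, by push_cast; ring⟩
  have h1 := Int.floor_le (t - D.time 0)
  have h2 := Int.lt_floor_add_one (t - D.time 0)
  rw [Set.mem_iUnion, ← e]
  simp only [mem_arc]
  generalize (⌊t - D.time 0⌋ : ℝ) = f at *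
  by_cases c1 : t - f ≤ D.time 1
  · exact ⟨0, _, ⟨by linarith, c1⟩, rfl⟩
  by_cases c2 : t - f ≤ D.time 2
  · exact ⟨1, _, ⟨by linarith, c2⟩, rfl⟩
  · exact ⟨2, _, ⟨by linarith, show t - f ≤ D.time 0 + 1 by linarith⟩, rfl⟩

/-- Inside of a boundary arc there are no marks. -/
lemma bdry_ne_pt {j i : Fin 3} {t : ℝ} (ht : t ∈ Set.Ioo (D.time j) (D.nextTime j)) :
    D.bdry t ≠ D.pt i := by
  intro h
  obtain ⟨n, hn⟩ := D.bdry_eq_iff.1 h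
  have h1 := D.time_strictMono (show (0 : Fin 3) < 1 by decide)
  have h2 := D.time_strictMono (show (1 : Fin 3) < 2 by decide)
  have h3 := D.time_lt 2 0
  have h4 : D.nextTime 0 = D.time 1 := rfl
  have h5 : D.nextTime 1 = D.time 2 := rfl
  have h6 : D.nextTime 2 = D.time 0 + 1 := rfl
  have hc : (n : ℝ) ≤ -1 ∨ (n : ℝ) = 0 ∨ (n : ℝ) = 1 ∨ (2 : ℝ) ≤ n := by
    have : n ≤ -1 ∨ n = 0 ∨ n = 1 ∨ 2 ≤ n := by omega
    exact_mod_cast this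
  obtain ⟨ht1, ht2⟩ := ht
  fin_cases j <;> fin_cases i <;>
    simp only [Fin.zero_eta, Fin.mk_one, Fin.reduceFinMk, h4, h5, h6] at hn ht1 ht2 <;>
    rcases hc with hc | hc | hc | hc <;> linarith

/-- The boundary arcs are determined by the marks they contain. -/
lemma arc_eq {G : Fin 3 → Set ℂ} (hcl : ∀ i, IsClosed (G i))
    (hfr : ∀ p, p ∈ frontier D.carrier ↔ ∃ i, p ∈ G i)
    (hpt : ∀ i j, D.pt j ∈ G i ↔ i = j ∨ i = j + 2)
    (hint : ∀ i i', i ≠ i' → ∀ p ∈ G i, p ∈ G i' → ∃ j, p = D.pt j) (j : Fin 3) :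
    D.arc j = G j := by
  have hsub : ∀ j, D.arc j ⊆ G j := by
    intro j
    have hlt := D.time_lt_nextTime j
    set A := D.bdry '' Set.Ioo (D.time j) (D.nextTime j)
    have hA : IsPreconnected A := isPreconnected_Ioo.image _ D.bdry_continuous.continuousOn
    have hAfr : ∀ p ∈ A, ∃ i, p ∈ G i := by
      rintro _ ⟨t, -, rfl⟩
      rw [← hfr, ← D.bdry_range]
      exact Set.mem_range_self t
    obtain ⟨p, hp⟩ : A.Nonempty := (Set.nonempty_Ioo.2 hlt).image _
    obtain ⟨i, hi⟩ := hAfr p hp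
    -- Inside of an arc of `D` there are no marks, so the closed sets `G` do not meet there; as it
    -- is connected, it is contained in one of them.
    have hAi : A ⊆ G i := by
      intro q hq
      obtain ⟨i', hi'⟩ := hAfr q hq
      by_cases h : i' = i
      · exact h ▸ hi'
      rw [isPreconnected_closed_iff] at hA
      obtain ⟨x, hxA, hx1, hx2⟩ := hA (G i) (⋃ a ∈ {a | a ≠ i}, G a) (hcl i)
        ((Set.toFinite _).isClosed_biUnion fun a _ => hcl a)
        (fun x hx => by
          obtain ⟨a, ha⟩ := hAfr x hx
          by_cases h : a = i
          · exact .inl (h ▸ ha)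
          · exact .inr (Set.mem_biUnion (show a ∈ {a | a ≠ i} from h) ha))
        ⟨p, hp, hi⟩ ⟨q, hq, Set.mem_biUnion (show i' ∈ {a | a ≠ i} from h) hi'⟩
      obtain ⟨a, ha, hxa⟩ := Set.mem_iUnion₂.1 hx2
      obtain ⟨l, hl⟩ := hint a i ha x hxa hx1
      obtain ⟨t, ht, rfl⟩ := hxA
      exact absurd hl (D.bdry_ne_pt ht)
    have hAcl : D.arc j ⊆ G i := by
      intro p hp
      obtain ⟨t, ht, rfl⟩ := D.mem_arc.1 hp
      rw [← closure_Ioo hlt.ne] at ht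
      exact closure_minimal hAi (hcl i) (image_closure_subset_closure_image D.bdry_continuous
        (Set.mem_image_of_mem _ ht))
    -- Only `G j` contains both endpoints.
    have h1 := (hpt i j).1 (hAcl (D.mem_arc.2 ⟨_, Set.left_mem_Icc.2 hlt.le, rfl⟩))
    have h2 := (hpt i (j + 1)).1 (hAcl (D.mem_arc.2 ⟨_, Set.right_mem_Icc.2 hlt.le,
      D.bdry_nextTime j⟩))
    have : i = j := by
      revert h1 h2
      clear * -
      revert i j
      decide
    rwa [this] at hAcl
  refine (hsub j).antisymm fun p hp => ?_
  obtain ⟨i, hi⟩ := Set.mem_iUnion.1 (D.frontier_subset ((hfr p).2 ⟨j, hp⟩))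
  by_cases h : i = j
  · exact h ▸ hi
  obtain ⟨l, rfl⟩ := hint i j h p (hsub i hi) hp
  have hlt := D.time_lt_nextTime j
  rcases (hpt j l).1 hp with h1 | h1
  · rw [← h1]
    exact D.mem_arc.2 ⟨_, Set.left_mem_Icc.2 hlt.le, rfl⟩
  · have : l = j + 1 := by
      revert h1
      clear * -
      revert l j
      decide
    rw [this]
    exact D.mem_arc.2 ⟨_, Set.right_mem_Icc.2 hlt.le, D.bdry_nextTime j⟩

end MarkedDomain

/-! ### Orientation of the boundary -/

/-- As a segment that avoids `z` is traversed, its direction from `z` never becomes opposite to the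
initial one. -/
lemma div_mem_slitPlane {p q z : ℂ} (h : z ∉ segment ℝ p q) : (q - z) / (p - z) ∈ Complex.slitPlane := by
  have hp : p - z ≠ 0 := fun h' => h (by rw [← sub_eq_zero.1 h']; exact left_mem_segment ℝ _ _)
  by_contra hw
  rw [Complex.mem_slitPlane_iff, not_or, not_lt, not_not] at hw
  set w := (q - z) / (p - z) with hwdef
  have h1 : (w.re : ℂ) = w := Complex.ext rfl (by simp [hw.2])
  have h2 : q - z = w.re * (p - z) := by rw [h1, hwdef, div_mul_cancel₀ _ hp]
  have h3 : 0 < 1 - w.re := by linarith [hw.1]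
  refine h ⟨-w.re / (1 - w.re), 1 / (1 - w.re), div_nonneg (by linarith [hw.1]) h3.le,
    by positivity, by rw [← add_div, neg_add_eq_sub, div_self h3.ne'], ?_⟩
  have h4 : ((1 - w.re : ℝ) : ℂ) ≠ 0 := by exact_mod_cast h3.ne'
  simp only [Complex.real_smul]
  push_cast at h4 ⊢
  field_simp
  linear_combination h2

/-- The increment along a segment of a continuous branch of `log (· - z)`. -/
lemma log_increment {p q z : ℂ} (h : z ∉ segment ℝ p q) {L : ℝ → ℂ}
    (hL : ContinuousOn L (Set.Icc 0 1))
    (he : ∀ s ∈ Set.Icc (0 : ℝ) 1, Complex.exp (L s) = p + s * (q - p) - z) :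
    L 1 - L 0 = Complex.log ((q - z) / (p - z)) := by
  have hp : p - z ≠ 0 := fun h' => h (by rw [← sub_eq_zero.1 h']; exact left_mem_segment ℝ _ _)
  have hw : ∀ s ∈ Set.Icc (0 : ℝ) 1, (p + s * (q - p) - z) / (p - z) ∈ Complex.slitPlane := by
    intro s hs
    refine div_mem_slitPlane fun hz => h ?_
    refine (convex_segment p q).segment_subset (left_mem_segment ℝ _ _) ?_ hz
    exact ⟨1 - s, s, by linarith [hs.2], hs.1, by ring, by
      simp only [Complex.real_smul]; push_cast; ring⟩
  -- The difference of `L` and the principal branch, in multiples of `2 * π * I`, is continuous and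
  -- integer valued, and it vanishes at `0`. Hence it does not take the values `1 / 2` and `-1 / 2`,
  -- and vanishes at `1`.
  set g : ℝ → ℝ := fun s => ((L s - L 0 - Complex.log ((p + s * (q - p) - z) / (p - z))) /
    (2 * Real.pi * Complex.I)).re
  have hg : ContinuousOn g (Set.Icc 0 1) := by
    refine Complex.continuous_re.comp_continuousOn (ContinuousOn.div_const ?_ _)
    refine (hL.sub continuousOn_const).sub (ContinuousOn.clog ?_ hw)
    fun_prop
  have hint : ∀ s ∈ Set.Icc (0 : ℝ) 1, ∃ n : ℤ, L s - L 0 -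
      Complex.log ((p + s * (q - p) - z) / (p - z)) = n * (2 * Real.pi * Complex.I) := by
    intro s hs
    rw [← Complex.exp_eq_one_iff, Complex.exp_sub, Complex.exp_sub, he s hs,
      he 0 (by simp), Complex.exp_log (Complex.slitPlane_ne_zero (hw s hs))]
    have := Complex.slitPlane_ne_zero (hw s hs)
    rw [div_ne_zero_iff] at this
    rw [Complex.ofReal_zero, zero_mul, add_zero, div_self (div_ne_zero this.1 hp)]
  have hpi : (2 * Real.pi * Complex.I : ℂ) ≠ 0 := Complex.two_pi_I_ne_zero
  have hgint : ∀ s ∈ Set.Icc (0 : ℝ) 1, ∃ n : ℤ, g s = n := by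
    intro s hs
    obtain ⟨n, hn⟩ := hint s hs
    exact ⟨n, by simp only [g]; rw [hn, mul_div_cancel_right₀ _ hpi]; simp⟩
  have hg0 : g 0 = 0 := by simp [g, div_self hp]
  have hhalf : ∀ s ∈ Set.Icc (0 : ℝ) 1, g s ≠ 1 / 2 ∧ g s ≠ -1 / 2 := by
    intro s hs
    obtain ⟨n, hn⟩ := hgint s hs
    rw [hn]
    constructor <;> intro h
    · have : (2 * n : ℝ) = 1 := by linarith
      have : (2 * n : ℤ) = 1 := by exact_mod_cast this
      omega
    · have : (2 * n : ℝ) = -1 := by linarith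
      have : (2 * n : ℤ) = -1 := by exact_mod_cast this
      omega
  have h1 : (1 : ℝ) ∈ Set.Icc (0 : ℝ) 1 := by simp
  obtain ⟨n, hn⟩ := hint 1 h1
  have hgn : g 1 = n := by
    simp only [g]; rw [hn, mul_div_cancel_right₀ _ hpi]; simp
  obtain rfl : n = 0 := by
    rcases lt_trichotomy n 0 with h | h | h
    · have h2 : (n : ℝ) ≤ -1 := by exact_mod_cast Int.le_sub_one_of_lt h
      obtain ⟨s, hs, hs'⟩ := intermediate_value_Icc' zero_le_one hg (show (-1 / 2 : ℝ) ∈ _ from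
        ⟨by rw [hgn]; linarith, by rw [hg0]; norm_num⟩)
      exact absurd hs' (hhalf s hs).2
    · exact h
    · have h2 : (1 : ℝ) ≤ n := by exact_mod_cast h
      obtain ⟨s, hs, hs'⟩ := intermediate_value_Icc zero_le_one hg (show (1 / 2 : ℝ) ∈ _ from
        ⟨by rw [hg0]; norm_num, by rw [hgn]; linarith⟩)
      exact absurd hs' (hhalf s hs).1
  rw [Int.cast_zero, zero_mul, sub_eq_zero] at hn
  rw [hn]
  congr 2
  push_cast; ring

/-- The increment of the logarithm around `z` along the side dual to `e`. -/
def logInc (δ : ℝ) (z : ℂ) (e : T.Dart) : ℂ :=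
  Complex.log ((hexPt δ (leftVertex e) - z) / (hexPt δ (leftVertex e.symm) - z))

lemma hexEdge_symm (δ : ℝ) (e : T.Dart) : hexEdge δ e.symm = hexEdge δ e := by
  rw [hexEdge, hexEdge, SimpleGraph.Dart.symm_symm, segment_symm]

lemma notMem_hexEdge_iff (δ : ℝ) (z : ℂ) (e : T.Dart) : z ∉ hexEdge δ e ↔
    z ∉ segment ℝ (hexPt δ (leftVertex e.symm)) (hexPt δ (leftVertex e)) := by
  rw [hexEdge, segment_symm]

lemma logInc_symm {δ : ℝ} {z : ℂ} {e : T.Dart} (h : z ∉ hexEdge δ e) :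
    logInc δ z e.symm = -logInc δ z e := by
  rw [notMem_hexEdge_iff] at h
  have := Complex.mem_slitPlane_iff_arg.1 (div_mem_slitPlane h)
  rw [logInc, logInc, SimpleGraph.Dart.symm_symm, ← Complex.log_inv _ this.1, inv_div]

/-- The increment of the logarithm along a side agrees with that of any continuous branch near the
side. -/
lemma logInc_eq_sub {δ : ℝ} {z : ℂ} {e : T.Dart} {S : Set ℂ} {g : ℂ → ℂ} (hg : ContinuousOn g S)
    (he : ∀ p ∈ S, Complex.exp (g p) = p - z) (hS : hexEdge δ e ⊆ S) :
    logInc δ z e = g (hexPt δ (leftVertex e)) - g (hexPt δ (leftVertex e.symm)) := by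
  have hz : z ∉ hexEdge δ e := fun h => by
    have := he z (hS h)
    rw [sub_self] at this
    exact Complex.exp_ne_zero _ this
  rw [notMem_hexEdge_iff] at hz
  set p := hexPt δ (leftVertex e.symm)
  set q := hexPt δ (leftVertex e)
  have hmem : ∀ s ∈ Set.Icc (0 : ℝ) 1, p + s * (q - p) ∈ S := fun s hs => hS <| by
    rw [hexEdge, segment_symm]
    exact ⟨1 - s, s, by linarith [hs.2], hs.1, by ring, by
      simp only [Complex.real_smul]; push_cast; ring⟩
  have := log_increment hz (L := fun s => g (p + s * (q - p)))
    (hg.comp (by fun_prop) hmem) (fun s hs => he _ (hmem s hs))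
  rw [logInc, ← this]
  simp

/-- The boundary of a hexagon winds around its centre but not around other sites. -/
lemma sum_logInc_turn {δ : ℝ} (hδ : 0 < δ) (v : Site) (e : T.Dart) :
    ∑ i ∈ Finset.range 6, logInc δ (sitePt δ v) (turn^[i] e) =
      if e.fst = v then 2 * Real.pi * Complex.I else 0 := by
  split_ifs with hv
  -- Seen from the centre of the hexagon each side increases the argument by `π / 3`.
  · have key : ∀ d : T.Dart, d.fst = v → logInc δ (sitePt δ v) d = Real.pi / 3 * Complex.I := by
      rintro d rfl
      have h1 := exp_sq_eq
      have hd : vec δ d ≠ 0 := by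
        intro h
        have := dist_sitePt_of_adj hδ d.adj
        rw [dist_comm, dist_eq_norm, show sitePt δ d.snd - sitePt δ d.fst = 0 from h, norm_zero] at this
        exact hδ.ne this
      have e1 : hexPt δ (leftVertex d) - sitePt δ d.fst =
          vec δ d * (1 + Complex.exp (Real.pi / 3 * Complex.I)) / 3 := by
        rw [hexPt_leftVertex, sitePt_apex]
        simp only [Complex.real_smul, vec]; push_cast; ring
      have e2 : hexPt δ (leftVertex d.symm) - sitePt δ d.fst =
          vec δ d * (2 - Complex.exp (Real.pi / 3 * Complex.I)) / 3 := by
        rw [hexPt_leftVertex, sitePt_apex, vec_symm]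
        simp only [Complex.real_smul, vec, symm_fst, symm_snd]; push_cast; ring
      have e3 : (2 - Complex.exp (Real.pi / 3 * Complex.I)) ≠ 0 := by
        rw [exp_pi_div_three]
        intro h
        have := congrArg Complex.re h
        norm_num at this
      have e4 : (hexPt δ (leftVertex d) - sitePt δ d.fst) /
          (hexPt δ (leftVertex d.symm) - sitePt δ d.fst) = Complex.exp (Real.pi / 3 * Complex.I) := by
        rw [e1, e2, div_eq_iff (div_ne_zero (mul_ne_zero hd e3) (by norm_num))]
        linear_combination (vec δ d / 3) * h1
      rw [logInc, e4, Complex.log_exp]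
      · simp only [Complex.mul_im, Complex.I_im, Complex.I_re]
        norm_num
        linarith [Real.pi_pos]
      · simp only [Complex.mul_im, Complex.I_im, Complex.I_re]
        norm_num
        linarith [Real.pi_pos]
    rw [Finset.sum_congr rfl fun i _ => key _ ((turn_iterate_fst e i).trans hv)]
    simp
    ring
  -- The hexagon does not contain `v`, so that the logarithm has a continuous branch on it.
  · set z := sitePt δ v
    set c := sitePt δ e.fst
    have hcv : Convex ℝ (hexagon δ e.fst) := convex_convexHull ℝ _
    have hc : c ∈ hexagon δ e.fst := (sitePt_mem_hexagon hδ).2 rfl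
    have hslit : ∀ p ∈ hexagon δ e.fst, (p - z) / (c - z) ∈ Complex.slitPlane := fun p hp =>
      div_mem_slitPlane fun hz => hv ((sitePt_mem_hexagon hδ).1 (hcv.segment_subset hc hp hz)).symm
    have hcz : c - z ≠ 0 := by
      have := Complex.slitPlane_ne_zero (hslit c hc)
      exact (div_ne_zero_iff.1 this).2
    set g : ℂ → ℂ := fun p => Complex.log ((p - z) / (c - z)) + Complex.log (c - z)
    have hg : ContinuousOn g (hexagon δ e.fst) :=
      (ContinuousOn.clog (by fun_prop) hslit).add continuousOn_const
    have hexp : ∀ p ∈ hexagon δ e.fst, Complex.exp (g p) = p - z := fun p hp => by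
      rw [Complex.exp_add, Complex.exp_log (Complex.slitPlane_ne_zero (hslit p hp)),
        Complex.exp_log hcz, div_mul_cancel₀ _ hcz]
    rw [← sum_turn_eq_zero (fun t => g (hexPt δ t)) e]
    refine Finset.sum_congr rfl fun i _ => logInc_eq_sub hg hexp ?_
    rw [hexEdge_eq hδ, turn_iterate_fst]
    exact Set.inter_subset_left

namespace DDom

variable {D : DDom} {δ : ℝ}

/-- The boundary of a discrete domain winds once around its sites. -/
lemma sum_logInc (hδ : 0 < δ) {v : Site} (hv : v ∈ D.F) (a : ℤ) :
    ∑ k ∈ Finset.Ico a (a + D.N), logInc δ (sitePt δ v) (D.β k) = 2 * Real.pi * Complex.I := by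
  have h1 := sum_outside D D.F subset_rfl a fun e => logInc δ (sitePt δ v) e
  simp only [D.β_fst, if_true] at h1
  rw [← h1, sum_boundary, sum_star]
  · simp only [sum_logInc_turn hδ]
    rw [show (fun x => if (baseDart x).fst = v then 2 * (Real.pi : ℂ) * Complex.I else 0) =
      fun x => if x = v then 2 * (Real.pi : ℂ) * Complex.I else 0 from rfl,
      Finset.sum_ite_eq' D.F v, if_pos hv]
  · intro e
    refine logInc_symm fun h => ?_
    rw [hexEdge_eq hδ] at h
    exact fst_ne_snd e (((sitePt_mem_hexagon hδ).1 h.1).symm.trans ((sitePt_mem_hexagon hδ).1 h.2))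

end DDom

lemma sum_Ico_int_sub {A : Type*} [AddCommGroup A] (f : ℤ → A) {a b : ℤ} (h : a ≤ b) :
    ∑ k ∈ Finset.Ico a b, (f (k + 1) - f k) = f b - f a := by
  induction b, h using Int.leInduction with
  | base => simp
  | succ b hb ih =>
    have : Finset.Ico a (b + 1) = insert b (Finset.Ico a b) := by
      ext x; simp only [Finset.mem_Ico, Finset.mem_insert]; omega
    rw [this, Finset.sum_insert (by simp), ih]
    abel

lemma sum_Ico_int_add {A : Type*} [AddCommMonoid A] {f : ℤ → A} {a b c : ℤ} (h : a ≤ b)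
    (h' : b ≤ c) :
    ∑ k ∈ Finset.Ico a c, f k = ∑ k ∈ Finset.Ico a b, f k + ∑ k ∈ Finset.Ico b c, f k := by
  rw [← Finset.Ico_union_Ico_eq_Ico h h',
    Finset.sum_union (Finset.Ico_disjoint_Ico_consecutive a b c)]

namespace MarkedDomain

variable (D : MarkedDomain 3)

/-- A lift of the argument along the boundary curve descends to each boundary arc. -/
lemma exists_log_arc (j : Fin 3) {z : ℂ} {ℓ : ℝ → ℂ} (hℓ : Continuous ℓ)
    (he : ∀ t, D.bdry t - z = Complex.exp (ℓ t)) : ∃ g : ℂ → ℂ, ContinuousOn g (D.arc j) ∧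
      (∀ p ∈ D.arc j, Complex.exp (g p) = p - z) ∧ g (D.pt j) = ℓ (D.time j) ∧
      g (D.pt (j + 1)) = ℓ (D.nextTime j) := by
  have hlt := D.time_lt_nextTime j
  have hlt' := D.nextTime_lt j
  let τ : unitInterval → ℝ := fun s => D.time j + s * (D.nextTime j - D.time j)
  have hτ : Continuous τ := by fun_prop
  -- An arc is less than a full period, hence simple.
  have hinj : Function.Injective (D.arcCurve j) := by
    intro s t h
    obtain ⟨n, hn⟩ := D.bdry_eq_iff.1 (show D.bdry (τ s) = D.bdry (τ t) from h)
    simp only [τ] at hn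
    have h1 : (n : ℝ) < (1 : ℤ) := by push_cast; nlinarith [s.2.1, s.2.2, t.2.1, t.2.2]
    have h2 : ((-1 : ℤ) : ℝ) < n := by push_cast; nlinarith [s.2.1, s.2.2, t.2.1, t.2.2]
    rw [Int.cast_lt] at h1 h2
    obtain rfl : n = 0 := by omega
    refine Subtype.ext (mul_right_cancel₀ (sub_ne_zero.2 hlt.ne') ?_)
    push_cast at hn
    linarith
  have hinv : ∀ s, Function.invFun (D.arcCurve j) (D.arcCurve j s) = s :=
    Function.leftInverse_invFun hinj
  let g : ℂ → ℂ := fun p => ℓ (τ (Function.invFun (D.arcCurve j) p))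
  have hgτ : ∀ s, g (D.arcCurve j s) = ℓ (τ s) := fun s => by simp only [g, hinv]
  refine ⟨g, ?_, ?_, ?_, ?_⟩
  · rw [continuousOn_iff_continuous_domRestrict]
    have hemb := ((D.arcCurve j).continuous.isClosedEmbedding hinj).toIsEmbedding
    have h1 : Continuous ((Set.domRestrict (D.arc j) g) ∘ hemb.toHomeomorph) := by
      have : (Set.domRestrict (D.arc j) g) ∘ hemb.toHomeomorph = fun s => ℓ (τ s) :=
        funext fun s => hgτ s
      rw [this]
      exact hℓ.comp hτ
    exact (hemb.toHomeomorph.comp_continuous_iff').1 h1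
  · rintro _ ⟨s, rfl⟩
    rw [hgτ, ← he]
    rfl
  · have : D.pt j = D.arcCurve j 0 := by
      change D.bdry _ = D.bdry _
      simp
    rw [this, hgτ]
    simp [τ]
  · have : D.pt (j + 1) = D.arcCurve j 1 := by
      rw [← D.bdry_nextTime]
      change D.bdry _ = D.bdry _
      simp
    rw [this, hgτ]
    simp [τ]

end MarkedDomain

/-- The increment of the logarithm along an arc, by means of a continuous branch on the arc. -/
lemma DDom.sum_arc {D : DDom} {δ : ℝ} {z : ℂ} {i : ℤ} {S : Set ℂ} {g : ℂ → ℂ}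
    (hg : ContinuousOn g S) (he : ∀ p ∈ S, Complex.exp (g p) = p - z)
    (hS : S = D.arcSet δ i) :
    ∑ k ∈ Finset.Ico (D.M i) (D.M (i + 1)), logInc δ z (D.β k) =
      g (hexPt δ (D.vert (D.M (i + 1)))) - g (hexPt δ (D.vert (D.M i))) := by
  rw [← sum_Ico_int_sub (fun k => g (hexPt δ (D.vert k))) (D.M_lt i).le]
  refine Finset.sum_congr rfl fun k hk => ?_
  rw [Finset.mem_Ico] at hk
  rw [logInc_eq_sub hg he, D.vert_succ, DDom.vert]
  exact fun p hp => hS ▸ DDom.mem_arcSet.2 ⟨k, hk.1, hk.2, hp⟩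

/-- A marked discrete domain is described by combinatorial data: its boundary is a cycle of sides of
hexagons, traversed counterclockwise, on which the marks appear in their order. -/
theorem exists_ddom_arc {D : MarkedDomain 3} {δ : ℝ} (hδ : 0 < δ) (hD : D.IsDiscrete δ) :
    ∃ D' : DDom, (D'.F : Set Site) = D.faces δ ∧ ∀ j : Fin 3, D.arc j = D'.arcSet δ (j : ℕ) := by
  obtain ⟨D', hF, hβ, h0, h12⟩ := exists_ddom hδ hD
  refine ⟨D', hF, ?_⟩
  have hfr : ∀ p, p ∈ frontier D.carrier ↔
      p ∈ D'.arcSet δ 0 ∨ p ∈ D'.arcSet δ 1 ∨ p ∈ D'.arcSet δ 2 := by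
    intro p
    rw [mem_frontier_iff hδ hD, ← hF]
    constructor
    · rintro ⟨e, h1, h2, h3⟩
      obtain ⟨k, rfl⟩ := D'.β_surj e h1 h2
      obtain ⟨i, a, m, rfl, hi1, hi2, h4, h5⟩ := D'.exists_index k
      rw [DDom.β_add_mul] at h3
      have : p ∈ D'.arcSet δ i := DDom.mem_arcSet.2 ⟨a, h4, h5, h3⟩
      obtain rfl | rfl | rfl : i = 0 ∨ i = 1 ∨ i = 2 := by omega
      exacts [.inl this, .inr (.inl this), .inr (.inr this)]
    · have : ∀ i, p ∈ D'.arcSet δ i → ∃ e : T.Dart, e.fst ∈ (D'.F : Set Site) ∧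
          e.snd ∉ (D'.F : Set Site) ∧ p ∈ hexEdge δ e := by
        intro i hi
        obtain ⟨k, -, -, hk⟩ := DDom.mem_arcSet.1 hi
        exact ⟨_, D'.β_fst k, D'.β_snd k, hk⟩
      rintro (h | h | h) <;> exact this _ h
  have hmk : ∀ a i : ℤ, hexPt δ (D'.vert (D'.M a)) ∈ D'.arcSet δ i ↔
      3 ∣ a - i ∨ 3 ∣ a - (i + 1) := by
    intro a i
    rw [DDom.hexPt_mem_arcSet hδ]
    refine ⟨DDom.exists_arcVert, ?_⟩
    have hM := D'.M_lt i
    rintro (⟨m, hm⟩ | ⟨m, hm⟩)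
    · refine ⟨D'.M i, le_rfl, hM.le, DDom.vert_eq_iff.2 ⟨-m, ?_⟩⟩
      rw [show a = i + 3 * m by linarith, DDom.M_add_mul]; ring
    · refine ⟨D'.M (i + 1), hM.le, le_rfl, DDom.vert_eq_iff.2 ⟨-m, ?_⟩⟩
      rw [show a = i + 1 + 3 * m by linarith, DDom.M_add_mul]; ring
  have hcase : ∀ a : ℤ, ∃ i : ℤ, 0 ≤ i ∧ i < 3 ∧
      hexPt δ (D'.vert (D'.M a)) = hexPt δ (D'.vert (D'.M i)) := fun a =>
    ⟨a % 3, by omega, by omega, by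
      rw [DDom.vert_eq_iff.2]
      refine ⟨a / 3, ?_⟩
      have := DDom.M_add_mul (D := D') (a % 3) (a / 3)
      rw [Int.emod_add_mul_ediv] at this
      rw [this]; ring⟩
  rcases h12 with ⟨h1, h2⟩ | ⟨h1, h2⟩
  · refine D.arc_eq (G := fun j => D'.arcSet δ (j : ℕ)) (fun i => DDom.isClosed_arcSet hδ _) ?_ ?_ ?_
    · intro p
      rw [hfr]
      simp [Fin.exists_fin_succ]
    · intro i j
      have hj : D.pt j = hexPt δ (D'.vert (D'.M (j : ℕ))) := by
        fin_cases j
        exacts [h0.symm, h1.symm, h2.symm]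
      rw [hj, hmk]
      clear hj
      revert i j
      decide
    · intro i i' hne p hp hp'
      obtain ⟨a, ha⟩ := DDom.arcSet_inter hδ hβ (by omega) hp hp'
      obtain ⟨b, hb0, hb3, hb⟩ := hcase a
      rw [ha, hb]
      obtain rfl | rfl | rfl : b = 0 ∨ b = 1 ∨ b = 2 := by omega
      exacts [⟨_, h0⟩, ⟨_, h1⟩, ⟨_, h2⟩]
  -- In the opposite order the two lifts of the argument would have opposite total increments.
  · exfalso
    have harc : ∀ j : Fin 3, D.arc j = D'.arcSet δ (2 - (j : ℕ)) := by
      refine D.arc_eq (G := fun j => D'.arcSet δ (2 - (j : ℕ)))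
        (fun i => DDom.isClosed_arcSet hδ _) ?_ ?_ ?_
      · intro p
        rw [hfr]
        simp [Fin.exists_fin_succ]
        tauto
      · intro i j
        have hj : D.pt j = hexPt δ (D'.vert (D'.M (3 - (j : ℕ)))) := by
          fin_cases j
          · change D.pt 0 = hexPt δ (D'.vert (D'.M 3))
            rw [← h0]
            congr 1
            refine DDom.vert_eq_iff.2 ⟨-1, ?_⟩
            rw [show D'.M 3 = D'.M 0 + D'.N from D'.M_add 0]
            ring
          exacts [h2.symm, h1.symm]
        rw [hj, hmk]
        clear hj
        revert i j
        decide
      · intro i i' hne p hp hp'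
        obtain ⟨a, ha⟩ := DDom.arcSet_inter hδ hβ (by omega) hp hp'
        obtain ⟨b, hb0, hb3, hb⟩ := hcase a
        rw [ha, hb]
        obtain rfl | rfl | rfl : b = 0 ∨ b = 1 ∨ b = 2 := by omega
        exacts [⟨_, h0⟩, ⟨_, h1⟩, ⟨_, h2⟩]
    have hv : (D'.β 0).fst ∈ D'.F := D'.β_fst 0
    have hz : sitePt δ (D'.β 0).fst ∈ D.carrier := by
      have : (D'.β 0).fst ∈ D.faces δ := by rw [← hF]; exact hv
      exact this
    obtain ⟨ℓ, hℓ, hℓe, hℓ1⟩ := D.bdry_ccw _ hz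
    choose g hg1 hg2 hg3 hg4 using fun j => D.exists_log_arc j hℓ hℓe
    -- The arc `i` of `D'` is the arc `2 - i` of `D`, run through backwards.
    have s0 := DDom.sum_arc (hg1 0) (hg2 0) (harc 0)
    have s1 := DDom.sum_arc (hg1 1) (hg2 1) (harc 1)
    have s2 := DDom.sum_arc (hg1 2) (hg2 2) (harc 2)
    have hsum := DDom.sum_logInc hδ hv (D'.M 0)
    have h3 : D'.M 3 = D'.M 0 + D'.N := D'.M_add 0
    have h03 : hexPt δ (D'.vert (D'.M 3)) = D.pt 0 := by rw [h3, DDom.vert_add, h0]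
    have m01 := D'.M_lt 0
    have m12 := D'.M_lt 1
    have m23 := D'.M_lt 2
    norm_num at s0 s1 s2 m01 m12 m23
    rw [h03, h2] at s0
    rw [h1, h2] at s1
    rw [h0, h1] at s2
    rw [← h3, sum_Ico_int_add m01.le (m12.trans m23).le, sum_Ico_int_add m12.le m23.le,
      s0, s1, s2] at hsum
    have t0 : g 0 (D.pt 1) = ℓ (D.time 1) := hg4 0
    have t1 : g 1 (D.pt 2) = ℓ (D.time 2) := hg4 1
    have t2 : g 2 (D.pt 0) = ℓ (D.time 0 + 1) := hg4 2
    rw [hg3, hg3, hg3, t0, t1, t2, hℓ1] at hsum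
    refine Complex.two_pi_I_ne_zero ?_
    linear_combination (-1 / 2 : ℂ) * hsum

/-! ### The separation events of a discrete domain -/

/-- Connections of vertices are walks on the hexagonal lattice. -/
lemma conn_iff_exists_walk {ok : T.Dart → Prop} {s t : HexVertex} :
    Conn ok s t ↔ ∃ W : H.Walk s t, ∀ d ∈ W.darts,
      ∃ e, ok e ∧ leftVertex e.symm = d.fst ∧ leftVertex e = d.snd := by
  constructor
  · intro h
    induction h with
    | refl => exact ⟨.nil, by simp⟩
    | tail _ h ih =>
      obtain ⟨W, hW⟩ := ih
      obtain ⟨e, he, h1, h2⟩ := h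
      refine ⟨W.concat (H_adj_iff.2 ⟨e, h1, h2⟩), fun d hd => ?_⟩
      rw [SimpleGraph.Walk.darts_concat, List.concat_eq_append, List.mem_append,
        List.mem_singleton] at hd
      rcases hd with hd | rfl
      · exact hW d hd
      · exact ⟨e, he, h1, h2⟩
  · rintro ⟨W, hW⟩
    induction W with
    | nil => exact Conn.refl _ _
    | cons h W ih =>
      obtain ⟨e, he, h1, h2⟩ := hW ⟨_, h⟩ List.mem_cons_self
      have h3 := Conn.step he
      rw [h1, h2] at h3
      exact h3.trans (ih fun d hd => hW d (List.mem_cons_of_mem _ hd))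

lemma edge_mem_iff {u v : Site} (γ : T.Walk u v) (e : T.Dart) :
    s(e.fst, e.snd) ∈ γ.edges ↔ e ∈ γ.darts ∨ e.symm ∈ γ.darts := by
  rw [SimpleGraph.Walk.edges, List.mem_map]
  constructor
  · rintro ⟨d, hd, h⟩
    rcases SimpleGraph.dart_edge_eq_iff d e |>.1 h with rfl | rfl
    · exact .inl hd
    · exact .inr hd
  · rintro (h | h)
    · exact ⟨_, h, rfl⟩
    · exact ⟨_, h, SimpleGraph.Dart.edge_symm e⟩

/-- The hexagonal edge dual to `e` crosses the path `γ`, prolonged through the sides `β k` and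
`β l`, iff it is not off that path. -/
lemma DDom.not_off_iff {D : DDom} {k l : ℤ} {γ : T.Walk (D.β k).fst (D.β l).fst} {e : T.Dart}
    {s t : HexVertex} (hs : leftVertex e.symm = s) (ht : leftVertex e = t) :
    ¬ D.Off γ k l e ↔ ∃ x y : Site,
      s(x, y) ∈ (SimpleGraph.Walk.cons (D.β k).adj.symm (γ.concat (D.β l).adj)).edges ∧
      s.1 ∩ t.1 = {x, y} := by
  have hβ : ∀ m, (s(e.fst, e.snd) = s((D.β m).fst, (D.β m).snd) ↔
      e = D.β m ∨ e.symm = D.β m) := fun m => by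
    have := SimpleGraph.dart_edge_eq_iff e (D.β m)
    rw [SimpleGraph.Dart.symm_involutive.eq_iff (x := e)]
    exact this
  have key : (∃ x y : Site,
      s(x, y) ∈ (SimpleGraph.Walk.cons (D.β k).adj.symm (γ.concat (D.β l).adj)).edges ∧
      s.1 ∩ t.1 = {x, y}) ↔
      s(e.fst, e.snd) ∈ (SimpleGraph.Walk.cons (D.β k).adj.symm (γ.concat (D.β l).adj)).edges := by
    rw [← hs, ← ht, left_inter_right]
    constructor
    · rintro ⟨x, y, h, hxy⟩
      have : s(e.fst, e.snd) = s(x, y) := by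
        rw [Sym2.eq_iff]
        have h1 : e.fst = x ∨ e.fst = y := by
          have : e.fst ∈ ({x, y} : Finset Site) := hxy ▸ by simp
          simpa using this
        have h2 : e.snd = x ∨ e.snd = y := by
          have : e.snd ∈ ({x, y} : Finset Site) := hxy ▸ by simp
          simpa using this
        have := fst_ne_snd e
        grind
      rwa [this]
    · exact fun h => ⟨_, _, h, rfl⟩
  rw [key, SimpleGraph.Walk.edges_cons, SimpleGraph.Walk.edges_concat, List.mem_cons,
    List.concat_eq_append, List.mem_append, List.mem_singleton, edge_mem_iff, hβ,
    Sym2.eq_swap (a := (D.β k).snd), hβ, Off]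
  tauto

/-- A side of the boundary that is part of an arc, as a subset of the plane, is one of its sides. -/
lemma DDom.exists_of_hexEdge_subset {D : DDom} {δ : ℝ} (hδ : 0 < δ) {e : T.Dart} (he : e.fst ∈ D.F)
    {i : ℤ} (h : hexEdge δ e ⊆ D.arcSet δ i) : ∃ k, D.M i ≤ k ∧ k < D.M (i + 1) ∧ D.β k = e := by
  obtain ⟨k, h1, h2, h3⟩ := mem_arcSet.1 (h (midpoint_mem_segment _ _))
  refine ⟨k, h1, h2, ?_⟩
  rw [hexEdge_eq hδ] at h3
  have hf := midpoint_mem_hexagon hδ h3.1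
  have hs := midpoint_mem_hexagon hδ h3.2
  have hne := fst_ne_snd (D.β k)
  have hsF := D.β_snd k
  rw [dart_eq_iff]
  rcases hs with hs | hs
  · exact absurd (hs ▸ he) hsF
  · rcases hf with hf | hf
    · exact ⟨hf, hs⟩
    · exact absurd (hf.trans hs.symm) hne

/-- The separation event of a marked discrete domain is the combinatorial one. -/
theorem sepEvent_eq {D : MarkedDomain 3} {δ : ℝ} (hδ : 0 < δ) {D' : DDom}
    (hF : (D'.F : Set Site) = D.faces δ) (harc : ∀ j : Fin 3, D.arc j = D'.arcSet δ (j : ℕ))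
    (j : Fin 3) (z : HexVertex) : sepEvent D δ j z = D'.sep (j : ℕ) z := by
  have hprev : D.arc (j - 1) = D'.arcSet δ ((j : ℕ) - 1) := by
    have h : (((j - 1 : Fin 3) : ℕ) : ℤ) = (j : ℕ) - 1 ∨
        (((j - 1 : Fin 3) : ℕ) : ℤ) = (j : ℕ) - 1 + 3 := by
      clear * -
      revert j
      decide
    rcases h with h | h
    · rw [harc, h]
    · rw [harc, h, DDom.arcSet_add_three]
  have hnext : D.arc (j + 1) = D'.arcSet δ ((j : ℕ) + 1) := by
    have h : (((j + 1 : Fin 3) : ℕ) : ℤ) = (j : ℕ) + 1 ∨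
        (((j + 1 : Fin 3) : ℕ) : ℤ) + 3 = (j : ℕ) + 1 := by
      clear * -
      revert j
      decide
    rcases h with h | h
    · rw [harc, h]
    · rw [harc, ← h, DDom.arcSet_add_three]
  have hface : ∀ x, x ∈ D.faces δ ↔ x ∈ D'.F := fun x => by rw [← hF, Finset.mem_coe]
  have hshift : ∀ i : ℤ, i - 1 + 1 = i ∧ i + 1 + 1 = i + 2 := fun i => ⟨by ring, by ring⟩
  ext ω
  constructor
  · rintro ⟨a, u, v, b, hau, γ, hvb, hγ, hblue, h1, h2, hsep⟩
    rw [hprev, show (⟨(a, u), hau⟩ : T.Dart) = SimpleGraph.Dart.symm ⟨(u, a), hau.symm⟩ from rfl,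
      hexEdge_symm] at h1
    rw [hnext] at h2
    obtain ⟨k, hk1, hk2, hk⟩ := DDom.exists_of_hexEdge_subset hδ
      ((hface u).1 (hblue u γ.start_mem_support).1) h1
    obtain ⟨l, hl1, hl2, hl⟩ := DDom.exists_of_hexEdge_subset hδ
      ((hface v).1 (hblue v γ.end_mem_support).1) h2
    rw [(hshift _).1] at hk2
    rw [(hshift _).2] at hl2
    obtain rfl : (D'.β k).fst = u := by rw [hk]
    obtain rfl : (D'.β k).snd = a := by rw [hk]
    obtain rfl : (D'.β l).fst = v := by rw [hl]
    obtain rfl : (D'.β l).snd = b := by rw [hl]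
    refine ⟨k, l, hk1, hk2, hl1, hl2, γ, hγ, fun x hx => ⟨(hface x).1 (hblue x hx).1,
      (hblue x hx).2⟩, fun t ht hconn => ?_⟩
    obtain ⟨W, hW⟩ := conn_iff_exists_walk.1 hconn
    obtain ⟨d, hd, x, y, hxy⟩ := hsep t W (by rw [harc, DDom.hexPt_mem_arcSet hδ]; exact ht)
      (fun d hd => by
        obtain ⟨e, ⟨he, -⟩, hs, ht⟩ := hW d hd
        rw [← hs, ← ht, left_inter_right]
        rcases he with he | he
        · exact ⟨_, (hface _).2 he, by simp⟩
        · exact ⟨_, (hface _).2 he, by simp⟩)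
    obtain ⟨e, ⟨-, he⟩, hs, ht⟩ := hW d hd
    exact (DDom.not_off_iff hs ht).2 ⟨x, y, hxy⟩ he
  · rintro ⟨k, l, hk1, hk2, hl1, hl2, γ, hγ, hblue, hsep⟩
    refine ⟨(D'.β k).snd, _, _, (D'.β l).snd, (D'.β k).adj.symm, γ, (D'.β l).adj, hγ,
      fun x hx => ⟨(hface x).2 (hblue x hx).1, (hblue x hx).2⟩, ?_, ?_, fun t W ht hW => ?_⟩
    · rw [hprev]
      intro p hp
      have hp : p ∈ hexEdge δ (D'.β k).symm := hp
      rw [hexEdge_symm] at hp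
      exact DDom.mem_arcSet.2 ⟨k, hk1, by rwa [(hshift _).1], hp⟩
    · rw [hnext]
      exact fun p hp => DDom.mem_arcSet.2 ⟨l, hl1, by rwa [(hshift _).2], hp⟩
    · rw [harc, DDom.hexPt_mem_arcSet hδ] at ht
      by_contra hcon
      refine hsep t ht (conn_iff_exists_walk.2 ⟨W, fun d hd => ?_⟩)
      obtain ⟨e, hes, het⟩ := H_adj_iff.1 d.adj
      refine ⟨e, ⟨?_, ?_⟩, hes, het⟩
      · obtain ⟨x, hxF, hx⟩ := hW d hd
        rw [← hes, ← het, left_inter_right, Finset.mem_insert, Finset.mem_singleton] at hx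
        rcases hx with rfl | rfl
        · exact .inl ((hface _).1 hxF)
        · exact .inr ((hface _).1 hxF)
      · by_contra hoff
        obtain ⟨x, y, hxy⟩ := (DDom.not_off_iff hes het).1 hoff
        exact hcon ⟨d, hd, x, y, hxy⟩

/-! ### Points are far from one of the three arcs -/

namespace MarkedDomain

lemma isCompact_arc {k : ℕ} (D : MarkedDomain k) (j : Fin k) : IsCompact (D.arc j) :=
  isCompact_range (D.arcCurve j).continuous

lemma arc_nonempty {k : ℕ} (D : MarkedDomain k) (j : Fin k) : (D.arc j).Nonempty :=
  Set.range_nonempty _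

/-- The three boundary arcs have no common point, hence by compactness no point of the plane is
close to all of them. -/
lemma exists_far_arc (D : MarkedDomain 3) :
    ∃ ε > 0, ∀ x : ℂ, ∃ j, ∀ p ∈ D.arc j, ε ≤ dist x p := by
  have hcl : ∀ j, IsClosed (D.arc j) := fun j => (D.isCompact_arc j).isClosed
  set h : ℂ → ℝ := fun x => Metric.infDist x (D.arc 1) + Metric.infDist x (D.arc 2)
  have hcont : Continuous h :=
    (Metric.continuous_infDist_pt _).add (Metric.continuous_infDist_pt _)
  obtain ⟨x₀, hx₀, hmin⟩ := (D.isCompact_arc 0).exists_isMinOn (D.arc_nonempty 0)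
    hcont.continuousOn
  -- A common point of the three arcs would correspond to times in all three intervals that differ
  -- by integers.
  have hpos : 0 < h x₀ := by
    have n1 := Metric.infDist_nonneg (x := x₀) (s := D.arc 1)
    have n2 := Metric.infDist_nonneg (x := x₀) (s := D.arc 2)
    refine lt_of_le_of_ne (add_nonneg n1 n2) fun h0 => ?_
    have h0 : Metric.infDist x₀ (D.arc 1) + Metric.infDist x₀ (D.arc 2) = 0 := h0.symm
    have h1 : x₀ ∈ D.arc 1 := ((hcl 1).mem_iff_infDist_zero (D.arc_nonempty 1)).2 (by linarith)
    have h2 : x₀ ∈ D.arc 2 := ((hcl 2).mem_iff_infDist_zero (D.arc_nonempty 2)).2 (by linarith)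
    obtain ⟨s, hs, hsx⟩ := D.mem_arc.1 hx₀
    obtain ⟨t, ht, htx⟩ := D.mem_arc.1 h1
    obtain ⟨u, hu, hux⟩ := D.mem_arc.1 h2
    obtain ⟨n, hn⟩ := D.bdry_eq_iff.1 (htx.trans hsx.symm)
    obtain ⟨m, hm⟩ := D.bdry_eq_iff.1 (hux.trans hsx.symm)
    have h3 := D.time_strictMono (show (0 : Fin 3) < 1 by decide)
    have h4 := D.time_strictMono (show (1 : Fin 3) < 2 by decide)
    have h5 := D.time_lt 2 0
    have e0 : D.nextTime 0 = D.time 1 := rfl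
    have e1 : D.nextTime 1 = D.time 2 := rfl
    have e2 : D.nextTime 2 = D.time 0 + 1 := rfl
    obtain ⟨hs1, hs2⟩ := hs
    obtain ⟨ht1, ht2⟩ := ht
    obtain ⟨hu1, hu2⟩ := hu
    rw [e0] at hs2
    rw [e1] at ht2
    rw [e2] at hu2
    have hn1 : (n : ℝ) < (1 : ℤ) := by push_cast; linarith
    have hn2 : ((-1 : ℤ) : ℝ) < n := by push_cast; linarith
    rw [Int.cast_lt] at hn1 hn2
    obtain rfl : n = 0 := by omega
    push_cast at hn
    have hm1 : (m : ℝ) < (1 : ℤ) := by push_cast; linarith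
    have hm2 : ((0 : ℤ) : ℝ) < m := by push_cast; linarith
    rw [Int.cast_lt] at hm1 hm2
    omega
  -- If `x` is within `h x₀ / 4` of all three arcs, then a point of the first arc is too close to
  -- the two others.
  refine ⟨h x₀ / 4, by positivity, fun x => ?_⟩
  by_contra hx
  push Not at hx
  obtain ⟨p, hp, hpx⟩ := hx 0
  obtain ⟨q, hq, hqx⟩ := hx 1
  obtain ⟨r, hr, hrx⟩ := hx 2
  have h1 : h x₀ ≤ h p := hmin hp
  have h2 : h p ≤ dist p q + dist p r :=
    add_le_add (Metric.infDist_le_dist_of_mem hq) (Metric.infDist_le_dist_of_mem hr)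
  have h3 := dist_triangle_left p q x
  have h4 := dist_triangle_left p r x
  linarith

/-- Every arc of a four-marked domain is part of the corresponding arc after forgetting the last
mark. -/
lemma arc_subset_forgetLast (D : MarkedDomain 4) {i : Fin 4} {j : Fin 3}
    (h : i = j.castSucc ∨ i = 3 ∧ j = 2) : D.arc i ⊆ D.forgetLast.arc j := by
  intro p hp
  obtain ⟨t, ht, rfl⟩ := D.mem_arc.1 hp
  have h1 := D.time_lt 3 0
  have h2 := D.time_strictMono (show (2 : Fin 4) < 3 by decide)
  refine D.forgetLast.mem_arc.2 ⟨t, ?_, rfl⟩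
  have e3 : D.nextTime 2 = D.time 3 := rfl
  have e5 : D.forgetLast.time 2 = D.time 2 := rfl
  have e6 : D.forgetLast.nextTime 2 = D.time 0 + 1 := rfl
  have e7 : D.nextTime 3 = D.time 0 + 1 := rfl
  rcases h with rfl | ⟨rfl, rfl⟩
  · fin_cases j
    · exact ht
    · exact ht
    · have ht : t ∈ Set.Icc (D.time 2) (D.nextTime 2) := ht
      rw [e3] at ht
      change t ∈ Set.Icc (D.forgetLast.time 2) (D.forgetLast.nextTime 2)
      rw [e5, e6]
      exact ⟨ht.1, by linarith [ht.2]⟩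
  · rw [e7] at ht
    rw [e5, e6]
    exact ⟨by linarith [ht.1], ht.2⟩

/-- After the last mark is forgotten, the last arc consists of the last two arcs of the four-marked
domain. -/
lemma exists_arc_of_forgetLast (D : MarkedDomain 4) {j : Fin 3} {p : ℂ}
    (hp : p ∈ D.forgetLast.arc j) :
    ∃ i : Fin 4, (i = j.castSucc ∨ i = 3 ∧ j = 2) ∧ p ∈ D.arc i := by
  obtain ⟨t, ht, rfl⟩ := D.forgetLast.mem_arc.1 hp
  have e3 : D.nextTime 2 = D.time 3 := rfl
  have e5 : D.forgetLast.time 2 = D.time 2 := rfl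
  have e6 : D.forgetLast.nextTime 2 = D.time 0 + 1 := rfl
  have e7 : D.nextTime 3 = D.time 0 + 1 := rfl
  fin_cases j
  · exact ⟨0, .inl rfl, D.mem_arc.2 ⟨t, ht, rfl⟩⟩
  · exact ⟨1, .inl rfl, D.mem_arc.2 ⟨t, ht, rfl⟩⟩
  · have ht : t ∈ Set.Icc (D.forgetLast.time 2) (D.forgetLast.nextTime 2) := ht
    rw [e5, e6] at ht
    rcases le_total t (D.time 3) with h | h
    · exact ⟨2, .inl rfl, D.mem_arc.2 ⟨t, ⟨ht.1, by rwa [e3]⟩, rfl⟩⟩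
    · exact ⟨3, .inr ⟨rfl, rfl⟩, D.mem_arc.2 ⟨t, ⟨h, by rw [e7]; exact ht.2⟩, rfl⟩⟩

end MarkedDomain

/-- Curves that are close up to reparametrization are close as sets. -/
lemma exists_dist_lt_of_dcurve_lt {f g : C(unitInterval, ℂ)} {η : ℝ} (h : dcurve f g < η)
    (s : unitInterval) : ∃ t, dist (f s) (g t) < η := by
  obtain ⟨φ, hφ⟩ := exists_lt_of_ciInf_lt h
  refine ⟨φ.symm s, lt_of_le_of_lt ?_ hφ⟩
  have := ContinuousMap.dist_apply_le_dist (f := f.comp ⟨φ, φ.continuous⟩) (g := g) (φ.symm s)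
  simpa using this

/-- For the domains far in a convergent family no point is close to all three arcs. -/
lemma eventually_far_arc {ι : Type*} {l : Filter ι} {D : ι → MarkedDomain 4} {D₀ : MarkedDomain 4}
    (h : ConvergesUniformly D l D₀) :
    ∃ ε > 0, ∀ᶠ i in l, ∀ x : ℂ, ∃ j, ∀ p ∈ (D i).forgetLast.arc j, ε ≤ dist x p := by
  obtain ⟨ε, hε, hfar⟩ := D₀.forgetLast.exists_far_arc
  refine ⟨ε / 2, by positivity, ?_⟩
  have h1 : ∀ᶠ i in l, ∀ j, dcurve ((D i).arcCurve j) (D₀.arcCurve j) < ε / 2 :=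
    eventually_all.2 fun j => (h j).eventually (gt_mem_nhds (by positivity))
  filter_upwards [h1] with i hi x
  obtain ⟨j, hj⟩ := hfar x
  refine ⟨j, fun p hp => ?_⟩
  obtain ⟨a, ha, hpa⟩ := (D i).exists_arc_of_forgetLast hp
  obtain ⟨s, rfl⟩ := hpa
  obtain ⟨t, ht⟩ := exists_dist_lt_of_dcurve_lt (hi a) s
  have := hj _ (D₀.arc_subset_forgetLast ha ⟨t, rfl⟩)
  have := dist_triangle x ((D i).arcCurve a s) (D₀.arcCurve a t)
  linarith

/-! ### The bound for the gaps -/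

namespace DDom

variable {D : DDom} {δ : ℝ}

/-- A path from a hexagon near `x` to an arc that is far from `x` crosses an annulus. -/
lemma annulusCrossing_of_joined (hδ : 0 < δ) {ω : Config} {x : ℂ} {r R : ℝ} {y : Site} {k i : ℤ}
    (hJ : Joined {v | ω v = true} y (D.β k).fst) (h1 : D.M i ≤ k) (h2 : k < D.M (i + 1))
    (hy : (hexagon δ y ∩ Metric.closedBall x r).Nonempty)
    (hfar : ∀ p ∈ D.arcSet δ i, R ≤ dist x p) : ω ∈ annulusCrossing δ x r R := by
  obtain ⟨p, hp⟩ := hJ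
  refine ⟨y, _, p, hp, hy, hexPt δ (leftVertex (D.β k)),
    (hexPt_mem_hexagon hδ).2 (fst_mem_left _), ?_⟩
  rw [Set.mem_compl_iff, Metric.mem_ball, not_lt, dist_comm]
  exact hfar _ (mem_arcSet.2 ⟨k, h1, h2, (hexPt_mem_hexEdge hδ).2 (.inl rfl)⟩)

/-- Of the arms of different colours around an edge that are present in the event of the gap, one
has to reach an arc that is far away. -/
lemma gap_le_annulusCrossing (hδ : 0 < δ) {e : T.Dart} (h1 : e.fst ∈ D.F) (h2 : e.snd ∈ D.F)
    {r R : ℝ} (hr : δ ≤ r) (hR : δ < R) {a : ℤ}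
    (hfar : ∀ p ∈ D.arcSet δ a, R ≤ dist (sitePt δ e.fst) p) (j : ℤ) :
    D.gap j e ≤ critPerc.real (annulusCrossing δ (sitePt δ e.fst) r R) := by
  have hshift : ∀ m b : ℤ, b = a + 3 * m → ∀ p ∈ D.arcSet δ b, R ≤ dist (sitePt δ e.fst) p := by
    have key : ∀ m : ℤ, D.arcSet δ (a + 3 * m) = D.arcSet δ a := by
      intro m
      induction m with
      | zero => simp
      | succ m ih => rw [show a + 3 * (m + 1 : ℤ) = a + 3 * m + 3 by ring, arcSet_add_three, ih]
      | pred m ih =>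
        rw [← ih, show a + 3 * -(m : ℤ) = a + 3 * (-(m : ℤ) - 1) + 3 by ring, arcSet_add_three]
    rintro m b rfl p hp
    exact hfar p (key m ▸ hp)
  have harms : ∀ ω ∈ D.sep j (leftVertex e.symm) \ D.sep j (leftVertex e),
      leftVertex e ∈ D.below ω j ∧
      ∃ k l, D.M (j - 1) ≤ k ∧ k < D.M j ∧ D.M (j + 1) ≤ l ∧ l < D.M (j + 2) ∧
      ∃ γ : T.Walk (D.β k).fst (D.β l).fst, γ.IsPath ∧
        (∀ x ∈ γ.support, x ∈ D.F ∧ ω x = true) ∧ e.symm ∈ γ.darts := by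
    rintro ω ⟨hw, hz⟩
    exact exists_arms_of_sep (e₀ := e.symm) h2 h1 hw hz
  have hnear : (hexagon δ e.fst ∩ Metric.closedBall (sitePt δ e.fst) r).Nonempty :=
    ⟨_, (sitePt_mem_hexagon hδ).2 rfl, Metric.mem_closedBall_self (hδ.le.trans hr)⟩
  have hblue : ∀ ω : Config, ∀ u v : Site, ∀ γ : T.Walk u v,
      (∀ x ∈ γ.support, x ∈ D.F ∧ ω x = true) → e.symm ∈ γ.darts →
      Joined {v | ω v = true} e.fst u ∧ Joined {v | ω v = true} e.fst v := by
    intro ω u v γ hγ he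
    have hm : e.fst ∈ γ.support := γ.dart_snd_mem_support_of_mem_darts he
    classical
    refine ⟨Joined.symm ⟨γ.takeUntil _ hm, fun y hy => (hγ y ?_).2⟩,
      ⟨γ.dropUntil _ hm, fun y hy => (hγ y ?_).2⟩⟩
    · exact γ.support_takeUntil_subset_support hm hy
    · exact γ.support_dropUntil_subset_support hm hy
  have hmod : (∃ m, j - 1 = a + 3 * m) ∨ (∃ m, j + 1 = a + 3 * m) ∨ ∃ m, j = a + 3 * m := by
    have : (j - a) % 3 = 1 ∨ (j - a) % 3 = 2 ∨ (j - a) % 3 = 0 := by omega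
    rcases this with h | h | h
    · exact .inl ⟨(j - a) / 3, by omega⟩
    · exact .inr (.inl ⟨(j - a) / 3 + 1, by omega⟩)
    · exact .inr (.inr ⟨(j - a) / 3, by omega⟩)
  -- The arc that is far away is the one of the first blue arm, of the second blue arm, or of the
  -- yellow arm; in the last case the colours are exchanged.
  rcases hmod with ⟨m, hm⟩ | ⟨m, hm⟩ | ⟨m, hm⟩
  · refine measureReal_mono fun ω hω => ?_
    obtain ⟨-, k, l, hk1, hk2, -, -, γ, -, hγ, he⟩ := harms ω hω
    exact annulusCrossing_of_joined hδ (hblue ω _ _ γ hγ he).1 hk1 (by rwa [sub_add_cancel])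
      hnear (hshift m _ hm)
  · refine measureReal_mono fun ω hω => ?_
    obtain ⟨-, k, l, -, -, hl1, hl2, γ, -, hγ, he⟩ := harms ω hω
    exact annulusCrossing_of_joined hδ (hblue ω _ _ γ hγ he).2 hl1
      (by rwa [add_assoc, one_add_one_eq_two]) hnear (hshift m _ hm)
  · set Y : Set Config := {ω | ∃ y ∈ (leftVertex e).1, ∃ k, D.M j ≤ k ∧ k < D.M (j + 1) ∧
      Joined {v | v ∈ D.F ∧ ω v = false} y (D.β k).fst}
    have hY : DetBy D.F Y := by
      rintro ω ω' h ⟨y, hy, k, hk1, hk2, hJ⟩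
      exact ⟨y, hy, k, hk1, hk2, hJ.mono fun v hv => ⟨hv.1, (h v hv.1).symm.trans hv.2⟩⟩
    have hsub : D.sep j (leftVertex e.symm) \ D.sep j (leftVertex e) ⊆ Y := by
      intro ω hω
      rcases joined_of_below (harms ω hω).1 with h | h
      · have h3 := hshift m j hm _ ((hexPt_mem_arcSet hδ).2 h)
        have h4 := dist_hexPt_le hδ (fst_mem_left e)
        rw [dist_comm] at h4
        linarith
      · exact h
    refine (measureReal_mono hsub).trans ?_
    rw [← real_flip hY]
    refine measureReal_mono fun ω hω => ?_
    obtain ⟨y, hy, k, hk1, hk2, hJ⟩ := hω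
    refine annulusCrossing_of_joined hδ (hJ.mono fun v hv => by simpa using hv.2) hk1 hk2
      ⟨hexPt δ (leftVertex e), (hexPt_mem_hexagon hδ).2 hy, ?_⟩ (hshift m _ hm)
    exact (dist_hexPt_le hδ (fst_mem_left e)).trans hr

end DDom

lemma IsContourIn.sitePt_mem {o : Site} {C : T.Walk o o} {δ : ℝ} {U : Set ℂ}
    (h : IsContourIn C δ U) : ∀ x ∈ C.support, sitePt δ x ∈ U := by
  have key : ∀ x ∈ C.support.tail, sitePt δ x ∈ U := by
    intro x hx
    rw [← SimpleGraph.Walk.map_snd_darts, List.mem_map] at hx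
    obtain ⟨e, he, rfl⟩ := hx
    exact h.2.1 e he (right_mem_segment ℝ _ _)
  intro x hx
  rcases SimpleGraph.Walk.mem_support_iff C |>.1 hx with rfl | hx
  · exact key _ (C.end_mem_tail_support h.1.not_nil)
  · exact key _ hx

/-- The discrete contour integrals of a marked discrete domain, when the annulus crossing
probabilities between the scale `r` and the distance to the farthest arc are at most `B`. -/
lemma norm_contourIntegral_sepProb_le {D : MarkedDomain 3} {δ : ℝ} (hδ : 0 < δ)
    (hD : D.IsDiscrete δ) {r R B : ℝ} (hr : δ ≤ r) (hR : δ < R)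
    (hB : ∀ x, critPerc.real (annulusCrossing δ x r R) ≤ B)
    (hfar : ∀ x : ℂ, ∃ j, ∀ p ∈ D.arc j, R ≤ dist x p) (j : Fin 3) {o : Site} {C : T.Walk o o}
    (hC : IsContourIn C δ D.carrier) :
    ‖contourIntegral C δ (sepProb D δ (j + 1)) - zeta * contourIntegral C δ (sepProb D δ j)‖ ≤
      2 * B * contourLength C δ := by
  obtain ⟨D', hF, harc⟩ := exists_ddom_arc hδ hD
  have hCF : ∀ x ∈ C.support, x ∈ D'.F := fun x hx => by
    rw [← Finset.mem_coe, hF]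
    exact hC.sitePt_mem x hx
  have e1 : sepProb D δ j = fun t => critPerc.real (D'.sep (j : ℕ) t) :=
    funext fun t => by rw [sepProb, sepEvent_eq hδ hF harc]
  have e2 : sepProb D δ (j + 1) = fun t => critPerc.real (D'.sep ((j : ℕ) + 1) t) := by
    funext t
    rw [sepProb, sepEvent_eq hδ hF harc]
    have h : (((j + 1 : Fin 3) : ℕ) : ℤ) = (j : ℕ) + 1 ∨
        (((j + 1 : Fin 3) : ℕ) : ℤ) + 3 = (j : ℕ) + 1 := by
      clear * -
      revert j
      decide
    rcases h with h | h
    · rw [h]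
    · rw [← h, DDom.sep_add_three]
  rw [e1, e2]
  refine DDom.norm_contourIntegral_sub_le hC.1 hCF hC.2.2 _ fun e he i => ?_
  obtain ⟨a, ha⟩ := hfar (sitePt δ e.fst)
  rw [harc] at ha
  exact (DDom.gap_le_annulusCrossing hδ (hCF _ (C.dart_fst_mem_support_of_mem_darts he))
    (hCF _ (C.dart_snd_mem_support_of_mem_darts he)) hr hR ha i).trans (hB _)

end TriPerc

end

theorem mainTheorem6 :
    (∃ lam : ℝ, TriPerc.IsAnnulusExponent lam) ∧
    ∀ lam : ℝ, TriPerc.IsAnnulusExponent lam →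
      ∀ (ι : Type*) (l : Filter ι) (δ : ι → ℝ) (D : ι → TriPerc.MarkedDomain 4)
        (D₀ : TriPerc.MarkedDomain 4),
        (∀ i, 0 < δ i) → Tendsto δ l (𝓝 0) → (∀ i, (D i).IsDiscrete (δ i)) →
        TriPerc.ConvergesUniformly D l D₀ →
        ∃ K : ℝ, ∀ᶠ i in l, ∀ (j : Fin 3) (o : TriPerc.Site) (C : TriPerc.T.Walk o o),
          TriPerc.IsContourIn C (δ i) (D i).carrier →
          ‖TriPerc.contourIntegral C (δ i)
                (TriPerc.sepProb (D i).forgetLast (δ i) (j + 1)) -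
              TriPerc.zeta * TriPerc.contourIntegral C (δ i)
                (TriPerc.sepProb (D i).forgetLast (δ i) j)‖ ≤
            K * δ i ^ lam * TriPerc.contourLength C (δ i) := by
  refine ⟨TriPerc.exists_annulusExponent, ?_⟩
  rintro lam ⟨-, c, hc, K, hK⟩ ι l δ D D₀ hδ hδ0 hD hconv
  obtain ⟨ε, hε, hfar⟩ := TriPerc.eventually_far_arc hconv
  -- The inner radius of the annuli is `c' * δ`: it must be at least `c * δ` for the bound on the
  -- crossing probability, and at least `δ` to reach the hexagons around an edge.
  set c' := max c 1
  have hc' : 0 < c' := lt_of_lt_of_le hc (le_max_left _ _)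
  refine ⟨2 * (K * (c' / ε) ^ lam), ?_⟩
  have h1 : ∀ᶠ i in l, δ i < ε := hδ0.eventually (gt_mem_nhds hε)
  have h2 : ∀ᶠ i in l, δ i < ε / (c * c') := hδ0.eventually (gt_mem_nhds (by positivity))
  filter_upwards [hfar, h1, h2] with i hi h1 h2 j o C hC
  have hδi := hδ i
  have hdisc : (D i).forgetLast.IsDiscrete (δ i) := ⟨(hD i).1, fun j => (hD i).2 j.castSucc⟩
  have hB : ∀ x, TriPerc.critPerc.real (TriPerc.annulusCrossing (δ i) x (c' * δ i) ε) ≤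
      K * (c' / ε) ^ lam * δ i ^ lam := by
    intro x
    refine (hK (δ i) x (c' * δ i) ε hδi (by positivity) ?_ ?_).trans_eq ?_
    · rw [lt_div_iff₀ (by positivity)] at h2
      rw [le_div_iff₀ (by positivity)]
      linarith
    · rw [mul_div_cancel_right₀ _ hδi.ne']
      exact le_max_left _ _
    · rw [mul_div_right_comm, Real.mul_rpow (by positivity) hδi.le, mul_assoc]
  refine (TriPerc.norm_contourIntegral_sepProb_le hδi hdisc
    (le_mul_of_one_le_left hδi.le (le_max_right _ _)) h1 hB hi j hC).trans_eq ?_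
  ring
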